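/- **Setting.** For each $N$ let $H=(h_{ij})_{i,j=1}^N$ be a random Hermitian matrix ($h_{ij}=\bar h_{ji}$, real diagonal) whose entries $h_{ij}$, $i\le j$, are independent complex random variables with $\mathbb E h_{ij}=0$. Put $s_{ij}=\mathbb E|h_{ij}|^2$, $S=(s_{ij})$ and $M=1/\max_{i,j}s_{ij}$. Assume that $S$ is irreducible and stochastic, $\sum_j s_{ij}=1$ for all $i$; that $N^\delta\le M\le N$ for a fixed $\delta>0$; and that there are constants $\mu_p$, $p\in\mathbb N$, with $\mathbb E|s_{ij}^{-1/2}h_{ij}|^p\le\mu_p$ for all $N$, $p$ and all $i,j$ with $s_{ij}\ne0$. For $z=E+\mathrm i\eta$ with $\eta>0$ let $$m(z)=\frac1{2\pi}\int_{-2}^2\frac{\sqrt{4-x^2}}{x-z}\,dx,\quad G(z)=(H-z)^{-1},\quad m_N(z)=\frac1N\operatorname{Tr}G(z),$$ $$\Gamma(z)=\big\|(1-m(z)^2S)^{-1}\big\|_{\ell^\infty\to\ell^\infty},\quad \Pi(z)=\sqrt{\frac{\operatorname{Im}m(z)}{M\eta}}+\frac1{M\eta},$$ where $\|A\|_{\ell^\infty\to\ell^\infty}=\max_i\sum_j|A_{ij}|$.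 For families of nonnegative random variables $X^{(N)}(u)$, $Y^{(N)}(u)$, $u\in U^{(N)}$, write $X\prec Y$ (uniformly in $u$) if for all $\epsilon,D>0$ there is $N_0$ such that $\sup_{u\in U^{(N)}}\mathbb P\big[X^{(N)}(u)>N^\epsilon Y^{(N)}(u)\big]\le N^{-D}$ for all $N\ge N_0$. **Theorem.** Fix $\gamma\in(0,1/2)$. For $E\in[-10,10]$ let $\eta_E$ be the minimum of all $\eta\in(0,10]$ such that $$\frac1{M\eta}\le\min\Big\{\frac{M^{-\gamma}}{\Gamma(w)^3},\ \frac{M^{-2\gamma}}{\Gamma(w)^4\operatorname{Im}m(w)}\Big\}\quad\text{for all }w\in[E+\mathrm i\eta,\,E+10\mathrm i],$$ and let $\mathbf S=\{E+\mathrm i\eta:\ |E|\le10,\ \eta_E\le\eta\le10\}$. Then $$|G_{ij}(z)-\delta_{ij}m(z)|\prec\Pi(z)\quad\text{uniformly in } i,j\text{ and }z\in\mathbf S,$$ $$|m_N(z)-m(z)|\prec\frac1{M\eta}\quad\text{uniformly in }z=E+\mathrm i\eta\in\mathbf S.$$ In both bounds the threshold $N_0$ depends only on $\epsilon$, $D$,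 $\gamma$, $\delta$ and the sequence $(\mu_p)$, and not otherwise on the random matrix $H$. -/

import Mathlib

open MeasureTheory ProbabilityTheory

noncomputable section

namespace LocalSemicircle

/-- The Stieltjes transform of the Wigner semicircle law. -/
def msc (z : ℂ) : ℂ :=
  (1 / (2 * Real.pi) : ℂ) * ∫ x in (-2 : ℝ)..2, (Real.sqrt (4 - x ^ 2) : ℂ) / ((x : ℂ) - z)

/-- The variance matrix `s i j = E |h i j|²` of a random matrix. -/
def varianceMatrix {Ω : Type*} [MeasurableSpace Ω] (P : Measure Ω) {N : ℕ}
    (h : Fin N → Fin N → Ω → ℂ) : Matrix (Fin N) (Fin N) ℝ :=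
  Matrix.of fun i j => ∫ ω, ‖h i j ω‖ ^ 2 ∂P

/-- The parameter `M = 1 / max_{i,j} s i j` of a variance matrix. -/
def bandParameter {N : ℕ} (S : Matrix (Fin N) (Fin N) ℝ) : ℝ :=
  1 / ⨆ p : Fin N × Fin N, S p.1 p.2

/-- The operator norm `max_i ∑_j |A i j|` on `ℓ^∞`. -/
def linftyNorm {N : ℕ} (A : Matrix (Fin N) (Fin N) ℂ) : ℝ :=
  ⨆ i, ∑ j, ‖A i j‖

/-- `Γ(z) = ‖(1 - m(z)² S)⁻¹‖` on `ℓ^∞`. The matrix is invertible for `Im z > 0` and `S`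
stochastic, because `|m(z)| < 1` there. -/
def Gam {N : ℕ} (S : Matrix (Fin N) (Fin N) ℝ) (z : ℂ) : ℝ :=
  linftyNorm (1 - (msc z) ^ 2 • S.map (fun x : ℝ => (x : ℂ)))⁻¹

/-- The set of admissible `η`, of which `η_E` is the minimum: `1 / (M η)` is bounded as required at
all points `E + i y`, `η ≤ y ≤ 10`, of the vertical segment from `E + i η` to `E + 10 i`. -/
def etaSet {N : ℕ} (S : Matrix (Fin N) (Fin N) ℝ) (γ E : ℝ) : Set ℝ :=
  {η | 0 < η ∧ η ≤ 10 ∧ ∀ y ∈ Set.Icc η 10,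
    1 / (bandParameter S * η) ≤
      min (bandParameter S ^ (-γ) / Gam S ⟨E, y⟩ ^ 3)
        (bandParameter S ^ (-(2 * γ)) / (Gam S ⟨E, y⟩ ^ 4 * (msc ⟨E, y⟩).im))}

/-- The threshold `η_E`. For stochastic `S` and `0 < γ < 1/2` the set contains `10`, and its
infimum is positive and attained. -/
def etaE {N : ℕ} (S : Matrix (Fin N) (Fin N) ℝ) (γ E : ℝ) : ℝ :=
  sInf (etaSet S γ E)

/-- The spectral domain `{E + i η : |E| ≤ 10, η_E ≤ η ≤ 10}`. -/
def specDomain {N : ℕ} (S : Matrix (Fin N) (Fin N) ℝ) (γ : ℝ) : Set ℂ :=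
  {z | |z.re| ≤ 10 ∧ etaE S γ z.re ≤ z.im ∧ z.im ≤ 10}

/-- The control parameter `Π(z) = √(Im m(z) / (M η)) + 1 / (M η)`. -/
def controlPi {N : ℕ} (S : Matrix (Fin N) (Fin N) ℝ) (z : ℂ) : ℝ :=
  Real.sqrt ((msc z).im / (bandParameter S * z.im)) + 1 / (bandParameter S * z.im)

/-- An `N × N` random Hermitian matrix `(h i j)` on some probability space, with independent centred
entries on and above the diagonal and a stochastic, irreducible variance matrix, satisfying
`N^δ ≤ M ≤ N` and having the moments of its normalized entries bounded by the sequence `μ`. -/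
structure Ensemble (δ : ℝ) (μ : ℕ → ℝ) (N : ℕ) where
  /-- the probability space -/
  Ω : Type*
  [mΩ : MeasurableSpace Ω]
  /-- the probability measure -/
  P : Measure Ω
  [isProb : IsProbabilityMeasure P]
  /-- the matrix entries -/
  h : Fin N → Fin N → Ω → ℂ
  measurable : ∀ i j, Measurable (h i j)
  hermitian : ∀ i j ω, h j i ω = star (h i j ω)
  indep : iIndepFun (fun (p : {p : Fin N × Fin N // p.1 ≤ p.2}) => h p.1.1 p.1.2) P
  memLp : ∀ i j (p : ℕ), MemLp (h i j) p P
  mean_zero : ∀ i j, ∫ ω, h i j ω ∂P = 0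
  stochastic : ∀ i, ∑ j, varianceMatrix P h i j = 1
  irreducible : (varianceMatrix P h).IsIrreducible
  lower_M : (N : ℝ) ^ δ ≤ bandParameter (varianceMatrix P h)
  M_le : bandParameter (varianceMatrix P h) ≤ N
  /-- The law of a normalized entry is immaterial where the variance vanishes, hence `≠ 0`. -/
  moments : ∀ i j (p : ℕ), varianceMatrix P h i j ≠ 0 →
    ∫ ω, ‖((varianceMatrix P h i j) ^ (-(1 / 2) : ℝ) : ℝ) • h i j ω‖ ^ p ∂P ≤ μ p

namespace Ensemble

variable {δ : ℝ} {μ : ℕ → ℝ} {N : ℕ} (A : Ensemble δ μ N)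

instance : MeasurableSpace A.Ω := A.mΩ

instance : IsProbabilityMeasure A.P := A.isProb

/-- The variance matrix `S`. -/
def S : Matrix (Fin N) (Fin N) ℝ := varianceMatrix A.P A.h

/-- The parameter `M`. -/
def M : ℝ := bandParameter A.S

/-- The random matrix `H`. -/
def H (ω : A.Ω) : Matrix (Fin N) (Fin N) ℂ := Matrix.of fun i j => A.h i j ω

/-- The resolvent `G(z) = (H - z)⁻¹`. -/
def G (z : ℂ) (ω : A.Ω) : Matrix (Fin N) (Fin N) ℂ :=
  (A.H ω - z • (1 : Matrix (Fin N) (Fin N) ℂ))⁻¹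

/-- The Stieltjes transform `m_N(z) = N⁻¹ Tr G(z)` of the empirical spectral measure. -/
def mN (z : ℂ) (ω : A.Ω) : ℂ := (1 / (N : ℂ)) * (A.G z ω).trace

end Ensemble

/-- Stochastic domination `X ≺ Y`, uniformly in the parameter `u ∈ U N`. The probability space is
allowed to depend on `N` and `u`, so that the random matrix itself may be a part of the parameter:
the threshold `N₀` is then uniform in the random matrix. -/
def StochDom {U : ℕ → Type*} {Ω : (N : ℕ) → U N → Type*}
    [∀ N u, MeasurableSpace (Ω N u)] (P : ∀ N u, Measure (Ω N u))
    (X Y : ∀ N u, Ω N u → ℝ) : Prop :=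
  ∀ ε : ℝ, 0 < ε → ∀ D : ℝ, 0 < D → ∃ N₀ : ℕ, ∀ N : ℕ, N₀ ≤ N → ∀ u : U N,
    (P N u).real {ω | (N : ℝ) ^ ε * Y N u ω < X N u ω} ≤ (N : ℝ) ^ (-D)

/-- A random matrix of size `N`, with fixed `δ` and `μ`, and a point `z` of its spectral domain. -/
structure DomainPoint (δ : ℝ) (μ : ℕ → ℝ) (γ : ℝ) (N : ℕ) where
  /-- the random matrix -/
  A : Ensemble δ μ N
  /-- the spectral parameter -/
  z : ℂ
  mem : z ∈ specDomain A.S γ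

end LocalSemicircle

end

/-! ### The Stieltjes transform of the semicircle law -/

noncomputable section
namespace LocalSemicircle

/-! Schur's formula expresses 1/G_kk through h_kk, z and a quadratic form in row k whose
coefficients are resolvent entries of the minor without row and column k. That minor is independent
of the row, so the form concentrates at the weighted sum of the minor's diagonal entries. By the
large deviation bounds and the Ward identity Σ_j |G_ij|² = Im G_ii / η, its fluctuation has size at
most Θ = √((Im m + ψ)/(Mη)), up to N^ε, when all entries of G are ψ-close to those of m·1. Since 1/m
= -z - m, the vector v_k = G_kk - m solves (1 - m²S)v = -m²Υ + O(|v|²), where Υ is the error of the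
self-consistent equation, and Γ is the norm of the inverse of the linear part. The off-diagonal
entries are linear forms in a row and are bounded by Θ directly.

A weak law comes first. With the a priori size M^{-γ/3}/Γ, the equation and the definition of the
domain show that closeness at this size forces closeness at half of it, with very high probability
(`hp_gap`). At η = 10 the equation is a contraction (`hp_initial`). A net of N⁶ + 1 heights and the
Lipschitz continuity in z carry closeness from η = 10 down to any point of the domain
(`hp_close_apriori`).

The sharp bound needs fluctuation averaging: weighted averages of the fluctuations of the 1/G_kk
have size nearly ψ², although each one has size ψ (`Ensemble.fluctuation_averaging`). In a high
moment of the average one factor is centred given the minor without its row. The other factors may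
therefore be compared with their versions in that minor, and each difference between minors gains a
factor ψ. Iterated differences over sets B of removed rows make this a recursion whose step is a
geometric mean (`moment_avgDfl_step`); K steps give the size ψ^{2 - 2^{-K}}.

Applied with the rows of S as weights, averaging bounds Sv by ΓΨ². Inserted back into the equation,
this improves the entrywise size Ψ to ΓΨ² + √((Im m + Ψ)/(Mη)) (`Dom.improve`). Iterating leads to Π
(`dom_ctrl`). With uniform weights S drops out of the averaged equation, so that |1 - m²| |m_N - m|
is at most about Π², and dividing by |1 - m²| gives 1/(Mη) (`hp_averaged`).

Probabilities come from Markov's inequality at high moments whose constants depend only on μ and the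
order. Hence every threshold is uniform over `DomainPoint`, that is, over the random matrix and z
together. -/

theorem exists_inverse_joukowsky {z : ℂ} (hz : 0 < z.im) :
    ∃ w : ℂ, w ≠ 0 ∧ ‖w‖ < 1 ∧ w ^ 2 + z * w + 1 = 0 := by
  obtain ⟨s, hs⟩ := IsAlgClosed.exists_pow_nat_eq (z ^ 2 - 4) (n := 2) (by norm_num)
  set a : ℂ := (-z + s) / 2 with ha
  set b : ℂ := (-z - s) / 2 with hb
  have hab : a * b = 1 := by rw [ha, hb]; linear_combination (-1 / 4 : ℂ) * hs
  have hae : a ^ 2 + z * a + 1 = 0 := by rw [ha]; linear_combination (1 / 4 : ℂ) * hs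
  have hbe : b ^ 2 + z * b + 1 = 0 := by rw [hb]; linear_combination (1 / 4 : ℂ) * hs
  have ha0 : a ≠ 0 := left_ne_zero_of_mul_eq_one hab
  have hb0 : b ≠ 0 := right_ne_zero_of_mul_eq_one hab
  have hn : ‖a‖ * ‖b‖ = 1 := by rw [← norm_mul, hab, norm_one]
  -- As ab = 1, a root on the unit circle would have the other root as its conjugate, and z = -(a +
  -- b) would be real.
  have ha1 : ‖a‖ ≠ 1 := by
    intro h1
    have hz' : z = -(a + b) := by rw [ha, hb]; ring
    have hba : b = star a := by
      have : a * star a = 1 := by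
        rw [Complex.star_def, Complex.mul_conj, Complex.normSq_eq_norm_sq, h1]; simp
      exact mul_left_cancel₀ ha0 (hab.trans this.symm)
    have : z.im = 0 := by rw [hz', hba]; simp
    exact hz.ne' this
  rcases lt_or_gt_of_ne ha1 with h | h
  · exact ⟨a, ha0, h, hae⟩
  · refine ⟨b, hb0, ?_, hbe⟩
    have hbpos : 0 < ‖b‖ := norm_pos_iff.2 hb0
    nlinarith

/-- With sin and cos written through e^{±it}, this is the difference of two geometric series with
ratios w e^{∓it}. -/
theorem hasSum_chebyshev {w : ℂ} (hw : ‖w‖ < 1) (t : ℝ) :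
    HasSum (fun n : ℕ => w ^ n * Complex.sin ((n + 1) * t))
      (Complex.sin t / (1 - 2 * w * Complex.cos t + w ^ 2)) := by
  set e : ℂ := Complex.exp (t * Complex.I) with he
  set f : ℂ := Complex.exp (-t * Complex.I) with hf
  have hne : ‖e‖ = 1 := by rw [he]; exact Complex.norm_exp_ofReal_mul_I t
  have hnf : ‖f‖ = 1 := by
    rw [hf]; have := Complex.norm_exp_ofReal_mul_I (-t); simpa using this
  have hef : e * f = 1 := by rw [he, hf, ← Complex.exp_add]; simp
  have h1 : HasSum (fun n : ℕ => (w * e) ^ n) (1 - w * e)⁻¹ :=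
    hasSum_geometric_of_norm_lt_one (by rw [norm_mul, hne, mul_one]; exact hw)
  have h2 : HasSum (fun n : ℕ => (w * f) ^ n) (1 - w * f)⁻¹ :=
    hasSum_geometric_of_norm_lt_one (by rw [norm_mul, hnf, mul_one]; exact hw)
  have hn1 : 1 - w * e ≠ 0 := by
    intro h
    have : ‖w * e‖ = 1 := by rw [← sub_eq_zero.1 h]; simp
    rw [norm_mul, hne, mul_one] at this; exact hw.ne this
  have hn2 : 1 - w * f ≠ 0 := by
    intro h
    have : ‖w * f‖ = 1 := by rw [← sub_eq_zero.1 h]; simp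
    rw [norm_mul, hnf, mul_one] at this; exact hw.ne this
  have hs : Complex.sin t = (f - e) * Complex.I / 2 := by
    rw [hf, he, Complex.sin]
  have hc : Complex.cos t = (e + f) / 2 := by rw [hf, he, Complex.cos]
  have h3 := ((h2.mul_left f).sub (h1.mul_left e)).mul_right (Complex.I / 2)
  have hfac : 1 - 2 * w * Complex.cos t + w ^ 2 = (1 - w * e) * (1 - w * f) := by
    rw [hc]; linear_combination (-w ^ 2) * hef
  have hsum : Complex.sin t / (1 - 2 * w * Complex.cos t + w ^ 2)
      = (f * (1 - w * f)⁻¹ - e * (1 - w * e)⁻¹) * (Complex.I / 2) := by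
    rw [hfac, hs, div_eq_iff (mul_ne_zero hn1 hn2)]
    linear_combination (-(Complex.I / 2) * f * (1 - w * e)) * mul_inv_cancel₀ hn2
      + (Complex.I / 2) * e * (1 - w * f) * mul_inv_cancel₀ hn1
  rw [hsum]
  refine h3.congr_fun fun n => ?_
  have e1 : Complex.exp (((n : ℂ) + 1) * t * Complex.I) = e ^ (n + 1) := by
    rw [he, ← Complex.exp_nat_mul]; push_cast; ring_nf
  have e2 : Complex.exp (-(((n : ℂ) + 1) * t) * Complex.I) = f ^ (n + 1) := by
    rw [hf, ← Complex.exp_nat_mul]; push_cast; ring_nf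
  rw [Complex.sin, e1, e2]
  ring

theorem integral_sin_mul_sin (n : ℕ) :
    ∫ t in (0 : ℝ)..Real.pi, (Real.sin t * Real.sin ((n + 1) * t)) =
      if n = 0 then Real.pi / 2 else 0 := by
  rcases Nat.eq_zero_or_pos n with rfl | hn
  · have := integral_sin_sq (a := 0) (b := Real.pi)
    simp only [CharP.cast_eq_zero, zero_add, one_mul, if_true]
    simp_rw [← pow_two]
    rw [this]; simp
  · have hn' : (n : ℝ) ≠ 0 := by positivity
    have hn2 : (n : ℝ) + 2 ≠ 0 := by positivity
    have h : ∀ t : ℝ, Real.sin t * Real.sin ((n + 1) * t)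
        = (Real.cos (n * t) - Real.cos ((n + 2) * t)) / 2 := by
      intro t
      have h1 := Real.cos_sub ((n + 1) * t) t
      have h2 := Real.cos_add ((n + 1) * t) t
      have h3 : ((n : ℝ) + 1) * t - t = n * t := by ring
      have h4 : ((n : ℝ) + 1) * t + t = (n + 2) * t := by ring
      rw [h3] at h1; rw [h4] at h2
      rw [h1, h2]; ring
    have hc : ∀ k : ℕ, 0 < k → ∫ t in (0 : ℝ)..Real.pi, Real.cos (k * t) = 0 := by
      intro k hk
      rw [intervalIntegral.integral_comp_mul_left (f := Real.cos) (by positivity : (k : ℝ) ≠ 0)]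
      simp [Real.sin_nat_mul_pi]
    have hc2 := hc (n + 2) (by omega)
    push_cast at hc2
    simp_rw [h]
    rw [intervalIntegral.integral_div, intervalIntegral.integral_sub, hc n hn, hc2]
    · simp [hn.ne']
    · exact Continuous.intervalIntegrable (by fun_prop) _ _
    · exact Continuous.intervalIntegrable (by fun_prop) _ _

/-- Integrate the Chebyshev series term by term; by orthogonality of the sines only n = 0 survives.
-/
theorem integral_poisson_sin_sq {w : ℂ} (hw : ‖w‖ < 1) :
    ∫ t in (0 : ℝ)..Real.pi,
      Complex.sin t * (Complex.sin t / (1 - 2 * w * Complex.cos t + w ^ 2)) = (Real.pi / 2 : ℂ) := by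
  have hsum : HasSum (fun n : ℕ => ∫ t in (0 : ℝ)..Real.pi,
      Complex.sin t * (w ^ n * Complex.sin ((n + 1) * t)))
      (∫ t in (0 : ℝ)..Real.pi,
        Complex.sin t * (Complex.sin t / (1 - 2 * w * Complex.cos t + w ^ 2))) := by
    refine intervalIntegral.hasSum_integral_of_dominated_convergence
      (fun n _ => ‖w‖ ^ n) (fun n => ?_) (fun n => ?_) ?_ ?_ ?_
    · exact Continuous.aestronglyMeasurable (by fun_prop)
    · refine Filter.Eventually.of_forall fun t _ => ?_
      have h1 : ‖Complex.sin t‖ ≤ 1 := by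
        rw [← Complex.ofReal_sin, Complex.norm_real]; exact Real.abs_sin_le_one t
      have h2 : ‖Complex.sin ((n + 1) * t)‖ ≤ 1 := by
        have : ((n : ℂ) + 1) * t = (((n + 1) * t : ℝ) : ℂ) := by push_cast; ring
        rw [this, ← Complex.ofReal_sin, Complex.norm_real]; exact Real.abs_sin_le_one _
      rw [norm_mul, norm_mul, norm_pow]
      calc ‖Complex.sin t‖ * (‖w‖ ^ n * ‖Complex.sin ((n + 1) * t)‖)
          ≤ 1 * (‖w‖ ^ n * 1) := by gcongr
        _ = ‖w‖ ^ n := by ring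
    · exact Filter.Eventually.of_forall fun t _ =>
        summable_geometric_of_lt_one (norm_nonneg _) hw
    · exact intervalIntegrable_const
    · exact Filter.Eventually.of_forall fun t _ => (hasSum_chebyshev hw t).mul_left _
  have hval : ∀ n : ℕ, ∫ t in (0 : ℝ)..Real.pi,
      Complex.sin t * (w ^ n * Complex.sin ((n + 1) * t)) =
      if n = 0 then ((Real.pi / 2 : ℝ) : ℂ) else 0 := by
    intro n
    have : ∀ t : ℝ, Complex.sin t * (w ^ n * Complex.sin ((n + 1) * t))
        = w ^ n * ((Real.sin t * Real.sin ((n + 1) * t) : ℝ) : ℂ) := by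
      intro t; push_cast; ring
    simp_rw [this]
    rw [intervalIntegral.integral_const_mul, intervalIntegral.integral_ofReal,
      integral_sin_mul_sin]
    split_ifs with h <;> simp [h]
  simp_rw [hval] at hsum
  have := hsum.unique (hasSum_ite_eq 0 ((Real.pi / 2 : ℝ) : ℂ))
  rw [this]; push_cast; ring

/-- The substitution x = -2 cos t turns the density into 4 sin² t dt, and the quadratic equation
turns w(x - z) into 1 - 2w cos t + w². The integral is then the previous one times 4w. -/
theorem msc_eq_of_root {z w : ℂ} (hz : 0 < z.im) (hw0 : w ≠ 0) (hw : ‖w‖ < 1)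
    (hroot : w ^ 2 + z * w + 1 = 0) : msc z = w := by
  have hsub : ∫ x in (-2 : ℝ)..2, (Real.sqrt (4 - x ^ 2) : ℂ) / ((x : ℂ) - z)
      = ∫ t in (0 : ℝ)..Real.pi, (2 * Real.sin t : ℝ) •
        ((fun x : ℝ => (Real.sqrt (4 - x ^ 2) : ℂ) / ((x : ℂ) - z)) ∘
          (fun t : ℝ => -2 * Real.cos t)) t := by
    rw [intervalIntegral.integral_deriv_smul_comp (a := 0) (b := Real.pi)
      (f := fun t : ℝ => -2 * Real.cos t) (f' := fun t : ℝ => 2 * Real.sin t)]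
    · simp
    · intro t _
      have := (Real.hasDerivAt_cos t).const_mul (-2)
      simpa using this
    · exact Continuous.continuousOn (by fun_prop)
    · have hne : ∀ x : ℝ, (x : ℂ) - z ≠ 0 := by
        intro x h
        have : ((x : ℂ) - z).im = 0 := by rw [h]; rfl
        simp at this; exact hz.ne' this
      refine Continuous.div ?_ (by fun_prop) hne
      exact Complex.continuous_ofReal.comp (by fun_prop)
  rw [msc, hsub]
  have hInt : ∀ t ∈ Set.uIcc (0 : ℝ) Real.pi, (2 * Real.sin t : ℝ) •
        ((fun x : ℝ => (Real.sqrt (4 - x ^ 2) : ℂ) / ((x : ℂ) - z)) ∘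
          (fun t : ℝ => -2 * Real.cos t)) t =
      4 * w * (Complex.sin t * (Complex.sin t / (1 - 2 * w * Complex.cos t + w ^ 2))) := by
    intro t ht
    rw [Set.uIcc_of_le Real.pi_pos.le] at ht
    have hs : 0 ≤ Real.sin t := Real.sin_nonneg_of_mem_Icc ht
    have h1 : Real.sqrt (4 - (-2 * Real.cos t) ^ 2) = 2 * Real.sin t := by
      rw [show 4 - (-2 * Real.cos t) ^ 2 = (2 * Real.sin t) ^ 2 by
        nlinarith [Real.sin_sq_add_cos_sq t]]
      exact Real.sqrt_sq (by positivity)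
    have h2 : ((-2 * Real.cos t : ℝ) : ℂ) - z ≠ 0 := by
      intro h
      have : (((-2 * Real.cos t : ℝ) : ℂ) - z).im = 0 := by rw [h]; rfl
      rw [Complex.sub_im, Complex.ofReal_im] at this
      linarith
    have h3 : 1 - 2 * w * Complex.cos t + w ^ 2 = w * (((-2 * Real.cos t : ℝ) : ℂ) - z) := by
      push_cast; linear_combination hroot
    simp only [Function.comp_apply, h1, Complex.real_smul]
    rw [h3]
    push_cast at h2 ⊢
    field_simp
    ring
  rw [intervalIntegral.integral_congr hInt, intervalIntegral.integral_const_mul,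
    integral_poisson_sin_sq hw]
  have hpi : (Real.pi : ℂ) ≠ 0 := by exact_mod_cast Real.pi_ne_zero
  field_simp
  norm_num

theorem msc_eq {z : ℂ} (hz : 0 < z.im) : msc z ^ 2 + z * msc z + 1 = 0 := by
  obtain ⟨w, h0, h1, h2⟩ := exists_inverse_joukowsky hz
  rw [msc_eq_of_root hz h0 h1 h2]; exact h2

theorem msc_ne_zero {z : ℂ} (hz : 0 < z.im) : msc z ≠ 0 := by
  intro h; have := msc_eq hz; rw [h] at this; norm_num at this

theorem norm_msc_lt_one {z : ℂ} (hz : 0 < z.im) : ‖msc z‖ < 1 := by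
  obtain ⟨w, h0, h1, h2⟩ := exists_inverse_joukowsky hz
  rw [msc_eq_of_root hz h0 h1 h2]; exact h1

theorem inv_msc {z : ℂ} (hz : 0 < z.im) : (msc z)⁻¹ = -z - msc z := by
  have := msc_ne_zero hz
  rw [inv_eq_iff_eq_inv, inv_eq_one_div, eq_div_iff]
  · linear_combination -(msc_eq hz)
  · intro h
    have h2 := msc_eq hz
    have h3 : (1 : ℂ) = 0 := by linear_combination h2 + msc z * h
    exact one_ne_zero h3

/-- The imaginary part of 1/m = -z - m, multiplied by |m|². It ties Im m, |m| and η together and is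
the source of the quantitative facts on m. -/
theorem im_msc_eq {z : ℂ} (hz : 0 < z.im) :
    (msc z).im = ‖msc z‖ ^ 2 * (z.im + (msc z).im) := by
  have h := congrArg Complex.im (inv_msc hz)
  have h0 : Complex.normSq (msc z) ≠ 0 := by simpa using msc_ne_zero hz
  rw [Complex.inv_im, Complex.sub_im, Complex.neg_im, div_eq_iff h0] at h
  rw [← Complex.normSq_eq_norm_sq]
  linarith

theorem im_msc_pos {z : ℂ} (hz : 0 < z.im) : 0 < (msc z).im := by
  have h := im_msc_eq hz
  have h1 := norm_msc_lt_one hz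
  have h0 : 0 < ‖msc z‖ := norm_pos_iff.2 (msc_ne_zero hz)
  have h2 : (1 - ‖msc z‖ ^ 2) * (msc z).im = ‖msc z‖ ^ 2 * z.im := by linarith
  have h3 : 0 < 1 - ‖msc z‖ ^ 2 := by nlinarith
  have h4 : 0 < (1 - ‖msc z‖ ^ 2) * (msc z).im := by rw [h2]; positivity
  exact (pos_iff_pos_of_mul_pos h4).1 h3

theorem im_msc_le_norm (z : ℂ) : (msc z).im ≤ ‖msc z‖ :=
  (le_abs_self _).trans (Complex.abs_im_le_norm _)

/-- In 1 - m² = (1 - m)(1 + m) both factors have modulus at least Im m, and the larger one at least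
1. This allows division by 1 - m² in the averaged law. -/
theorem im_msc_le_norm_one_sub_sq (z : ℂ) : (msc z).im ≤ ‖1 - msc z ^ 2‖ := by
  set m := msc z
  have h1 : m.im ≤ ‖1 - m‖ := by
    have := (neg_le_abs _).trans (Complex.abs_im_le_norm (1 - m)); simpa using this
  have h2 : m.im ≤ ‖1 + m‖ := by
    have := (le_abs_self _).trans (Complex.abs_im_le_norm (1 + m)); simpa using this
  have h3 : (2 : ℝ) ≤ ‖1 - m‖ + ‖1 + m‖ := by
    have := norm_add_le (1 - m) (1 + m)
    rw [show (1 - m) + (1 + m) = 2 by ring] at this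
    simpa using this
  rw [show 1 - m ^ 2 = (1 - m) * (1 + m) by ring, norm_mul]
  rcases le_total ‖1 - m‖ ‖1 + m‖ with h | h
  · nlinarith [norm_nonneg (1 - m)]
  · nlinarith [norm_nonneg (1 + m)]

theorem norm_msc_le_inv_im {z : ℂ} (hz : 0 < z.im) : ‖msc z‖ * z.im ≤ 1 := by
  have h := im_msc_eq hz
  have h0 : 0 < ‖msc z‖ := norm_pos_iff.2 (msc_ne_zero hz)
  have h1 := im_msc_le_norm z
  have h2 := im_msc_pos hz
  have : ‖msc z‖ * (‖msc z‖ * z.im) ≤ ‖msc z‖ * 1 := by nlinarith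
  exact le_of_mul_le_mul_left this h0

/-- Cross-multiplying the quadratic equations at z and w gives (m - n)(1 - mn) = mn(z - w). -/
theorem norm_msc_sub_le {z w : ℂ} (hz : 0 < z.im) (hw : 0 < w.im) :
    ‖msc z - msc w‖ * (1 - ‖msc z‖ * ‖msc w‖) ≤ ‖z - w‖ := by
  set m := msc z
  set n := msc w
  have h : (m - n) * (1 - m * n) = m * n * (z - w) := by
    have h1 := msc_eq hz
    have h2 := msc_eq hw
    linear_combination m * h2 - n * h1
  have h1 := norm_msc_lt_one hz
  have h2 := norm_msc_lt_one hw
  have h3 : 1 - ‖m‖ * ‖n‖ ≤ ‖1 - m * n‖ := by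
    have := norm_sub_norm_le (1 : ℂ) (m * n)
    rwa [norm_one, norm_mul] at this
  have h4 : ‖m‖ * ‖n‖ ≤ 1 := by nlinarith [norm_nonneg m, norm_nonneg n]
  calc ‖m - n‖ * (1 - ‖m‖ * ‖n‖) ≤ ‖m - n‖ * ‖1 - m * n‖ := by gcongr
    _ = ‖m‖ * ‖n‖ * ‖z - w‖ := by rw [← norm_mul, h, norm_mul, norm_mul]
    _ ≤ 1 * ‖z - w‖ := by gcongr
    _ = ‖z - w‖ := one_mul _

theorem one_sub_norm_msc_sq_ge {z : ℂ} (hz : 0 < z.im) :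
    ‖msc z‖ ^ 2 * z.im ≤ 1 - ‖msc z‖ ^ 2 := by
  have h := im_msc_eq hz
  have h1 := norm_msc_lt_one hz
  have h2 := im_msc_le_norm z
  have h3 := im_msc_pos hz
  have h4 : ‖msc z‖ ^ 2 * z.im = (1 - ‖msc z‖ ^ 2) * (msc z).im := by linarith
  rw [h4]
  have : 0 ≤ 1 - ‖msc z‖ ^ 2 := by nlinarith [norm_nonneg (msc z)]
  nlinarith

end LocalSemicircle
end

/-! ### Resolvents of Hermitian matrices and of their minors -/

noncomputable section
namespace LocalSemicircle

section Minorize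

variable {n : Type*} [DecidableEq n]

/-- The matrix `H` with the rows and columns in `T` replaced by zero. -/
def minorize (T : Finset n) (H : Matrix n n ℂ) : Matrix n n ℂ :=
  Matrix.of fun i j => if i ∈ T ∨ j ∈ T then 0 else H i j

theorem minorize_apply (T : Finset n) (H : Matrix n n ℂ) (i j : n) :
    minorize T H i j = if i ∈ T ∨ j ∈ T then 0 else H i j := rfl

theorem minorize_empty (H : Matrix n n ℂ) : minorize ∅ H = H := by
  ext i j; simp [minorize_apply]

theorem minorize_minorize (T U : Finset n) (H : Matrix n n ℂ) :
    minorize T (minorize U H) = minorize (T ∪ U) H := by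
  ext i j; simp only [minorize_apply, Finset.mem_union]; grind

theorem minorize_insert (k : n) (T : Finset n) (H : Matrix n n ℂ) :
    minorize (insert k T) H = minorize {k} (minorize T H) := by
  rw [minorize_minorize, Finset.insert_eq]

theorem isHermitian_minorize {H : Matrix n n ℂ} (hH : H.IsHermitian) (T : Finset n) :
    (minorize T H).IsHermitian := by
  ext i j
  rw [Matrix.conjTranspose_apply, minorize_apply, minorize_apply]
  have := hH.apply i j
  grind [star_zero]

end Minorize

section Resolvent

variable {n : Type*} [Fintype n] [DecidableEq n]

/-- The resolvent `(H - z)⁻¹`. -/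
def res (H : Matrix n n ℂ) (z : ℂ) : Matrix n n ℂ := (H - z • (1 : Matrix n n ℂ))⁻¹

theorem isUnit_det_sub {H : Matrix n n ℂ} (hH : H.IsHermitian) {z : ℂ} (hz : 0 < z.im) :
    IsUnit (H - z • (1 : Matrix n n ℂ)).det := by
  rw [isUnit_iff_ne_zero]
  intro h
  obtain ⟨v, hv, hv0⟩ := Matrix.exists_mulVec_eq_zero_iff.2 h
  rw [Matrix.sub_mulVec, Matrix.smul_mulVec, Matrix.one_mulVec, sub_eq_zero] at hv0
  have h1 : star v ⬝ᵥ H.mulVec v = z * (star v ⬝ᵥ v) := by rw [hv0, dotProduct_smul, smul_eq_mul]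
  have h2 := hH.im_star_dotProduct_mulVec_self v
  have h3 : star v ⬝ᵥ v = ((∑ i, ‖v i‖ ^ 2 : ℝ) : ℂ) := by
    simp only [dotProduct, Pi.star_apply, Complex.star_def]
    push_cast
    exact Finset.sum_congr rfl fun i _ => Complex.conj_mul' _
  have h4 : 0 < ∑ i, ‖v i‖ ^ 2 := by
    obtain ⟨i, hi⟩ := Function.ne_iff.1 hv
    have hi' : 0 < ‖v i‖ := norm_pos_iff.2 hi
    exact Finset.sum_pos' (fun _ _ => by positivity) ⟨i, Finset.mem_univ _, by positivity⟩
  rw [h1, h3] at h2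
  have h5 : (z * ((∑ i, ‖v i‖ ^ 2 : ℝ) : ℂ)).im = z.im * ∑ i, ‖v i‖ ^ 2 := by
    rw [Complex.mul_im, Complex.ofReal_im, Complex.ofReal_re]; ring
  have h6 : z.im * ∑ i, ‖v i‖ ^ 2 = 0 := by rw [← h5]; exact h2
  have : 0 < z.im * ∑ i, ‖v i‖ ^ 2 := by positivity
  linarith

variable {H : Matrix n n ℂ} {z : ℂ}

theorem sub_mul_res (hH : H.IsHermitian) (hz : 0 < z.im) :
    (H - z • (1 : Matrix n n ℂ)) * res H z = 1 :=
  Matrix.mul_nonsing_inv _ (isUnit_det_sub hH hz)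

theorem res_mul_sub (hH : H.IsHermitian) (hz : 0 < z.im) :
    res H z * (H - z • (1 : Matrix n n ℂ)) = 1 :=
  Matrix.nonsing_inv_mul _ (isUnit_det_sub hH hz)

/-- The resolvent identity between z and its conjugate; its diagonal is the Ward identity. -/
theorem res_sub_conjTranspose (hH : H.IsHermitian) (hz : 0 < z.im) :
    res H z - (res H z).conjTranspose =
      (z - star z) • (res H z * (res H z).conjTranspose) := by
  have h1 := sub_mul_res hH hz
  have h2 := res_mul_sub hH hz
  have h3 : (H - star z • (1 : Matrix n n ℂ)) * (res H z).conjTranspose = 1 := by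
    have := congrArg Matrix.conjTranspose h2
    rwa [Matrix.conjTranspose_mul, Matrix.conjTranspose_sub, hH.eq, Matrix.conjTranspose_smul,
      Matrix.conjTranspose_one] at this
  calc res H z - (res H z).conjTranspose
      = res H z * ((H - star z • (1 : Matrix n n ℂ)) * (res H z).conjTranspose)
        - (res H z * (H - z • (1 : Matrix n n ℂ))) * (res H z).conjTranspose := by
        rw [h3, h2, mul_one, one_mul]
    _ = (z - star z) • (res H z * (res H z).conjTranspose) := by
        simp only [mul_sub, sub_mul, Matrix.mul_assoc, Matrix.mul_smul, Matrix.smul_mul,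
          Matrix.one_mul, Matrix.mul_one, sub_smul]
        abel

/-- The resolvent identity can be expanded in either order, and z is not real. Normality yields the
Ward identity for columns as well as rows. -/
theorem res_mul_conjTranspose_comm (hH : H.IsHermitian) (hz : 0 < z.im) :
    res H z * (res H z).conjTranspose = (res H z).conjTranspose * res H z := by
  have h1 := sub_mul_res hH hz
  have h2 := res_mul_sub hH hz
  have h3 : (H - star z • (1 : Matrix n n ℂ)) * (res H z).conjTranspose = 1 := by
    have := congrArg Matrix.conjTranspose h2
    rwa [Matrix.conjTranspose_mul, Matrix.conjTranspose_sub, hH.eq, Matrix.conjTranspose_smul,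
      Matrix.conjTranspose_one] at this
  have h4 : (res H z).conjTranspose * (H - star z • (1 : Matrix n n ℂ)) = 1 :=
    mul_eq_one_comm.1 h3
  have hz' : z - star z ≠ 0 := by
    intro h
    have := congrArg Complex.im h
    simp at this
    linarith
  have h5 := res_sub_conjTranspose hH hz
  have h6 : res H z - (res H z).conjTranspose =
      (z - star z) • ((res H z).conjTranspose * res H z) := by
    have h7 : res H z - (res H z).conjTranspose =
        ((res H z).conjTranspose * (H - star z • (1 : Matrix n n ℂ))) * res H z
          - (res H z).conjTranspose * ((H - z • (1 : Matrix n n ℂ)) * res H z) := by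
      rw [h4, h1, mul_one, one_mul]
    rw [h7]
    simp only [mul_sub, sub_mul, Matrix.mul_assoc, Matrix.mul_smul, Matrix.smul_mul,
      Matrix.one_mul, Matrix.mul_one, sub_smul]
    abel
  exact smul_right_injective _ hz' (h5.symm.trans h6)

/-- The Ward identity. It turns the ℓ² sums that appear as variances of linear and quadratic forms
into Im G_ii / η. -/
theorem im_res_diag (hH : H.IsHermitian) (hz : 0 < z.im) (i : n) :
    (res H z i i).im = z.im * ∑ j, ‖res H z i j‖ ^ 2 := by
  have h := congrFun (congrFun (res_sub_conjTranspose hH hz) i) i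
  have h2 : (res H z * (res H z).conjTranspose) i i = ((∑ j, ‖res H z i j‖ ^ 2 : ℝ) : ℂ) := by
    rw [Matrix.mul_apply]; push_cast
    exact Finset.sum_congr rfl fun j _ => by
      rw [Matrix.conjTranspose_apply]; exact Complex.mul_conj' _
  rw [Matrix.sub_apply, Matrix.smul_apply, h2, Matrix.conjTranspose_apply] at h
  have h3 := congrArg Complex.im h
  simp only [Complex.sub_im, Complex.star_def, Complex.conj_im, smul_eq_mul, Complex.mul_im,
    Complex.ofReal_im, Complex.ofReal_re, mul_zero, zero_add] at h3
  linarith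

theorem im_res_diag' (hH : H.IsHermitian) (hz : 0 < z.im) (j : n) :
    (res H z j j).im = z.im * ∑ i, ‖res H z i j‖ ^ 2 := by
  have h := congrFun (congrFun (res_sub_conjTranspose hH hz) j) j
  have h2 : (res H z * (res H z).conjTranspose) j j = ((∑ i, ‖res H z i j‖ ^ 2 : ℝ) : ℂ) := by
    rw [res_mul_conjTranspose_comm hH hz, Matrix.mul_apply]; push_cast
    exact Finset.sum_congr rfl fun i _ => by
      rw [Matrix.conjTranspose_apply]; exact Complex.conj_mul' _
  rw [Matrix.sub_apply, Matrix.smul_apply, h2, Matrix.conjTranspose_apply] at h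
  have h3 := congrArg Complex.im h
  simp only [Complex.sub_im, Complex.star_def, Complex.conj_im, smul_eq_mul, Complex.mul_im,
    Complex.ofReal_im, Complex.ofReal_re, mul_zero, zero_add] at h3
  linarith

theorem res_diag_ne_zero (hH : H.IsHermitian) (hz : 0 < z.im) (i : n) : res H z i i ≠ 0 := by
  intro h
  have h1 := im_res_diag hH hz i
  rw [h, Complex.zero_im, eq_comm, mul_eq_zero, or_iff_right hz.ne',
    Finset.sum_eq_zero_iff_of_nonneg (fun _ _ => by positivity)] at h1
  have h2 := congrFun (congrFun (res_mul_sub hH hz) i) i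
  rw [Matrix.mul_apply, Matrix.one_apply_eq] at h2
  rw [Finset.sum_eq_zero] at h2
  · exact zero_ne_one h2
  · intro j _
    have := h1 j (Finset.mem_univ _)
    rw [pow_eq_zero_iff two_ne_zero, norm_eq_zero] at this
    rw [this, zero_mul]

theorem norm_res_diag_le (hH : H.IsHermitian) (hz : 0 < z.im) (i : n) :
    ‖res H z i i‖ ≤ 1 / z.im := by
  have h1 := im_res_diag hH hz i
  have h2 : ‖res H z i i‖ ^ 2 ≤ ∑ j, ‖res H z i j‖ ^ 2 :=
    Finset.single_le_sum (f := fun j => ‖res H z i j‖ ^ 2) (fun _ _ => by positivity)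
      (Finset.mem_univ i)
  have h3 : (res H z i i).im ≤ ‖res H z i i‖ := (le_abs_self _).trans (Complex.abs_im_le_norm _)
  have h0 : 0 < ‖res H z i i‖ := norm_pos_iff.2 (res_diag_ne_zero hH hz i)
  rw [le_div_iff₀ hz]
  have : ‖res H z i i‖ * (‖res H z i i‖ * z.im) ≤ ‖res H z i i‖ * 1 := by nlinarith
  exact le_of_mul_le_mul_left this h0

theorem norm_res_le (hH : H.IsHermitian) (hz : 0 < z.im) (i j : n) :
    ‖res H z i j‖ ≤ 1 / z.im := by
  have h1 := im_res_diag hH hz i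
  have h2 : ‖res H z i j‖ ^ 2 ≤ ∑ j, ‖res H z i j‖ ^ 2 :=
    Finset.single_le_sum (f := fun j => ‖res H z i j‖ ^ 2) (fun _ _ => by positivity)
      (Finset.mem_univ j)
  have h3 : (res H z i i).im ≤ 1 / z.im :=
    ((le_abs_self _).trans (Complex.abs_im_le_norm _)).trans (norm_res_diag_le hH hz i)
  rw [le_div_iff₀ hz] at h3 ⊢
  refine abs_le_one_iff_mul_self_le_one.2 ?_ |> fun h => (le_abs_self _).trans h
  have : z.im ^ 2 * ‖res H z i j‖ ^ 2 ≤ z.im ^ 2 * ∑ j, ‖res H z i j‖ ^ 2 := by gcongr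
  nlinarith

theorem res_sub_res (hH : H.IsHermitian) {w : ℂ} (hz : 0 < z.im) (hw : 0 < w.im) :
    res H z - res H w = (z - w) • (res H z * res H w) := by
  have h1 := sub_mul_res hH hw
  have h2 := res_mul_sub hH hz
  calc res H z - res H w = res H z * ((H - w • (1 : Matrix n n ℂ)) * res H w)
        - (res H z * (H - z • (1 : Matrix n n ℂ))) * res H w := by rw [h1, h2, mul_one, one_mul]
    _ = _ := by
      simp only [mul_sub, sub_mul, Matrix.mul_assoc, Matrix.mul_smul, Matrix.smul_mul,
          Matrix.one_mul, Matrix.mul_one, sub_smul]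
      abel

/-- A crude Lipschitz bound, polynomial in the dimension and in 1/η, which suffices between
neighbouring points of a fine net. -/
theorem norm_res_sub_le (hH : H.IsHermitian) {w : ℂ} (hz : 0 < z.im) (hw : 0 < w.im) (i j : n) :
    ‖res H z i j - res H w i j‖ ≤ ‖z - w‖ * (Fintype.card n * (1 / z.im * (1 / w.im))) := by
  have h := congrFun (congrFun (res_sub_res hH hz hw) i) j
  rw [Matrix.sub_apply, Matrix.smul_apply, Matrix.mul_apply] at h
  rw [h, norm_smul]
  gcongr
  calc ‖∑ k, res H z i k * res H w k j‖ ≤ ∑ k, ‖res H z i k * res H w k j‖ := norm_sum_le _ _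
    _ ≤ ∑ _k : n, 1 / z.im * (1 / w.im) := by
      refine Finset.sum_le_sum fun k _ => ?_
      rw [norm_mul]
      have := norm_res_le hH hz i k
      have := norm_res_le hH hw k j
      gcongr
    _ = _ := by rw [Finset.sum_const, nsmul_eq_mul, Finset.card_univ]

/-- The resolvent of the matrix with the rows and columns in `T` removed. -/
def mres (H : Matrix n n ℂ) (z : ℂ) (T : Finset n) : Matrix n n ℂ := res (minorize T H) z

theorem mres_empty (H : Matrix n n ℂ) (z : ℂ) : mres H z ∅ = res H z := by
  rw [mres, minorize_empty]

theorem mres_insert (H : Matrix n n ℂ) (z : ℂ) (k : n) (T : Finset n) :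
    mres H z (insert k T) = mres (minorize T H) z {k} := by
  rw [mres, mres, minorize_insert]

/-- The minorized matrix vanishes on the rows of T, so its resolvent is decoupled there from the
remaining indices. This is why zeroing rows and columns may replace deleting them, and all minors
keep the same index type. -/
theorem mres_off (hH : H.IsHermitian) (hz : 0 < z.im) {T : Finset n} {k j : n} (hk : k ∈ T)
    (hkj : k ≠ j) : mres H z T k j = 0 := by
  have h := congrFun (congrFun (sub_mul_res (isHermitian_minorize hH T) hz) k) j
  rw [sub_mul, Matrix.smul_mul, Matrix.one_mul, Matrix.sub_apply, Matrix.smul_apply,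
    Matrix.mul_apply, Matrix.one_apply_ne hkj] at h
  rw [Finset.sum_eq_zero (fun i _ => by rw [minorize_apply, if_pos (Or.inl hk), zero_mul]),
    zero_sub, neg_eq_zero, smul_eq_zero] at h
  refine h.resolve_left ?_
  rintro rfl; simp at hz

theorem mres_off' (hH : H.IsHermitian) (hz : 0 < z.im) {T : Finset n} {k j : n} (hk : k ∈ T)
    (hkj : j ≠ k) : mres H z T j k = 0 := by
  have h := congrFun (congrFun (res_mul_sub (isHermitian_minorize hH T) hz) j) k
  rw [mul_sub, Matrix.mul_smul, Matrix.mul_one, Matrix.sub_apply, Matrix.smul_apply,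
    Matrix.mul_apply, Matrix.one_apply_ne hkj] at h
  rw [Finset.sum_eq_zero (fun i _ => by rw [minorize_apply, if_pos (Or.inr hk), mul_zero]),
    zero_sub, neg_eq_zero, smul_eq_zero] at h
  refine h.resolve_left ?_
  rintro rfl; simp at hz

/-- H minus its minor lives on row and column k. In the resolvent identity the column part meets
only the entry (k, j) of the minor's resolvent, which vanishes, so one row sum remains. -/
theorem res_eq_mres_sub (hH : H.IsHermitian) (hz : 0 < z.im) {k j : n} (hj : j ≠ k) (i : n) :
    res H z i j = mres H z {k} i j - res H z i k * ∑ b, H k b * mres H z {k} b j := by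
  have hH' := isHermitian_minorize hH {k}
  have h : res H z - mres H z {k} = - (res H z * ((H - minorize {k} H) * mres H z {k})) := by
    have h1 := sub_mul_res hH' hz
    have h2 := res_mul_sub hH hz
    calc res H z - mres H z {k} = res H z * ((minorize {k} H - z • (1 : Matrix n n ℂ)) * mres H z {k})
        - (res H z * (H - z • (1 : Matrix n n ℂ))) * mres H z {k} := by
          rw [mres, h1, h2, mul_one, one_mul]
      _ = _ := by
        simp only [mul_sub, sub_mul, Matrix.mul_assoc]
        abel
  have h' := congrFun (congrFun h i) j
  rw [Matrix.sub_apply, Matrix.neg_apply, Matrix.mul_apply] at h'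
  rw [Finset.sum_eq_single k] at h'
  · rw [Matrix.mul_apply] at h'
    have : ∑ b, (H - minorize {k} H) k b * mres H z {k} b j = ∑ b, H k b * mres H z {k} b j := by
      refine Finset.sum_congr rfl fun b _ => ?_
      rw [Matrix.sub_apply, minorize_apply, if_pos (by simp), sub_zero]
    rw [this] at h'
    linear_combination h'
  · intro a _ ha
    rw [Matrix.mul_apply, Finset.sum_eq_zero, mul_zero]
    intro b _
    by_cases hb : b = k
    · rw [hb, mres_off hH hz (by simp) hj.symm, mul_zero]
    · rw [Matrix.sub_apply, minorize_apply, if_neg (by simp [ha, hb]), sub_self, zero_mul]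
  · simp

theorem res_row (hH : H.IsHermitian) (hz : 0 < z.im) {k j : n} (hj : j ≠ k) :
    res H z k j = - res H z k k * ∑ b, H k b * mres H z {k} b j := by
  rw [res_eq_mres_sub hH hz hj k, mres_off hH hz (by simp) hj.symm]; ring

/-- Eliminate the row sum between `res_eq_mres_sub` and `res_row`. -/
theorem mres_single (hH : H.IsHermitian) (hz : 0 < z.im) {k i j : n} (hj : j ≠ k) :
    mres H z {k} i j = res H z i j - res H z i k * res H z k j / res H z k k := by
  have h0 := res_diag_ne_zero hH hz k
  rw [res_row hH hz hj, res_eq_mres_sub hH hz hj i]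
  field_simp
  ring

theorem res_col (hH : H.IsHermitian) (hz : 0 < z.im) {k i : n} (hi : i ≠ k) :
    res H z i k = - res H z k k * ∑ a, mres H z {k} i a * H a k := by
  have h := congrFun (congrFun (res_mul_sub hH hz) i) k
  rw [mul_sub, Matrix.mul_smul, Matrix.mul_one, Matrix.sub_apply, Matrix.smul_apply,
    Matrix.mul_apply, Matrix.one_apply_ne hi, smul_eq_mul] at h
  have h2 := congrFun (congrFun (res_mul_sub hH hz) k) k
  rw [mul_sub, Matrix.mul_smul, Matrix.mul_one, Matrix.sub_apply, Matrix.smul_apply,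
    Matrix.mul_apply, Matrix.one_apply_eq, smul_eq_mul] at h2
  have h0 := res_diag_ne_zero hH hz k
  have hs : ∑ a, mres H z {k} i a * H a k =
      ∑ a, (res H z i a * H a k - res H z i k / res H z k k * (res H z k a * H a k)) := by
    refine Finset.sum_congr rfl fun a _ => ?_
    by_cases ha : a = k
    · rw [ha, mres_off' hH hz (by simp) hi]; field_simp; ring
    · rw [mres_single hH hz ha]; field_simp
  rw [hs, Finset.sum_sub_distrib, ← Finset.mul_sum, sub_eq_zero.1 h, sub_eq_iff_eq_add.1 h2]
  field_simp
  ring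

/-- Schur's formula for the diagonal resolvent entries. -/
theorem inv_res_diag (hH : H.IsHermitian) (hz : 0 < z.im) (k : n) :
    (res H z k k)⁻¹ = H k k - z -
      ∑ b ∈ Finset.univ.erase k, ∑ a ∈ Finset.univ.erase k,
        H k b * mres H z {k} b a * H a k := by
  have h := congrFun (congrFun (sub_mul_res hH hz) k) k
  rw [sub_mul, Matrix.smul_mul, Matrix.one_mul, Matrix.sub_apply, Matrix.smul_apply,
    Matrix.mul_apply, Matrix.one_apply_eq, smul_eq_mul,
    ← Finset.add_sum_erase _ _ (Finset.mem_univ k)] at h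
  have h0 := res_diag_ne_zero hH hz k
  have hs : ∑ b ∈ Finset.univ.erase k, H k b * res H z b k = - res H z k k *
      ∑ b ∈ Finset.univ.erase k, ∑ a ∈ Finset.univ.erase k,
        H k b * mres H z {k} b a * H a k := by
    rw [Finset.mul_sum]
    refine Finset.sum_congr rfl fun b hb => ?_
    rw [Finset.mem_erase] at hb
    rw [res_col hH hz hb.1, ← Finset.add_sum_erase _ _ (Finset.mem_univ k),
      mres_off' hH hz (by simp) hb.1, zero_mul, zero_add, ← mul_assoc, mul_comm (H k b),
      mul_assoc, Finset.mul_sum (a := H k b)]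
    simp only [mul_assoc]
  rw [hs] at h
  rw [inv_eq_iff_eq_inv, inv_eq_one_div, eq_div_iff]
  · linear_combination h
  · intro h'
    have : (0 : ℂ) = 1 := by linear_combination h - res H z k k * h'
    exact zero_ne_one this

/-- Removing one more row changes a resolvent entry by a rank-one correction. -/
theorem mres_sub_mres_insert (hH : H.IsHermitian) (hz : 0 < z.im) {T : Finset n} {k i j : n}
    (hj : j ≠ k) : mres H z T i j - mres H z (insert k T) i j =
      mres H z T i k * mres H z T k j / mres H z T k k := by
  rw [mres_insert, mres_single (isHermitian_minorize hH T) hz hj]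
  simp [mres]

theorem mres_diag_ne_zero (hH : H.IsHermitian) (hz : 0 < z.im) (T : Finset n) (i : n) :
    mres H z T i i ≠ 0 := res_diag_ne_zero (isHermitian_minorize hH T) hz i

end Resolvent
end LocalSemicircle
end

/-! ### Iterated differences over sets of removed rows -/

noncomputable section
namespace LocalSemicircle

section AltDiff

variable {n : Type*} [DecidableEq n]

/-- The iterated difference `∑_{C ⊆ B} (-1)^|C| f (T ∪ C)` of a set function. -/
def altDiff (B : Finset n) (f : Finset n → ℂ) (T : Finset n) : ℂ :=
  ∑ C ∈ B.powerset, (-1) ^ C.card * f (T ∪ C)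

theorem altDiff_empty (f : Finset n → ℂ) (T : Finset n) : altDiff ∅ f T = f T := by
  simp [altDiff]

theorem altDiff_congr {B T : Finset n} {f g : Finset n → ℂ} (h : ∀ C ⊆ B, f (T ∪ C) = g (T ∪ C)) :
    altDiff B f T = altDiff B g T :=
  Finset.sum_congr rfl fun C hC => by rw [h C (Finset.mem_powerset.1 hC)]

theorem altDiff_sub (B T : Finset n) (f g : Finset n → ℂ) :
    altDiff B (fun T => f T - g T) T = altDiff B f T - altDiff B g T := by
  simp [altDiff, mul_sub]

theorem altDiff_add (B T : Finset n) (f g : Finset n → ℂ) :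
    altDiff B (fun T => f T + g T) T = altDiff B f T + altDiff B g T := by
  simp [altDiff, mul_add, Finset.sum_add_distrib]

theorem altDiff_const_mul (B T : Finset n) (c : ℂ) (f : Finset n → ℂ) :
    altDiff B (fun T => c * f T) T = c * altDiff B f T := by
  rw [altDiff, altDiff, Finset.mul_sum]
  exact Finset.sum_congr rfl fun _ _ => by ring

theorem altDiff_sum {ι : Type*} (s : Finset ι) (B T : Finset n) (f : ι → Finset n → ℂ) :
    altDiff B (fun T => ∑ i ∈ s, f i T) T = ∑ i ∈ s, altDiff B (f i) T := by
  simp only [altDiff, Finset.mul_sum]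
  exact Finset.sum_comm

theorem altDiff_insert {b : n} {B : Finset n} (hb : b ∉ B) (f : Finset n → ℂ) (T : Finset n) :
    altDiff (insert b B) f T = altDiff B (fun T => f T - f (insert b T)) T := by
  rw [altDiff, Finset.sum_powerset_insert hb, altDiff_sub, altDiff, altDiff, sub_eq_add_neg,
    ← Finset.sum_neg_distrib]
  congr 1
  refine Finset.sum_congr rfl fun C hC => ?_
  have hbC : b ∉ C := fun h => hb (Finset.mem_powerset.1 hC h)
  rw [Finset.card_insert_of_notMem hbC, pow_succ, Finset.union_insert]
  ring

theorem altDiff_shift (b : n) (B T : Finset n) (f : Finset n → ℂ) :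
    altDiff B (fun T => f (insert b T)) T = altDiff B f (insert b T) :=
  Finset.sum_congr rfl fun C _ => by rw [Finset.insert_union]

theorem altDiff_insert' {b : n} {B : Finset n} (hb : b ∉ B) (f : Finset n → ℂ) (T : Finset n) :
    altDiff (insert b B) f T = altDiff B f T - altDiff B f (insert b T) := by
  rw [altDiff_insert hb, altDiff_sub, altDiff_shift]

theorem altDiff_const {B : Finset n} (hB : B.Nonempty) (c : ℂ) (T : Finset n) :
    altDiff B (fun _ => c) T = 0 := by
  obtain ⟨b, hb⟩ := hB
  rw [← Finset.insert_erase hb, altDiff_insert (Finset.notMem_erase _ _)]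
  simp [altDiff]

/-- The product rule for iterated differences. -/
theorem altDiff_mul (B : Finset n) : ∀ (f g : Finset n → ℂ) (T : Finset n),
    altDiff B (fun T => f T * g T) T =
      ∑ A ∈ B.powerset, altDiff A f (T ∪ (B \ A)) * altDiff (B \ A) g T := by
  induction B using Finset.induction_on with
  | empty => intro f g T; simp [altDiff]
  | insert b B hb ih =>
    intro f g T
    rw [altDiff_insert hb]
    have h : (fun T => f T * g T - f (insert b T) * g (insert b T)) =
        fun T => (f T - f (insert b T)) * g T + f (insert b T) * (g T - g (insert b T)) := by
      funext T; ring
    rw [h, altDiff_add, ih, ih (fun T => f (insert b T)), Finset.sum_powerset_insert hb, add_comm]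
    congr 1
    · refine Finset.sum_congr rfl fun A hA => ?_
      rw [Finset.mem_powerset] at hA
      have hbA : b ∉ A := fun h => hb (hA h)
      rw [Finset.insert_sdiff_of_notMem _ hbA, altDiff_shift, altDiff_insert (by simp [hb]),
        Finset.union_insert]
    · refine Finset.sum_congr rfl fun A hA => ?_
      rw [Finset.mem_powerset] at hA
      have hbA : b ∉ A := fun h => hb (hA h)
      have : insert b B \ insert b A = B \ A := by
        ext x; simp only [Finset.mem_sdiff, Finset.mem_insert]; grind
      rw [this, altDiff_insert hbA]

/-- `f` has order `r` on `V`: up to `m` differences, each difference gains a factor `ψ`. -/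
def HasOrder (ψ : ℝ) (V : Finset n) (m r : ℕ) (C : ℝ) (f : Finset n → ℂ) : Prop :=
  ∀ B T : Finset n, B ⊆ V → T ⊆ V → Disjoint B T → B.card ≤ m →
    ‖altDiff B f T‖ ≤ C * ψ ^ (B.card + r)

variable {ψ : ℝ} {V : Finset n} {m r r' : ℕ} {C C' : ℝ} {f g : Finset n → ℂ}

theorem HasOrder.shift (h : HasOrder ψ V m r C f) {b : n} (hb : b ∈ V) :
    HasOrder ψ (V.erase b) m r C (fun T => f (insert b T)) := by
  intro B T hB hT hd hm
  rw [altDiff_shift]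
  refine h B _ (hB.trans (Finset.erase_subset _ _))
    (Finset.insert_subset hb (hT.trans (Finset.erase_subset _ _))) ?_ hm
  rw [Finset.disjoint_insert_right]
  exact ⟨fun h' => Finset.notMem_erase _ _ (hB h'), hd⟩

theorem HasOrder.lower (h : HasOrder ψ V m (r + 1) C f) (hψ0 : 0 ≤ ψ) (hψ : ψ ≤ 1) (hC : 0 ≤ C) :
    HasOrder ψ V m r C f := by
  intro B T hB hT hd hm
  refine (h B T hB hT hd hm).trans ?_
  gcongr C * ?_
  exact pow_le_pow_of_le_one hψ0 hψ (by omega)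

theorem HasOrder.add (hf : HasOrder ψ V m r C f) (hg : HasOrder ψ V m r C' g) :
    HasOrder ψ V m r (C + C') (fun T => f T + g T) := by
  intro B T hB hT hd hm
  rw [altDiff_add, add_mul]
  exact (norm_add_le _ _).trans (add_le_add (hf B T hB hT hd hm) (hg B T hB hT hd hm))

theorem HasOrder.neg (hf : HasOrder ψ V m r C f) : HasOrder ψ V m r C (fun T => - f T) := by
  intro B T hB hT hd hm
  have : altDiff B (fun T => - f T) T = - altDiff B f T := by simp [altDiff]
  rw [this, norm_neg]
  exact hf B T hB hT hd hm

theorem hasOrder_const (hψ0 : 0 ≤ ψ) (V : Finset n) (m : ℕ) (c : ℂ) :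
    HasOrder ψ V m 0 ‖c‖ (fun _ => c) := by
  intro B T _ _ _ _
  rcases B.eq_empty_or_nonempty with rfl | hB
  · simp [altDiff_empty]
  · rw [altDiff_const hB, norm_zero]; positivity

/-- The product rule distributes the differences between the factors, so orders add; 2^m bounds the
number of ways to distribute them. -/
theorem HasOrder.mul (hψ0 : 0 ≤ ψ) (hC' : 0 ≤ C') (hC : 0 ≤ C)
    (hf : HasOrder ψ V m r C f) (hg : HasOrder ψ V m r' C' g) :
    HasOrder ψ V m (r + r') (2 ^ m * (C * C')) (fun T => f T * g T) := by
  intro B T hB hT hd hm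
  rw [altDiff_mul]
  calc ‖∑ A ∈ B.powerset, altDiff A f (T ∪ (B \ A)) * altDiff (B \ A) g T‖
      ≤ ∑ A ∈ B.powerset, ‖altDiff A f (T ∪ (B \ A)) * altDiff (B \ A) g T‖ := norm_sum_le _ _
    _ ≤ ∑ _A ∈ B.powerset, C * C' * ψ ^ (B.card + (r + r')) := by
      refine Finset.sum_le_sum fun A hA => ?_
      rw [Finset.mem_powerset] at hA
      have h1 := hf A (T ∪ (B \ A)) (hA.trans hB)
        (Finset.union_subset hT (Finset.sdiff_subset.trans hB))
        (Finset.disjoint_union_right.2 ⟨Finset.disjoint_of_subset_left hA hd,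
          Finset.disjoint_sdiff⟩) ((Finset.card_le_card hA).trans hm)
      have h2 := hg (B \ A) T (Finset.sdiff_subset.trans hB) hT
        (Finset.disjoint_of_subset_left Finset.sdiff_subset hd)
        ((Finset.card_le_card Finset.sdiff_subset).trans hm)
      have h3 : (B \ A).card + A.card = B.card := Finset.card_sdiff_add_card_eq_card hA
      rw [norm_mul]
      calc _ ≤ (C * ψ ^ (A.card + r)) * (C' * ψ ^ ((B \ A).card + r')) := by gcongr
        _ = C * C' * ψ ^ (B.card + (r + r')) := by
          rw [← h3, show (B \ A).card + A.card + (r + r') = (A.card + r) + ((B \ A).card + r') by ring,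
            pow_add ψ (A.card + r)]
          ring
    _ = 2 ^ B.card * (C * C' * ψ ^ (B.card + (r + r'))) := by
      rw [Finset.sum_const, Finset.card_powerset, nsmul_eq_mul]; push_cast; ring
    _ ≤ 2 ^ m * (C * C' * ψ ^ (B.card + (r + r'))) := by
      gcongr
      norm_num
    _ = _ := by ring

end AltDiff

/-! ### Each removed row gains a factor ψ -/

section MinorBounds

variable {N : ℕ}

/-- The entries of the resolvents of all minors indexed by subsets of `W` are `ψ`-close to those of
`m • 1`. -/
structure MinorsClose (H : Matrix (Fin N) (Fin N) ℂ) (z m : ℂ) (W : Finset (Fin N)) (ψ c : ℝ) :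
    Prop where
  close : ∀ T ⊆ W, ∀ i j, i ∉ T → j ∉ T → ‖mres H z T i j - (if i = j then m else 0)‖ ≤ ψ
  inv_le : ∀ T ⊆ W, ∀ i, i ∉ T → ‖(mres H z T i i)⁻¹‖ ≤ c

/-- Removing k changes an entry by G_ik G_kj / G_kk, which is quadratic in small quantities. As long
as 2^K ψ · 2c ≤ 1, each removal at most doubles the error. -/
theorem mres_close_of_close {H : Matrix (Fin N) (Fin N) ℂ} (hH : H.IsHermitian) {z m : ℂ}
    (hz : 0 < z.im) {c ψ : ℝ} (hc : 1 ≤ c) (hm0 : m ≠ 0) (hm : ‖m⁻¹‖ ≤ c)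
    (h : ∀ i j, ‖res H z i j - (if i = j then m else 0)‖ ≤ ψ) (hψ : 0 ≤ ψ) (K : ℕ)
    (hK : 2 ^ K * ψ * (2 * c) ≤ 1) (T : Finset (Fin N)) : T.card ≤ K → ∀ i j, i ∉ T → j ∉ T →
      ‖mres H z T i j - (if i = j then m else 0)‖ ≤ 2 ^ T.card * ψ ∧ ‖(mres H z T i i)⁻¹‖ ≤ 2 * c := by
  -- Here |m| ≥ 1/c and the entry differs from m by at most 1/(2c).
  have key : ∀ (T : Finset (Fin N)) (i : Fin N), T.card ≤ K → ‖mres H z T i i - m‖ ≤ 2 ^ T.card * ψ →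
      ‖(mres H z T i i)⁻¹‖ ≤ 2 * c := by
    intro T i hT hi
    have h1 : 2 ^ T.card * ψ ≤ 2 ^ K * ψ := by
      gcongr
      norm_num
    have h2 : ‖m‖ * c ≥ 1 := by
      have : ‖m‖ * ‖m⁻¹‖ = 1 := by rw [← norm_mul, mul_inv_cancel₀ hm0, norm_one]
      nlinarith [norm_nonneg m]
    have h3 : ‖m‖ ≤ ‖mres H z T i i‖ + 2 ^ K * ψ := by
      have := norm_sub_norm_le m (mres H z T i i)
      rw [norm_sub_rev] at this
      linarith
    have h0 := mres_diag_ne_zero hH hz T i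
    have h0' : 0 < ‖mres H z T i i‖ := norm_pos_iff.2 h0
    rw [norm_inv, inv_le_iff_one_le_mul₀ h0']
    nlinarith
  induction T using Finset.induction_on with
  | empty =>
    intro hT i j _ _
    have h1 : ∀ i j, ‖mres H z ∅ i j - (if i = j then m else 0)‖ ≤ 2 ^ (∅ : Finset (Fin N)).card * ψ := by
      intro i j; rw [mres_empty]; simpa using h i j
    refine ⟨h1 i j, key ∅ i hT ?_⟩
    simpa using h1 i i
  | insert k T hk ih =>
    intro hT
    rw [Finset.card_insert_of_notMem hk] at hT ⊢
    have h1 : ∀ i j, i ∉ insert k T → j ∉ insert k T →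
        ‖mres H z (insert k T) i j - (if i = j then m else 0)‖ ≤ 2 ^ (T.card + 1) * ψ := by
      intro i j hi hj
      rw [Finset.mem_insert, not_or] at hi hj
      have e := mres_sub_mres_insert hH hz (T := T) (k := k) (i := i) hj.1
      have e' : mres H z (insert k T) i j - (if i = j then m else 0) =
          (mres H z T i j - (if i = j then m else 0)) -
            mres H z T i k * mres H z T k j * (mres H z T k k)⁻¹ := by
        rw [← div_eq_mul_inv, ← e]; ring
      have a1 := (ih (by omega) i j hi.2 hj.2).1
      have a2 := (ih (by omega) i k hi.2 hk).1
      have a3 := (ih (by omega) k j hk hj.2).1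
      have a4 := (ih (by omega) k k hk hk).2
      rw [if_neg hi.1, sub_zero] at a2
      rw [if_neg (Ne.symm hj.1), sub_zero] at a3
      rw [e']
      have hle : (2 : ℝ) ^ T.card * ψ * (2 * c) ≤ 1 := by
        refine le_trans ?_ hK
        gcongr
        · norm_num
        · omega
      calc _ ≤ ‖mres H z T i j - (if i = j then m else 0)‖ +
            ‖mres H z T i k * mres H z T k j * (mres H z T k k)⁻¹‖ := norm_sub_le _ _
        _ ≤ 2 ^ T.card * ψ + (2 ^ T.card * ψ) * (2 ^ T.card * ψ) * (2 * c) := by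
          rw [norm_mul, norm_mul]; gcongr
        _ ≤ 2 ^ T.card * ψ + (2 ^ T.card * ψ) * 1 := by
          rw [mul_assoc (2 ^ T.card * ψ) (2 ^ T.card * ψ)]; gcongr
        _ = 2 ^ (T.card + 1) * ψ := by ring
    intro i j hi hj
    refine ⟨h1 i j hi hj, key _ i (by rw [Finset.card_insert_of_notMem hk]; exact hT) ?_⟩
    rw [Finset.card_insert_of_notMem hk]
    simpa using h1 i i hi hi

theorem minorsClose_of_close {H : Matrix (Fin N) (Fin N) ℂ} (hH : H.IsHermitian) {z m : ℂ}
    (hz : 0 < z.im) {c ψ : ℝ} (hc : 1 ≤ c) (hm0 : m ≠ 0) (hm : ‖m⁻¹‖ ≤ c)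
    (h : ∀ i j, ‖res H z i j - (if i = j then m else 0)‖ ≤ ψ) (hψ : 0 ≤ ψ) (K : ℕ)
    (hK : 2 ^ K * ψ * (2 * c) ≤ 1) {W : Finset (Fin N)} (hW : W.card ≤ K) :
    MinorsClose H z m W (2 ^ K * ψ) (2 * c) where
  close T hT i j hi hj := by
    have hTK := (Finset.card_le_card hT).trans hW
    refine (mres_close_of_close hH hz hc hm0 hm h hψ K hK T hTK i j hi hj).1.trans ?_
    gcongr
    norm_num
  inv_le T hT i hi :=
    (mres_close_of_close hH hz hc hm0 hm h hψ K hK T ((Finset.card_le_card hT).trans hW) i i hi hi).2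

/-- Induction on the number of differences. One difference of G_ij equals G_ib G_bj / G_bb, a
product of two off-diagonal entries, hence of order two; one difference of 1/G_ii is minus such a
product times two inverse diagonal entries. The product rule then handles the remaining d
differences with the bounds already known. -/
theorem hasOrder_mres (d : ℕ) (c : ℝ) (hc : 1 ≤ c) : ∃ C : ℝ, 1 ≤ C ∧
    ∀ (N : ℕ) (H : Matrix (Fin N) (Fin N) ℂ) (z m : ℂ) (W : Finset (Fin N)) (ψ : ℝ),
      H.IsHermitian → 0 < z.im → m ≠ 0 → ‖m⁻¹‖ ≤ c → 0 ≤ ψ → ψ ≤ 1 → MinorsClose H z m W ψ c →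
      ∀ V ⊆ W, ∀ i j, i ∉ V → j ∉ V →
        HasOrder ψ V d 1 C (fun T => mres H z T i j - (if i = j then m else 0)) ∧
        HasOrder ψ V d 1 C (fun T => (mres H z T i i)⁻¹ - m⁻¹) := by
  induction d with
  | zero =>
    refine ⟨c * c, by nlinarith, ?_⟩
    intro N H z m W ψ hH hz hm0 hm hψ0 hψ hcl V hV i j hi hj
    constructor
    · intro B T hB hT _ hB0
      rw [Finset.card_eq_zero.1 (Nat.le_zero.1 hB0), altDiff_empty]
      have := hcl.close T (hT.trans hV) i j (fun h => hi (hT h)) (fun h => hj (hT h))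
      simp only [Finset.card_empty, zero_add, pow_one]
      exact this.trans (le_mul_of_one_le_left hψ0 (by nlinarith))
    · intro B T hB hT _ hB0
      rw [Finset.card_eq_zero.1 (Nat.le_zero.1 hB0), altDiff_empty]
      have h1 := hcl.close T (hT.trans hV) i i (fun h => hi (hT h)) (fun h => hi (hT h))
      have h2 := hcl.inv_le T (hT.trans hV) i (fun h => hi (hT h))
      rw [if_pos rfl] at h1
      have h0 := mres_diag_ne_zero hH hz T i
      have e : (mres H z T i i)⁻¹ - m⁻¹ =
          - ((mres H z T i i)⁻¹ * m⁻¹ * (mres H z T i i - m)) := by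
        field_simp; ring
      rw [e, norm_neg, norm_mul, norm_mul]
      simp only [Finset.card_empty, zero_add, pow_one]
      gcongr
  | succ d ih =>
    obtain ⟨C, hC, ih⟩ := ih
    have hC0 : 0 ≤ C := by linarith
    -- D comes from the product rule for G_ib G_bj / G_bb, and E from the further product with two
    -- inverse diagonal entries.
    set D : ℝ := 2 ^ d * (C * (2 ^ d * (C * (C + c)))) with hD
    have hD0 : 0 ≤ D := by positivity
    set E : ℝ := 2 ^ d * (D * (2 ^ d * ((C + c) * (C + c)))) with hE
    have hE0 : 0 ≤ E := by positivity
    refine ⟨C + D + E, by linarith, ?_⟩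
    intro N H z m W ψ hH hz hm0 hm hψ0 hψ hcl V hV i j hi hj
    have ih' := ih N H z m W ψ hH hz hm0 hm hψ0 hψ hcl
    have hinv : ∀ V ⊆ W, ∀ i, i ∉ V → HasOrder ψ V d 0 (C + c) (fun T => (mres H z T i i)⁻¹) := by
      intro V hV i hi
      have h1 := ((ih' V hV i i hi hi).2.lower hψ0 hψ hC0).add (hasOrder_const hψ0 V d m⁻¹)
      have h2 : HasOrder ψ V d 0 (C + ‖m⁻¹‖) (fun T => (mres H z T i i)⁻¹) := by
        simpa using h1
      intro B T hB hT hd hm'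
      refine (h2 B T hB hT hd hm').trans ?_
      gcongr
    have hoff : ∀ V ⊆ W, ∀ i j, i ≠ j → i ∉ V → j ∉ V →
        HasOrder ψ V d 1 C (fun T => mres H z T i j) := by
      intro V hV i j hij hi hj
      simpa [hij] using (ih' V hV i j hi hj).1
    have hcorr : ∀ V ⊆ W, ∀ i j b, i ≠ b → b ≠ j → i ∉ V → j ∉ V → b ∉ V →
        HasOrder ψ V d 2 D (fun T => mres H z T i b * (mres H z T b j * (mres H z T b b)⁻¹)) := by
      intro V hV i j b hib hbj hi hj hb
      exact (hoff V hV i b hib hi hb).mul hψ0 (by positivity) hC0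
        ((hoff V hV b j hbj hb hj).mul hψ0 (by positivity) hC0 (hinv V hV b hb))
    constructor
    · intro B T hB hT hd hBc
      rcases Nat.lt_or_ge d B.card with hlt | hge
      · have hcard : B.card = d + 1 := by omega
        obtain ⟨b, hb⟩ : B.Nonempty := Finset.card_pos.1 (by omega)
        have hbV := hB hb
        have hib : i ≠ b := fun h => hi (h ▸ hbV)
        have hjb : j ≠ b := fun h => hj (h ▸ hbV)
        have hcE : (B.erase b).card = d := by rw [Finset.card_erase_of_mem hb]; omega
        rw [← Finset.insert_erase hb, altDiff_insert (Finset.notMem_erase _ _)]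
        have e : (fun T => mres H z T i j - (if i = j then m else 0) -
            (mres H z (insert b T) i j - (if i = j then m else 0))) =
            fun T => mres H z T i b * (mres H z T b j * (mres H z T b b)⁻¹) := by
          funext T
          rw [← mul_assoc, ← div_eq_mul_inv, ← mres_sub_mres_insert hH hz hjb]; ring
        rw [e]
        have hTV : T ⊆ V.erase b := fun x hx => Finset.mem_erase.2
          ⟨fun h => Finset.disjoint_left.1 hd hb (h ▸ hx), hT hx⟩
        have := hcorr (V.erase b) ((Finset.erase_subset _ _).trans hV) i j b hib hjb.symm
          (fun h => hi (Finset.mem_of_mem_erase h)) (fun h => hj (Finset.mem_of_mem_erase h))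
          (Finset.notMem_erase _ _) (B.erase b) T (Finset.erase_subset_erase _ hB) hTV
          (Finset.disjoint_of_subset_left (Finset.erase_subset _ _) hd) hcE.le
        refine this.trans ?_
        rw [Finset.insert_erase hb, hcE, hcard]
        gcongr ?_ * ψ ^ ?_
        linarith
      · refine ((ih' V hV i j hi hj).1 B T hB hT hd hge).trans ?_
        gcongr; linarith
    · intro B T hB hT hd hBc
      rcases Nat.lt_or_ge d B.card with hlt | hge
      · have hcard : B.card = d + 1 := by omega
        obtain ⟨b, hb⟩ : B.Nonempty := Finset.card_pos.1 (by omega)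
        have hbV := hB hb
        have hib : i ≠ b := fun h => hi (h ▸ hbV)
        have hcE : (B.erase b).card = d := by rw [Finset.card_erase_of_mem hb]; omega
        rw [← Finset.insert_erase hb, altDiff_insert (Finset.notMem_erase _ _)]
        have e : (fun T => (mres H z T i i)⁻¹ - m⁻¹ - ((mres H z (insert b T) i i)⁻¹ - m⁻¹)) =
            fun T => -((mres H z T i b * (mres H z T b i * (mres H z T b b)⁻¹)) *
              ((mres H z T i i)⁻¹ * (mres H z (insert b T) i i)⁻¹)) := by
          funext T
          rw [← mul_assoc (mres H z T i b), ← div_eq_mul_inv, ← mres_sub_mres_insert hH hz hib]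
          have h1 := mres_diag_ne_zero hH hz T i
          have h2 := mres_diag_ne_zero hH hz (insert b T) i
          field_simp
          ring
        rw [e]
        have hTV : T ⊆ V.erase b := fun x hx => Finset.mem_erase.2
          ⟨fun h => Finset.disjoint_left.1 hd hb (h ▸ hx), hT hx⟩
        have hiE : i ∉ V.erase b := fun h => hi (Finset.mem_of_mem_erase h)
        have hVE := (Finset.erase_subset b V).trans hV
        have := ((hcorr (V.erase b) hVE i i b hib hib.symm hiE hiE
          (Finset.notMem_erase _ _)).mul hψ0 (by positivity) hD0
            ((hinv (V.erase b) hVE i hiE).mul hψ0 (by positivity) (by positivity)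
              ((hinv V hV i hi).shift hbV))).neg (B.erase b) T
            (Finset.erase_subset_erase _ hB) hTV
            (Finset.disjoint_of_subset_left (Finset.erase_subset _ _) hd) hcE.le
        refine this.trans ?_
        rw [Finset.insert_erase hb, hcE, hcard]
        gcongr ?_ * ψ ^ ?_
        linarith
      · refine ((ih' V hV i j hi hj).2 B T hB hT hd hge).trans ?_
        gcongr; linarith

/-- The fluctuation of `1 / G_kk` under the law of the `k`-th row, for the minor indexed by `T`. -/
def fluct (S : Matrix (Fin N) (Fin N) ℝ) (H : Matrix (Fin N) (Fin N) ℂ) (z : ℂ) (k : Fin N)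
    (T : Finset (Fin N)) : ℂ :=
  (mres H z T k k)⁻¹ + z +
    ∑ a ∈ Finset.univ.erase k, (S k a : ℂ) * (if a ∈ T then 0 else mres H z (insert k T) a a)

/-- Since 1/m = -z - m and the row sums to one, the fluctuation is 1/G_kk - 1/m, plus a weighted
average of G_aa - m in the minor without k, plus the constant -S_kk m. The first two have order one
by `hasOrder_mres`. A summand with a ∈ B spends its difference at a on switching itself off and
keeps only |B| - 1 differences of a quantity of order zero; its weight S_ka ≤ ψ² makes up for this,
and there are at most d such summands. -/
theorem norm_altDiff_fluct_le (d : ℕ) (c : ℝ) (hc : 1 ≤ c) : ∃ C : ℝ, 1 ≤ C ∧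
    ∀ (N : ℕ) (H : Matrix (Fin N) (Fin N) ℂ) (S : Matrix (Fin N) (Fin N) ℝ) (z m : ℂ) (ψ : ℝ)
      (k : Fin N) (B : Finset (Fin N)),
      H.IsHermitian → 0 < z.im → m ≠ 0 → ‖m‖ ≤ 1 → ‖m⁻¹‖ ≤ c → m⁻¹ = -z - m → 0 ≤ ψ → ψ ≤ 1 →
      (∀ i j, 0 ≤ S i j) → (∀ i, ∑ j, S i j = 1) → (∀ i j, S i j ≤ ψ ^ 2) →
      B.card ≤ d → k ∉ B → MinorsClose H z m (insert k B) ψ c →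
        ‖altDiff B (fluct S H z k) ∅‖ ≤ C * ψ ^ (B.card + 1) := by
  obtain ⟨C, hC, hO⟩ := hasOrder_mres d c hc
  have hC0 : 0 ≤ C := by linarith
  refine ⟨C + (C + d * (C + 1)) + 1, by nlinarith [(Nat.cast_nonneg d : (0 : ℝ) ≤ d)], ?_⟩
  intro N H S z m ψ k B hH hz hm0 hm1 hm hmz hψ0 hψ hS hSs hSψ hBd hkB hcl
  have hO' := hO N H z m (insert k B) ψ hH hz hm0 hm hψ0 hψ hcl
  set g : Fin N → Finset (Fin N) → ℂ := fun a T =>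
    (if a ∈ T then 0 else mres H z (insert k T) a a) - m with hg
  have e : fluct S H z k = fun T => ((mres H z T k k)⁻¹ - m⁻¹) +
      ((∑ a ∈ Finset.univ.erase k, (S k a : ℂ) * g a T) + (-(S k k : ℂ) * m)) := by
    funext T
    have hs : (∑ a ∈ Finset.univ.erase k, (S k a : ℂ)) = 1 - S k k := by
      have h1 := hSs k
      rw [← Finset.add_sum_erase _ _ (Finset.mem_univ k)] at h1
      have h2 := congrArg (fun x : ℝ => (x : ℂ)) h1
      push_cast at h2
      linear_combination h2
    simp only [fluct, hg, mul_sub, Finset.sum_sub_distrib]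
    rw [← Finset.sum_mul, hs, hmz]
    ring
  have hcard1 : ψ ^ (B.card + 1) ≥ 0 := by positivity
  rw [e, altDiff_add, altDiff_add, altDiff_sum]
  have hemp : (∅ : Finset (Fin N)) ⊆ B := Finset.empty_subset _
  have b1 : ‖altDiff B (fun T => (mres H z T k k)⁻¹ - m⁻¹) ∅‖ ≤ C * ψ ^ (B.card + 1) :=
    (hO' B (Finset.subset_insert _ _) k k hkB hkB).2 B ∅ subset_rfl hemp (Finset.disjoint_empty_right _) hBd
  have b3 : ‖altDiff B (fun _ => -(S k k : ℂ) * m) ∅‖ ≤ 1 * ψ ^ (B.card + 1) := by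
    rcases B.eq_empty_or_nonempty with rfl | hB
    · rw [altDiff_empty, norm_mul, norm_neg, Complex.norm_real, Real.norm_eq_abs, abs_of_nonneg (hS k k)]
      simp only [Finset.card_empty, zero_add, pow_one, one_mul]
      have := hSψ k k
      nlinarith [hS k k, norm_nonneg m]
    · rw [altDiff_const hB, norm_zero]; positivity
  have hord : ∀ a, a ≠ k → ∀ V ⊆ B, a ∉ V →
      HasOrder ψ V d 1 C (fun T => mres H z (insert k T) a a - m) := by
    intro a ha V hV haV
    have hkV : k ∉ V := fun h => hkB (hV h)
    have h1 := (hO' (insert k V) (Finset.insert_subset_insert _ hV) a a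
      (by simp [ha, haV]) (by simp [ha, haV])).1.shift (Finset.mem_insert_self k V)
    rw [Finset.erase_insert hkV] at h1
    simpa using h1
  have b2 : ∀ a ∈ Finset.univ.erase k, ‖altDiff B (fun T => (S k a : ℂ) * g a T) ∅‖ ≤
      S k a * (C * ψ ^ (B.card + 1)) + if a ∈ B then (C + 1) * ψ ^ (B.card + 1) else 0 := by
    intro a ha
    have hak : a ≠ k := Finset.ne_of_mem_erase ha
    rw [altDiff_const_mul, norm_mul, Complex.norm_real, Real.norm_eq_abs, abs_of_nonneg (hS k a)]
    by_cases haB : a ∈ B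
    · rw [if_pos haB, ← Finset.insert_erase haB, altDiff_insert (Finset.notMem_erase _ _),
        Finset.insert_erase haB]
      -- Once a is removed its summand is -m, so the difference at a is the resolvent entry itself,
      -- not its distance to m.
      have e2 : altDiff (B.erase a) (fun T => g a T - g a (insert a T)) ∅ =
          altDiff (B.erase a) (fun T => (mres H z (insert k T) a a - m) + m) ∅ := by
        refine altDiff_congr fun D hD => ?_
        have : a ∉ D := fun h => Finset.notMem_erase _ _ (hD h)
        simp [hg, this]
      have h2 := ((hord a hak (B.erase a) (Finset.erase_subset _ _)
        (Finset.notMem_erase _ _)).lower hψ0 hψ hC0).add (hasOrder_const hψ0 _ d m)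
        (B.erase a) ∅ subset_rfl (Finset.empty_subset _) (Finset.disjoint_empty_right _)
        ((Finset.card_le_card (Finset.erase_subset _ _)).trans hBd)
      have hcE : (B.erase a).card + 1 = B.card := Finset.card_erase_add_one haB
      rw [e2]
      calc S k a * _ ≤ ψ ^ 2 * ((C + ‖m‖) * ψ ^ ((B.erase a).card + 0)) := by
            gcongr; exact hSψ k a
        _ ≤ ψ ^ 2 * ((C + 1) * ψ ^ ((B.erase a).card + 0)) := by gcongr
        _ = (C + 1) * ψ ^ (B.card + 1) := by rw [← hcE]; ring
        _ ≤ _ := le_add_of_nonneg_left (mul_nonneg (hS k a) (by positivity))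
    · rw [if_neg haB, add_zero]
      gcongr
      · exact hS k a
      have e2 : altDiff B (g a) ∅ = altDiff B (fun T => mres H z (insert k T) a a - m) ∅ := by
        refine altDiff_congr fun D hD => ?_
        have : a ∉ D := fun h => haB (hD h)
        simp [hg, this]
      rw [e2]
      exact hord a hak B subset_rfl haB B ∅ subset_rfl hemp (Finset.disjoint_empty_right _) hBd
  have b2' : ‖∑ a ∈ Finset.univ.erase k, altDiff B (fun T => (S k a : ℂ) * g a T) ∅‖ ≤
      (C + d * (C + 1)) * ψ ^ (B.card + 1) := by
    refine (norm_sum_le _ _).trans ((Finset.sum_le_sum b2).trans ?_)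
    rw [Finset.sum_add_distrib, ← Finset.sum_mul,
      show (C + d * (C + 1)) * ψ ^ (B.card + 1) =
        C * ψ ^ (B.card + 1) + d * (C + 1) * ψ ^ (B.card + 1) by ring]
    refine add_le_add ?_ ?_
    · have : ∑ a ∈ Finset.univ.erase k, S k a ≤ 1 := by
        rw [← hSs k]
        exact Finset.sum_le_sum_of_subset_of_nonneg (Finset.erase_subset _ _) fun a _ _ => hS k a
      have h3 : 0 ≤ C * ψ ^ (B.card + 1) := by positivity
      nlinarith
    · calc _ ≤ ∑ a : Fin N, if a ∈ B then (C + 1) * ψ ^ (B.card + 1) else 0 :=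
            Finset.sum_le_sum_of_subset_of_nonneg (Finset.erase_subset _ _) fun a _ _ => by
              split_ifs <;> positivity
        _ = B.card * ((C + 1) * ψ ^ (B.card + 1)) := by
          rw [Finset.sum_ite_mem, Finset.univ_inter, Finset.sum_const, nsmul_eq_mul]
        _ ≤ d * ((C + 1) * ψ ^ (B.card + 1)) := by gcongr
        _ = _ := by ring
  calc _ ≤ _ := norm_add_le _ _
    _ ≤ C * ψ ^ (B.card + 1) + ((C + d * (C + 1)) * ψ ^ (B.card + 1) + 1 * ψ ^ (B.card + 1)) :=
      add_le_add b1 ((norm_add_le _ _).trans (add_le_add b2' b3))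
    _ = _ := by ring

end MinorBounds
end LocalSemicircle
end

/-! ### Moments of sums with martingale differences -/

noncomputable section
namespace LocalSemicircle

section AllLp

variable {Ω : Type*} [MeasurableSpace Ω] {P : Measure Ω}

/-- All moments of `f` are finite. -/
def AllLp (P : Measure Ω) (f : Ω → ℂ) : Prop := ∀ p : ℕ, MemLp f p P

variable {f g : Ω → ℂ}

theorem AllLp.aesm (hf : AllLp P f) : AEStronglyMeasurable f P := (hf 0).1

theorem AllLp.integrable (hf : AllLp P f) : Integrable f P := by
  have := hf 1
  rwa [Nat.cast_one, memLp_one_iff_integrable] at this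

theorem AllLp.integrable_norm_pow [IsProbabilityMeasure P] (hf : AllLp P f) (p : ℕ) : Integrable (fun ω => ‖f ω‖ ^ p) P :=
  (hf p).integrable_norm_pow'

theorem AllLp.add (hf : AllLp P f) (hg : AllLp P g) : AllLp P (fun ω => f ω + g ω) :=
  fun p => (hf p).add (hg p)

theorem AllLp.sub (hf : AllLp P f) (hg : AllLp P g) : AllLp P (fun ω => f ω - g ω) :=
  fun p => (hf p).sub (hg p)

theorem AllLp.sum {ι : Type*} (s : Finset ι) {f : ι → Ω → ℂ} (hf : ∀ i ∈ s, AllLp P (f i)) :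
    AllLp P (fun ω => ∑ i ∈ s, f i ω) :=
  fun p => memLp_finsetSum s fun i hi => hf i hi p

theorem AllLp.const_mul (hf : AllLp P f) (c : ℂ) : AllLp P (fun ω => c * f ω) :=
  fun p => (hf p).const_mul c

theorem AllLp.star (hf : AllLp P f) : AllLp P (fun ω => star (f ω)) :=
  fun p => (hf p).star

theorem allLp_of_bound [IsProbabilityMeasure P] (hf : AEStronglyMeasurable f P) (C : ℝ) (h : ∀ ω, ‖f ω‖ ≤ C) :
    AllLp P f :=
  fun _ => MemLp.of_bound hf C (Filter.Eventually.of_forall h)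

theorem allLp_const [IsProbabilityMeasure P] (c : ℂ) : AllLp P (fun _ => c) :=
  allLp_of_bound aestronglyMeasurable_const ‖c‖ fun _ => le_rfl

theorem AllLp.mul (hf : AllLp P f) (hg : AllLp P g) : AllLp P (fun ω => f ω * g ω) := by
  intro p
  have h1 := hf (2 * p)
  have h2 := hg (2 * p)
  have : ENNReal.HolderTriple ((2 * p : ℕ) : ENNReal) ((2 * p : ℕ) : ENNReal) (p : ENNReal) := by
    constructor
    push_cast
    rw [ENNReal.mul_inv (Or.inl (by norm_num)) (Or.inl (by norm_num)), ← add_mul,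
      ENNReal.inv_two_add_inv_two, one_mul]
  exact h2.mul h1

theorem AllLp.pow [IsProbabilityMeasure P] (hf : AllLp P f) (q : ℕ) : AllLp P (fun ω => f ω ^ q) := by
  induction q with
  | zero => simpa using allLp_const (P := P) 1
  | succ q ih => simpa [pow_succ] using ih.mul hf

end AllLp

section TwoPoint

/-- A Taylor bound whose linear term is exact, so that it integrates to zero when x is a martingale
difference. The induction multiplies by |s + x|² = |s|² + 2 Re(s̄x) + |x|² and absorbs mixed
monomials into the two extreme ones. -/
theorem two_point_inequality (q : ℕ) : ∃ C : ℝ, 1 ≤ C ∧ ∀ s x : ℂ,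
    ‖s + x‖ ^ (2 * (q + 1)) ≤ ‖s‖ ^ (2 * (q + 1)) +
      2 * (q + 1) * (‖s‖ ^ (2 * q) * (star s * x).re) +
      C * (‖s‖ ^ (2 * q) * ‖x‖ ^ 2 + ‖x‖ ^ (2 * (q + 1))) := by
  have hsq : ∀ s x : ℂ, ‖s + x‖ ^ 2 = ‖s‖ ^ 2 + 2 * (star s * x).re + ‖x‖ ^ 2 := by
    intro s x
    simp only [← Complex.normSq_eq_norm_sq, Complex.normSq_apply, Complex.mul_re, Complex.star_def,
      Complex.conj_re, Complex.conj_im, Complex.add_re, Complex.add_im]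
    ring
  induction q with
  | zero =>
    refine ⟨1, le_rfl, fun s x => ?_⟩
    have := hsq s x
    simp only [Nat.cast_zero, zero_add, mul_one, mul_zero, pow_zero, one_mul]
    nlinarith [sq_nonneg ‖x‖]
  | succ q ih =>
    obtain ⟨C, hC, ih⟩ := ih
    refine ⟨1 + 4 * (q + 1) + 4 * (q + 1) + 8 * C, by nlinarith [(Nat.cast_nonneg q : (0 : ℝ) ≤ q)],
      fun s x => ?_⟩
    have h1 := ih s x
    have h2 := hsq s x
    have hR : |(star s * x).re| ≤ ‖s‖ * ‖x‖ := by
      have := Complex.abs_re_le_norm (star s * x)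
      rwa [norm_mul, norm_star] at this
    set R := (star s * x).re
    set a := ‖s‖
    set b := ‖x‖
    have ha : 0 ≤ a := norm_nonneg _
    have hb : 0 ≤ b := norm_nonneg _
    set u := a ^ 2 with hu
    set v := b ^ 2 with hv
    have hu0 : 0 ≤ u := by positivity
    have hv0 : 0 ≤ v := by positivity
    have hR2 : R ^ 2 ≤ u * v := by
      rw [hu, hv, ← mul_pow, ← sq_abs R]; gcongr
    have hRuv : 2 * R ≤ u + v := by
      have := (le_abs_self R).trans hR
      nlinarith [sq_nonneg (a - b)]
    have hq : (0 : ℝ) ≤ q := Nat.cast_nonneg q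
    have m1 : u ^ q * v ^ 2 ≤ u ^ (q + 1) * v + v ^ (q + 2) := by
      rcases le_total u v with h | h
      · have : u ^ q * v ^ 2 ≤ v ^ q * v ^ 2 := by gcongr
        have h' : 0 ≤ u ^ (q + 1) * v := by positivity
        calc _ ≤ _ := this
          _ = v ^ (q + 2) := by ring
          _ ≤ _ := by linarith
      · have : u ^ q * (v * v) ≤ u ^ q * (u * v) := by gcongr
        have h' : 0 ≤ v ^ (q + 2) := by positivity
        calc u ^ q * v ^ 2 = u ^ q * (v * v) := by ring
          _ ≤ _ := this
          _ = u ^ (q + 1) * v := by ring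
          _ ≤ _ := by linarith
    have m2 : u * v ^ (q + 1) ≤ u ^ (q + 1) * v + v ^ (q + 2) := by
      rcases le_total u v with h | h
      · have : u * v ^ (q + 1) ≤ v * v ^ (q + 1) := by gcongr
        have h' : 0 ≤ u ^ (q + 1) * v := by positivity
        calc _ ≤ _ := this
          _ = v ^ (q + 2) := by ring
          _ ≤ _ := by linarith
      · have : u * (v ^ q * v) ≤ u * (u ^ q * v) := by gcongr
        have h' : 0 ≤ v ^ (q + 2) := by positivity
        calc u * v ^ (q + 1) = u * (v ^ q * v) := by ring
          _ ≤ _ := this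
          _ = u ^ (q + 1) * v := by ring
          _ ≤ _ := by linarith
    have e1 : ∀ (y : ℝ) (k : ℕ), y ^ (2 * k) = (y ^ 2) ^ k := fun y k => pow_mul y 2 k
    rw [e1, e1, e1, e1, ← hu, ← hv] at h1
    rw [e1, e1, e1, e1, ← hu, ← hv, pow_succ (‖s + x‖ ^ 2), h2]
    have hL : 0 ≤ u + 2 * R + v := by rw [← h2]; positivity
    rw [h2] at h1
    push_cast
    have hw0 : 0 ≤ u ^ q := by positivity
    have t1 : u ^ q * R ^ 2 ≤ u ^ (q + 1) * v := by
      calc u ^ q * R ^ 2 ≤ u ^ q * (u * v) := by gcongr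
        _ = _ := by ring
    have t2 : 2 * (u ^ q * (R * v)) ≤ 2 * (u ^ (q + 1) * v + v ^ (q + 2)) := by
      calc 2 * (u ^ q * (R * v)) = u ^ q * v * (2 * R) := by ring
        _ ≤ u ^ q * v * (u + v) := by gcongr
        _ = u ^ (q + 1) * v + u ^ q * v ^ 2 := by ring
        _ ≤ _ := by
          have : 0 ≤ v ^ (q + 2) := by positivity
          have : 0 ≤ u ^ (q + 1) * v := by positivity
          linarith
    have t3 : (u ^ q * v + v ^ (q + 1)) * (u + 2 * R + v) ≤ 8 * (u ^ (q + 1) * v + v ^ (q + 2)) := by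
      calc (u ^ q * v + v ^ (q + 1)) * (u + 2 * R + v)
          ≤ (u ^ q * v + v ^ (q + 1)) * (2 * (u + v)) := by gcongr; linarith
        _ = 2 * (u ^ (q + 1) * v + u ^ q * v ^ 2 + u * v ^ (q + 1) + v ^ (q + 2)) := by ring
        _ ≤ _ := by
          have : 0 ≤ v ^ (q + 2) := by positivity
          have : 0 ≤ u ^ (q + 1) * v := by positivity
          linarith
    set A := u ^ (q + 1) * v + v ^ (q + 2) with hA
    calc (u + 2 * R + v) ^ (q + 1) * (u + 2 * R + v)
        ≤ (u ^ (q + 1) + 2 * (q + 1) * (u ^ q * R) + C * (u ^ q * v + v ^ (q + 1))) *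
          (u + 2 * R + v) := by gcongr
      _ = u ^ (q + 1 + 1) + 2 * (q + 1 + 1) * (u ^ (q + 1) * R) + u ^ (q + 1) * v
          + 4 * (q + 1) * (u ^ q * R ^ 2) + (q + 1) * (2 * (u ^ q * (R * v)))
          + C * ((u ^ q * v + v ^ (q + 1)) * (u + 2 * R + v)) := by ring
      _ ≤ u ^ (q + 1 + 1) + 2 * (q + 1 + 1) * (u ^ (q + 1) * R) + A
          + 4 * (q + 1) * A + (q + 1) * (2 * A) + C * (8 * A) := by
        have hvp : 0 ≤ v ^ (q + 2) := by positivity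
        gcongr
        · rw [hA]; linarith
        · exact t1.trans (by rw [hA]; linarith)
      _ ≤ _ := by
        have hA0 : 0 ≤ A := by positivity
        nlinarith

/-- Adding a martingale difference increases the square of the `L^{2(q+1)}` norm at most by a
multiple of the square of its norm. -/
theorem integral_norm_add_pow_le (q : ℕ) : ∃ C : ℝ, 1 ≤ C ∧
    ∀ {Ω : Type*} [MeasurableSpace Ω] (P : Measure Ω) [IsProbabilityMeasure P] (S d : Ω → ℂ)
      (a b : ℝ), AllLp P S → AllLp P d → 0 ≤ a → 0 ≤ b →
      ∫ ω, ‖S ω‖ ^ (2 * (q + 1)) ∂P ≤ a ^ (q + 1) → ∫ ω, ‖d ω‖ ^ (2 * (q + 1)) ∂P ≤ b ^ (q + 1) →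
      ∫ ω, ((‖S ω‖ ^ (2 * q) : ℝ) : ℂ) * star (S ω) * d ω ∂P = 0 →
      ∫ ω, ‖S ω + d ω‖ ^ (2 * (q + 1)) ∂P ≤ (a + C * b) ^ (q + 1) := by
  obtain ⟨C, hC, h2⟩ := two_point_inequality q
  refine ⟨3 * C, by linarith, ?_⟩
  intro Ω _ P _ S d a b hS hd ha hb hSa hdb hcross
  have hIS := hS.integrable_norm_pow (2 * (q + 1))
  have hId := hd.integrable_norm_pow (2 * (q + 1))
  have hISd : Integrable (fun ω => ‖S ω‖ ^ (2 * q) * ‖d ω‖ ^ 2) P := by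
    have := ((hS.pow q).mul hd).integrable_norm_pow 2
    refine this.congr (Filter.Eventually.of_forall fun ω => ?_)
    simp only [norm_mul, norm_pow]; ring
  have hIc : Integrable (fun ω => ((‖S ω‖ ^ (2 * q) : ℝ) : ℂ) * star (S ω) * d ω) P := by
    have := (((hS.pow q).mul (hS.star.pow q)).mul hS.star).mul hd |>.integrable
    refine this.congr (Filter.Eventually.of_forall fun ω => ?_)
    have : ((‖S ω‖ ^ (2 * q) : ℝ) : ℂ) = S ω ^ q * star (S ω) ^ q := by
      rw [← mul_pow, Complex.star_def, Complex.mul_conj', pow_mul]; push_cast; rfl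
    simp only [this]
  have hIr : Integrable (fun ω => ‖S ω‖ ^ (2 * q) * (star (S ω) * d ω).re) P := by
    refine hIc.re.congr (Filter.Eventually.of_forall fun ω => ?_)
    simp only [mul_assoc, RCLike.re_to_complex, Complex.re_ofReal_mul]
  have hr : ∫ ω, ‖S ω‖ ^ (2 * q) * (star (S ω) * d ω).re ∂P = 0 := by
    have := integral_re hIc
    rw [hcross] at this
    simp only [mul_assoc, RCLike.re_to_complex, Complex.re_ofReal_mul, Complex.zero_re] at this
    exact this
  have main : ∀ a b : ℝ, 0 < a → 0 < b →
      ∫ ω, ‖S ω‖ ^ (2 * (q + 1)) ∂P ≤ a ^ (q + 1) → ∫ ω, ‖d ω‖ ^ (2 * (q + 1)) ∂P ≤ b ^ (q + 1) →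
      ∫ ω, ‖S ω + d ω‖ ^ (2 * (q + 1)) ∂P ≤ (a + 3 * C * b) ^ (q + 1) := by
    intro a b ha hb hSa hdb
    -- Compare |S|²/a with |d|²/b; the larger one controls the mixed term. These weights make both
    -- contributions equal to a^q b after integration.
    have hyoung : ∀ ω, ‖S ω‖ ^ (2 * q) * ‖d ω‖ ^ 2 ≤
        b / a * ‖S ω‖ ^ (2 * (q + 1)) + a ^ q / b ^ q * ‖d ω‖ ^ (2 * (q + 1)) := by
      intro ω
      set u := ‖S ω‖ ^ 2 with hu
      set v := ‖d ω‖ ^ 2 with hv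
      have hu0 : 0 ≤ u := by positivity
      have hv0 : 0 ≤ v := by positivity
      rw [pow_mul, pow_mul, pow_mul, ← hu, ← hv]
      rcases le_total (v * a) (b * u) with h | h
      · have : u ^ q * v ≤ b / a * u ^ (q + 1) := by
          rw [div_mul_eq_mul_div, le_div_iff₀ ha]
          calc u ^ q * v * a = u ^ q * (v * a) := by ring
            _ ≤ u ^ q * (b * u) := by gcongr
            _ = _ := by ring
        have h' : 0 ≤ a ^ q / b ^ q * v ^ (q + 1) := by positivity
        linarith
      · have : u ^ q * v ≤ a ^ q / b ^ q * v ^ (q + 1) := by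
          rw [div_mul_eq_mul_div, le_div_iff₀ (by positivity)]
          calc u ^ q * v * b ^ q = (b * u) ^ q * v := by rw [mul_pow]; ring
            _ ≤ (v * a) ^ q * v := by gcongr
            _ = _ := by rw [mul_pow]; ring
        have h' : 0 ≤ b / a * u ^ (q + 1) := by positivity
        linarith
    have hmix : ∫ ω, ‖S ω‖ ^ (2 * q) * ‖d ω‖ ^ 2 ∂P ≤ 2 * (a ^ q * b) := by
      calc _ ≤ ∫ ω, (b / a * ‖S ω‖ ^ (2 * (q + 1)) + a ^ q / b ^ q * ‖d ω‖ ^ (2 * (q + 1))) ∂P :=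
            integral_mono hISd ((hIS.const_mul _).add (hId.const_mul _)) hyoung
        _ = b / a * ∫ ω, ‖S ω‖ ^ (2 * (q + 1)) ∂P + a ^ q / b ^ q * ∫ ω, ‖d ω‖ ^ (2 * (q + 1)) ∂P := by
          rw [integral_add (hIS.const_mul _) (hId.const_mul _), integral_const_mul,
            integral_const_mul]
        _ ≤ b / a * a ^ (q + 1) + a ^ q / b ^ q * b ^ (q + 1) := by gcongr
        _ = _ := by field_simp; ring
    calc ∫ ω, ‖S ω + d ω‖ ^ (2 * (q + 1)) ∂P
        ≤ ∫ ω, (‖S ω‖ ^ (2 * (q + 1)) +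
            2 * (q + 1) * (‖S ω‖ ^ (2 * q) * (star (S ω) * d ω).re) +
            C * (‖S ω‖ ^ (2 * q) * ‖d ω‖ ^ 2 + ‖d ω‖ ^ (2 * (q + 1)))) ∂P :=
          integral_mono ((hS.add hd).integrable_norm_pow _)
            ((hIS.add (hIr.const_mul _)).add ((hISd.add hId).const_mul _)) fun ω => h2 _ _
      _ = ∫ ω, ‖S ω‖ ^ (2 * (q + 1)) ∂P +
            C * (∫ ω, ‖S ω‖ ^ (2 * q) * ‖d ω‖ ^ 2 ∂P + ∫ ω, ‖d ω‖ ^ (2 * (q + 1)) ∂P) := by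
          have i1 : Integrable (fun ω => ‖S ω‖ ^ (2 * (q + 1)) +
              2 * (q + 1) * (‖S ω‖ ^ (2 * q) * (star (S ω) * d ω).re)) P :=
            hIS.add (hIr.const_mul _)
          have i2 : Integrable (fun ω =>
              C * (‖S ω‖ ^ (2 * q) * ‖d ω‖ ^ 2 + ‖d ω‖ ^ (2 * (q + 1)))) P :=
            (hISd.add hId).const_mul _
          rw [integral_add i1 i2, integral_add hIS (hIr.const_mul _), integral_const_mul, hr,
            mul_zero, add_zero, integral_const_mul, integral_add hISd hId]
      _ ≤ a ^ (q + 1) + C * (2 * (a ^ q * b) + b ^ (q + 1)) := by gcongr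
      _ ≤ (a + 3 * C * b) ^ (q + 1) := by
          have key : ∀ q : ℕ, a ^ (q + 1) + 2 * C * (a ^ q * b) + (C * b) ^ (q + 1) ≤
              (a + 3 * C * b) ^ (q + 1) := by
            intro q
            induction q with
            | zero => simp; nlinarith
            | succ q ih =>
              rw [pow_succ (a + 3 * C * b)]
              have hC0 : 0 ≤ C := by linarith
              calc _ ≤ (a ^ (q + 1) + 2 * C * (a ^ q * b) + (C * b) ^ (q + 1)) * (a + 3 * C * b) := by
                    have r1 : 0 ≤ a ^ q * b * (C * b) * C := by positivity
                    have r2 : 0 ≤ a * (C * b) ^ (q + 1) := by positivity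
                    have r3 : 0 ≤ C * b * (C * b) ^ (q + 1) := by positivity
                    have r4 : 0 ≤ a ^ (q + 1) * b * C := by positivity
                    have e : (a ^ (q + 1) + 2 * C * (a ^ q * b) + (C * b) ^ (q + 1)) * (a + 3 * C * b)
                      - (a ^ (q + 1 + 1) + 2 * C * (a ^ (q + 1) * b) + (C * b) ^ (q + 1 + 1))
                      = 3 * (a ^ (q + 1) * b * C) + 6 * (a ^ q * b * (C * b) * C)
                        + a * (C * b) ^ (q + 1) + 2 * (C * b * (C * b) ^ (q + 1)) := by ring
                    linarith
                _ ≤ _ := by gcongr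
          refine le_trans ?_ (key q)
          have : C * b ^ (q + 1) ≤ (C * b) ^ (q + 1) := by
            rw [mul_pow]
            gcongr
            exact le_self_pow₀ hC (by omega)
          linarith
  -- The weights b/a need positive a and b; the remaining cases follow as ε tends to 0.
  have hlim : ∀ ε : ℝ, 0 < ε →
      ∫ ω, ‖S ω + d ω‖ ^ (2 * (q + 1)) ∂P ≤ ((a + ε) + 3 * C * (b + ε)) ^ (q + 1) := by
    intro ε hε
    refine main _ _ (by linarith) (by linarith) (hSa.trans ?_) (hdb.trans ?_)
    · gcongr; linarith
    · gcongr; linarith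
  have ht : Filter.Tendsto (fun ε : ℝ => ((a + ε) + 3 * C * (b + ε)) ^ (q + 1))
      (nhdsWithin 0 (Set.Ioi 0)) (nhds (((a + 0) + 3 * C * (b + 0)) ^ (q + 1))) := by
    refine Filter.Tendsto.mono_left ?_ nhdsWithin_le_nhds
    exact Continuous.tendsto (by fun_prop) 0
  have := ge_of_tendsto ht (Filter.eventually_of_mem self_mem_nhdsWithin hlim)
  simpa using this

end TwoPoint
end LocalSemicircle
end

/-! ### Large deviation bounds for linear and quadratic forms -/

noncomputable section
namespace LocalSemicircle

section LargeDeviation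

theorem sum_offDiag_insert {ι M : Type*} [DecidableEq ι] [AddCommMonoid M] {n : ι} {s : Finset ι}
    (hn : n ∉ s) (F : ι → ι → M) :
    ∑ i ∈ insert n s, ∑ j ∈ (insert n s).erase i, F i j =
      ∑ i ∈ s, ∑ j ∈ s.erase i, F i j + (∑ j ∈ s, F n j + ∑ i ∈ s, F i n) := by
  rw [Finset.sum_insert hn, Finset.erase_insert hn]
  have : ∀ i ∈ s, ∑ j ∈ (insert n s).erase i, F i j = F i n + ∑ j ∈ s.erase i, F i j := by
    intro i hi
    have hne : n ≠ i := fun h => hn (h ▸ hi)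
    rw [Finset.erase_insert_of_ne hne, Finset.sum_insert (by simp [hn])]
  rw [Finset.sum_congr rfl this, Finset.sum_add_distrib]
  abel

theorem integral_mul_eq_zero_of_indep {Ω : Type*} [MeasurableSpace Ω] {P : Measure Ω}
    {U V : Ω → ℂ} (h : IndepFun U V P) (hU : AEStronglyMeasurable U P)
    (hV : AEStronglyMeasurable V P) (h0 : ∫ ω, U ω ∂P = 0) : ∫ ω, U ω * V ω ∂P = 0 := by
  rw [h.integral_fun_mul_eq_mul_integral hU hV, h0, zero_mul]

/-- A family of independent centred random variables with controlled moments of order `4 (q+1)`. -/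
structure IndepFamily {Ω ι : Type*} [MeasurableSpace Ω] (P : Measure Ω) (X : ι → Ω → ℂ) (v : ι → ℝ)
    (q : ℕ) (κ : ℝ) : Prop where
  indep : iIndepFun X P
  meas : ∀ i, Measurable (X i)
  allLp : ∀ i, AllLp P (X i)
  mean : ∀ i, ∫ ω, X i ω ∂P = 0
  v_nonneg : ∀ i, 0 ≤ v i
  moment : ∀ i, ∫ ω, ‖X i ω‖ ^ (2 * (q + 1)) ∂P ≤ κ * v i ^ (q + 1)

variable {Ω ι : Type*} [MeasurableSpace Ω] {P : Measure Ω}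
  [DecidableEq ι] {X : ι → Ω → ℂ} {v : ι → ℝ} {q : ℕ} {κ : ℝ}

/-- Extension by zero outside s keeps the argument of type ι → ℂ, so that partial sums over s are
measurable functions of it. -/
theorem IndepFamily.indepFun_restrict (hX : IndepFamily P X v q κ) {i : ι} {s : Finset ι}
    (hi : i ∉ s) : IndepFun (X i) (fun ω j => if j ∈ s then X j ω else 0) P := by
  have h := hX.indep.indepFun_finset {i} s (by simpa using hi) hX.meas
  have hm : Measurable (fun (y : s → ℂ) (j : ι) => if h : j ∈ s then y ⟨j, h⟩ else 0) := by
    refine measurable_pi_lambda _ fun j => ?_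
    by_cases hj : j ∈ s
    · simp only [hj, dite_true]; exact measurable_pi_apply _
    · simp only [hj, dite_false]; exact measurable_const
  have h2 := h.comp (measurable_pi_apply (⟨i, Finset.mem_singleton_self i⟩ : ({i} : Finset ι))) hm
  refine h2.congr (Filter.Eventually.of_forall fun ω => rfl)
    (Filter.Eventually.of_forall fun ω => ?_)
  funext j
  by_cases hj : j ∈ s <;> simp [hj]

theorem le_one_add_pow {κ : ℝ} (hκ : 0 ≤ κ) (q : ℕ) : κ ≤ (1 + κ) ^ (q + 1) := by
  have : (1 + κ) ≤ (1 + κ) ^ (q + 1) := le_self_pow₀ (by linarith) (by omega)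
  linarith

/-- Moments of linear forms in independent centred random variables. -/
theorem moment_linear_form (q : ℕ) (κ : ℝ) (hκ : 0 ≤ κ) : ∃ C : ℝ, 1 ≤ C ∧
    ∀ {Ω ι : Type*} [MeasurableSpace Ω] (P : Measure Ω) [IsProbabilityMeasure P] [DecidableEq ι]
      (X : ι → Ω → ℂ) (v : ι → ℝ), IndepFamily P X v q κ → ∀ (a : ι → ℂ) (s : Finset ι),
      ∫ ω, ‖∑ i ∈ s, a i * X i ω‖ ^ (2 * (q + 1)) ∂P ≤
        (C * ∑ i ∈ s, ‖a i‖ ^ 2 * v i) ^ (q + 1) := by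
  obtain ⟨C, hC, hMZ⟩ := integral_norm_add_pow_le q
  refine ⟨C * (1 + κ), by nlinarith, ?_⟩
  intro Ω ι _ P _ _ X v hX a s
  induction s using Finset.induction_on with
  | empty => simp
  | insert n s hn ih =>
    simp only [Finset.sum_insert hn]
    have hv := hX.v_nonneg
    have hS : AllLp P (fun ω => ∑ i ∈ s, a i * X i ω) :=
      AllLp.sum s fun i _ => (hX.allLp i).const_mul _
    -- The variables are added one at a time, as martingale differences; the n-th contributes a
    -- multiple of |a_n|² v_n to the square of the norm.
    have := hMZ P (fun ω => ∑ i ∈ s, a i * X i ω) (fun ω => a n * X n ω)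
      (C * (1 + κ) * ∑ i ∈ s, ‖a i‖ ^ 2 * v i) ((1 + κ) * (‖a n‖ ^ 2 * v n)) hS
      ((hX.allLp n).const_mul _)
      (mul_nonneg (by positivity) (Finset.sum_nonneg fun i _ => mul_nonneg (by positivity) (hv i)))
      (mul_nonneg (by positivity) (mul_nonneg (by positivity) (hv n))) ih ?_ ?_
    · simp only [add_comm (a n * X n _)]
      refine this.trans (le_of_eq ?_)
      ring
    · simp only [norm_mul, mul_pow]
      rw [integral_const_mul, pow_mul]
      calc (‖a n‖ ^ 2) ^ (q + 1) * ∫ ω, ‖X n ω‖ ^ (2 * (q + 1)) ∂P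
          ≤ (‖a n‖ ^ 2) ^ (q + 1) * (κ * v n ^ (q + 1)) := by
            gcongr; exact hX.moment n
        _ ≤ (‖a n‖ ^ 2) ^ (q + 1) * ((1 + κ) ^ (q + 1) * v n ^ (q + 1)) := by
            gcongr
            · exact pow_nonneg (hv n) _
            · exact le_one_add_pow hκ q
        _ = _ := by ring
    · have hi := (hX.indepFun_restrict hn).comp (φ := id)
        (ψ := fun y : ι → ℂ => a n * (((‖∑ i ∈ s, a i * y i‖ ^ (2 * q) : ℝ) : ℂ) *
          star (∑ i ∈ s, a i * y i))) measurable_id (by fun_prop)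
      have hmV : Measurable ((fun y : ι → ℂ => a n * (((‖∑ i ∈ s, a i * y i‖ ^ (2 * q) : ℝ) : ℂ) *
          star (∑ i ∈ s, a i * y i))) ∘ (fun ω j => if j ∈ s then X j ω else 0)) := by
        refine Measurable.comp (by fun_prop) (measurable_pi_lambda _ fun j => ?_)
        split_ifs
        · exact hX.meas j
        · exact measurable_const
      have h0 := integral_mul_eq_zero_of_indep hi (hX.meas n).aestronglyMeasurable
        hmV.aestronglyMeasurable (hX.mean n)
      refine Eq.trans (integral_congr_ae (Filter.Eventually.of_forall fun ω => ?_)) h0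
      have e : ∑ i ∈ s, a i * (if i ∈ s then X i ω else 0) = ∑ i ∈ s, a i * X i ω :=
        Finset.sum_congr rfl fun i hi => by rw [if_pos hi]
      simp only [Function.comp_apply, e, id]
      ring

theorem add_pow_le_four_pow {a b : ℝ} (ha : 0 ≤ a) (hb : 0 ≤ b) (q : ℕ) :
    (a + b) ^ (2 * (q + 1)) ≤ 4 ^ (q + 1) * (a ^ (2 * (q + 1)) + b ^ (2 * (q + 1))) := by
  refine (add_pow_le ha hb _).trans ?_
  have : (4 : ℝ) ^ (q + 1) = 2 ^ (2 * (q + 1)) := by rw [pow_mul]; norm_num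
  rw [this]
  gcongr
  · norm_num
  · omega

theorem pow_succ_add_pow_succ_le {a b : ℝ} (ha : 0 ≤ a) (hb : 0 ≤ b) (q : ℕ) :
    a ^ (q + 1) + b ^ (q + 1) ≤ (a + b) ^ (q + 1) :=
  pow_add_pow_le ha hb (by omega)

/-- Moments of off-diagonal quadratic forms in independent centred random variables. -/
theorem moment_offDiag_form (q : ℕ) (κ : ℝ) (hκ : 0 ≤ κ) : ∃ C : ℝ, 1 ≤ C ∧
    ∀ {Ω ι : Type*} [MeasurableSpace Ω] (P : Measure Ω) [IsProbabilityMeasure P] [DecidableEq ι]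
      (X : ι → Ω → ℂ) (v : ι → ℝ), IndepFamily P X v q κ → ∀ (a : ι → ι → ℂ) (s : Finset ι),
      ∫ ω, ‖∑ i ∈ s, ∑ j ∈ s.erase i, a i j * (X i ω * star (X j ω))‖ ^ (2 * (q + 1)) ∂P ≤
        (C * ∑ i ∈ s, ∑ j ∈ s.erase i, ‖a i j‖ ^ 2 * (v i * v j)) ^ (q + 1) := by
  obtain ⟨C, hC, hMZ⟩ := integral_norm_add_pow_le q
  obtain ⟨C₁, hC₁, hlin⟩ := moment_linear_form q κ hκ
  have h4 : 1 ≤ 4 * (1 + κ) * C₁ := by nlinarith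
  refine ⟨C * (4 * (1 + κ) * C₁), by nlinarith, ?_⟩
  intro Ω ι _ P _ _ X v hX a s
  have hv := hX.v_nonneg
  induction s using Finset.induction_on with
  | empty => simp
  | insert n s hn ih =>
    simp only [sum_offDiag_insert hn]
    set V : ℝ := ∑ i ∈ s, ∑ j ∈ s.erase i, ‖a i j‖ ^ 2 * (v i * v j) with hV
    have hV0 : 0 ≤ V := Finset.sum_nonneg fun i _ => Finset.sum_nonneg fun j _ =>
      mul_nonneg (by positivity) (mul_nonneg (hv i) (hv j))
    set S : Ω → ℂ := fun ω => ∑ i ∈ s, ∑ j ∈ s.erase i, a i j * (X i ω * star (X j ω)) with hSdef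
    set L : Ω → ℂ := fun ω => ∑ j ∈ s, star (a n j) * X j ω with hL
    set L' : Ω → ℂ := fun ω => ∑ j ∈ s, a j n * X j ω with hL'
    -- The new terms are linear in X_n and its conjugate, with coefficients L and L' that are linear
    -- forms in the earlier variables.
    have hdec : ∀ ω, ∑ j ∈ s, a n j * (X n ω * star (X j ω)) + ∑ i ∈ s, a i n * (X i ω * star (X n ω))
        = X n ω * star (L ω) + star (X n ω) * L' ω := by
      intro ω
      simp only [hL, hL', star_sum, star_mul', star_star, Finset.mul_sum]
      congr 1
      · exact Finset.sum_congr rfl fun j _ => by ring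
      · exact Finset.sum_congr rfl fun j _ => by ring
    have hSLp : AllLp P S := AllLp.sum s fun i _ => AllLp.sum _ fun j _ =>
      ((hX.allLp i).mul (hX.allLp j).star).const_mul _
    have hLLp : AllLp P L := AllLp.sum s fun i _ => (hX.allLp i).const_mul _
    have hL'Lp : AllLp P L' := AllLp.sum s fun i _ => (hX.allLp i).const_mul _
    set w : ℝ := ∑ j ∈ s, ‖a n j‖ ^ 2 * v j with hw
    set w' : ℝ := ∑ j ∈ s, ‖a j n‖ ^ 2 * v j with hw'
    have hw0 : 0 ≤ w := Finset.sum_nonneg fun j _ => mul_nonneg (by positivity) (hv j)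
    have hw'0 : 0 ≤ w' := Finset.sum_nonneg fun j _ => mul_nonneg (by positivity) (hv j)
    have hmL : ∫ ω, ‖L ω‖ ^ (2 * (q + 1)) ∂P ≤ (C₁ * w) ^ (q + 1) := by
      have := hlin P X v hX (fun j => star (a n j)) s
      simpa only [norm_star] using this
    have hmL' : ∫ ω, ‖L' ω‖ ^ (2 * (q + 1)) ∂P ≤ (C₁ * w') ^ (q + 1) :=
      hlin P X v hX (fun j => a j n) s
    have hres : ∀ (F : (ι → ℂ) → ℂ), Measurable F →
        (∀ ω, F (fun j => if j ∈ s then X j ω else 0) = F (fun j => X j ω)) →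
        IndepFun (X n) (fun ω => F (fun j => X j ω)) P := by
      intro F hF hFe
      have h := (hX.indepFun_restrict hn).comp (φ := id) measurable_id hF
      have e : (F ∘ fun ω j => if j ∈ s then X j ω else 0) = fun ω => F (fun j => X j ω) :=
        funext hFe
      rw [e] at h
      exact h
    have hmX : ∀ (F : (ι → ℂ) → ℂ), Measurable F → Measurable (fun ω => F (fun j => X j ω)) :=
      fun F hF => hF.comp (measurable_pi_lambda _ hX.meas)
    have sum_res : ∀ (c : ι → ℂ) ω, ∑ j ∈ s, c j * (if j ∈ s then X j ω else 0) =
        ∑ j ∈ s, c j * X j ω := fun c ω => Finset.sum_congr rfl fun i hi => by rw [if_pos hi]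
    have sum_res2 : ∀ ω, ∑ i ∈ s, ∑ j ∈ s.erase i,
        a i j * ((if i ∈ s then X i ω else 0) * star (if j ∈ s then X j ω else 0)) = S ω :=
      fun ω => Finset.sum_congr rfl fun i hi => Finset.sum_congr rfl fun j hj => by
        rw [if_pos hi, if_pos (Finset.mem_of_mem_erase hj)]
    have hd : AllLp P (fun ω => X n ω * star (L ω) + star (X n ω) * L' ω) :=
      ((hX.allLp n).mul hLLp.star).add ((hX.allLp n).star.mul hL'Lp)
    have := hMZ P S (fun ω => X n ω * star (L ω) + star (X n ω) * L' ω)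
      (C * (4 * (1 + κ) * C₁) * V) (4 * (1 + κ) * C₁ * (v n * (w + w'))) hSLp hd
      (by positivity) (mul_nonneg (by positivity) (mul_nonneg (hv n) (by positivity))) ih ?_ ?_
    · simp only [hdec]
      refine this.trans (le_of_eq ?_)
      congr 1
      have e1 : ∑ j ∈ s, ‖a n j‖ ^ 2 * (v n * v j) = v n * w := by
        rw [hw, Finset.mul_sum]; exact Finset.sum_congr rfl fun j _ => by ring
      have e2 : ∑ j ∈ s, ‖a j n‖ ^ 2 * (v j * v n) = v n * w' := by
        rw [hw', Finset.mul_sum]; exact Finset.sum_congr rfl fun j _ => by ring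
      rw [e1, e2]
      ring
    · have hpt : ∀ ω, ‖X n ω * star (L ω) + star (X n ω) * L' ω‖ ^ (2 * (q + 1)) ≤
          4 ^ (q + 1) * (‖X n ω‖ ^ (2 * (q + 1)) *
            (‖L ω‖ ^ (2 * (q + 1)) + ‖L' ω‖ ^ (2 * (q + 1)))) := by
        intro ω
        have h1 : ‖X n ω * star (L ω) + star (X n ω) * L' ω‖ ≤ ‖X n ω‖ * (‖L ω‖ + ‖L' ω‖) := by
          refine (norm_add_le _ _).trans (le_of_eq ?_)
          rw [norm_mul, norm_mul, norm_star, norm_star]; ring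
        calc _ ≤ (‖X n ω‖ * (‖L ω‖ + ‖L' ω‖)) ^ (2 * (q + 1)) := by gcongr
          _ = ‖X n ω‖ ^ (2 * (q + 1)) * (‖L ω‖ + ‖L' ω‖) ^ (2 * (q + 1)) := mul_pow _ _ _
          _ ≤ ‖X n ω‖ ^ (2 * (q + 1)) * (4 ^ (q + 1) *
                (‖L ω‖ ^ (2 * (q + 1)) + ‖L' ω‖ ^ (2 * (q + 1)))) := by
              gcongr; exact add_pow_le_four_pow (norm_nonneg _) (norm_nonneg _) q
          _ = _ := by ring
      have hind : IndepFun (fun ω => ‖X n ω‖ ^ (2 * (q + 1)))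
          (fun ω => ‖L ω‖ ^ (2 * (q + 1)) + ‖L' ω‖ ^ (2 * (q + 1))) P := by
        have h := (hX.indepFun_restrict hn).comp (φ := fun x : ℂ => ‖x‖ ^ (2 * (q + 1)))
          (ψ := fun y : ι → ℂ => ‖∑ j ∈ s, star (a n j) * y j‖ ^ (2 * (q + 1)) +
            ‖∑ j ∈ s, a j n * y j‖ ^ (2 * (q + 1))) (by fun_prop) (by fun_prop)
        refine h.congr (Filter.Eventually.of_forall fun ω => rfl)
          (Filter.Eventually.of_forall fun ω => ?_)
        simp only [Function.comp_apply, sum_res (fun j => star (a n j)), sum_res (fun j => a j n), hL, hL']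
      have hiL := hLLp.integrable_norm_pow (2 * (q + 1))
      have hiL' := hL'Lp.integrable_norm_pow (2 * (q + 1))
      have hiX := (hX.allLp n).integrable_norm_pow (2 * (q + 1))
      calc _ ≤ ∫ ω, 4 ^ (q + 1) * (‖X n ω‖ ^ (2 * (q + 1)) *
            (‖L ω‖ ^ (2 * (q + 1)) + ‖L' ω‖ ^ (2 * (q + 1)))) ∂P :=
            integral_mono (hd.integrable_norm_pow _)
              ((hind.integrable_mul hiX (hiL.add hiL')).const_mul _) hpt
        _ = 4 ^ (q + 1) * ((∫ ω, ‖X n ω‖ ^ (2 * (q + 1)) ∂P) *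
            (∫ ω, ‖L ω‖ ^ (2 * (q + 1)) ∂P + ∫ ω, ‖L' ω‖ ^ (2 * (q + 1)) ∂P)) := by
            rw [integral_const_mul, hind.integral_fun_mul_eq_mul_integral hiX.1 (hiL.add hiL').1,
              integral_add hiL hiL']
        _ ≤ 4 ^ (q + 1) * (((1 + κ) ^ (q + 1) * v n ^ (q + 1)) *
            ((C₁ * w) ^ (q + 1) + (C₁ * w') ^ (q + 1))) := by
            have : ∫ ω, ‖X n ω‖ ^ (2 * (q + 1)) ∂P ≤ (1 + κ) ^ (q + 1) * v n ^ (q + 1) := by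
              refine (hX.moment n).trans ?_
              gcongr
              · exact pow_nonneg (hv n) _
              · exact le_one_add_pow hκ q
            gcongr
            exact mul_nonneg (by positivity) (pow_nonneg (hv n) _)
        _ ≤ 4 ^ (q + 1) * (((1 + κ) ^ (q + 1) * v n ^ (q + 1)) *
            (C₁ * w + C₁ * w') ^ (q + 1)) := by
            gcongr
            · exact mul_nonneg (by positivity) (pow_nonneg (hv n) _)
            · exact pow_succ_add_pow_succ_le (by positivity) (by positivity) q
        _ = _ := by rw [← mul_pow, ← mul_pow, ← mul_pow]; ring_nf
    -- The cross term splits into X_n times F₁ and its conjugate times F₂. Both F₁ and F₂ depend on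
    -- earlier variables only, and X_n is centred.
    · set F₁ : (ι → ℂ) → ℂ := fun y =>
        ((‖∑ i ∈ s, ∑ j ∈ s.erase i, a i j * (y i * star (y j))‖ ^ (2 * q) : ℝ) : ℂ) *
        star (∑ i ∈ s, ∑ j ∈ s.erase i, a i j * (y i * star (y j))) *
        star (∑ j ∈ s, star (a n j) * y j) with hF₁
      set F₂ : (ι → ℂ) → ℂ := fun y =>
        ((‖∑ i ∈ s, ∑ j ∈ s.erase i, a i j * (y i * star (y j))‖ ^ (2 * q) : ℝ) : ℂ) *
        star (∑ i ∈ s, ∑ j ∈ s.erase i, a i j * (y i * star (y j))) *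
        (∑ j ∈ s, a j n * y j) with hF₂
      have hm₁ : Measurable F₁ := by fun_prop
      have hm₂ : Measurable F₂ := by fun_prop
      have i₁ := hres F₁ hm₁ (fun ω => by
        simp only [hF₁, sum_res2, sum_res (fun j => star (a n j))]; rfl)
      have i₂ := (hres F₂ hm₂ (fun ω => by
        simp only [hF₂, sum_res2, sum_res (fun j => a j n)]; rfl)).comp
        (φ := fun x : ℂ => star x) (ψ := id) (by fun_prop) measurable_id
      have z₁ := integral_mul_eq_zero_of_indep i₁ (hX.meas n).aestronglyMeasurable
        (hmX F₁ hm₁).aestronglyMeasurable (hX.mean n)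
      have z₂ := integral_mul_eq_zero_of_indep i₂ (hX.allLp n).star.aesm
        (hmX F₂ hm₂).aestronglyMeasurable (by
          have := integral_conj (μ := P) (f := X n)
          rw [hX.mean n, map_zero] at this
          exact this)
      have hpw : AllLp P (fun ω => ((‖S ω‖ ^ (2 * q) : ℝ) : ℂ)) := by
        have := (hSLp.pow q).mul (hSLp.star.pow q)
        have e : (fun ω => ((‖S ω‖ ^ (2 * q) : ℝ) : ℂ)) = fun ω => S ω ^ q * star (S ω) ^ q := by
          funext ω
          rw [← mul_pow, Complex.star_def, Complex.mul_conj', pow_mul]; push_cast; rfl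
        rw [e]; exact this
      have I₁ : Integrable (fun ω => X n ω * F₁ (fun j => X j ω)) P :=
        ((hX.allLp n).mul ((hpw.mul hSLp.star).mul hLLp.star)).integrable
      have I₂ : Integrable (fun ω => star (X n ω) * F₂ (fun j => X j ω)) P :=
        ((hX.allLp n).star.mul ((hpw.mul hSLp.star).mul hL'Lp)).integrable
      have hsplit : ∀ ω, ((‖S ω‖ ^ (2 * q) : ℝ) : ℂ) * star (S ω) *
          (X n ω * star (L ω) + star (X n ω) * L' ω) =
          X n ω * F₁ (fun j => X j ω) + star (X n ω) * F₂ (fun j => X j ω) := by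
        intro ω
        simp only [hF₁, hF₂, hSdef, hL, hL']
        ring
      simp only [hsplit]
      rw [integral_add I₁ I₂, z₁, zero_add]
      exact z₂

/-- The centred squared moduli of an independent family. -/
theorem IndepFamily.normSq_sub {Ω ι : Type*} [MeasurableSpace Ω] {P : Measure Ω}
    {X : ι → Ω → ℂ} {v : ι → ℝ} {q : ℕ} {κ : ℝ} [IsProbabilityMeasure P] {κ' : ℝ} (hX : IndepFamily P X v q κ)
    (hvar : ∀ i, ∫ ω, ‖X i ω‖ ^ 2 ∂P = v i)
    (hmom : ∀ i, ∫ ω, ‖X i ω‖ ^ (4 * (q + 1)) ∂P ≤ κ' * v i ^ (2 * (q + 1))) :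
    IndepFamily P (fun i ω => X i ω * star (X i ω) - (v i : ℂ)) (fun i => v i ^ 2) q
      (4 ^ (q + 1) * (κ' + 1)) := by
  have hv := hX.v_nonneg
  set Y : ι → Ω → ℂ := fun i ω => X i ω * star (X i ω) - (v i : ℂ) with hY
  have hallLp : ∀ i, AllLp P (Y i) := fun i =>
    ((hX.allLp i).mul (hX.allLp i).star).sub (allLp_const _)
  refine ⟨?_, ?_, hallLp, ?_, fun i => sq_nonneg _, ?_⟩
  · exact hX.indep.comp (fun i x => x * star x - (v i : ℂ)) (fun i => by fun_prop)
  · intro i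
    have := hX.meas i
    exact (this.mul (continuous_star.measurable.comp this)).sub_const _
  · intro i
    have e : ∀ ω, Y i ω = ((‖X i ω‖ ^ 2 - v i : ℝ) : ℂ) := by
      intro ω
      simp only [hY, Complex.star_def, Complex.mul_conj']; push_cast; rfl
    simp only [e]
    refine (integral_ofReal (𝕜 := ℂ) (f := fun ω => ‖X i ω‖ ^ 2 - v i)).trans ?_
    rw [integral_sub ((hX.allLp i).integrable_norm_pow 2) (integrable_const _), hvar i]
    simp
  · intro i
    have hpt : ∀ ω, ‖Y i ω‖ ^ (2 * (q + 1)) ≤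
        4 ^ (q + 1) * (‖X i ω‖ ^ (4 * (q + 1)) + v i ^ (2 * (q + 1))) := by
      intro ω
      have h1 : ‖Y i ω‖ ≤ ‖X i ω‖ ^ 2 + v i := by
        refine (norm_sub_le _ _).trans (le_of_eq ?_)
        rw [norm_mul, norm_star, Complex.norm_real, Real.norm_eq_abs, abs_of_nonneg (hv i)]; ring
      calc _ ≤ (‖X i ω‖ ^ 2 + v i) ^ (2 * (q + 1)) := by gcongr
        _ ≤ _ := add_pow_le_four_pow (by positivity) (hv i) q
        _ = _ := by rw [← pow_mul]; ring_nf
    have hi := (hX.allLp i).integrable_norm_pow (4 * (q + 1))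
    calc _ ≤ ∫ ω, 4 ^ (q + 1) * (‖X i ω‖ ^ (4 * (q + 1)) + v i ^ (2 * (q + 1))) ∂P :=
          integral_mono ((hallLp i).integrable_norm_pow _)
            ((hi.add (integrable_const _)).const_mul _) hpt
      _ = 4 ^ (q + 1) * (∫ ω, ‖X i ω‖ ^ (4 * (q + 1)) ∂P + v i ^ (2 * (q + 1))) := by
          rw [integral_const_mul, integral_add hi (integrable_const _)]; simp
      _ ≤ 4 ^ (q + 1) * (κ' * v i ^ (2 * (q + 1)) + v i ^ (2 * (q + 1))) := by
          gcongr; exact hmom i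
      _ = _ := by rw [← pow_mul]; ring

/-- Moments of centred quadratic forms in independent centred random variables. -/
theorem moment_quadratic_form (q : ℕ) (κ κ' : ℝ) (hκ : 0 ≤ κ) (hκ' : 0 ≤ κ') : ∃ C : ℝ, 1 ≤ C ∧
    ∀ {Ω ι : Type*} [MeasurableSpace Ω] (P : Measure Ω) [IsProbabilityMeasure P] [DecidableEq ι]
      (X : ι → Ω → ℂ) (v : ι → ℝ), IndepFamily P X v q κ → (∀ i, ∫ ω, ‖X i ω‖ ^ 2 ∂P = v i) →
      (∀ i, ∫ ω, ‖X i ω‖ ^ (4 * (q + 1)) ∂P ≤ κ' * v i ^ (2 * (q + 1))) →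
      ∀ (a : ι → ι → ℂ) (s : Finset ι),
      ∫ ω, ‖∑ i ∈ s, ∑ j ∈ s, a i j * (X i ω * star (X j ω) - if i = j then (v i : ℂ) else 0)‖ ^
          (2 * (q + 1)) ∂P ≤
        (C * ∑ i ∈ s, ∑ j ∈ s, ‖a i j‖ ^ 2 * (v i * v j)) ^ (q + 1) := by
  obtain ⟨C₁, hC₁, hoff⟩ := moment_offDiag_form q κ hκ
  obtain ⟨C₂, hC₂, hlin⟩ := moment_linear_form q (4 ^ (q + 1) * (κ' + 1)) (by positivity)
  refine ⟨4 * (C₁ + C₂), by linarith, ?_⟩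
  intro Ω ι _ P _ _ X v hX hvar hmom a s
  have hv := hX.v_nonneg
  set Y : ι → Ω → ℂ := fun i ω => X i ω * star (X i ω) - (v i : ℂ) with hY
  have hYfam : IndepFamily P Y (fun i => v i ^ 2) q (4 ^ (q + 1) * (κ' + 1)) :=
    hX.normSq_sub hvar hmom
  set D : Ω → ℂ := fun ω => ∑ i ∈ s, a i i * Y i ω with hD
  set O : Ω → ℂ := fun ω => ∑ i ∈ s, ∑ j ∈ s.erase i, a i j * (X i ω * star (X j ω)) with hO
  have hDLp : AllLp P D := AllLp.sum s fun i _ => (hYfam.allLp i).const_mul _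
  have hOLp : AllLp P O := AllLp.sum s fun i _ => AllLp.sum _ fun j _ =>
      ((hX.allLp i).mul (hX.allLp j).star).const_mul _
  -- The diagonal part is a linear form in the centred variables |X_i|² - v_i, whence the moments of
  -- order 4(q+1).
  have hdec : ∀ ω, ∑ i ∈ s, ∑ j ∈ s,
      a i j * (X i ω * star (X j ω) - if i = j then (v i : ℂ) else 0) = D ω + O ω := by
    intro ω
    simp only [hD, hO, ← Finset.sum_add_distrib]
    refine Finset.sum_congr rfl fun i hi => ?_
    rw [← Finset.add_sum_erase _ _ hi, if_pos rfl]
    congr 1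
    refine Finset.sum_congr rfl fun j hj => ?_
    rw [if_neg (Finset.ne_of_mem_erase hj).symm, sub_zero]
  have hV : ∑ i ∈ s, ∑ j ∈ s, ‖a i j‖ ^ 2 * (v i * v j) = ∑ i ∈ s, ‖a i i‖ ^ 2 * v i ^ 2 +
      ∑ i ∈ s, ∑ j ∈ s.erase i, ‖a i j‖ ^ 2 * (v i * v j) := by
    rw [← Finset.sum_add_distrib]
    refine Finset.sum_congr rfl fun i hi => ?_
    rw [← Finset.add_sum_erase _ _ hi, ← sq]
  have bD : ∫ ω, ‖D ω‖ ^ (2 * (q + 1)) ∂P ≤ _ := hlin P Y _ hYfam (fun i => a i i) s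
  have bO : ∫ ω, ‖O ω‖ ^ (2 * (q + 1)) ∂P ≤ _ := hoff P X v hX a s
  set VD := ∑ i ∈ s, ‖a i i‖ ^ 2 * v i ^ 2 with hVD
  set VO := ∑ i ∈ s, ∑ j ∈ s.erase i, ‖a i j‖ ^ 2 * (v i * v j) with hVO
  have hVD0 : 0 ≤ VD := Finset.sum_nonneg fun i _ => by positivity
  have hVO0 : 0 ≤ VO := Finset.sum_nonneg fun i _ => Finset.sum_nonneg fun j _ =>
    mul_nonneg (by positivity) (mul_nonneg (hv i) (hv j))
  simp only [hdec]
  rw [hV]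
  have hiD := hDLp.integrable_norm_pow (2 * (q + 1))
  have hiO := hOLp.integrable_norm_pow (2 * (q + 1))
  clear_value VD VO D O
  calc ∫ ω, ‖D ω + O ω‖ ^ (2 * (q + 1)) ∂P
      ≤ ∫ ω, 4 ^ (q + 1) * (‖D ω‖ ^ (2 * (q + 1)) + ‖O ω‖ ^ (2 * (q + 1))) ∂P := by
        refine integral_mono ((hDLp.add hOLp).integrable_norm_pow _)
          ((hiD.add hiO).const_mul _) fun ω => ?_
        exact (pow_le_pow_left₀ (norm_nonneg _) (norm_add_le (D ω) (O ω)) _).trans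
          (add_pow_le_four_pow (norm_nonneg (D ω)) (norm_nonneg (O ω)) q)
    _ = 4 ^ (q + 1) * (∫ ω, ‖D ω‖ ^ (2 * (q + 1)) ∂P + ∫ ω, ‖O ω‖ ^ (2 * (q + 1)) ∂P) := by
        rw [integral_const_mul, integral_add hiD hiO]
    _ ≤ 4 ^ (q + 1) * ((C₂ * VD) ^ (q + 1) + (C₁ * VO) ^ (q + 1)) := by gcongr
    _ ≤ 4 ^ (q + 1) * (C₂ * VD + C₁ * VO) ^ (q + 1) := by
        gcongr
        exact pow_succ_add_pow_succ_le (by positivity) (by positivity) q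
    _ = (4 * (C₂ * VD + C₁ * VO)) ^ (q + 1) := by rw [mul_pow]
    _ ≤ (4 * (C₁ + C₂) * (VD + VO)) ^ (q + 1) := by
        have h1 : 0 ≤ C₁ * VD := by positivity
        have h2 : 0 ≤ C₂ * VO := by positivity
        exact pow_le_pow_left₀ (by positivity) (by linarith) _

/-- Markov's inequality for a moment of order `2 (q+1)`. -/
theorem measureReal_lt_norm_le {Ω : Type*} [MeasurableSpace Ω] (P : Measure Ω)
    [IsProbabilityMeasure P] {Z : Ω → ℂ} (hZ : AllLp P Z) {q : ℕ} {C V t : ℝ} (hC : 0 ≤ C)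
    (hV : 0 ≤ V) (ht : 0 < t) (h : ∫ ω, ‖Z ω‖ ^ (2 * (q + 1)) ∂P ≤ (C * V) ^ (q + 1)) :
    P.real {ω | t * Real.sqrt V < ‖Z ω‖} ≤ C ^ (q + 1) / t ^ (2 * (q + 1)) := by
  have hi := hZ.integrable_norm_pow (2 * (q + 1))
  -- For V = 0 the moment vanishes, so Z = 0 almost surely and the strict inequality has probability
  -- zero.
  rcases hV.eq_or_lt with rfl | hV
  · have h0 : ∫ ω, ‖Z ω‖ ^ (2 * (q + 1)) ∂P = 0 :=
      le_antisymm (by simpa using h) (integral_nonneg fun ω => by positivity)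
    rw [integral_eq_zero_iff_of_nonneg (fun ω => by positivity) hi] at h0
    have : P {ω | t * Real.sqrt 0 < ‖Z ω‖} = 0 := by
      refine measure_mono_null ?_ (ae_iff.1 h0)
      intro ω hω
      simp only [Set.mem_ofPred_eq, Real.sqrt_zero, mul_zero, norm_pos_iff] at hω
      simp [hω]
    rw [measureReal_def, this]
    simp only [ENNReal.toReal_zero]
    positivity
  · have hm := mul_meas_ge_le_integral_of_nonneg
      (Filter.Eventually.of_forall fun ω => by positivity) hi (t ^ (2 * (q + 1)) * V ^ (q + 1))
    have hsub : P.real {ω | t * Real.sqrt V < ‖Z ω‖} ≤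
        P.real {ω | t ^ (2 * (q + 1)) * V ^ (q + 1) ≤ ‖Z ω‖ ^ (2 * (q + 1))} := by
      refine measureReal_mono ?_
      intro ω hω
      simp only [Set.mem_ofPred_eq] at hω ⊢
      calc t ^ (2 * (q + 1)) * V ^ (q + 1) = (t * Real.sqrt V) ^ (2 * (q + 1)) := by
            rw [mul_pow, pow_mul (Real.sqrt V), Real.sq_sqrt hV.le]
        _ ≤ _ := by gcongr
    refine hsub.trans ?_
    rw [le_div_iff₀ (by positivity)]
    have h3 := hm.trans h
    rw [mul_pow] at h3
    have h4 : 0 < V ^ (q + 1) := by positivity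
    nlinarith

/-- Conditioning on an independent random variable. -/
theorem measureReal_indep_le {Ω α β : Type*} [MeasurableSpace Ω] [MeasurableSpace α]
    [MeasurableSpace β] (P : Measure Ω) [IsProbabilityMeasure P] {U : Ω → α} {V : Ω → β}
    (hU : Measurable U) (hV : Measurable V) (hUV : IndepFun U V P) {E : Set (α × β)}
    (hE : MeasurableSet E) {c : ℝ} (hc : 0 ≤ c)
    (h : ∀ y, P.real {ω | (U ω, y) ∈ E} ≤ c) : P.real {ω | (U ω, V ω) ∈ E} ≤ c := by
  have h1 : P {ω | (U ω, V ω) ∈ E} = ((P.map U).prod (P.map V)) E := by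
    rw [← (indepFun_iff_map_prod_eq_prod_map_map hU.aemeasurable hV.aemeasurable).1 hUV,
      Measure.map_apply (hU.prodMk hV) hE]
    rfl
  have : IsProbabilityMeasure (P.map U) := Measure.isProbabilityMeasure_map hU.aemeasurable
  have : IsProbabilityMeasure (P.map V) := Measure.isProbabilityMeasure_map hV.aemeasurable
  rw [measureReal_def, h1, Measure.prod_apply_symm hE]
  refine ENNReal.toReal_le_of_le_ofReal hc ?_
  calc ∫⁻ y, (P.map U) ((fun x => (x, y)) ⁻¹' E) ∂(P.map V)
      ≤ ∫⁻ _y, ENNReal.ofReal c ∂(P.map V) := by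
        refine lintegral_mono fun y => ?_
        rw [Measure.map_apply hU (measurable_prodMk_right hE)]
        refine (ENNReal.le_ofReal_iff_toReal_le (measure_ne_top _ _) hc).2 ?_
        exact h y
    _ = ENNReal.ofReal c := by simp

end LargeDeviation
end LocalSemicircle
end

/-! ### Measurability and independence of a row from its minor -/

noncomputable section
namespace LocalSemicircle

section Measurability

variable {N : ℕ}

theorem measurable_res (z : ℂ) (i j : Fin N) :
    Measurable (fun y : Fin N → Fin N → ℂ => res (Matrix.of y) z i j) := by
  have hc : Continuous (fun y : Fin N → Fin N → ℂ =>
      (Matrix.of y - z • (1 : Matrix (Fin N) (Fin N) ℂ))) := by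
    refine continuous_matrix fun a b => ?_
    simp only [Matrix.sub_apply, Matrix.of_apply]
    fun_prop
  have h1 : Measurable (fun y : Fin N → Fin N → ℂ =>
      (Matrix.of y - z • (1 : Matrix (Fin N) (Fin N) ℂ)).det) := hc.matrix_det.measurable
  have h2 : Measurable (fun y : Fin N → Fin N → ℂ =>
      (Matrix.of y - z • (1 : Matrix (Fin N) (Fin N) ℂ)).adjugate i j) :=
    (hc.matrix_adjugate.matrix_elem i j).measurable
  simp only [res, Matrix.inv_def, Ring.inverse_eq_inv', Matrix.smul_apply, smul_eq_mul]
  exact h1.inv.mul h2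

theorem measurable_mres (z : ℂ) (T : Finset (Fin N)) (i j : Fin N) :
    Measurable (fun y : Fin N → Fin N → ℂ => mres (Matrix.of y) z T i j) := by
  have h : Measurable (fun (y : Fin N → Fin N → ℂ) (a b : Fin N) =>
      minorize T (Matrix.of y) a b) := by
    refine measurable_pi_lambda _ fun a => measurable_pi_lambda _ fun b => ?_
    simp only [minorize_apply, Matrix.of_apply]
    split_ifs
    · exact measurable_const
    · fun_prop
  exact (measurable_res z i j).comp h

theorem measurable_fluct (S : Matrix (Fin N) (Fin N) ℝ) (z : ℂ) (k : Fin N) (T : Finset (Fin N)) :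
    Measurable (fun y : Fin N → Fin N → ℂ => fluct S (Matrix.of y) z k T) := by
  unfold fluct
  refine ((measurable_mres z T k k).inv.add_const _).add
    (Finset.measurable_sum _ fun a _ => measurable_const.mul ?_)
  split_ifs
  · exact measurable_const
  · exact measurable_mres z _ a a

/-- For k ∈ T the resolvent does not see row k, so it is a function of the minor without k. This is
how independence of that row is used. -/
theorem mres_minorize (H : Matrix (Fin N) (Fin N) ℂ) (z : ℂ) {k : Fin N} {T : Finset (Fin N)}
    (hk : k ∈ T) : mres (minorize {k} H) z T = mres H z T := by
  rw [mres, mres, minorize_minorize, Finset.union_eq_left.2 (by simpa using hk)]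

theorem fluct_minorize (S : Matrix (Fin N) (Fin N) ℝ) (H : Matrix (Fin N) (Fin N) ℂ) (z : ℂ)
    {k : Fin N} (l : Fin N) {T : Finset (Fin N)} (hk : k ∈ T) :
    fluct S (minorize {k} H) z l T = fluct S H z l T := by
  simp only [fluct, mres_minorize H z hk, mres_minorize H z (Finset.mem_insert_of_mem hk)]

/-- The fluctuation as a centred quadratic form in the entries of one row. -/
theorem fluct_eq (S : Matrix (Fin N) (Fin N) ℝ) {H : Matrix (Fin N) (Fin N) ℂ} (hH : H.IsHermitian)
    {z : ℂ} (hz : 0 < z.im) {k : Fin N} {T : Finset (Fin N)} (hk : k ∉ T) :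
    fluct S H z k T = H k k - ∑ b ∈ Finset.univ \ insert k T, ∑ a ∈ Finset.univ \ insert k T,
      mres H z (insert k T) b a * (H k b * star (H k a) - if b = a then (S k b : ℂ) else 0) := by
  have h := inv_res_diag (isHermitian_minorize hH T) hz k
  have hsub : Finset.univ \ insert k T ⊆ Finset.univ.erase k := by
    intro x; simp only [Finset.mem_sdiff, Finset.mem_erase, Finset.mem_insert]; tauto
  have hout : ∀ x ∈ Finset.univ.erase k, x ∉ Finset.univ \ insert k T → x ∈ T := by
    intro x; simp only [Finset.mem_sdiff, Finset.mem_erase, Finset.mem_insert]; tauto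
  have hin : ∀ x ∈ Finset.univ \ insert k T, x ∉ T := by
    intro x; simp only [Finset.mem_sdiff, Finset.mem_insert]; tauto
  have e1 : ∑ b ∈ Finset.univ.erase k, ∑ a ∈ Finset.univ.erase k,
        minorize T H k b * mres (minorize T H) z {k} b a * minorize T H a k =
      ∑ b ∈ Finset.univ \ insert k T, ∑ a ∈ Finset.univ \ insert k T,
        mres H z (insert k T) b a * (H k b * star (H k a)) := by
    rw [← Finset.sum_subset hsub]
    · refine Finset.sum_congr rfl fun b hb => ?_
      rw [← Finset.sum_subset hsub]
      · refine Finset.sum_congr rfl fun a ha => ?_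
        rw [← mres_insert, minorize_apply, minorize_apply, if_neg (by simp [hk, hin b hb]),
          if_neg (by simp [hk, hin a ha]), ← hH.apply a k]
        ring
      · intro a ha ha'
        rw [minorize_apply T H a k, if_pos (Or.inl (hout a ha ha')), mul_zero]
    · intro b hb hb'
      refine Finset.sum_eq_zero fun a _ => ?_
      rw [minorize_apply T H k b, if_pos (Or.inr (hout b hb hb')), zero_mul, zero_mul]
  have e2 : ∑ a ∈ Finset.univ.erase k, (S k a : ℂ) * (if a ∈ T then 0 else mres H z (insert k T) a a)
      = ∑ b ∈ Finset.univ \ insert k T, ∑ a ∈ Finset.univ \ insert k T,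
        mres H z (insert k T) b a * (if b = a then (S k b : ℂ) else 0) := by
    rw [← Finset.sum_subset hsub]
    · refine Finset.sum_congr rfl fun b hb => ?_
      rw [Finset.sum_eq_single b, if_neg (hin b hb), if_pos rfl, mul_comm]
      · intro a _ hab; rw [if_neg hab.symm, mul_zero]
      · intro h'; exact absurd hb h'
    · intro a ha ha'
      rw [if_pos (hout a ha ha'), mul_zero]
  rw [e1, minorize_apply T H k k, if_neg (by simp [hk])] at h
  simp only [fluct, mul_sub, Finset.sum_sub_distrib]
  rw [e2, mres, h]
  ring

end Measurability

namespace Ensemble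

variable {δ : ℝ} {μ : ℕ → ℝ} {N : ℕ} (A : Ensemble δ μ N)

theorem isHermitian_H (ω : A.Ω) : (A.H ω).IsHermitian := by
  ext i j
  rw [Matrix.conjTranspose_apply]
  exact (A.hermitian j i ω).symm

theorem S_apply (i j : Fin N) : A.S i j = ∫ ω, ‖A.h i j ω‖ ^ 2 ∂A.P := rfl

theorem S_nonneg (i j : Fin N) : 0 ≤ A.S i j := integral_nonneg fun ω => by positivity

theorem S_symm (i j : Fin N) : A.S i j = A.S j i := by
  rw [S_apply, S_apply]
  refine integral_congr_ae (Filter.Eventually.of_forall fun ω => ?_)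
  simp only [A.hermitian i j ω, norm_star]

theorem S_row_sum (i : Fin N) : ∑ j, A.S i j = 1 := A.stochastic i

theorem S_col_sum (j : Fin N) : ∑ i, A.S i j = 1 := by
  simp only [A.S_symm _ j]; exact A.stochastic j

theorem M_pos (hN : 0 < N) : 0 < A.M :=
  lt_of_lt_of_le (Real.rpow_pos_of_pos (by exact_mod_cast hN) δ) A.lower_M

theorem one_le_M (hN : 0 < N) (hδ : 0 ≤ δ) : 1 ≤ A.M :=
  (Real.one_le_rpow (by exact_mod_cast hN) hδ).trans A.lower_M

theorem S_le (i j : Fin N) : A.S i j ≤ 1 / A.M := by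
  have h : (1 : ℝ) / A.M = ⨆ p : Fin N × Fin N, A.S p.1 p.2 := by
    rw [M, bandParameter, one_div_one_div]
  rw [h]
  exact le_ciSup (f := fun p : Fin N × Fin N => A.S p.1 p.2) (Set.finite_range _).bddAbove (i, j)

theorem allLp_h (i j : Fin N) : AllLp A.P (A.h i j) := A.memLp i j

/-- Where the variance vanishes the entry is almost surely zero; elsewhere undo the normalization.
As μ is an arbitrary sequence, its absolute value serves as a nonnegative constant. -/
theorem moment_h_le (i j : Fin N) (r : ℕ) :
    ∫ ω, ‖A.h i j ω‖ ^ (2 * (r + 1)) ∂A.P ≤ |μ (2 * (r + 1))| * A.S i j ^ (r + 1) := by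
  rcases (A.S_nonneg i j).eq_or_lt with h0 | h0
  · have h1 : ∫ ω, ‖A.h i j ω‖ ^ 2 ∂A.P = 0 := h0.symm
    rw [integral_eq_zero_iff_of_nonneg (fun ω => by positivity)
      ((A.allLp_h i j).integrable_norm_pow 2)] at h1
    have : ∫ ω, ‖A.h i j ω‖ ^ (2 * (r + 1)) ∂A.P = 0 := by
      rw [← integral_zero (α := A.Ω) (G := ℝ) (μ := A.P)]
      refine integral_congr_ae ?_
      filter_upwards [h1] with ω hω
      rw [pow_mul, hω]
      simp
    rw [this, ← h0]; simp
  · have h1 : ∫ ω, ‖(A.S i j ^ (-(1 / 2) : ℝ) : ℝ) • A.h i j ω‖ ^ (2 * (r + 1)) ∂A.P ≤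
        μ (2 * (r + 1)) := A.moments i j (2 * (r + 1)) h0.ne'
    simp only [norm_smul, mul_pow] at h1
    have e : (A.S i j ^ (-(1 / 2) : ℝ)) ^ 2 = (A.S i j)⁻¹ := by
      rw [← Real.rpow_natCast, ← Real.rpow_mul h0.le,
        show (-(1 / 2) * ((2 : ℕ) : ℝ)) = -1 by norm_num, Real.rpow_neg_one]
    rw [integral_const_mul, Real.norm_eq_abs, pow_mul |_|, sq_abs, e, inv_pow] at h1
    have hp : 0 < A.S i j ^ (r + 1) := by positivity
    rw [inv_mul_le_iff₀ hp] at h1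
    calc _ ≤ _ := h1
      _ ≤ A.S i j ^ (r + 1) * |μ (2 * (r + 1))| := by gcongr; exact le_abs_self _
      _ = _ := mul_comm _ _

/-- Position of the pair `{k, j}` in the upper triangle. -/
def upperPair (k j : Fin N) : {p : Fin N × Fin N // p.1 ≤ p.2} :=
  if h : k ≤ j then ⟨(k, j), h⟩ else ⟨(j, k), (not_le.1 h).le⟩

theorem upperPair_injective (k : Fin N) : Function.Injective (upperPair k) := by
  intro a b hab
  unfold upperPair at hab
  split_ifs at hab with h1 h2 h2 <;> simp only [Subtype.mk.injEq, Prod.mk.injEq] at hab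
  · exact hab.2
  · obtain ⟨rfl, rfl⟩ := hab; rfl
  · obtain ⟨rfl, rfl⟩ := hab; rfl
  · exact hab.1

theorem h_eq_upperPair (k j : Fin N) (ω : A.Ω) : A.h k j ω =
    (fun x : ℂ => if k ≤ j then x else star x)
      (A.h (upperPair k j).1.1 (upperPair k j).1.2 ω) := by
  unfold upperPair
  split_ifs with h
  · rfl
  · exact A.hermitian j k ω

theorem iIndepFun_row (k : Fin N) : iIndepFun (fun j => A.h k j) A.P := by
  have h := (A.indep.precomp (upperPair_injective k)).comp
    (fun j (x : ℂ) => if k ≤ j then x else star x) (fun j => by split_ifs <;> fun_prop)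
  have e : (fun j => A.h k j) = fun j => (fun x : ℂ => if k ≤ j then x else star x) ∘
      A.h (upperPair k j).1.1 (upperPair k j).1.2 := by
    funext j ω; exact A.h_eq_upperPair k j ω
  rw [e]; exact h

theorem indepFamily_row (k : Fin N) (q : ℕ) :
    IndepFamily A.P (fun j => A.h k j) (fun j => A.S k j) q |μ (2 * (q + 1))| where
  indep := A.iIndepFun_row k
  meas := A.measurable k
  allLp := A.allLp_h k
  mean := A.mean_zero k
  v_nonneg := A.S_nonneg k
  moment j := A.moment_h_le k j q

/-- A row is independent of the minor obtained by deleting it. -/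
theorem indepFun_row_minor (k : Fin N) :
    IndepFun (fun ω j => A.h k j ω) (fun ω i j => minorize {k} (A.H ω) i j) A.P := by
  classical
  -- The positions of the upper triangle that lie in row or column k. The row is a function of the
  -- entries in s, the minor of those outside.
  let s : Finset {p : Fin N × Fin N // p.1 ≤ p.2} := {p | p.1.1 = k ∨ p.1.2 = k}
  have hs : ∀ j, upperPair k j ∈ s := by
    intro j; simp only [s, Finset.mem_filter_univ, upperPair]; split_ifs <;> simp
  have hs' : ∀ i j, i ≠ k → j ≠ k → upperPair i j ∈ sᶜ := by
    intro i j hi hj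
    simp only [s, Finset.mem_compl, Finset.mem_filter_univ, upperPair]
    split_ifs <;> simp [hi, hj]
  have h := A.indep.indepFun_finset s sᶜ disjoint_compl_right (fun p => A.measurable _ _)
  have m1 : Measurable (fun (y : s → ℂ) (j : Fin N) =>
      (fun x : ℂ => if k ≤ j then x else star x) (y ⟨upperPair k j, hs j⟩)) := by
    refine measurable_pi_lambda _ fun j => ?_
    split_ifs <;> fun_prop
  have m2 : Measurable (fun (y : (sᶜ : Finset _) → ℂ) (i j : Fin N) =>
      if h : i ≠ k ∧ j ≠ k then
        (fun x : ℂ => if i ≤ j then x else star x) (y ⟨upperPair i j, hs' i j h.1 h.2⟩) else 0) := by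
    refine measurable_pi_lambda _ fun i => measurable_pi_lambda _ fun j => ?_
    split_ifs <;> fun_prop
  refine (h.comp m1 m2).congr (Filter.Eventually.of_forall fun ω => ?_)
    (Filter.Eventually.of_forall fun ω => ?_)
  · funext j
    exact (A.h_eq_upperPair k j ω).symm
  · funext i j
    simp only [Function.comp_apply]
    by_cases hij : i ≠ k ∧ j ≠ k
    · have e : minorize {k} (A.H ω) i j = A.h i j ω := by
        rw [minorize_apply, if_neg (by simp [hij.1, hij.2])]; rfl
      rw [dif_pos hij, e]
      exact (A.h_eq_upperPair i j ω).symm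
    · have e : minorize {k} (A.H ω) i j = 0 := by
        rw [minorize_apply, if_pos]
        simp only [Finset.mem_singleton]; tauto
      rw [dif_neg hij, e]

theorem measurable_minor (T : Finset (Fin N)) : Measurable (fun ω i j => minorize T (A.H ω) i j) := by
  refine measurable_pi_lambda _ fun i => measurable_pi_lambda _ fun j => ?_
  simp only [minorize_apply]
  split_ifs
  · exact measurable_const
  · exact A.measurable i j

theorem measurable_mres_H (z : ℂ) (T : Finset (Fin N)) (i j : Fin N) :
    Measurable (fun ω => mres (A.H ω) z T i j) :=
  (measurable_mres z T i j).comp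
    (measurable_pi_lambda _ fun i => measurable_pi_lambda _ fun j => A.measurable i j)

variable {z : ℂ}

theorem norm_mres_H_le (hz : 0 < z.im) (T : Finset (Fin N)) (i j : Fin N) (ω : A.Ω) :
    ‖mres (A.H ω) z T i j‖ ≤ 1 / z.im :=
  norm_res_le (isHermitian_minorize (A.isHermitian_H ω) T) hz i j

theorem allLp_mres (hz : 0 < z.im) (T : Finset (Fin N)) (i j : Fin N) :
    AllLp A.P (fun ω => mres (A.H ω) z T i j) :=
  allLp_of_bound (A.measurable_mres_H z T i j).aestronglyMeasurable _
    (A.norm_mres_H_le hz T i j)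

theorem indepFun_row_mres (z : ℂ) (k : Fin N) {T : Finset (Fin N)} (hk : k ∈ T) :
    IndepFun (fun ω j => A.h k j ω) (fun ω i j => mres (A.H ω) z T i j) A.P := by
  have h := (A.indepFun_row_minor k).comp (φ := id)
    (ψ := fun (y : Fin N → Fin N → ℂ) i j => mres (Matrix.of y) z T i j) measurable_id
    (measurable_pi_lambda _ fun i => measurable_pi_lambda _ fun j => measurable_mres z T i j)
  refine h.congr (Filter.Eventually.of_forall fun ω => rfl)
    (Filter.Eventually.of_forall fun ω => ?_)
  funext i j
  exact congrFun (congrFun (mres_minorize (A.H ω) z hk) i) j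

theorem measurable_row (k : Fin N) : Measurable (fun ω j => A.h k j ω) :=
  measurable_pi_lambda _ fun j => A.measurable k j

end Ensemble

/-- Large deviation bounds for the entries of a row, a linear and a quadratic form in it. -/
theorem large_deviation (μ : ℕ → ℝ) (q : ℕ) : ∃ C : ℝ, 1 ≤ C ∧
    ∀ {δ : ℝ} {N : ℕ} (A : Ensemble δ μ N) (z : ℂ), 0 < z.im → ∀ (k : Fin N) (t : ℝ), 0 < t →
      A.P.real {ω | t * Real.sqrt (A.S k k) < ‖A.h k k ω‖} ≤ C ^ (q + 1) / t ^ (2 * (q + 1)) ∧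
      (∀ j, A.P.real {ω | t * Real.sqrt (∑ b, ‖mres (A.H ω) z {k} b j‖ ^ 2 * A.S k b) <
        ‖∑ b, A.h k b ω * mres (A.H ω) z {k} b j‖} ≤ C ^ (q + 1) / t ^ (2 * (q + 1))) ∧
      A.P.real {ω | t * Real.sqrt (∑ b ∈ Finset.univ \ {k}, ∑ a ∈ Finset.univ \ {k},
          ‖mres (A.H ω) z {k} b a‖ ^ 2 * (A.S k b * A.S k a)) <
        ‖∑ b ∈ Finset.univ \ {k}, ∑ a ∈ Finset.univ \ {k}, mres (A.H ω) z {k} b a *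
          (A.h k b ω * star (A.h k a ω) - if b = a then (A.S k b : ℂ) else 0)‖} ≤
        C ^ (q + 1) / t ^ (2 * (q + 1)) := by
  obtain ⟨C₁, hC₁, hlin⟩ := moment_linear_form q |μ (2 * (q + 1))| (abs_nonneg _)
  -- The index 2(2q+1+1) is 4(q+1), written in the shape of `moment_h_le`.
  obtain ⟨C₂, hC₂, hquad⟩ := moment_quadratic_form q |μ (2 * (q + 1))|
    |μ (2 * (2 * q + 1 + 1))| (abs_nonneg _) (abs_nonneg _)
  have hmono : ∀ {C t : ℝ}, 0 ≤ C → C ≤ C₁ + C₂ → 0 < t →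
      C ^ (q + 1) / t ^ (2 * (q + 1)) ≤ (C₁ + C₂) ^ (q + 1) / t ^ (2 * (q + 1)) := by
    intro C t h0 h ht; gcongr
  refine ⟨C₁ + C₂, by linarith, ?_⟩
  intro δ N A z hz k t ht
  have hfam := A.indepFamily_row k q
  have hS := A.S_nonneg k
  have hmr : Measurable (fun ω i j => mres (A.H ω) z {k} i j) :=
    measurable_pi_lambda _ fun i => measurable_pi_lambda _ fun j => A.measurable_mres_H z {k} i j
  have hind := A.indepFun_row_mres z k (Finset.mem_singleton_self k)
  refine ⟨?_, fun j => ?_, ?_⟩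
  · have h := hlin A.P _ _ hfam (fun _ => 1) {k}
    simp only [Finset.sum_singleton, one_mul, norm_one, one_pow] at h
    exact (measureReal_lt_norm_le A.P (A.allLp_h k k) (by linarith) (hS k) ht h).trans
      (hmono (by linarith) (by linarith) ht)
  · refine le_trans ?_ (hmono (C := C₁) (by linarith) (by linarith) ht)
    -- The minor is independent of row k and may be frozen; the coefficients of the form are then
    -- deterministic.
    refine measureReal_indep_le A.P (A.measurable_row k) hmr hind
      (E := {p : (Fin N → ℂ) × (Fin N → Fin N → ℂ) |
        t * Real.sqrt (∑ b, ‖p.2 b j‖ ^ 2 * A.S k b) < ‖∑ b, p.1 b * p.2 b j‖})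
      (measurableSet_lt (by fun_prop) (by fun_prop)) (by positivity) fun y => ?_
    have h := hlin A.P _ _ hfam (fun b => y b j) Finset.univ
    have := measureReal_lt_norm_le A.P (AllLp.sum Finset.univ fun b _ =>
      (A.allLp_h k b).const_mul (y b j)) (by linarith : (0 : ℝ) ≤ C₁)
      (Finset.sum_nonneg fun b _ => mul_nonneg (by positivity) (hS b)) ht h
    simp only [mul_comm (y _ j)] at this
    exact this
  · refine le_trans ?_ (hmono (C := C₂) (by linarith) (by linarith) ht)
    refine measureReal_indep_le A.P (A.measurable_row k) hmr hind
      (E := {p : (Fin N → ℂ) × (Fin N → Fin N → ℂ) |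
        t * Real.sqrt (∑ b ∈ Finset.univ \ {k}, ∑ a ∈ Finset.univ \ {k},
          ‖p.2 b a‖ ^ 2 * (A.S k b * A.S k a)) <
        ‖∑ b ∈ Finset.univ \ {k}, ∑ a ∈ Finset.univ \ {k}, p.2 b a *
          (p.1 b * star (p.1 a) - if b = a then (A.S k b : ℂ) else 0)‖})
      (measurableSet_lt (by fun_prop) (by fun_prop)) (by positivity) fun y => ?_
    have hmom : ∀ b, ∫ ω, ‖A.h k b ω‖ ^ (4 * (q + 1)) ∂A.P ≤
        |μ (2 * (2 * q + 1 + 1))| * A.S k b ^ (2 * (q + 1)) := by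
      intro b
      rw [show 4 * (q + 1) = 2 * (2 * q + 1 + 1) by ring, show 2 * (q + 1) = 2 * q + 1 + 1 by ring]
      exact A.moment_h_le k b (2 * q + 1)
    have h := hquad A.P _ _ hfam (fun b => rfl) hmom y (Finset.univ \ {k})
    have hV : 0 ≤ ∑ b ∈ Finset.univ \ {k}, ∑ a ∈ Finset.univ \ {k},
        ‖y b a‖ ^ 2 * (A.S k b * A.S k a) := Finset.sum_nonneg fun b _ =>
      Finset.sum_nonneg fun a _ => mul_nonneg (by positivity) (mul_nonneg (hS b) (hS a))
    have hZ : AllLp A.P (fun ω => ∑ b ∈ Finset.univ \ {k}, ∑ a ∈ Finset.univ \ {k}, y b a *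
          (A.h k b ω * star (A.h k a ω) - if b = a then (A.S k b : ℂ) else 0)) := by
      refine AllLp.sum _ fun b _ => AllLp.sum _ fun a _ => AllLp.const_mul ?_ _
      exact ((A.allLp_h k b).mul (A.allLp_h k a).star).sub (allLp_const _)
    exact measureReal_lt_norm_le A.P hZ (by linarith : (0 : ℝ) ≤ C₂) hV ht h

end LocalSemicircle
end

/-! ### Fluctuation averaging: one step of the recursion -/

noncomputable section
namespace LocalSemicircle

section Elementary

/-- The function g(y) = y^q ȳ^{q+1} satisfies y g(y) = |y|^{2(q+1)}. This is its Lipschitz bound, by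
telescoping the powers, and lets g of an average be compared with g of the average in a minor. -/
theorem norm_pow_conj_sub_le (q : ℕ) : ∃ C : ℝ, 1 ≤ C ∧ ∀ y w : ℂ,
    ‖y ^ q * star y ^ (q + 1) - (y - w) ^ q * star (y - w) ^ (q + 1)‖ ≤
      C * (‖w‖ * (‖y‖ ^ (2 * q) + ‖w‖ ^ (2 * q))) := by
  have hpow : ∀ (n : ℕ) (a b : ℂ) (r : ℝ), ‖a‖ ≤ r → ‖b‖ ≤ r →
      ‖a ^ (n + 1) - b ^ (n + 1)‖ ≤ (n + 1) * (‖a - b‖ * r ^ n) := by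
    intro n a b r ha hb
    have hr : 0 ≤ r := (norm_nonneg a).trans ha
    induction n with
    | zero => simp
    | succ n ih =>
      have e : a ^ (n + 1 + 1) - b ^ (n + 1 + 1) = a * (a ^ (n + 1) - b ^ (n + 1)) +
          (a - b) * b ^ (n + 1) := by ring
      rw [e]
      calc _ ≤ ‖a‖ * ‖a ^ (n + 1) - b ^ (n + 1)‖ + ‖a - b‖ * ‖b‖ ^ (n + 1) := by
            refine (norm_add_le _ _).trans ?_
            rw [norm_mul, norm_mul, norm_pow]
        _ ≤ r * ((n + 1) * (‖a - b‖ * r ^ n)) + ‖a - b‖ * r ^ (n + 1) := by gcongr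
        _ = _ := by push_cast; ring
  refine ⟨(2 * q + 2) * 4 ^ q, by
    have : (1 : ℝ) ≤ 4 ^ q := one_le_pow₀ (by norm_num)
    nlinarith [(Nat.cast_nonneg q : (0 : ℝ) ≤ q)], ?_⟩
  intro y w
  set r : ℝ := ‖y‖ + ‖w‖ with hr
  have hr0 : 0 ≤ r := by positivity
  have hy : ‖y‖ ≤ r := by rw [hr]; linarith [norm_nonneg w]
  have hyw : ‖y - w‖ ≤ r := norm_sub_le _ _
  have h1 : ‖star y ^ (q + 1) - star (y - w) ^ (q + 1)‖ ≤ (q + 1) * (‖w‖ * r ^ q) := by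
    have := hpow q (star y) (star (y - w)) r (by rwa [norm_star]) (by rwa [norm_star])
    rwa [← star_sub, norm_star, sub_sub_cancel] at this
  have h2 : ‖y ^ q - (y - w) ^ q‖ * r ≤ (q + 1) * (‖w‖ * r ^ q) := by
    rcases q with _ | n
    · simp
    · have := hpow n y (y - w) r hy hyw
      rw [sub_sub_cancel] at this
      calc _ ≤ (n + 1) * (‖w‖ * r ^ n) * r := by gcongr
        _ = (n + 1) * (‖w‖ * r ^ (n + 1)) := by ring
        _ ≤ _ := by push_cast; gcongr; linarith
  have e : y ^ q * star y ^ (q + 1) - (y - w) ^ q * star (y - w) ^ (q + 1) =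
      y ^ q * (star y ^ (q + 1) - star (y - w) ^ (q + 1)) +
      (y ^ q - (y - w) ^ q) * star (y - w) ^ (q + 1) := by ring
  rw [e]
  calc _ ≤ ‖y‖ ^ q * ‖star y ^ (q + 1) - star (y - w) ^ (q + 1)‖ +
        ‖y ^ q - (y - w) ^ q‖ * ‖y - w‖ ^ (q + 1) := by
        refine (norm_add_le _ _).trans ?_
        rw [norm_mul, norm_mul, norm_pow, norm_pow, norm_star]
    _ ≤ r ^ q * ((q + 1) * (‖w‖ * r ^ q)) + ‖y ^ q - (y - w) ^ q‖ * r ^ (q + 1) := by gcongr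
    _ = r ^ q * ((q + 1) * (‖w‖ * r ^ q)) + (‖y ^ q - (y - w) ^ q‖ * r) * r ^ q := by ring
    _ ≤ r ^ q * ((q + 1) * (‖w‖ * r ^ q)) + ((q + 1) * (‖w‖ * r ^ q)) * r ^ q := by gcongr
    _ = (2 * q + 2) * (‖w‖ * r ^ (2 * q)) := by rw [two_mul q, pow_add]; ring
    _ ≤ (2 * q + 2) * (‖w‖ * (4 ^ q * (‖y‖ ^ (2 * q) + ‖w‖ ^ (2 * q)))) := by
        gcongr
        rcases q with _ | n
        · simp
        · exact add_pow_le_four_pow (norm_nonneg _) (norm_nonneg _) n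
    _ = _ := by ring

theorem mul_pow_le_young {a b θ : ℝ} (ha : 0 ≤ a) (hb : 0 ≤ b) (hθ : 0 < θ) (q : ℕ) :
    a * b ^ q ≤ θ * b ^ (q + 1) + (θ ^ q)⁻¹ * a ^ (q + 1) := by
  rcases le_total a (θ * b) with h | h
  · have h1 : a * b ^ q ≤ θ * b * b ^ q := by gcongr
    have h2 : 0 ≤ (θ ^ q)⁻¹ * a ^ (q + 1) := by positivity
    calc _ ≤ _ := h1
      _ = θ * b ^ (q + 1) := by ring
      _ ≤ _ := by linarith
  · have h1 : (θ * b) ^ q ≤ a ^ q := by gcongr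
    have h2 : 0 ≤ θ * b ^ (q + 1) := by positivity
    have h3 : a * b ^ q ≤ (θ ^ q)⁻¹ * a ^ (q + 1) := by
      rw [inv_mul_eq_div, le_div_iff₀ (by positivity)]
      calc a * b ^ q * θ ^ q = a * (θ * b) ^ q := by rw [mul_pow]; ring
        _ ≤ a * a ^ q := by gcongr
        _ = _ := by ring
    linarith

end Elementary

namespace Ensemble

variable {δ : ℝ} {μ : ℕ → ℝ} {N : ℕ} (A : Ensemble δ μ N) {z : ℂ}

theorem allLp_fluct (hz : 0 < z.im) {k : Fin N} {T : Finset (Fin N)} (hk : k ∉ T) :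
    AllLp A.P (fun ω => fluct A.S (A.H ω) z k T) := by
  simp only [fun ω => fluct_eq A.S (A.isHermitian_H ω) hz hk]
  refine (A.allLp_h k k).sub (AllLp.sum _ fun b _ => AllLp.sum _ fun a _ => ?_)
  exact (A.allLp_mres hz _ b a).mul
    (((A.allLp_h k b).mul (A.allLp_h k a).star).sub (allLp_const _))

theorem integral_row_mul_eq_zero {k : Fin N} {φ : (Fin N → ℂ) → ℂ} {F : (Fin N → Fin N → ℂ) → ℂ}
    (hφ : Measurable φ) (hF : Measurable F) (h0 : ∫ ω, φ (fun j => A.h k j ω) ∂A.P = 0) :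
    ∫ ω, φ (fun j => A.h k j ω) * F (fun i j => minorize {k} (A.H ω) i j) ∂A.P = 0 :=
  integral_mul_eq_zero_of_indep ((A.indepFun_row_minor k).comp hφ hF)
    (hφ.comp (A.measurable_row k)).aestronglyMeasurable
    (hF.comp (A.measurable_minor {k})).aestronglyMeasurable h0

theorem integral_pair_eq_zero (k a b : Fin N) :
    ∫ ω, (A.h k b ω * star (A.h k a ω) - if b = a then (A.S k b : ℂ) else 0) ∂A.P = 0 := by
  rw [integral_sub ((A.allLp_h k b).mul (A.allLp_h k a).star).integrable (integrable_const _)]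
  by_cases hab : b = a
  · subst hab
    have e : ∀ ω, A.h k b ω * star (A.h k b ω) = ((‖A.h k b ω‖ ^ 2 : ℝ) : ℂ) := by
      intro ω; rw [Complex.star_def, Complex.mul_conj']; push_cast; rfl
    simp only [e, if_true]
    rw [(integral_ofReal (𝕜 := ℂ) (f := fun ω => ‖A.h k b ω‖ ^ 2) :
      ∫ ω, ((‖A.h k b ω‖ ^ 2 : ℝ) : ℂ) ∂A.P = _), A.S_apply]
    simp
  · rw [if_neg hab, integral_zero, sub_zero]
    have hi := ((A.iIndepFun_row k).indepFun hab).comp (φ := id) (ψ := fun x : ℂ => star x)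
      measurable_id (by fun_prop)
    exact integral_mul_eq_zero_of_indep hi (A.allLp_h k b).aesm (A.allLp_h k a).star.aesm
      (A.mean_zero k b)

/-- The fluctuations of the `k`-th row are centred given the minor without that row. -/
theorem integral_fluct_mul_eq_zero (hz : 0 < z.im) {k : Fin N} {T : Finset (Fin N)} (hk : k ∉ T)
    {F : (Fin N → Fin N → ℂ) → ℂ} (hF : Measurable F)
    (hFLp : AllLp A.P (fun ω => F (fun i j => minorize {k} (A.H ω) i j))) :
    ∫ ω, fluct A.S (A.H ω) z k T * F (fun i j => minorize {k} (A.H ω) i j) ∂A.P = 0 := by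
  set W : A.Ω → ℂ := fun ω => F (fun i j => minorize {k} (A.H ω) i j) with hW
  have e : ∀ ω, fluct A.S (A.H ω) z k T * W ω = A.h k k ω * W ω -
      ∑ b ∈ Finset.univ \ insert k T, ∑ a ∈ Finset.univ \ insert k T,
        (A.h k b ω * star (A.h k a ω) - if b = a then (A.S k b : ℂ) else 0) *
          (mres (A.H ω) z (insert k T) b a * W ω) := by
    intro ω
    rw [fluct_eq A.S (A.isHermitian_H ω) hz hk, sub_mul, Finset.sum_mul]
    congr 1
    refine Finset.sum_congr rfl fun b _ => ?_
    rw [Finset.sum_mul]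
    refine Finset.sum_congr rfl fun a _ => ?_
    simp only [H, Matrix.of_apply]
    ring
  refine (integral_congr_ae (Filter.Eventually.of_forall e)).trans ?_
  have hterm : ∀ b a, AllLp A.P (fun ω =>
      (A.h k b ω * star (A.h k a ω) - if b = a then (A.S k b : ℂ) else 0) *
        (mres (A.H ω) z (insert k T) b a * W ω)) := fun b a =>
    (((A.allLp_h k b).mul (A.allLp_h k a).star).sub (allLp_const _)).mul
      ((A.allLp_mres hz _ b a).mul hFLp)
  rw [integral_sub ((A.allLp_h k k).mul hFLp).integrable
    (AllLp.sum _ fun b _ => AllLp.sum _ fun a _ => hterm b a).integrable,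
    integral_finsetSum _ fun b _ => (AllLp.sum _ fun a _ => hterm b a).integrable]
  have z1 : ∫ ω, A.h k k ω * W ω ∂A.P = 0 :=
    A.integral_row_mul_eq_zero (φ := fun y => y k) (measurable_pi_apply k) hF (A.mean_zero k k)
  rw [z1, zero_sub, neg_eq_zero]
  refine Finset.sum_eq_zero fun b _ => ?_
  rw [integral_finsetSum _ fun a _ => (hterm b a).integrable]
  refine Finset.sum_eq_zero fun a _ => ?_
  have := A.integral_row_mul_eq_zero (k := k)
    (φ := fun y => y b * star (y a) - if b = a then (A.S k b : ℂ) else 0)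
    (F := fun y => mres (Matrix.of y) z (insert k T) b a * F y) (by fun_prop)
    ((measurable_mres z _ b a).mul hF) (A.integral_pair_eq_zero k a b)
  refine Eq.trans (integral_congr_ae (Filter.Eventually.of_forall fun ω => ?_)) this
  have e2 := congrFun (congrFun (mres_minorize (A.H ω) z (Finset.mem_insert_self k T)) b) a
  simp only [← e2]
  rfl

/-- The iterated difference of the fluctuation of the `k`-th row. -/
def dfl (z : ℂ) (B : Finset (Fin N)) (k : Fin N) (T : Finset (Fin N)) (ω : A.Ω) : ℂ :=
  altDiff B (fluct A.S (A.H ω) z k) T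

/-- The weighted average of iterated differences of fluctuations. -/
def avgDfl (z : ℂ) (t : Fin N → ℝ) (B T : Finset (Fin N)) (ω : A.Ω) : ℂ :=
  ∑ l ∈ Finset.univ \ (T ∪ B), (t l : ℂ) * A.dfl z B l T ω

theorem allLp_dfl (hz : 0 < z.im) {B T : Finset (Fin N)} {k : Fin N} (hB : k ∉ B) (hT : k ∉ T) :
    AllLp A.P (A.dfl z B k T) := by
  unfold dfl altDiff
  refine AllLp.sum _ fun C hC => AllLp.const_mul (A.allLp_fluct hz ?_) _
  rw [Finset.mem_union, not_or]
  exact ⟨hT, fun h => hB (Finset.mem_powerset.1 hC h)⟩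

theorem allLp_avgDfl (hz : 0 < z.im) (t : Fin N → ℝ) (B T : Finset (Fin N)) :
    AllLp A.P (A.avgDfl z t B T) := by
  refine AllLp.sum _ fun l hl => AllLp.const_mul (A.allLp_dfl hz ?_ ?_) _
  · exact fun h => (Finset.mem_sdiff.1 hl).2 (Finset.mem_union_right _ h)
  · exact fun h => (Finset.mem_sdiff.1 hl).2 (Finset.mem_union_left _ h)

/-- Removing k drops the summand l = k; in every other summand the change is one more iterated
difference, now over `insert k B`. -/
theorem avgDfl_sub (t : Fin N → ℝ) {B : Finset (Fin N)} {k : Fin N} (hk : k ∉ B) (ω : A.Ω) :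
    A.avgDfl z t B ∅ ω - A.avgDfl z t B {k} ω =
      (t k : ℂ) * A.dfl z B k ∅ ω + A.avgDfl z t (insert k B) ∅ ω := by
  have h1 : Finset.univ \ (∅ ∪ B) = insert k (Finset.univ \ insert k B) := by
    ext x; simp only [Finset.mem_sdiff, Finset.mem_insert, Finset.mem_union]; grind
  have h2 : Finset.univ \ ({k} ∪ B) = Finset.univ \ insert k B := by rw [Finset.insert_eq]
  have h3 : Finset.univ \ (∅ ∪ insert k B) = Finset.univ \ insert k B := by
    rw [Finset.empty_union]
  unfold avgDfl
  rw [h1, h2, h3, Finset.sum_insert (by simp), add_sub_assoc, ← Finset.sum_sub_distrib]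
  congr 1
  refine Finset.sum_congr rfl fun l _ => ?_
  rw [← mul_sub, dfl, dfl, dfl, altDiff_insert' hk]
  rfl

/-- The average based at {k} is a function of the minor without row k, and each term of the iterated
difference for k is centred given that minor. -/
theorem integral_dfl_mul_eq_zero (hz : 0 < z.im) (t : Fin N → ℝ) {B : Finset (Fin N)} {k : Fin N}
    (hk : k ∉ B) (q : ℕ) :
    ∫ ω, A.dfl z B k ∅ ω * (A.avgDfl z t B {k} ω ^ q * star (A.avgDfl z t B {k} ω) ^ (q + 1)) ∂A.P
      = 0 := by
  set Y : (Fin N → Fin N → ℂ) → ℂ := fun y => ∑ l ∈ Finset.univ \ ({k} ∪ B),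
    (t l : ℂ) * altDiff B (fluct A.S (Matrix.of y) z l) {k} with hY
  have hYm : Measurable Y := by
    refine Finset.measurable_sum _ fun l _ => measurable_const.mul ?_
    exact Finset.measurable_sum _ fun C _ => measurable_const.mul (measurable_fluct _ _ _ _)
  have hYe : ∀ ω, Y (fun i j => minorize {k} (A.H ω) i j) = A.avgDfl z t B {k} ω := by
    intro ω
    refine Finset.sum_congr rfl fun l _ => ?_
    rw [dfl]
    congr 1
    refine altDiff_congr fun C _ => ?_
    exact fluct_minorize A.S (A.H ω) z l (by simp)
  have hLp := A.allLp_avgDfl hz t B {k}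
  have hWLp : AllLp A.P (fun ω => A.avgDfl z t B {k} ω ^ q * star (A.avgDfl z t B {k} ω) ^ (q + 1)) :=
    (hLp.pow q).mul (hLp.star.pow (q + 1))
  have hsplit : ∀ ω, A.dfl z B k ∅ ω *
      (A.avgDfl z t B {k} ω ^ q * star (A.avgDfl z t B {k} ω) ^ (q + 1)) =
      ∑ C ∈ B.powerset, (-1) ^ C.card * (fluct A.S (A.H ω) z k (∅ ∪ C) *
        (A.avgDfl z t B {k} ω ^ q * star (A.avgDfl z t B {k} ω) ^ (q + 1))) := by
    intro ω
    rw [dfl, altDiff, Finset.sum_mul]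
    exact Finset.sum_congr rfl fun C _ => by ring
  have hkC : ∀ C ∈ B.powerset, k ∉ ∅ ∪ C := by
    intro C hC h
    rw [Finset.empty_union] at h
    exact hk (Finset.mem_powerset.1 hC h)
  simp only [hsplit]
  rw [integral_finsetSum _ fun C hC =>
    (((A.allLp_fluct hz (hkC C hC)).mul hWLp).const_mul _).integrable]
  refine Finset.sum_eq_zero fun C hC => ?_
  rw [integral_const_mul]
  have hFm : Measurable (fun y => Y y ^ q * star (Y y) ^ (q + 1)) :=
    (hYm.pow_const q).mul ((continuous_star.measurable.comp hYm).pow_const (q + 1))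
  have := A.integral_fluct_mul_eq_zero hz (hkC C hC) hFm (by simpa only [hYe] using hWLp)
  simp only [hYe] at this
  rw [this, mul_zero]

end Ensemble

/-- One step of the fluctuation averaging recursion. -/
theorem moment_avgDfl_step (q : ℕ) : ∃ C : ℝ, 1 ≤ C ∧
    ∀ {δ : ℝ} {μ : ℕ → ℝ} {N : ℕ} (A : Ensemble δ μ N) (z : ℂ) (t : Fin N → ℝ) (B : Finset (Fin N))
      (τ x y : ℝ), 0 < z.im → (∀ l, 0 ≤ t l) → (∀ l, t l ≤ τ) → ∑ l, t l = 1 → 0 < y →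
      τ * x ≤ y → y ≤ x →
      (∀ k, k ∉ B → ∫ ω, ‖A.dfl z B k ∅ ω‖ ^ (2 * (q + 1)) ∂A.P ≤ x ^ (2 * (q + 1))) →
      (∀ k, k ∉ B → ∫ ω, ‖A.avgDfl z t (insert k B) ∅ ω‖ ^ (2 * (q + 1)) ∂A.P ≤
        y ^ (2 * (q + 1))) →
      ∫ ω, ‖A.avgDfl z t B ∅ ω‖ ^ (2 * (q + 1)) ∂A.P ≤ C * (x * y) ^ (q + 1) := by
  obtain ⟨C₀, hC₀, hg⟩ := norm_pow_conj_sub_le q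
  -- Chosen so that C₀θ = 1/2; the moment E on the right is then absorbed on the left.
  set θ : ℝ := (2 * C₀)⁻¹ with hθ
  have hC₀p : 0 < C₀ := by linarith
  have hθ0 : 0 < θ := by positivity
  set K : ℝ := ((θ ^ q)⁻¹ + 1) * 4 ^ (q + 1) + 16 ^ (q + 1) with hK
  have hK1 : 1 ≤ K := by
    have h1 : (1 : ℝ) ≤ 16 ^ (q + 1) := one_le_pow₀ (by norm_num)
    have h2 : 0 ≤ ((θ ^ q)⁻¹ + 1) * 4 ^ (q + 1) := by positivity
    linarith
  refine ⟨2 * C₀ * K, by nlinarith, ?_⟩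
  intro δ μ N A z t B τ x y hz ht0 htτ hts hy hτx hyx hX hY
  have hx : 0 < x := by linarith
  set Y : A.Ω → ℂ := A.avgDfl z t B ∅ with hYdef
  have hYLp : AllLp A.P Y := A.allLp_avgDfl hz t B ∅
  set R : Finset (Fin N) := Finset.univ \ (∅ ∪ B) with hR
  have hRB : ∀ k ∈ R, k ∉ B := by
    intro k hk; rw [hR, Finset.empty_union] at hk; exact (Finset.mem_sdiff.1 hk).2
  set E : ℝ := ∫ ω, ‖Y ω‖ ^ (2 * (q + 1)) ∂A.P with hE
  have hE0 : 0 ≤ E := integral_nonneg fun ω => by positivity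
  set X : Fin N → A.Ω → ℂ := fun k => A.dfl z B k ∅ with hXdef
  set W : Fin N → A.Ω → ℂ := fun k ω => (t k : ℂ) * X k ω + A.avgDfl z t (insert k B) ∅ ω with hW
  have hXLp : ∀ k ∈ R, AllLp A.P (X k) := fun k hk => A.allLp_dfl hz (hRB k hk) (by simp)
  have hWLp : ∀ k ∈ R, AllLp A.P (W k) := fun k hk =>
    ((hXLp k hk).const_mul _).add (A.allLp_avgDfl hz t _ _)
  have hYk : ∀ k ∈ R, ∀ ω, A.avgDfl z t B {k} ω = Y ω - W k ω := by
    intro k hk ω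
    have := A.avgDfl_sub (z := z) t (hRB k hk) ω
    simp only [hW, hXdef, hYdef, ← this]
    ring
  have hgLp : AllLp A.P (fun ω => Y ω ^ q * star (Y ω) ^ (q + 1)) :=
    (hYLp.pow q).mul (hYLp.star.pow (q + 1))
  have hg'Lp : ∀ k ∈ R, AllLp A.P (fun ω => (Y ω - W k ω) ^ q * star (Y ω - W k ω) ^ (q + 1)) :=
    fun k hk => ((hYLp.sub (hWLp k hk)).pow q).mul ((hYLp.sub (hWLp k hk)).star.pow (q + 1))
  -- Write |Y|^{2(q+1)} = Y g(Y) with g(y) = y^q ȳ^{q+1} and expand the first factor into the t_k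
  -- X_k. Since Y - W_k does not involve row k, g(Y - W_k) can be subtracted without changing the
  -- integral against X_k.
  have hEc : (E : ℂ) = ∑ k ∈ R, (t k : ℂ) *
      ∫ ω, X k ω * (Y ω ^ q * star (Y ω) ^ (q + 1) -
        (Y ω - W k ω) ^ q * star (Y ω - W k ω) ^ (q + 1)) ∂A.P := by
    have e1 : (E : ℂ) = ∫ ω, ∑ k ∈ R, (t k : ℂ) * (X k ω * (Y ω ^ q * star (Y ω) ^ (q + 1))) ∂A.P := by
      rw [hE]
      refine (integral_ofReal (𝕜 := ℂ) (f := fun ω => ‖Y ω‖ ^ (2 * (q + 1)))).symm.trans ?_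
      refine integral_congr_ae (Filter.Eventually.of_forall fun ω => ?_)
      have e2 : ∑ k ∈ R, (t k : ℂ) * (X k ω * (Y ω ^ q * star (Y ω) ^ (q + 1))) =
          Y ω * (Y ω ^ q * star (Y ω) ^ (q + 1)) := by
        refine Eq.trans ?_ (Finset.sum_mul R (fun k => (t k : ℂ) * X k ω)
          (Y ω ^ q * star (Y ω) ^ (q + 1))).symm
        exact Finset.sum_congr rfl fun k _ => by ring
      simp only [e2]
      have e3 : Y ω * (Y ω ^ q * star (Y ω) ^ (q + 1)) = (Y ω * star (Y ω)) ^ (q + 1) := by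
        rw [mul_pow]; ring
      rw [e3, Complex.star_def, Complex.mul_conj', pow_mul]
      push_cast
      rfl
    rw [e1, integral_finsetSum _ fun k hk => (((hXLp k hk).mul hgLp).const_mul _).integrable]
    refine Finset.sum_congr rfl fun k hk => ?_
    rw [integral_const_mul]
    congr 1
    have h0 := A.integral_dfl_mul_eq_zero hz t (hRB k hk) q
    simp only [hYk k hk] at h0
    simp only [mul_sub]
    rw [integral_sub ((hXLp k hk).mul hgLp).integrable ((hXLp k hk).mul (hg'Lp k hk)).integrable]
    rw [h0, sub_zero]
  have hWm : ∀ k ∈ R, ∫ ω, ‖W k ω‖ ^ (2 * (q + 1)) ∂A.P ≤ (4 * y) ^ (2 * (q + 1)) := by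
    intro k hk
    have i1 := ((hXLp k hk).const_mul (t k)).integrable_norm_pow (2 * (q + 1))
    have i2 := (A.allLp_avgDfl hz t (insert k B) ∅).integrable_norm_pow (2 * (q + 1))
    calc ∫ ω, ‖W k ω‖ ^ (2 * (q + 1)) ∂A.P
        ≤ ∫ ω, 4 ^ (q + 1) * (‖(t k : ℂ) * X k ω‖ ^ (2 * (q + 1)) +
            ‖A.avgDfl z t (insert k B) ∅ ω‖ ^ (2 * (q + 1))) ∂A.P := by
          refine integral_mono ((hWLp k hk).integrable_norm_pow _) ((i1.add i2).const_mul _)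
            fun ω => ?_
          exact (pow_le_pow_left₀ (norm_nonneg _) (norm_add_le _ _) _).trans
            (add_pow_le_four_pow (norm_nonneg _) (norm_nonneg _) q)
      _ = 4 ^ (q + 1) * (t k ^ (2 * (q + 1)) * ∫ ω, ‖X k ω‖ ^ (2 * (q + 1)) ∂A.P +
            ∫ ω, ‖A.avgDfl z t (insert k B) ∅ ω‖ ^ (2 * (q + 1)) ∂A.P) := by
          rw [integral_const_mul, integral_add i1 i2]
          simp only [norm_mul, mul_pow, Complex.norm_real, Real.norm_eq_abs, abs_of_nonneg (ht0 k)]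
          rw [integral_const_mul]
      _ ≤ 4 ^ (q + 1) * (t k ^ (2 * (q + 1)) * x ^ (2 * (q + 1)) + y ^ (2 * (q + 1))) := by
          have := ht0 k
          gcongr
          · exact hX k (hRB k hk)
          · exact hY k (hRB k hk)
      _ ≤ 4 ^ (q + 1) * (y ^ (2 * (q + 1)) + y ^ (2 * (q + 1))) := by
          rw [← mul_pow]
          have := ht0 k
          gcongr
          exact (mul_le_mul_of_nonneg_right (htτ k) hx.le).trans hτx
      _ ≤ (4 * y) ^ (2 * (q + 1)) := by
          rw [mul_pow, pow_mul 4]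
          have h1 : (4 : ℝ) ^ (q + 1) * 2 ≤ (4 ^ 2) ^ (q + 1) := by
            have h2 : (2 : ℝ) ≤ 4 ^ (q + 1) := by
              have : (4 : ℝ) ^ 1 ≤ 4 ^ (q + 1) := pow_le_pow_right₀ (by norm_num) (by omega)
              linarith
            have h3 : ((4 : ℝ) ^ 2) ^ (q + 1) = 4 ^ (q + 1) * 4 ^ (q + 1) := by
              rw [← mul_pow]; norm_num
            rw [h3]
            gcongr
          have h4 : 0 ≤ y ^ (2 * (q + 1)) := by positivity
          calc _ = 4 ^ (q + 1) * 2 * y ^ (2 * (q + 1)) := by ring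
            _ ≤ _ := by gcongr
  have hterm : ∀ k ∈ R, ‖∫ ω, X k ω * (Y ω ^ q * star (Y ω) ^ (q + 1) -
        (Y ω - W k ω) ^ q * star (Y ω - W k ω) ^ (q + 1)) ∂A.P‖ ≤
      C₀ * (θ * E + K * (x * y) ^ (q + 1)) := by
    intro k hk
    have iY := hYLp.integrable_norm_pow (2 * (q + 1))
    have iX := (hXLp k hk).integrable_norm_pow (2 * (q + 1))
    have iW := (hWLp k hk).integrable_norm_pow (2 * (q + 1))
    -- This weight balances the moments of X_k, of size x, against those of W_k, of size 4y: both
    -- terms become (4xy)^{q+1}.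
    set α : ℝ := (4 * y / x) ^ (q + 1) with hα
    have hα0 : 0 < α := by positivity
    have hpt : ∀ ω, ‖X k ω * (Y ω ^ q * star (Y ω) ^ (q + 1) -
        (Y ω - W k ω) ^ q * star (Y ω - W k ω) ^ (q + 1))‖ ≤
        C₀ * (θ * ‖Y ω‖ ^ (2 * (q + 1)) + ((θ ^ q)⁻¹ + 1) * ((α / 2) * ‖X k ω‖ ^ (2 * (q + 1)) +
          (α⁻¹ / 2) * ‖W k ω‖ ^ (2 * (q + 1))) + ‖W k ω‖ ^ (2 * (q + 1))) := by
      intro ω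
      set a := ‖X k ω‖
      set b := ‖W k ω‖
      set u := ‖Y ω‖
      have ha : 0 ≤ a := norm_nonneg _
      have hb : 0 ≤ b := norm_nonneg _
      have hu : 0 ≤ u := norm_nonneg _
      have y1 := mul_pow_le_young (a := a * b) (b := u ^ 2) (by positivity) (by positivity) hθ0 q
      have y2 := mul_pow_le_young (a := a * b) (b := b ^ 2) (by positivity) (by positivity) one_pos q
      have y3 : (a * b) ^ (q + 1) ≤ (α / 2) * a ^ (2 * (q + 1)) + (α⁻¹ / 2) * b ^ (2 * (q + 1)) := by
        have hs : 0 ≤ α⁻¹ * (α * a ^ (q + 1) - b ^ (q + 1)) ^ 2 := by positivity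
        have e : α⁻¹ * (α * a ^ (q + 1) - b ^ (q + 1)) ^ 2 = α * a ^ (2 * (q + 1)) -
            2 * (a * b) ^ (q + 1) + α⁻¹ * b ^ (2 * (q + 1)) := by
          rw [mul_pow, pow_mul', pow_mul']
          field_simp
          ring
        rw [e] at hs
        linarith
      rw [one_pow, inv_one, one_mul, one_mul] at y2
      rw [norm_mul]
      calc a * _ ≤ a * (C₀ * (b * (u ^ (2 * q) + b ^ (2 * q)))) := by
            gcongr; exact hg (Y ω) (W k ω)
        _ = C₀ * ((a * b) * (u ^ 2) ^ q + (a * b) * (b ^ 2) ^ q) := by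
            rw [← pow_mul, ← pow_mul]; ring
        _ ≤ C₀ * ((θ * (u ^ 2) ^ (q + 1) + (θ ^ q)⁻¹ * (a * b) ^ (q + 1)) +
              ((b ^ 2) ^ (q + 1) + (a * b) ^ (q + 1))) := by gcongr
        _ = C₀ * (θ * u ^ (2 * (q + 1)) + ((θ ^ q)⁻¹ + 1) * (a * b) ^ (q + 1) +
              b ^ (2 * (q + 1))) := by rw [← pow_mul, ← pow_mul]; ring
        _ ≤ _ := by gcongr
    have hi1 : Integrable (fun ω => ((θ ^ q)⁻¹ + 1) * ((α / 2) * ‖X k ω‖ ^ (2 * (q + 1)) +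
          (α⁻¹ / 2) * ‖W k ω‖ ^ (2 * (q + 1)))) A.P :=
      ((iX.const_mul _).add (iW.const_mul _)).const_mul _
    have hi2 : Integrable (fun ω => θ * ‖Y ω‖ ^ (2 * (q + 1)) +
        ((θ ^ q)⁻¹ + 1) * ((α / 2) * ‖X k ω‖ ^ (2 * (q + 1)) +
          (α⁻¹ / 2) * ‖W k ω‖ ^ (2 * (q + 1)))) A.P := (iY.const_mul _).add hi1
    have hmix : (α / 2) * x ^ (2 * (q + 1)) + (α⁻¹ / 2) * (4 * y) ^ (2 * (q + 1)) =
        4 ^ (q + 1) * (x * y) ^ (q + 1) := by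
      have e1 : α * x ^ (2 * (q + 1)) = 4 ^ (q + 1) * (x * y) ^ (q + 1) := by
        rw [hα, pow_mul, ← mul_pow, ← mul_pow]
        congr 1; field_simp
      have e2 : α⁻¹ * (4 * y) ^ (2 * (q + 1)) = 4 ^ (q + 1) * (x * y) ^ (q + 1) := by
        rw [hα, pow_mul, ← inv_pow, ← mul_pow, ← mul_pow]
        congr 1; field_simp
      linear_combination e1 / 2 + e2 / 2
    calc _ ≤ ∫ ω, ‖X k ω * (Y ω ^ q * star (Y ω) ^ (q + 1) -
            (Y ω - W k ω) ^ q * star (Y ω - W k ω) ^ (q + 1))‖ ∂A.P := norm_integral_le_integral_norm _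
      _ ≤ ∫ ω, C₀ * (θ * ‖Y ω‖ ^ (2 * (q + 1)) + ((θ ^ q)⁻¹ + 1) *
            ((α / 2) * ‖X k ω‖ ^ (2 * (q + 1)) +
            (α⁻¹ / 2) * ‖W k ω‖ ^ (2 * (q + 1))) + ‖W k ω‖ ^ (2 * (q + 1))) ∂A.P :=
          integral_mono ((hXLp k hk).mul (hgLp.sub (hg'Lp k hk))).integrable.norm
            ((hi2.add iW).const_mul _) hpt
      _ = C₀ * (θ * E + ((θ ^ q)⁻¹ + 1) * ((α / 2) * ∫ ω, ‖X k ω‖ ^ (2 * (q + 1)) ∂A.P +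
            (α⁻¹ / 2) * ∫ ω, ‖W k ω‖ ^ (2 * (q + 1)) ∂A.P) +
            ∫ ω, ‖W k ω‖ ^ (2 * (q + 1)) ∂A.P) := by
          rw [integral_const_mul, integral_add hi2 iW, integral_add (iY.const_mul _) hi1,
            integral_const_mul, integral_const_mul,
            integral_add (iX.const_mul _) (iW.const_mul _), integral_const_mul, integral_const_mul]
      _ ≤ C₀ * (θ * E + ((θ ^ q)⁻¹ + 1) * ((α / 2) * x ^ (2 * (q + 1)) +
            (α⁻¹ / 2) * (4 * y) ^ (2 * (q + 1))) + (4 * y) ^ (2 * (q + 1))) := by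
          gcongr
          · exact hX k (hRB k hk)
          · exact hWm k hk
          · exact hWm k hk
      _ ≤ _ := by
          rw [hmix]
          have h5 : (4 * y) ^ (2 * (q + 1)) ≤ 16 ^ (q + 1) * (x * y) ^ (q + 1) := by
            rw [pow_mul, ← mul_pow]
            gcongr
            nlinarith
          have h6 : θ * E + ((θ ^ q)⁻¹ + 1) * (4 ^ (q + 1) * (x * y) ^ (q + 1)) +
              (4 * y) ^ (2 * (q + 1)) ≤ θ * E + K * (x * y) ^ (q + 1) := by
            rw [hK]; linarith
          gcongr
  have hfin : E ≤ C₀ * (θ * E + K * (x * y) ^ (q + 1)) := by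
    set Q := C₀ * (θ * E + K * (x * y) ^ (q + 1)) with hQ
    have hQ0 : 0 ≤ Q := by positivity
    calc E = ‖(E : ℂ)‖ := by rw [Complex.norm_real, Real.norm_eq_abs, abs_of_nonneg hE0]
      _ ≤ ∑ k ∈ R, t k * Q := by
          rw [hEc]
          refine (norm_sum_le _ _).trans (Finset.sum_le_sum fun k hk => ?_)
          rw [norm_mul, Complex.norm_real, Real.norm_eq_abs, abs_of_nonneg (ht0 k)]
          exact mul_le_mul_of_nonneg_left (hterm k hk) (ht0 k)
      _ ≤ ∑ k, t k * Q := Finset.sum_le_sum_of_subset_of_nonneg (Finset.subset_univ _)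
          fun k _ _ => mul_nonneg (ht0 k) hQ0
      _ = Q := by rw [← Finset.sum_mul, hts, one_mul]
  have hθC : C₀ * θ = 1 / 2 := by rw [hθ]; field_simp
  have : C₀ * (θ * E + K * (x * y) ^ (q + 1)) = E / 2 + C₀ * K * (x * y) ^ (q + 1) := by
    rw [mul_add, ← mul_assoc, hθC]; ring
  linarith

end LocalSemicircle
end

/-! ### Stability of the linearized equation -/

noncomputable section
namespace LocalSemicircle

section Stability

variable {N : ℕ}

theorem sum_norm_le_linftyNorm (A : Matrix (Fin N) (Fin N) ℂ) (i : Fin N) :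
    ∑ j, ‖A i j‖ ≤ linftyNorm A :=
  le_ciSup (f := fun i => ∑ j, ‖A i j‖) (Set.finite_range _).bddAbove i

theorem linftyNorm_le {A : Matrix (Fin N) (Fin N) ℂ} {c : ℝ} (hc : 0 ≤ c)
    (h : ∀ i, ∑ j, ‖A i j‖ ≤ c) : linftyNorm A ≤ c := Real.iSup_le h hc

theorem linftyNorm_nonneg (A : Matrix (Fin N) (Fin N) ℂ) : 0 ≤ linftyNorm A :=
  Real.iSup_nonneg fun _ => Finset.sum_nonneg fun _ _ => norm_nonneg _

theorem linftyNorm_add_le (A B : Matrix (Fin N) (Fin N) ℂ) :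
    linftyNorm (A + B) ≤ linftyNorm A + linftyNorm B := by
  refine linftyNorm_le (add_nonneg (linftyNorm_nonneg _) (linftyNorm_nonneg _)) fun i => ?_
  calc ∑ j, ‖(A + B) i j‖ ≤ ∑ j, (‖A i j‖ + ‖B i j‖) :=
        Finset.sum_le_sum fun j _ => norm_add_le _ _
    _ ≤ _ := by
        rw [Finset.sum_add_distrib]
        exact add_le_add (sum_norm_le_linftyNorm A i) (sum_norm_le_linftyNorm B i)

theorem linftyNorm_mul_le (A B : Matrix (Fin N) (Fin N) ℂ) :
    linftyNorm (A * B) ≤ linftyNorm A * linftyNorm B := by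
  refine linftyNorm_le (mul_nonneg (linftyNorm_nonneg _) (linftyNorm_nonneg _)) fun i => ?_
  calc ∑ j, ‖(A * B) i j‖ ≤ ∑ j, ∑ k, ‖A i k‖ * ‖B k j‖ := by
        refine Finset.sum_le_sum fun j _ => ?_
        rw [Matrix.mul_apply]
        exact (norm_sum_le _ _).trans (le_of_eq (Finset.sum_congr rfl fun k _ => norm_mul _ _))
    _ = ∑ k, ‖A i k‖ * ∑ j, ‖B k j‖ := by
        rw [Finset.sum_comm]; simp only [Finset.mul_sum]
    _ ≤ ∑ k, ‖A i k‖ * linftyNorm B :=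
        Finset.sum_le_sum fun k _ =>
          mul_le_mul_of_nonneg_left (sum_norm_le_linftyNorm B k) (norm_nonneg _)
    _ = (∑ k, ‖A i k‖) * linftyNorm B := by rw [Finset.sum_mul]
    _ ≤ _ := mul_le_mul_of_nonneg_right (sum_norm_le_linftyNorm A i) (linftyNorm_nonneg _)

theorem linftyNorm_smul (c : ℂ) (A : Matrix (Fin N) (Fin N) ℂ) :
    linftyNorm (c • A) = ‖c‖ * linftyNorm A := by
  simp only [linftyNorm, Matrix.smul_apply, norm_smul, ← Finset.mul_sum]
  rw [Real.mul_iSup_of_nonneg (norm_nonneg c)]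

theorem linftyNorm_one_le : linftyNorm (1 : Matrix (Fin N) (Fin N) ℂ) ≤ 1 := by
  refine linftyNorm_le zero_le_one fun i => ?_
  rw [Finset.sum_eq_single i]
  · simp
  · intro j _ hj; rw [Matrix.one_apply_ne hj.symm, norm_zero]
  · simp

/-- The complexification of a real matrix. -/
def cmat (S : Matrix (Fin N) (Fin N) ℝ) : Matrix (Fin N) (Fin N) ℂ := S.map (fun x : ℝ => (x : ℂ))

theorem cmat_apply (S : Matrix (Fin N) (Fin N) ℝ) (i j : Fin N) : cmat S i j = (S i j : ℂ) := rfl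

theorem Gam_eq (S : Matrix (Fin N) (Fin N) ℝ) (z : ℂ) :
    Gam S z = linftyNorm (1 - msc z ^ 2 • cmat S)⁻¹ := rfl

variable {S : Matrix (Fin N) (Fin N) ℝ}

theorem linftyNorm_cmat_le (hS : ∀ i j, 0 ≤ S i j) (hSs : ∀ i, ∑ j, S i j = 1) :
    linftyNorm (cmat S) ≤ 1 := by
  refine linftyNorm_le zero_le_one fun i => ?_
  rw [← hSs i]
  refine Finset.sum_le_sum fun j _ => ?_
  rw [cmat_apply, Complex.norm_real, Real.norm_eq_abs, abs_of_nonneg (hS i j)]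

/-- Maximum principle: at its largest entry a kernel vector satisfies |v_i| ≤ |m|² |v_i|, with |m| <
1. -/
theorem isUnit_det_one_sub (hS : ∀ i j, 0 ≤ S i j) (hSs : ∀ i, ∑ j, S i j = 1)
    {z : ℂ} (hz : 0 < z.im) : IsUnit (1 - msc z ^ 2 • cmat S).det := by
  rw [isUnit_iff_ne_zero]
  intro h
  obtain ⟨v, hv, hv0⟩ := Matrix.exists_mulVec_eq_zero_iff.2 h
  rw [Matrix.sub_mulVec, Matrix.one_mulVec, Matrix.smul_mulVec, sub_eq_zero] at hv0
  have hm := norm_msc_lt_one hz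
  have hm2 : ‖msc z‖ ^ 2 < 1 := by nlinarith [norm_nonneg (msc z)]
  have hne : (Finset.univ : Finset (Fin N)).Nonempty := by
    obtain ⟨i, _⟩ := Function.ne_iff.1 hv; exact ⟨i, Finset.mem_univ i⟩
  obtain ⟨i, _, hi⟩ := Finset.exists_max_image Finset.univ (fun i => ‖v i‖) hne
  have h1 : ‖v i‖ ≤ ‖msc z‖ ^ 2 * ‖v i‖ := by
    have h2 := congrFun hv0 i
    rw [Pi.smul_apply, smul_eq_mul, Matrix.mulVec, dotProduct] at h2
    calc ‖v i‖ = ‖msc z‖ ^ 2 * ‖∑ j, cmat S i j * v j‖ := by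
          conv_lhs => rw [h2]
          rw [norm_mul, norm_pow]
      _ ≤ ‖msc z‖ ^ 2 * ∑ j, S i j * ‖v i‖ := by
          gcongr
          refine (norm_sum_le _ _).trans (Finset.sum_le_sum fun j _ => ?_)
          rw [norm_mul, cmat_apply, Complex.norm_real, Real.norm_eq_abs, abs_of_nonneg (hS i j)]
          exact mul_le_mul_of_nonneg_left (hi j (Finset.mem_univ j)) (hS i j)
      _ = _ := by rw [← Finset.sum_mul, hSs i, one_mul]
  have h3 : ‖v i‖ = 0 := by nlinarith [norm_nonneg (v i)]
  refine hv (funext fun j => ?_)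
  have := hi j (Finset.mem_univ j)
  rw [h3] at this
  exact norm_le_zero_iff.1 this

/-- The vector x is (1 - m²S)⁻¹ applied to its residual. This is how Γ enters the estimates. -/
theorem norm_le_Gam_mul (hS : ∀ i j, 0 ≤ S i j) (hSs : ∀ i, ∑ j, S i j = 1)
    {z : ℂ} (hz : 0 < z.im) {x : Fin N → ℂ} {r : ℝ}
    (h : ∀ i, ‖x i - msc z ^ 2 * ∑ j, (S i j : ℂ) * x j‖ ≤ r) (i : Fin N) :
    ‖x i‖ ≤ Gam S z * r := by
  set D := 1 - msc z ^ 2 • cmat S with hD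
  have hx : x = D⁻¹.mulVec (D.mulVec x) := by
    rw [Matrix.mulVec_mulVec, Matrix.nonsing_inv_mul _ (isUnit_det_one_sub hS hSs hz),
      Matrix.one_mulVec]
  have hDx : ∀ i, D.mulVec x i = x i - msc z ^ 2 * ∑ j, (S i j : ℂ) * x j := by
    intro i
    rw [hD, Matrix.sub_mulVec, Matrix.one_mulVec, Matrix.smul_mulVec, Pi.sub_apply,
      Pi.smul_apply, smul_eq_mul]
    rfl
  have hr : 0 ≤ r := (norm_nonneg _).trans (h i)
  calc ‖x i‖ = ‖∑ j, D⁻¹ i j * D.mulVec x j‖ := by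
        exact congrArg norm (congrFun hx i)
    _ ≤ ∑ j, ‖D⁻¹ i j‖ * r := by
        refine (norm_sum_le _ _).trans (Finset.sum_le_sum fun j _ => ?_)
        rw [norm_mul]
        exact mul_le_mul_of_nonneg_left (by rw [hDx]; exact h j) (norm_nonneg _)
    _ = (∑ j, ‖D⁻¹ i j‖) * r := by rw [Finset.sum_mul]
    _ ≤ _ := by
        rw [Gam_eq]
        exact mul_le_mul_of_nonneg_right (sum_norm_le_linftyNorm _ i) hr

/-- The constant vector is an eigenvector of S with eigenvalue 1. -/
theorem one_le_Gam_mul (hS : ∀ i j, 0 ≤ S i j) (hSs : ∀ i, ∑ j, S i j = 1)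
    (hN : 0 < N) {z : ℂ} (hz : 0 < z.im) :
    1 ≤ Gam S z * ‖1 - msc z ^ 2‖ := by
  have := norm_le_Gam_mul hS hSs hz (x := fun _ => 1) (r := ‖1 - msc z ^ 2‖) (fun i => by
    have : (∑ j, (S i j : ℂ) * 1) = 1 := by
      simp only [mul_one]; rw [← Complex.ofReal_sum, hSs i, Complex.ofReal_one]
    rw [this, mul_one]) ⟨0, hN⟩
  simpa using this

theorem half_le_Gam (hS : ∀ i j, 0 ≤ S i j) (hSs : ∀ i, ∑ j, S i j = 1)
    (hN : 0 < N) {z : ℂ} (hz : 0 < z.im) : 1 / 2 ≤ Gam S z := by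
  have h1 := one_le_Gam_mul hS hSs hN hz
  have h2 : ‖1 - msc z ^ 2‖ ≤ 2 := by
    refine (norm_sub_le _ _).trans ?_
    have := norm_msc_lt_one hz
    rw [norm_one, norm_pow]
    nlinarith [norm_nonneg (msc z)]
  have h3 : 0 ≤ Gam S z := linftyNorm_nonneg _
  nlinarith

/-- Take norms in D⁻¹ = 1 + m² S D⁻¹, where S has norm at most one. -/
theorem Gam_le_of_norm (hS : ∀ i j, 0 ≤ S i j) (hSs : ∀ i, ∑ j, S i j = 1)
    {z : ℂ} (hz : 0 < z.im) : Gam S z * (1 - ‖msc z‖ ^ 2) ≤ 1 := by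
  set D := 1 - msc z ^ 2 • cmat S with hD
  have hDi : D * D⁻¹ = 1 := Matrix.mul_nonsing_inv _ (isUnit_det_one_sub hS hSs hz)
  have e : D⁻¹ = 1 + msc z ^ 2 • (cmat S * D⁻¹) := by
    have : D * D⁻¹ = D⁻¹ - msc z ^ 2 • (cmat S * D⁻¹) := by
      conv_lhs => rw [hD]
      rw [sub_mul, one_mul, Matrix.smul_mul, ← hD]
    rw [hDi] at this
    exact (sub_eq_iff_eq_add.1 this.symm)
  have h1 : linftyNorm D⁻¹ ≤ 1 + ‖msc z‖ ^ 2 * (1 * linftyNorm D⁻¹) := by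
    conv_lhs => rw [e]
    refine (linftyNorm_add_le _ _).trans (add_le_add linftyNorm_one_le ?_)
    rw [linftyNorm_smul, norm_pow]
    gcongr
    exact (linftyNorm_mul_le _ _).trans
      (mul_le_mul_of_nonneg_right (linftyNorm_cmat_le hS hSs) (linftyNorm_nonneg _))
  rw [Gam_eq, ← hD]
  linarith

/-- The resolvent identity for D and D', divided by Γ(z)Γ(w). Unlike Γ, its inverse is Lipschitz in
m with an absolute constant. -/
theorem inv_Gam_sub_le (hS : ∀ i j, 0 ≤ S i j) (hSs : ∀ i, ∑ j, S i j = 1)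
    (hN : 0 < N) {z w : ℂ} (hz : 0 < z.im) (hw : 0 < w.im) :
    (Gam S z)⁻¹ ≤ (Gam S w)⁻¹ + 2 * ‖msc z - msc w‖ := by
  have g1 := half_le_Gam hS hSs hN hz
  have g2 := half_le_Gam hS hSs hN hw
  set D := 1 - msc z ^ 2 • cmat S with hD
  set D' := 1 - msc w ^ 2 • cmat S with hD'
  have hDi : D⁻¹ * D = 1 := Matrix.nonsing_inv_mul _ (isUnit_det_one_sub hS hSs hz)
  have hDi' : D' * D'⁻¹ = 1 := Matrix.mul_nonsing_inv _ (isUnit_det_one_sub hS hSs hw)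
  have e : D'⁻¹ = D⁻¹ + (msc w ^ 2 - msc z ^ 2) • (D⁻¹ * (cmat S * D'⁻¹)) := by
    have h1 : D - D' = (msc w ^ 2 - msc z ^ 2) • cmat S := by
      rw [hD, hD', sub_smul]; abel
    have h2 : D⁻¹ * ((D - D') * D'⁻¹) = D'⁻¹ - D⁻¹ := by
      rw [sub_mul, hDi', mul_sub, ← mul_assoc, hDi, one_mul, mul_one]
    rw [h1, Matrix.smul_mul, Matrix.mul_smul] at h2
    rw [h2]; abel
  have hk : ‖msc w ^ 2 - msc z ^ 2‖ ≤ 2 * ‖msc z - msc w‖ := by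
    rw [show msc w ^ 2 - msc z ^ 2 = -((msc z - msc w) * (msc z + msc w)) by ring, norm_neg,
      norm_mul, mul_comm]
    gcongr
    have := norm_add_le (msc z) (msc w)
    linarith [norm_msc_lt_one hz, norm_msc_lt_one hw]
  have h1 : Gam S w ≤ Gam S z + 2 * ‖msc z - msc w‖ * (Gam S z * (1 * Gam S w)) := by
    rw [Gam_eq, Gam_eq, ← hD, ← hD']
    conv_lhs => rw [e]
    refine (linftyNorm_add_le _ _).trans (add_le_add le_rfl ?_)
    rw [linftyNorm_smul]
    refine mul_le_mul hk ?_ (linftyNorm_nonneg _) (by positivity)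
    refine (linftyNorm_mul_le _ _).trans (mul_le_mul_of_nonneg_left ?_ (linftyNorm_nonneg _))
    exact (linftyNorm_mul_le _ _).trans
      (mul_le_mul_of_nonneg_right (linftyNorm_cmat_le hS hSs) (linftyNorm_nonneg _))
  have p1 : 0 < Gam S z := by linarith
  have p2 : 0 < Gam S w := by linarith
  have h2 : Gam S w * (Gam S z * Gam S w)⁻¹ ≤
      (Gam S z + 2 * ‖msc z - msc w‖ * (Gam S z * (1 * Gam S w))) * (Gam S z * Gam S w)⁻¹ := by
    gcongr
  calc (Gam S z)⁻¹ = Gam S w * (Gam S z * Gam S w)⁻¹ := by field_simp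
    _ ≤ _ := h2
    _ = _ := by field_simp

end Stability

section Continuity

theorem continuousAt_msc {z : ℂ} (hz : 0 < z.im) : ContinuousAt msc z := by
  rw [Metric.continuousAt_iff]
  intro ε hε
  have hm := norm_msc_lt_one hz
  have hopen : IsOpen {w : ℂ | 0 < w.im} := isOpen_lt continuous_const Complex.continuous_im
  obtain ⟨r, hr, hball⟩ := Metric.isOpen_iff.1 hopen z hz
  refine ⟨min r (ε * (1 - ‖msc z‖)), lt_min hr (mul_pos hε (by linarith)), fun {w} hw => ?_⟩
  have hwi : 0 < w.im := hball (lt_of_lt_of_le hw (min_le_left _ _))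
  have h1 := norm_msc_sub_le hwi hz
  have h2 := norm_msc_lt_one hwi
  rw [dist_eq_norm] at hw ⊢
  have h3 : ‖w - z‖ < ε * (1 - ‖msc z‖) := lt_of_lt_of_le hw (min_le_right _ _)
  have h4 : ‖msc w - msc z‖ * (1 - ‖msc z‖) ≤ ‖msc w - msc z‖ * (1 - ‖msc w‖ * ‖msc z‖) := by
    gcongr
    nlinarith [norm_nonneg (msc z)]
  have h5 : ‖msc w - msc z‖ * (1 - ‖msc z‖) < ε * (1 - ‖msc z‖) := by linarith
  exact lt_of_mul_lt_mul_right h5 (by linarith)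

theorem continuousAt_Gam {N : ℕ} (hN : 0 < N) {S : Matrix (Fin N) (Fin N) ℝ}
    (hS : ∀ i j, 0 ≤ S i j) (hSs : ∀ i, ∑ j, S i j = 1) {z : ℂ} (hz : 0 < z.im) :
    ContinuousAt (Gam S) z := by
  have hinv : ContinuousAt (fun w => (Gam S w)⁻¹) z := by
    rw [ContinuousAt, tendsto_iff_dist_tendsto_zero]
    have hm : Filter.Tendsto (fun w => 2 * ‖msc w - msc z‖) (nhds z) (nhds 0) := by
      have := (continuousAt_msc hz).sub (continuousAt_const (y := msc z))
      have h2 := (this.norm).const_mul 2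
      simpa [ContinuousAt] using h2
    refine squeeze_zero' (Filter.Eventually.of_forall fun _ => dist_nonneg) ?_ hm
    have hopen : IsOpen {w : ℂ | 0 < w.im} := isOpen_lt continuous_const Complex.continuous_im
    filter_upwards [hopen.mem_nhds hz] with w hw
    have a := inv_Gam_sub_le hS hSs hN hz hw
    have b := inv_Gam_sub_le hS hSs hN hw hz
    rw [norm_sub_rev] at a
    rw [Real.dist_eq, abs_le]
    constructor <;> linarith
  have hne : (Gam S z)⁻¹ ≠ 0 := by
    have := half_le_Gam hS hSs hN hz
    positivity
  exact (hinv.inv₀ hne).congr (Filter.Eventually.of_forall fun w => by simp)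

end Continuity

/-! ### The threshold η_E and the spectral domain -/

section Domain

variable {N : ℕ} {S : Matrix (Fin N) (Fin N) ℝ} {γ E : ℝ}

theorem etaSet_upward {η η' : ℝ} (hM : 0 < bandParameter S) (h : η ∈ etaSet S γ E) (hle : η ≤ η')
    (h10 : η' ≤ 10) : η' ∈ etaSet S γ E := by
  obtain ⟨h0, _, h2⟩ := h
  refine ⟨by linarith, h10, fun y hy => le_trans ?_ (h2 y ⟨hle.trans hy.1, hy.2⟩)⟩
  gcongr

/-- At height 10 one has |m| ≤ 1/10, hence Γ ≤ 100/99 and Im m ≤ 1/10, while γ < 1/2 makes M^{-2γ}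
at least M^{-1}. -/
theorem ten_mem_etaSet (hS : ∀ i j, 0 ≤ S i j) (hSs : ∀ i, ∑ j, S i j = 1)
    (hN : 0 < N) (hM : 1 ≤ bandParameter S) (hγ : γ ∈ Set.Ioo (0 : ℝ) (1 / 2)) :
    (10 : ℝ) ∈ etaSet S γ E := by
  refine ⟨by norm_num, le_rfl, fun y hy => ?_⟩
  have hy : y = 10 := le_antisymm hy.2 hy.1
  subst hy
  have hz : 0 < (⟨E, 10⟩ : ℂ).im := by norm_num
  set z : ℂ := ⟨E, 10⟩
  set M := bandParameter S
  have hm : ‖msc z‖ * 10 ≤ 1 := norm_msc_le_inv_im hz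
  have hm0 := norm_nonneg (msc z)
  have hG := Gam_le_of_norm hS hSs hz
  have hG2 := half_le_Gam hS hSs hN hz
  have hG3 : Gam S z ≤ 100 / 99 := by
    have : ‖msc z‖ ^ 2 ≤ 1 / 100 := by nlinarith
    nlinarith
  have him : (msc z).im ≤ 1 / 10 := (im_msc_le_norm z).trans (by linarith)
  have himp := im_msc_pos hz
  have hM0 : 0 < M := by linarith
  have e1 : M⁻¹ ≤ M ^ (-γ) := by
    rw [← Real.rpow_neg_one]
    exact Real.rpow_le_rpow_of_exponent_le hM (by linarith [hγ.2])
  have e2 : M⁻¹ ≤ M ^ (-(2 * γ)) := by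
    rw [← Real.rpow_neg_one]
    exact Real.rpow_le_rpow_of_exponent_le hM (by linarith [hγ.2])
  have hGp : 0 < Gam S z := by linarith
  have hMi : 0 < M⁻¹ := by positivity
  have g3 : Gam S z ^ 3 ≤ 10 := by
    calc Gam S z ^ 3 ≤ (100 / 99) ^ 3 := by gcongr
      _ ≤ 10 := by norm_num
  have g4 : Gam S z ^ 4 * (msc z).im ≤ 10 := by
    calc Gam S z ^ 4 * (msc z).im ≤ (100 / 99) ^ 4 * (1 / 10) := by gcongr
      _ ≤ 10 := by norm_num
  rw [one_div, mul_inv]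
  refine le_min ?_ ?_
  · rw [le_div_iff₀ (by positivity)]
    calc M⁻¹ * 10⁻¹ * Gam S z ^ 3 ≤ M⁻¹ * 10⁻¹ * 10 := by gcongr
      _ = M⁻¹ := by ring
      _ ≤ _ := e1
  · rw [le_div_iff₀ (by positivity)]
    calc M⁻¹ * 10⁻¹ * (Gam S z ^ 4 * (msc z).im) ≤ M⁻¹ * 10⁻¹ * 10 := by gcongr
      _ = M⁻¹ := by ring
      _ ≤ _ := e2

/-- Insert Γ ≥ 1/2 and M^{-γ} ≤ 1 into the first condition. With M ≤ N it bounds 1/η by 8N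
throughout the domain. -/
theorem le_of_mem_etaSet (hS : ∀ i j, 0 ≤ S i j) (hSs : ∀ i, ∑ j, S i j = 1)
    (hN : 0 < N) (hM : 1 ≤ bandParameter S) (hγ : 0 < γ) {η : ℝ} (h : η ∈ etaSet S γ E) :
    1 / (8 * bandParameter S) ≤ η := by
  obtain ⟨h0, h10, h2⟩ := h
  have h3 := (h2 η ⟨le_rfl, h10⟩).trans (min_le_left _ _)
  have hG := half_le_Gam hS hSs hN (z := ⟨E, η⟩) h0
  set M := bandParameter S
  have hM0 : 0 < M := by linarith
  have h4 : M ^ (-γ) ≤ 1 := Real.rpow_le_one_of_one_le_of_nonpos hM (by linarith)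
  have h5 : (1 / 8 : ℝ) ≤ Gam S ⟨E, η⟩ ^ 3 := by
    calc (1 / 8 : ℝ) = (1 / 2) ^ 3 := by norm_num
      _ ≤ _ := by gcongr
  rw [div_le_div_iff₀ (by positivity) (by positivity)] at h3
  rw [div_le_iff₀ (by positivity)]
  have h6 : M ^ (-γ) * (M * η) ≤ 1 * (M * η) := by gcongr
  nlinarith

/-- The set is closed upwards, so only the infimum itself is in question. There the inequalities
pass to the limit from above, by continuity of m and Γ. -/
theorem mem_etaSet_of_etaE_le (hS : ∀ i j, 0 ≤ S i j) (hSs : ∀ i, ∑ j, S i j = 1)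
    (hN : 0 < N) (hM : 1 ≤ bandParameter S) (hγ : γ ∈ Set.Ioo (0 : ℝ) (1 / 2)) {η : ℝ}
    (h : etaE S γ E ≤ η) (h10 : η ≤ 10) : η ∈ etaSet S γ E := by
  have hM0 : 0 < bandParameter S := by linarith
  have hten := ten_mem_etaSet (E := E) hS hSs hN hM hγ
  have hbdd : BddBelow (etaSet S γ E) := ⟨0, fun x hx => hx.1.le⟩
  have hgt : ∀ s, etaE S γ E < s → s ≤ 10 → s ∈ etaSet S γ E := by
    intro s hs hs10
    obtain ⟨x, hx, hxs⟩ := (csInf_lt_iff hbdd ⟨10, hten⟩).1 hs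
    exact etaSet_upward hM0 hx hxs.le hs10
  rcases h.eq_or_lt with heq | hlt
  · rcases h10.eq_or_lt with rfl | h10'
    · exact hten
    have hpos : 0 < η := by
      rw [← heq]
      have h1 : 1 / (8 * bandParameter S) ≤ etaE S γ E :=
        le_csInf ⟨10, hten⟩ fun x hx => le_of_mem_etaSet hS hSs hN hM hγ.1 hx
      exact lt_of_lt_of_le (by positivity) h1
    refine ⟨hpos, h10, fun y hy => ?_⟩
    have hy0 : 0 < y := lt_of_lt_of_le hpos hy.1
    have hz : 0 < (⟨E, y⟩ : ℂ).im := hy0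
    -- For s slightly above η the point at height y may fall below the segment that starts at s; max
    -- y s stays in it and tends to y.
    have hcurve : ContinuousAt (fun s : ℝ => (⟨E, max y s⟩ : ℂ)) η := by
      have e : (fun s : ℝ => (⟨E, max y s⟩ : ℂ)) = fun s : ℝ => (E : ℂ) + (max y s : ℝ) * Complex.I := by
        funext s; apply Complex.ext <;> simp
      rw [e]; fun_prop
    have hmax : max y η = y := max_eq_left hy.1
    have hm : ContinuousAt (fun s : ℝ => msc ⟨E, max y s⟩) η :=
      ContinuousAt.comp (f := fun s : ℝ => (⟨E, max y s⟩ : ℂ)) (g := msc)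
        (by rw [hmax]; exact continuousAt_msc hz) hcurve
    have hG : ContinuousAt (fun s : ℝ => Gam S ⟨E, max y s⟩) η :=
      ContinuousAt.comp (f := fun s : ℝ => (⟨E, max y s⟩ : ℂ)) (g := Gam S)
        (by rw [hmax]; exact continuousAt_Gam hN hS hSs hz) hcurve
    have hGpos : 0 < Gam S ⟨E, max y η⟩ := by
      rw [hmax]; have := half_le_Gam hS hSs hN hz; linarith
    have him : 0 < (msc ⟨E, max y η⟩).im := by rw [hmax]; exact im_msc_pos hz
    have hf : ContinuousAt (fun s : ℝ => min (bandParameter S ^ (-γ) / Gam S ⟨E, max y s⟩ ^ 3)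
        (bandParameter S ^ (-(2 * γ)) / (Gam S ⟨E, max y s⟩ ^ 4 * (msc ⟨E, max y s⟩).im))) η := by
      refine Filter.Tendsto.min ?_ ?_
      · exact continuousAt_const.div (hG.pow 3) (by positivity)
      · exact continuousAt_const.div ((hG.pow 4).mul
          (Complex.continuous_im.continuousAt.comp hm)) (by positivity)
    have hl : ContinuousAt (fun s : ℝ => 1 / (bandParameter S * s)) η :=
      continuousAt_const.div (continuousAt_const.mul continuousAt_id) (by positivity)
    have hlim := le_of_tendsto_of_tendsto (hl.tendsto.mono_left nhdsWithin_le_nhds)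
      (hf.tendsto.mono_left (nhdsWithin_le_nhds (s := Set.Ioi η))) ?_
    · simpa only [hmax] using hlim
    · filter_upwards [Ioo_mem_nhdsGT h10'] with s hs
      have := (hgt s (heq.symm ▸ hs.1) hs.2.le).2.2 (max y s)
        ⟨le_max_right _ _, max_le hy.2 hs.2.le⟩
      exact this
  · exact hgt η hlt h10

end Domain

namespace DomainPoint

variable {δ : ℝ} {μ : ℕ → ℝ} {γ : ℝ} {N : ℕ} (u : DomainPoint δ μ γ N)

theorem mem_etaSet (hN : 0 < N) (hδ : 0 < δ) (hγ : γ ∈ Set.Ioo (0 : ℝ) (1 / 2)) :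
    u.z.im ∈ etaSet u.A.S γ u.z.re :=
  mem_etaSet_of_etaE_le u.A.S_nonneg u.A.S_row_sum hN (u.A.one_le_M hN hδ.le) hγ u.mem.2.1
    u.mem.2.2

theorem im_pos (hN : 0 < N) (hδ : 0 < δ) (hγ : γ ∈ Set.Ioo (0 : ℝ) (1 / 2)) : 0 < u.z.im :=
  (u.mem_etaSet hN hδ hγ).1

theorem inv_im_le (hN : 0 < N) (hδ : 0 < δ) (hγ : γ ∈ Set.Ioo (0 : ℝ) (1 / 2)) :
    1 / u.z.im ≤ 8 * N := by
  have h1 := le_of_mem_etaSet u.A.S_nonneg u.A.S_row_sum hN (u.A.one_le_M hN hδ.le) hγ.1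
    (u.mem_etaSet hN hδ hγ)
  have hM := u.A.M_pos hN
  have h0 := u.im_pos hN hδ hγ
  have h2 := u.A.M_le
  change u.A.M ≤ N at h2
  change 1 / (8 * u.A.M) ≤ u.z.im at h1
  rw [div_le_iff₀ (by positivity)] at h1
  rw [div_le_iff₀ h0]
  nlinarith

theorem norm_z_le (hN : 0 < N) (hδ : 0 < δ) (hγ : γ ∈ Set.Ioo (0 : ℝ) (1 / 2)) : ‖u.z‖ ≤ 15 := by
  have h1 := u.mem.1
  have h2 := u.mem.2.2
  have h0 := u.im_pos hN hδ hγ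
  have h3 : ‖u.z‖ ^ 2 ≤ 15 ^ 2 := by
    rw [← Complex.normSq_eq_norm_sq, Complex.normSq_apply]
    have : u.z.re * u.z.re ≤ 100 := by nlinarith [abs_mul_abs_self u.z.re, abs_nonneg u.z.re]
    nlinarith
  exact le_of_abs_le (abs_le_of_sq_le_sq h3 (by norm_num))

theorem norm_inv_msc_le (hN : 0 < N) (hδ : 0 < δ) (hγ : γ ∈ Set.Ioo (0 : ℝ) (1 / 2)) :
    ‖(msc u.z)⁻¹‖ ≤ 16 := by
  have h0 := u.im_pos hN hδ hγ
  rw [inv_msc h0]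
  refine (norm_sub_le _ _).trans ?_
  rw [norm_neg]
  linarith [u.norm_z_le hN hδ hγ, norm_msc_lt_one h0]

theorem half_le_Gam (hN : 0 < N) (hδ : 0 < δ) (hγ : γ ∈ Set.Ioo (0 : ℝ) (1 / 2)) :
    1 / 2 ≤ Gam u.A.S u.z :=
  LocalSemicircle.half_le_Gam u.A.S_nonneg u.A.S_row_sum hN (u.im_pos hN hδ hγ)

theorem eta_bounds (hN : 0 < N) (hδ : 0 < δ) (hγ : γ ∈ Set.Ioo (0 : ℝ) (1 / 2)) :
    1 / (u.A.M * u.z.im) ≤ u.A.M ^ (-γ) / Gam u.A.S u.z ^ 3 ∧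
    1 / (u.A.M * u.z.im) ≤ u.A.M ^ (-(2 * γ)) / (Gam u.A.S u.z ^ 4 * (msc u.z).im) := by
  have h := (u.mem_etaSet hN hδ hγ).2.2 u.z.im ⟨le_rfl, u.mem.2.2⟩
  exact ⟨h.trans (min_le_left _ _), h.trans (min_le_right _ _)⟩

/-- The point of the spectral domain at height `y` above `u`. -/
def raise (hN : 0 < N) (hδ : 0 < δ) (hγ : γ ∈ Set.Ioo (0 : ℝ) (1 / 2)) (y : ℝ) (h1 : u.z.im ≤ y)
    (h2 : y ≤ 10) : DomainPoint δ μ γ N where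
  A := u.A
  z := ⟨u.z.re, y⟩
  mem := ⟨u.mem.1, csInf_le ⟨0, fun _ hx => hx.1.le⟩
    (etaSet_upward (u.A.M_pos hN) (u.mem_etaSet hN hδ hγ) h1 h2), h2⟩

end DomainPoint

end LocalSemicircle
end

/-! ### Moments of the fluctuations and of their averages -/

noncomputable section
namespace LocalSemicircle

/-- On the bad event x ≤ Λ + x²/Λ with x = ‖f‖^p; the parameter Λ trades the small probability
against a crude higher moment. -/
theorem integral_norm_pow_le_of_bad {Ω : Type*} [MeasurableSpace Ω] {P : Measure Ω}
    [IsProbabilityMeasure P] {f : Ω → ℂ} (hf : AllLp P f) {b : Set Ω} (hb : MeasurableSet b)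
    {a β Λ : ℝ} (ha : 0 ≤ a) (hΛ : 0 < Λ) (hβ : P.real b ≤ β) (p : ℕ)
    (h : ∀ ω, ω ∉ b → ‖f ω‖ ≤ a) :
    ∫ ω, ‖f ω‖ ^ p ∂P ≤ a ^ p + Λ * β + Λ⁻¹ * ∫ ω, ‖f ω‖ ^ (2 * p) ∂P := by
  have hpt : ∀ ω, ‖f ω‖ ^ p ≤ a ^ p + b.indicator (fun _ => Λ) ω + Λ⁻¹ * ‖f ω‖ ^ (2 * p) := by
    intro ω
    have h2 : 0 ≤ Λ⁻¹ * ‖f ω‖ ^ (2 * p) := by positivity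
    by_cases hω : ω ∈ b
    · rw [Set.indicator_of_mem hω]
      have h1 : 0 ≤ a ^ p := by positivity
      have h3 : ‖f ω‖ ^ p ≤ Λ + Λ⁻¹ * ‖f ω‖ ^ (2 * p) := by
        rw [mul_comm 2 p, pow_mul]
        set x := ‖f ω‖ ^ p
        have : 0 ≤ Λ⁻¹ * (x - Λ) ^ 2 := by positivity
        have e : Λ⁻¹ * (x - Λ) ^ 2 = Λ⁻¹ * x ^ 2 - 2 * x + Λ := by field_simp; ring
        have hx : 0 ≤ x := by positivity
        linarith
      linarith
    · rw [Set.indicator_of_notMem hω]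
      have := pow_le_pow_left₀ (norm_nonneg _) (h ω hω) p
      linarith
  have hi1 : Integrable (fun ω => b.indicator (fun _ => Λ) ω) P :=
    (integrable_const Λ).indicator hb
  have hi2 := hf.integrable_norm_pow (2 * p)
  calc ∫ ω, ‖f ω‖ ^ p ∂P
      ≤ ∫ ω, (a ^ p + b.indicator (fun _ => Λ) ω + Λ⁻¹ * ‖f ω‖ ^ (2 * p)) ∂P :=
        integral_mono (hf.integrable_norm_pow p)
          (((integrable_const _).add hi1).add (hi2.const_mul _)) hpt
    _ = a ^ p + P.real b * Λ + Λ⁻¹ * ∫ ω, ‖f ω‖ ^ (2 * p) ∂P := by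
        rw [integral_add (f := fun ω => a ^ p + b.indicator (fun _ => Λ) ω)
            ((integrable_const _).add hi1) (hi2.const_mul _), integral_add (integrable_const _) hi1, integral_const_mul, integral_const,
          integral_indicator_const _ hb]
        simp
    _ ≤ _ := by nlinarith

theorem sum_pow_le_card_pow_mul {ι : Type*} (s : Finset ι) {f : ι → ℝ} (hf : ∀ i ∈ s, 0 ≤ f i)
    (p : ℕ) : (∑ i ∈ s, f i) ^ (p + 1) ≤ (s.card : ℝ) ^ p * ∑ i ∈ s, f i ^ (p + 1) := by
  rcases s.eq_empty_or_nonempty with rfl | hs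
  · simp
  · have h := pow_sum_div_card_le_sum_pow (s := s) (f := f) hf p
    have hc : (0 : ℝ) < s.card := by exact_mod_cast hs.card_pos
    rw [div_le_iff₀ (by positivity)] at h
    linarith

namespace Ensemble

theorem S_le_one {δ : ℝ} {μ : ℕ → ℝ} {N : ℕ} (A : Ensemble δ μ N) (i j : Fin N) : A.S i j ≤ 1 := by
  rw [← A.S_row_sum i]
  exact Finset.single_le_sum (f := fun j => A.S i j) (fun j _ => A.S_nonneg i j) (Finset.mem_univ j)

theorem norm_fluct_le {δ : ℝ} {μ : ℕ → ℝ} {N : ℕ} (A : Ensemble δ μ N) {z : ℂ} (hz : 0 < z.im)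
    {k : Fin N} {T : Finset (Fin N)} (hk : k ∉ T) (ω : A.Ω) :
    ‖fluct A.S (A.H ω) z k T‖ ≤ (1 + 1 / z.im) * (1 + ∑ b, ‖A.h k b ω‖) ^ 2 := by
  rw [fluct_eq A.S (A.isHermitian_H ω) hz hk]
  set s := ∑ b, ‖A.h k b ω‖ with hs
  have hs0 : 0 ≤ s := Finset.sum_nonneg fun _ _ => norm_nonneg _
  have h1 : ‖A.H ω k k‖ ≤ s :=
    Finset.single_le_sum (f := fun b => ‖A.h k b ω‖) (fun _ _ => norm_nonneg _) (Finset.mem_univ k)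
  set R := Finset.univ \ insert k T
  have h2 : ‖∑ b ∈ R, ∑ a ∈ R, mres (A.H ω) z (insert k T) b a *
      (A.H ω k b * star (A.H ω k a) - if b = a then (A.S k b : ℂ) else 0)‖ ≤
      1 / z.im * (s * s + 1) := by
    calc _ ≤ ∑ b ∈ R, ∑ a ∈ R, 1 / z.im * (‖A.h k b ω‖ * ‖A.h k a ω‖ +
          if b = a then A.S k b else 0) := by
          refine (norm_sum_le _ _).trans (Finset.sum_le_sum fun b _ => ?_)
          refine (norm_sum_le _ _).trans (Finset.sum_le_sum fun a _ => ?_)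
          rw [norm_mul]
          refine mul_le_mul (A.norm_mres_H_le hz _ b a ω) ?_ (norm_nonneg _) (by positivity)
          refine (norm_sub_le _ _).trans (add_le_add ?_ ?_)
          · rw [norm_mul, norm_star]; rfl
          · split_ifs
            · rw [Complex.norm_of_nonneg (A.S_nonneg _ _)]
            · simp
      _ ≤ ∑ b, ∑ a, 1 / z.im * (‖A.h k b ω‖ * ‖A.h k a ω‖ + if b = a then A.S k b else 0) := by
          have hnn : ∀ b a, 0 ≤ 1 / z.im * (‖A.h k b ω‖ * ‖A.h k a ω‖ +
              if b = a then A.S k b else 0) := fun b a => by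
            have : 0 ≤ if b = a then A.S k b else 0 := by
              split_ifs; exacts [A.S_nonneg _ _, le_rfl]
            positivity
          refine (Finset.sum_le_sum fun b _ => Finset.sum_le_sum_of_subset_of_nonneg
            (Finset.subset_univ R) fun a _ _ => hnn b a).trans ?_
          exact Finset.sum_le_sum_of_subset_of_nonneg (Finset.subset_univ R)
            fun b _ _ => Finset.sum_nonneg fun a _ => hnn b a
      _ = _ := by
          simp only [mul_add, Finset.sum_add_distrib, ← Finset.mul_sum, ← Finset.sum_mul]
          simp only [Finset.sum_ite_eq, Finset.mem_univ, if_true]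
          rw [A.S_row_sum k, ← hs]
  have h3 : 0 < 1 / z.im := by positivity
  calc _ ≤ s + 1 / z.im * (s * s + 1) := (norm_sub_le _ _).trans (add_le_add h1 h2)
    _ ≤ _ := by nlinarith [mul_nonneg h3.le hs0, sq_nonneg s]

/-- Any power of N suffices here, since this bound is used only against an event of tiny
probability. The exponent is 2(r+1) from 1/η ≤ 8N and 4(r+1) from the sum over the N entries of the
row. -/
theorem moment_fluct_le (μ : ℕ → ℝ) (r : ℕ) : ∃ C : ℝ, 1 ≤ C ∧
    ∀ {δ : ℝ} {N : ℕ} (A : Ensemble δ μ N) (z : ℂ), 0 < N → 0 < z.im → 1 / z.im ≤ 8 * N →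
      ∀ (k : Fin N) (T : Finset (Fin N)), k ∉ T →
        ∫ ω, ‖fluct A.S (A.H ω) z k T‖ ^ (2 * (r + 1)) ∂A.P ≤ C * (N : ℝ) ^ (6 * (r + 1)) := by
  refine ⟨9 ^ (2 * (r + 1)) * (2 ^ (4 * (r + 1)) * (1 + |μ (4 * (r + 1))|)), ?_, ?_⟩
  · have h1 : (1 : ℝ) ≤ 9 ^ (2 * (r + 1)) := one_le_pow₀ (by norm_num)
    have h2 : (1 : ℝ) ≤ 2 ^ (4 * (r + 1)) := one_le_pow₀ (by norm_num)
    have h3 : (1 : ℝ) ≤ 1 + |μ (4 * (r + 1))| := by linarith [abs_nonneg (μ (4 * (r + 1)))]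
    exact one_le_mul_of_one_le_of_one_le h1 (one_le_mul_of_one_le_of_one_le h2 h3)
  intro δ N A z hN hz hzN k T hk
  have hN1 : (1 : ℝ) ≤ N := by exact_mod_cast hN
  set p := 4 * (r + 1) with hp
  obtain ⟨p', hp'⟩ : ∃ p', p = p' + 1 := ⟨4 * r + 3, by omega⟩
  have hpt : ∀ ω, ‖fluct A.S (A.H ω) z k T‖ ^ (2 * (r + 1)) ≤
      (9 * (N : ℝ)) ^ (2 * (r + 1)) * (2 ^ p * (1 + (N : ℝ) ^ p' * ∑ b, ‖A.h k b ω‖ ^ p)) := by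
    intro ω
    set s := ∑ b, ‖A.h k b ω‖ with hs
    have hs0 : 0 ≤ s := Finset.sum_nonneg fun _ _ => norm_nonneg _
    have h1 : ‖fluct A.S (A.H ω) z k T‖ ≤ 9 * N * (1 + s) ^ 2 := by
      refine (A.norm_fluct_le hz hk ω).trans ?_
      have : 0 ≤ (1 + s) ^ 2 := by positivity
      nlinarith
    calc _ ≤ (9 * N * (1 + s) ^ 2) ^ (2 * (r + 1)) :=
          pow_le_pow_left₀ (norm_nonneg _) h1 _
      _ = (9 * (N : ℝ)) ^ (2 * (r + 1)) * (1 + s) ^ p := by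
          rw [mul_pow, ← pow_mul]; congr 2; omega
      _ ≤ _ := by
          refine mul_le_mul_of_nonneg_left ?_ (by positivity)
          have h2 := add_pow_le (zero_le_one) hs0 p
          have h3 := sum_pow_le_card_pow_mul Finset.univ (f := fun b => ‖A.h k b ω‖)
            (fun _ _ => norm_nonneg _) p'
          rw [← hp', Finset.card_univ, Fintype.card_fin, ← hs] at h3
          rw [one_pow] at h2
          refine h2.trans ?_
          refine mul_le_mul (pow_le_pow_right₀ (by norm_num) (by omega))
            (by linarith) (by positivity) (by positivity)
  have hInt : ∀ b, Integrable (fun ω => ‖A.h k b ω‖ ^ p) A.P := fun b =>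
    (A.allLp_h k b).integrable_norm_pow p
  have hints : Integrable (fun ω => ∑ b, ‖A.h k b ω‖ ^ p) A.P :=
    integrable_finsetSum _ fun b _ => hInt b
  have hm : ∀ b, ∫ ω, ‖A.h k b ω‖ ^ p ∂A.P ≤ |μ p| := by
    intro b
    have := A.moment_h_le k b (2 * r + 1)
    have e : 2 * (2 * r + 1 + 1) = p := by omega
    rw [e] at this
    refine this.trans (mul_le_of_le_one_right (abs_nonneg _) ?_)
    exact pow_le_one₀ (A.S_nonneg _ _) (A.S_le_one _ _)
  calc _ ≤ ∫ ω, (9 * (N : ℝ)) ^ (2 * (r + 1)) *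
        (2 ^ p * (1 + (N : ℝ) ^ p' * ∑ b, ‖A.h k b ω‖ ^ p)) ∂A.P :=
        integral_mono ((A.allLp_fluct hz hk).integrable_norm_pow _)
          ((((integrable_const _).add (hints.const_mul _)).const_mul _).const_mul _) hpt
    _ = (9 * (N : ℝ)) ^ (2 * (r + 1)) *
        (2 ^ p * (1 + (N : ℝ) ^ p' * ∑ b, ∫ ω, ‖A.h k b ω‖ ^ p ∂A.P)) := by
        rw [integral_const_mul, integral_const_mul,
          integral_add (integrable_const _) (hints.const_mul _), integral_const_mul,
          integral_finsetSum _ fun b _ => hInt b]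
        simp
    _ ≤ (9 * (N : ℝ)) ^ (2 * (r + 1)) * (2 ^ p * ((1 + |μ p|) * (N : ℝ) ^ p)) := by
        have h4 : ∑ b, ∫ ω, ‖A.h k b ω‖ ^ p ∂A.P ≤ N * |μ p| := by
          refine (Finset.sum_le_sum fun b _ => hm b).trans ?_
          simp
        have h5 : (N : ℝ) ^ p' * ∑ b, ∫ ω, ‖A.h k b ω‖ ^ p ∂A.P ≤ |μ p| * (N : ℝ) ^ p := by
          refine (mul_le_mul_of_nonneg_left h4 (by positivity)).trans (le_of_eq ?_)
          rw [hp', pow_succ]; ring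
        have h6 : (1 : ℝ) ≤ (N : ℝ) ^ p := one_le_pow₀ hN1
        refine mul_le_mul_of_nonneg_left (mul_le_mul_of_nonneg_left ?_ (by positivity))
          (by positivity)
        nlinarith
    _ = _ := by
        have e : 6 * (r + 1) = 2 * (r + 1) + p := by omega
        rw [e, pow_add, mul_pow]; ring

theorem moment_dfl_crude (μ : ℕ → ℝ) (r K : ℕ) : ∃ C : ℝ, 1 ≤ C ∧
    ∀ {δ : ℝ} {N : ℕ} (A : Ensemble δ μ N) (z : ℂ), 0 < N → 0 < z.im → 1 / z.im ≤ 8 * N →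
      ∀ (B : Finset (Fin N)) (k : Fin N), B.card ≤ K → k ∉ B →
        ∫ ω, ‖A.dfl z B k ∅ ω‖ ^ (2 * (r + 1)) ∂A.P ≤ C * (N : ℝ) ^ (6 * (r + 1)) := by
  obtain ⟨C, hC, h⟩ := moment_fluct_le μ r
  refine ⟨((2 : ℝ) ^ K) ^ (2 * (r + 1)) * C,
    one_le_mul_of_one_le_of_one_le (one_le_pow₀ (one_le_pow₀ (by norm_num))) hC, ?_⟩
  intro δ N A z hN hz hzN B k hB hk
  have hkC : ∀ C ∈ B.powerset, k ∉ ∅ ∪ C := fun C hC => by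
    rw [Finset.empty_union]; exact fun h => hk (Finset.mem_powerset.1 hC h)
  have hcard : (B.powerset.card : ℝ) ≤ 2 ^ K := by
    rw [Finset.card_powerset]; push_cast
    exact pow_le_pow_right₀ (by norm_num) hB
  have hpt : ∀ ω, ‖A.dfl z B k ∅ ω‖ ^ (2 * (r + 1)) ≤ ((2 : ℝ) ^ K) ^ (2 * r + 1) *
      ∑ C ∈ B.powerset, ‖fluct A.S (A.H ω) z k (∅ ∪ C)‖ ^ (2 * (r + 1)) := by
    intro ω
    have h1 : ‖A.dfl z B k ∅ ω‖ ≤ ∑ C ∈ B.powerset, ‖fluct A.S (A.H ω) z k (∅ ∪ C)‖ := by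
      refine (norm_sum_le _ _).trans (Finset.sum_le_sum fun C _ => ?_)
      simp
    refine (pow_le_pow_left₀ (norm_nonneg _) h1 _).trans ?_
    refine (sum_pow_le_card_pow_mul _ (fun _ _ => norm_nonneg _) (2 * r + 1)).trans ?_
    refine mul_le_mul_of_nonneg_right (pow_le_pow_left₀ (by positivity) hcard _)
      (Finset.sum_nonneg fun _ _ => by positivity)
  have hInt : ∀ C ∈ B.powerset,
      Integrable (fun ω => ‖fluct A.S (A.H ω) z k (∅ ∪ C)‖ ^ (2 * (r + 1))) A.P := fun C hC =>
    (A.allLp_fluct hz (hkC C hC)).integrable_norm_pow _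
  calc _ ≤ ∫ ω, ((2 : ℝ) ^ K) ^ (2 * r + 1) *
      ∑ C ∈ B.powerset, ‖fluct A.S (A.H ω) z k (∅ ∪ C)‖ ^ (2 * (r + 1)) ∂A.P :=
        integral_mono ((A.allLp_dfl hz hk (Finset.notMem_empty k)).integrable_norm_pow _)
          ((integrable_finsetSum _ hInt).const_mul _) hpt
    _ = ((2 : ℝ) ^ K) ^ (2 * r + 1) *
      ∑ C ∈ B.powerset, ∫ ω, ‖fluct A.S (A.H ω) z k (∅ ∪ C)‖ ^ (2 * (r + 1)) ∂A.P := by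
        rw [integral_const_mul, integral_finsetSum _ hInt]
    _ ≤ ((2 : ℝ) ^ K) ^ (2 * r + 1) * ((2 : ℝ) ^ K * (C * (N : ℝ) ^ (6 * (r + 1)))) := by
        refine mul_le_mul_of_nonneg_left ?_ (by positivity)
        refine (Finset.sum_le_sum fun C hC => h A z hN hz hzN k _ (hkC C hC)).trans ?_
        rw [Finset.sum_const, nsmul_eq_mul]
        exact mul_le_mul_of_nonneg_right hcard (by positivity)
    _ = _ := by
        rw [show 2 * (r + 1) = 2 * r + 1 + 1 by ring, pow_succ _ (2 * r + 1)]; ring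

/-- Induction on n = K - |B|. For |B| = K, Jensen's inequality bounds the average by its terms. A
step takes the geometric mean of ψ^{|B|+1}, the size of one term, and the size for |B| + 1; so the
gain ψ^e beyond one term satisfies 2e_{n+1} = 1 + e_n with e_0 = 0, that is, e_n = 1 - 2^{-n}. -/
theorem moment_avgDfl_le (q K : ℕ) : ∃ C : ℝ, 1 ≤ C ∧
    ∀ {δ : ℝ} {μ : ℕ → ℝ} {N : ℕ} (A : Ensemble δ μ N) (z : ℂ) (t : Fin N → ℝ) (ψ D : ℝ),
      0 < z.im → (∀ l, 0 ≤ t l) → (∀ l, t l ≤ ψ ^ 2) → ∑ l, t l = 1 → 0 < ψ → ψ ≤ 1 → 1 ≤ D →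
      (∀ (B : Finset (Fin N)) (k : Fin N), B.card ≤ K → k ∉ B →
        ∫ ω, ‖A.dfl z B k ∅ ω‖ ^ (2 * (q + 1)) ∂A.P ≤ (D * ψ ^ (B.card + 1)) ^ (2 * (q + 1))) →
      ∫ ω, ‖A.avgDfl z t ∅ ∅ ω‖ ^ (2 * (q + 1)) ∂A.P ≤
        (C * D * (ψ * ψ ^ (1 - (1 / 2 : ℝ) ^ K))) ^ (2 * (q + 1)) := by
  obtain ⟨C, hC, hstep⟩ := moment_avgDfl_step q
  refine ⟨C ^ K, one_le_pow₀ hC, ?_⟩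
  intro δ μ N A z t ψ D hz ht0 htψ hts hψ hψ1 hD hX
  have hC0 : 0 < C := by linarith
  have hD0 : 0 < D := by linarith
  suffices key : ∀ (n : ℕ) (B : Finset (Fin N)), B.card + n = K →
      ∫ ω, ‖A.avgDfl z t B ∅ ω‖ ^ (2 * (q + 1)) ∂A.P ≤
        (C ^ n * D * (ψ ^ (B.card + 1) * ψ ^ (1 - (1 / 2 : ℝ) ^ n))) ^ (2 * (q + 1)) by
    simpa using key K ∅ (by simp)
  intro n
  induction n with
  | zero =>
    intro B hB
    have hInt : ∀ l ∈ Finset.univ \ (∅ ∪ B),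
        Integrable (fun ω => t l * ‖A.dfl z B l ∅ ω‖ ^ (2 * (q + 1))) A.P := fun l hl =>
      ((A.allLp_dfl hz (fun h => (Finset.mem_sdiff.1 hl).2 (Finset.mem_union_right _ h))
        (Finset.notMem_empty l)).integrable_norm_pow _).const_mul _
    have hpt : ∀ ω, ‖A.avgDfl z t B ∅ ω‖ ^ (2 * (q + 1)) ≤
        ∑ l ∈ Finset.univ \ (∅ ∪ B), t l * ‖A.dfl z B l ∅ ω‖ ^ (2 * (q + 1)) := by
      intro ω
      set R := Finset.univ \ (∅ ∪ B)
      set x : Fin N → ℝ := fun l => if l ∈ R then ‖A.dfl z B l ∅ ω‖ else 0 with hx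
      have h1 : ‖A.avgDfl z t B ∅ ω‖ ≤ ∑ l, t l * x l := by
        refine (norm_sum_le _ _).trans ?_
        rw [← Finset.sum_subset (Finset.subset_univ R)
          (f := fun l => t l * x l) (fun l _ hl => by simp [hx, hl])]
        refine Finset.sum_le_sum fun l hl => ?_
        rw [norm_mul, Complex.norm_of_nonneg (ht0 l)]
        simp only [hx, if_pos (show l ∈ R from hl)]; exact le_rfl
      have h2 := Real.pow_arith_mean_le_arith_mean_pow Finset.univ t x (fun l _ => ht0 l) hts
        (fun l _ => by simp only [hx]; split_ifs <;> positivity) (2 * (q + 1))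
      refine (pow_le_pow_left₀ (norm_nonneg _) h1 _).trans (h2.trans (le_of_eq ?_))
      rw [← Finset.sum_subset (Finset.subset_univ R)
          (f := fun l => t l * x l ^ (2 * (q + 1))) (fun l _ hl => by simp [hx, hl])]
      exact Finset.sum_congr rfl fun l hl => by simp [hx, hl]
    calc _ ≤ ∫ ω, ∑ l ∈ Finset.univ \ (∅ ∪ B), t l * ‖A.dfl z B l ∅ ω‖ ^ (2 * (q + 1)) ∂A.P :=
          integral_mono ((A.allLp_avgDfl hz t B ∅).integrable_norm_pow _)
            (integrable_finsetSum _ hInt) hpt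
      _ = ∑ l ∈ Finset.univ \ (∅ ∪ B), t l * ∫ ω, ‖A.dfl z B l ∅ ω‖ ^ (2 * (q + 1)) ∂A.P := by
          rw [integral_finsetSum _ hInt]
          exact Finset.sum_congr rfl fun l _ => integral_const_mul _ _
      _ ≤ ∑ l, t l * (D * ψ ^ (B.card + 1)) ^ (2 * (q + 1)) := by
          refine (Finset.sum_le_sum fun l hl => mul_le_mul_of_nonneg_left (hX B l (by omega)
            fun h => (Finset.mem_sdiff.1 hl).2 (Finset.mem_union_right _ h)) (ht0 l)).trans ?_
          exact Finset.sum_le_sum_of_subset_of_nonneg (Finset.subset_univ _)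
            fun l _ _ => mul_nonneg (ht0 l) (by positivity)
      _ = _ := by
          rw [← Finset.sum_mul, hts]; simp
  | succ n ih =>
    intro B hB
    set b := B.card
    set ρ : ℝ := ψ ^ (1 - (1 / 2 : ℝ) ^ n) with hρ
    have hρ0 : 0 < ρ := Real.rpow_pos_of_pos hψ _
    have hpow : (0 : ℝ) < (1 / 2 : ℝ) ^ n := by positivity
    have hpow1 : (1 / 2 : ℝ) ^ n ≤ 1 := pow_le_one₀ (by norm_num) (by norm_num)
    have hρ1 : ρ ≤ 1 := Real.rpow_le_one hψ.le hψ1 (by linarith)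
    have hψρ : ψ ≤ ρ := by
      conv_lhs => rw [← Real.rpow_one ψ]
      exact Real.rpow_le_rpow_of_exponent_ge hψ hψ1 (by linarith)
    have hρρ : (ψ ^ (1 - (1 / 2 : ℝ) ^ (n + 1))) ^ 2 = ψ * ρ := by
      rw [← Real.rpow_natCast, ← Real.rpow_mul hψ.le, hρ]
      nth_rewrite 2 [← Real.rpow_one ψ]
      rw [← Real.rpow_add hψ]
      congr 1; push_cast; ring
    have hCn : 1 ≤ C ^ n := one_le_pow₀ hC
    have hs := hstep A z t B (ψ ^ 2) (C ^ n * D * ψ ^ (b + 1)) (C ^ n * D * (ψ ^ (b + 2) * ρ))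
      hz ht0 htψ hts (by positivity) ?_ ?_ ?_ ?_
    · refine hs.trans ?_
      have e1 : C ^ n * D * ψ ^ (b + 1) * (C ^ n * D * (ψ ^ (b + 2) * ρ)) =
          (C ^ n * D * (ψ ^ (b + 1) * ψ ^ (1 - (1 / 2 : ℝ) ^ (n + 1)))) ^ 2 := by
        rw [mul_pow, mul_pow (ψ ^ (b + 1)), hρρ]; ring
      rw [e1, ← pow_mul]
      have e2 : C ^ (n + 1) * D * (ψ ^ (b + 1) * ψ ^ (1 - (1 / 2 : ℝ) ^ (n + 1))) =
          C * (C ^ n * D * (ψ ^ (b + 1) * ψ ^ (1 - (1 / 2 : ℝ) ^ (n + 1)))) := by ring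
      rw [e2, mul_pow C]
      have e3 : C ≤ C ^ (2 * (q + 1)) := le_self_pow₀ hC (by omega)
      exact mul_le_mul_of_nonneg_right e3 (by positivity)
    · have : ψ ^ 2 * (C ^ n * D * ψ ^ (b + 1)) = C ^ n * D * (ψ ^ (b + 2) * ψ) := by ring
      rw [this]; gcongr
    · rw [pow_succ ψ (b + 1), mul_assoc (ψ ^ (b + 1))]
      refine mul_le_mul_of_nonneg_left ?_ (by positivity)
      have : ψ * ρ ≤ 1 := mul_le_one₀ hψ1 hρ0.le hρ1
      exact (mul_le_mul_of_nonneg_left this (pow_pos hψ (b + 1)).le).trans_eq (mul_one _)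
    · intro k hk
      refine (hX B k (by omega) hk).trans (pow_le_pow_left₀ (by positivity) ?_ _)
      exact mul_le_mul_of_nonneg_right (le_mul_of_one_le_left hD0.le hCn) (by positivity)
    · intro k hk
      have := ih (insert k B) (by rw [Finset.card_insert_of_notMem hk]; omega)
      rwa [Finset.card_insert_of_notMem hk] at this

end Ensemble
end LocalSemicircle
end

/-! ### Fluctuation averaging -/

noncomputable section
namespace LocalSemicircle
namespace Ensemble

theorem measurableSet_far {δ : ℝ} {μ : ℕ → ℝ} {N : ℕ} (A : Ensemble δ μ N) (z m : ℂ) (ψ : ℝ) :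
    MeasurableSet {ω | ∃ i j, ψ < ‖res (A.H ω) z i j - (if i = j then m else 0)‖} := by
  have : {ω | ∃ i j, ψ < ‖res (A.H ω) z i j - (if i = j then m else 0)‖} =
      ⋃ i, ⋃ j, {ω | ψ < ‖res (A.H ω) z i j - (if i = j then m else 0)‖} := by
    ext ω; simp
  rw [this]
  refine MeasurableSet.iUnion fun i => MeasurableSet.iUnion fun j =>
    measurableSet_lt measurable_const (Measurable.norm (Measurable.sub_const ?_ _))
  have := A.measurable_mres_H z ∅ i j
  simpa only [mres_empty] using this

/-- Where the resolvent is close to m·1, `norm_altDiff_fluct_le` applies deterministically;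
elsewhere a crude moment is paid for by the probability N^{-L}. The factor 2^{K+1} on ψ is the cost
of passing to minors with up to K + 1 rows removed. -/
theorem moment_dfl_le (μ : ℕ → ℝ) (q K : ℕ) : ∃ D : ℝ, 1 ≤ D ∧ ∃ L : ℕ,
    ∀ {δ : ℝ} {N : ℕ} (A : Ensemble δ μ N) (z : ℂ) (ψ : ℝ), 0 < N → 0 < z.im → 1 / z.im ≤ 8 * N →
      ‖(msc z)⁻¹‖ ≤ 16 → 0 < ψ → 1 / A.M ≤ ψ ^ 2 → 2 ^ (K + 1) * ψ * (2 * 16) ≤ 1 →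
      A.P.real {ω | ∃ i j, ψ < ‖res (A.H ω) z i j - (if i = j then msc z else 0)‖} ≤
        ((N : ℝ) ^ L)⁻¹ →
      ∀ (B : Finset (Fin N)) (k : Fin N), B.card ≤ K → k ∉ B →
        ∫ ω, ‖A.dfl z B k ∅ ω‖ ^ (2 * (q + 1)) ∂A.P ≤
          (D * (2 ^ (K + 1) * ψ) ^ (B.card + 1)) ^ (2 * (q + 1)) := by
  obtain ⟨C₁, hC₁, h₁⟩ := norm_altDiff_fluct_le K (2 * 16) (by norm_num)
  obtain ⟨C₂, hC₂, h₂⟩ := moment_dfl_crude μ (2 * q + 1) K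
  refine ⟨C₁ * (2 + C₂), one_le_mul_of_one_le_of_one_le hC₁ (by linarith),
    2 * ((K + 1) * (q + 1)) + 12 * (q + 1), ?_⟩
  intro δ N A z ψ hN hz hzN hm hψ hMψ hψK hbad B k hB hk
  have hN1 : (1 : ℝ) ≤ N := by exact_mod_cast hN
  have hN0 : (0 : ℝ) < N := by linarith
  have hM := A.M_pos hN
  have hMN : A.M ≤ N := A.M_le
  set ψ' : ℝ := 2 ^ (K + 1) * ψ with hψ'
  have h2K : (1 : ℝ) ≤ 2 ^ (K + 1) := one_le_pow₀ (by norm_num)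
  have hψ'0 : 0 < ψ' := by positivity
  have hψψ' : ψ ≤ ψ' := le_mul_of_one_le_left hψ.le h2K
  have hψ'1 : ψ' ≤ 1 := by linarith
  have hMψ' : 1 / A.M ≤ ψ' ^ 2 := hMψ.trans (pow_le_pow_left₀ hψ.le hψψ' 2)
  have hgood : ∀ ω, ω ∉ {ω | ∃ i j, ψ < ‖res (A.H ω) z i j - (if i = j then msc z else 0)‖} →
      ‖A.dfl z B k ∅ ω‖ ≤ C₁ * ψ' ^ (B.card + 1) := by
    intro ω hω
    simp only [Set.mem_ofPred_eq, not_exists, not_lt] at hω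
    refine h₁ N (A.H ω) A.S z (msc z) ψ' k B (A.isHermitian_H ω) hz (msc_ne_zero hz)
      (norm_msc_lt_one hz).le (by linarith) (inv_msc hz) hψ'0.le hψ'1 A.S_nonneg A.S_row_sum
      (fun i j => (A.S_le i j).trans hMψ') hB hk ?_
    exact minorsClose_of_close (A.isHermitian_H ω) hz (by norm_num) (msc_ne_zero hz) hm hω hψ.le
      (K + 1) hψK (by rw [Finset.card_insert_of_notMem hk]; omega)
  -- With Λ = N^{e₁ + 12(q+1)} and the given L, both error terms become multiples of N^{-e₁}, which
  -- lies below the target because ψ² ≥ 1/M ≥ 1/N.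
  set e₁ := (K + 1) * (q + 1) with he₁
  have hI := integral_norm_pow_le_of_bad (A.allLp_dfl hz hk (Finset.notMem_empty k))
    (A.measurableSet_far z (msc z) ψ) (a := C₁ * ψ' ^ (B.card + 1))
    (Λ := (N : ℝ) ^ (e₁ + 12 * (q + 1))) (by positivity) (by positivity) hbad (2 * (q + 1)) hgood
  have hcr := h₂ A z hN hz hzN B k hB hk
  rw [show 2 * (2 * q + 1 + 1) = 2 * (2 * (q + 1)) by ring,
    show 6 * (2 * q + 1 + 1) = 12 * (q + 1) by ring] at hcr
  have hlow : ((N : ℝ) ^ e₁)⁻¹ ≤ (ψ' ^ (B.card + 1)) ^ (2 * (q + 1)) := by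
    have e : (ψ' ^ (B.card + 1)) ^ (2 * (q + 1)) = (ψ' ^ 2) ^ ((B.card + 1) * (q + 1)) := by
      rw [← pow_mul, ← pow_mul]; congr 1; ring
    rw [e]
    have h3 : (1 / (N : ℝ)) ≤ ψ' ^ 2 := (one_div_le_one_div_of_le hM hMN).trans hMψ'
    refine le_trans ?_ (pow_le_pow_left₀ (by positivity) h3 _)
    rw [one_div, inv_pow]
    exact inv_anti₀ (by positivity) (pow_le_pow_right₀ hN1 (Nat.mul_le_mul_right _ (by omega)))
  have t2 : (N : ℝ) ^ (e₁ + 12 * (q + 1)) * ((N : ℝ) ^ (2 * e₁ + 12 * (q + 1)))⁻¹ =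
      ((N : ℝ) ^ e₁)⁻¹ := by
    rw [show 2 * e₁ + 12 * (q + 1) = e₁ + (e₁ + 12 * (q + 1)) by ring, pow_add _ e₁ (e₁ + _)]
    field_simp
  have t3 : ((N : ℝ) ^ (e₁ + 12 * (q + 1)))⁻¹ * (C₂ * (N : ℝ) ^ (12 * (q + 1))) =
      C₂ * ((N : ℝ) ^ e₁)⁻¹ := by
    rw [pow_add]; field_simp
  set X := (ψ' ^ (B.card + 1)) ^ (2 * (q + 1)) with hX
  have hX0 : 0 < X := by positivity
  refine hI.trans ?_
  have t4 := mul_le_mul_of_nonneg_left hcr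
    (show 0 ≤ ((N : ℝ) ^ (e₁ + 12 * (q + 1)))⁻¹ by positivity)
  rw [t3] at t4
  rw [t2, mul_pow, mul_pow (C₁ * (2 + C₂)), mul_pow C₁, ← hX]
  have h5 : (1 : ℝ) ≤ C₁ ^ (2 * (q + 1)) := one_le_pow₀ hC₁
  have h6 : 2 + C₂ ≤ (2 + C₂) ^ (2 * (q + 1)) := le_self_pow₀ (by linarith) (by omega)
  have h7 : C₁ ^ (2 * (q + 1)) * (2 + C₂) * X ≤
      C₁ ^ (2 * (q + 1)) * (2 + C₂) ^ (2 * (q + 1)) * X := by gcongr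
  have h8 : C₂ * ((N : ℝ) ^ e₁)⁻¹ ≤ C₂ * X := by gcongr
  have h9 : (1 + C₂) * X ≤ C₁ ^ (2 * (q + 1)) * ((1 + C₂) * X) :=
    le_mul_of_one_le_left (by positivity) h5
  nlinarith

/-- Markov's inequality for `moment_avgDfl_le`. As K grows the exponent of ψ approaches 2: averaging
nearly squares the size of a single fluctuation. -/
theorem fluctuation_averaging (μ : ℕ → ℝ) (q K : ℕ) : ∃ C : ℝ, 1 ≤ C ∧ ∃ L : ℕ,
    ∀ {δ : ℝ} {N : ℕ} (A : Ensemble δ μ N) (z : ℂ) (t : Fin N → ℝ) (ψ : ℝ), 0 < N → 0 < z.im →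
      1 / z.im ≤ 8 * N → ‖(msc z)⁻¹‖ ≤ 16 → (∀ l, 0 ≤ t l) → (∀ l, t l ≤ 1 / A.M) →
      ∑ l, t l = 1 → 0 < ψ → 1 / A.M ≤ ψ ^ 2 → 2 ^ (K + 1) * ψ * (2 * 16) ≤ 1 →
      A.P.real {ω | ∃ i j, ψ < ‖res (A.H ω) z i j - (if i = j then msc z else 0)‖} ≤
        ((N : ℝ) ^ L)⁻¹ →
      ∀ s : ℝ, 0 < s →
        A.P.real {ω | s * (C * (ψ * ψ ^ (1 - (1 / 2 : ℝ) ^ K))) <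
          ‖∑ l, (t l : ℂ) * fluct A.S (A.H ω) z l ∅‖} ≤ 1 / s ^ (2 * (q + 1)) := by
  obtain ⟨D, hD, L, hmom⟩ := moment_dfl_le μ q K
  obtain ⟨C, hC, havg⟩ := moment_avgDfl_le q K
  have h2K : (1 : ℝ) ≤ 2 ^ (K + 1) := one_le_pow₀ (by norm_num)
  have h4K : (1 : ℝ) ≤ 2 ^ (K + 1) * 2 ^ (K + 1) := one_le_mul_of_one_le_of_one_le h2K h2K
  refine ⟨C * D * (2 ^ (K + 1) * 2 ^ (K + 1)),
    one_le_mul_of_one_le_of_one_le (one_le_mul_of_one_le_of_one_le hC hD) h4K, L, ?_⟩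
  intro δ N A z t ψ hN hz hzN hm ht0 htM hts hψ hMψ hψK hbad s hs
  set ψ' : ℝ := 2 ^ (K + 1) * ψ with hψ'
  have hψ'0 : 0 < ψ' := by positivity
  have hψψ' : ψ ≤ ψ' := le_mul_of_one_le_left hψ.le h2K
  have hM2 := havg A z t ψ' D hz ht0 (fun l => (htM l).trans
    (hMψ.trans (pow_le_pow_left₀ hψ.le hψψ' 2))) hts hψ'0 (by linarith) hD
    (hmom A z ψ hN hz hzN hm hψ hMψ hψK hbad)
  have heq : ∀ ω, A.avgDfl z t ∅ ∅ ω = ∑ l, (t l : ℂ) * fluct A.S (A.H ω) z l ∅ := by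
    intro ω; simp [avgDfl, dfl, altDiff_empty]
  set X := C * D * (ψ' * ψ' ^ (1 - (1 / 2 : ℝ) ^ K)) with hX
  have hC0 : 0 < C := by linarith
  have hD0 : 0 < D := by linarith
  have hX0 : 0 < X := by positivity
  have hmk := measureReal_lt_norm_le A.P (A.allLp_avgDfl hz t ∅ ∅) (q := q) (C := 1) (V := X ^ 2)
    (by norm_num) (by positivity) hs (by rw [one_mul, ← pow_mul]; exact hM2)
  rw [Real.sqrt_sq hX0.le, one_pow] at hmk
  refine le_trans (measureReal_mono ?_) hmk
  intro ω hω
  simp only [Set.mem_ofPred_eq, heq] at hω ⊢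
  refine lt_of_le_of_lt (mul_le_mul_of_nonneg_left ?_ hs.le) hω
  have hpow : (0 : ℝ) < (1 / 2 : ℝ) ^ K := by positivity
  have e1 : ψ' ^ (1 - (1 / 2 : ℝ) ^ K) ≤ 2 ^ (K + 1) * ψ ^ (1 - (1 / 2 : ℝ) ^ K) := by
    rw [hψ', Real.mul_rpow (by positivity) hψ.le]
    refine mul_le_mul_of_nonneg_right ?_ (by positivity)
    conv_rhs => rw [← Real.rpow_one (2 ^ (K + 1))]
    exact Real.rpow_le_rpow_of_exponent_le h2K (by linarith)
  calc X ≤ C * D * (ψ' * (2 ^ (K + 1) * ψ ^ (1 - (1 / 2 : ℝ) ^ K))) := by rw [hX]; gcongr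
    _ = _ := by rw [hψ']; ring

end Ensemble
end LocalSemicircle
end

/-! ### Events of very high probability -/

noncomputable section
namespace LocalSemicircle

theorem eventually_le_rpow (C : ℝ) {a : ℝ} (ha : 0 < a) :
    ∀ᶠ N : ℕ in Filter.atTop, C ≤ (N : ℝ) ^ a :=
  ((tendsto_rpow_atTop ha).comp tendsto_natCast_atTop_atTop).eventually_ge_atTop C

section HighProbability

variable {δ : ℝ} {μ : ℕ → ℝ} {γ : ℝ}

/-- The event `Ξ` has very high probability: its complement has probability at most `N⁻ᴰ` for every
`D` and large `N`, uniformly in the random matrix and the spectral parameter. -/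
def HP (Ξ : ∀ N (u : DomainPoint δ μ γ N), u.A.Ω → Prop) : Prop :=
  ∀ D : ℕ, ∀ᶠ N : ℕ in Filter.atTop, ∀ u : DomainPoint δ μ γ N,
    u.A.P.real {ω | ¬ Ξ N u ω} ≤ ((N : ℝ) ^ D)⁻¹

variable {Ξ Ξ' : ∀ N (u : DomainPoint δ μ γ N), u.A.Ω → Prop}

theorem HP.mono (h : HP Ξ)
    (hi : ∀ᶠ N : ℕ in Filter.atTop, ∀ (u : DomainPoint δ μ γ N) ω, Ξ N u ω → Ξ' N u ω) :
    HP Ξ' := by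
  intro D
  filter_upwards [h D, hi] with N h1 h2 u
  have hsub : {ω | ¬ Ξ' N u ω} ⊆ {ω | ¬ Ξ N u ω} := fun ω hω hΞ => hω (h2 u ω hΞ)
  exact (measureReal_mono hsub).trans (h1 u)

/-- Union bound: N^c events cost only a shift of D by c. -/
theorem HP.of_forall (ι : ℕ → Type) [∀ N, Fintype (ι N)] (c : ℕ)
    (hc : ∀ᶠ N : ℕ in Filter.atTop, Fintype.card (ι N) ≤ N ^ c)
    (Φ : ∀ N (u : DomainPoint δ μ γ N), ι N → u.A.Ω → Prop)
    (h : ∀ D : ℕ, ∀ᶠ N : ℕ in Filter.atTop, ∀ (u : DomainPoint δ μ γ N) (i : ι N),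
      u.A.P.real {ω | ¬ Φ N u i ω} ≤ ((N : ℝ) ^ D)⁻¹) :
    HP fun N u ω => ∀ i, Φ N u i ω := by
  intro D
  filter_upwards [h (c + D), hc, Filter.eventually_gt_atTop 0] with N h1 h2 hN u
  have hN0 : (0 : ℝ) < N := by exact_mod_cast hN
  have : {ω | ¬ ∀ i, Φ N u i ω} = ⋃ i, {ω | ¬ Φ N u i ω} := by ext ω; simp
  rw [this]
  calc _ ≤ ∑ i, u.A.P.real {ω | ¬ Φ N u i ω} := measureReal_iUnion_fintype_le _
    _ ≤ ∑ _i : ι N, ((N : ℝ) ^ (c + D))⁻¹ := Finset.sum_le_sum fun i _ => h1 u i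
    _ = Fintype.card (ι N) * ((N : ℝ) ^ (c + D))⁻¹ := by
        rw [Finset.sum_const, Finset.card_univ, nsmul_eq_mul]
    _ ≤ (N : ℝ) ^ c * ((N : ℝ) ^ (c + D))⁻¹ := by gcongr; exact_mod_cast h2
    _ = _ := by rw [pow_add]; field_simp

theorem HP.and (h : HP Ξ) (h' : HP Ξ') : HP fun N u ω => Ξ N u ω ∧ Ξ' N u ω := by
  have := HP.of_forall (fun _ => Bool) 1
    (by filter_upwards [Filter.eventually_ge_atTop 2] with N hN; simpa using hN)
    (fun N u b ω => if b then Ξ N u ω else Ξ' N u ω) (fun D => by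
      filter_upwards [h D, h' D] with N h1 h2 u b
      cases b
      · simpa using h2 u
      · simpa using h1 u)
  exact this.mono (Filter.Eventually.of_forall fun N u ω hω =>
    ⟨by simpa using hω true, by simpa using hω false⟩)

end HighProbability

/-- The large deviation bounds for the rows of `H`, with loss `t`. -/
structure Ensemble.RowBounds {δ : ℝ} {μ : ℕ → ℝ} {N : ℕ} (A : Ensemble δ μ N) (z : ℂ) (t : ℝ)
    (ω : A.Ω) (k : Fin N) : Prop where
  diag : ‖A.h k k ω‖ ≤ t * √(A.S k k)
  linear : ∀ j, ‖∑ b, A.h k b ω * mres (A.H ω) z {k} b j‖ ≤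
    t * √(∑ b, ‖mres (A.H ω) z {k} b j‖ ^ 2 * A.S k b)
  quadratic : ‖∑ b ∈ Finset.univ \ {k}, ∑ a ∈ Finset.univ \ {k}, mres (A.H ω) z {k} b a *
      (A.h k b ω * star (A.h k a ω) - if b = a then (A.S k b : ℂ) else 0)‖ ≤
    t * √(∑ b ∈ Finset.univ \ {k}, ∑ a ∈ Finset.univ \ {k},
      ‖mres (A.H ω) z {k} b a‖ ^ 2 * (A.S k b * A.S k a))

theorem hp_rowBounds {δ : ℝ} {μ : ℕ → ℝ} {γ : ℝ} (hδ : 0 < δ) (hγ : γ ∈ Set.Ioo (0 : ℝ) (1 / 2))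
    {ε : ℝ} (hε : 0 < ε) :
    HP fun N (u : DomainPoint δ μ γ N) ω => ∀ k, u.A.RowBounds u.z ((N : ℝ) ^ ε) ω k := by
  have key : ∀ D : ℕ, ∃ q : ℕ, ∃ C : ℝ, 1 ≤ C ∧ (∀ᶠ N : ℕ in Filter.atTop,
      C ^ (q + 1) / ((N : ℝ) ^ ε) ^ (2 * (q + 1)) ≤ ((N : ℝ) ^ D)⁻¹) ∧
      ∀ {δ : ℝ} {N : ℕ} (A : Ensemble δ μ N) (z : ℂ), 0 < z.im → ∀ (k : Fin N) (t : ℝ), 0 < t →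
      A.P.real {ω | t * √(A.S k k) < ‖A.h k k ω‖} ≤ C ^ (q + 1) / t ^ (2 * (q + 1)) ∧
      (∀ j, A.P.real {ω | t * √(∑ b, ‖mres (A.H ω) z {k} b j‖ ^ 2 * A.S k b) <
        ‖∑ b, A.h k b ω * mres (A.H ω) z {k} b j‖} ≤ C ^ (q + 1) / t ^ (2 * (q + 1))) ∧
      A.P.real {ω | t * √(∑ b ∈ Finset.univ \ {k}, ∑ a ∈ Finset.univ \ {k},
        ‖mres (A.H ω) z {k} b a‖ ^ 2 * (A.S k b * A.S k a)) <
        ‖∑ b ∈ Finset.univ \ {k}, ∑ a ∈ Finset.univ \ {k}, mres (A.H ω) z {k} b a *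
          (A.h k b ω * star (A.h k a ω) - if b = a then (A.S k b : ℂ) else 0)‖} ≤
        C ^ (q + 1) / t ^ (2 * (q + 1)) := by
    intro D
    -- The moment order is large enough for N^{2ε(q+1)} to exceed N^{D+1}; the spare power of N
    -- absorbs C^{q+1}.
    obtain ⟨q, hq⟩ := exists_nat_ge ((D + 1) / ε)
    obtain ⟨C, hC, h⟩ := large_deviation μ q
    refine ⟨q, C, hC, ?_, h⟩
    filter_upwards [eventually_le_rpow (C ^ (q + 1)) one_pos, Filter.eventually_ge_atTop 1]
      with N h1 h2
    have hN1 : (1 : ℝ) ≤ N := by exact_mod_cast h2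
    have hN0 : (0 : ℝ) < N := by linarith
    rw [Real.rpow_one] at h1
    have e : (N : ℝ) ^ (D + 1) ≤ ((N : ℝ) ^ ε) ^ (2 * (q + 1)) := by
      rw [← Real.rpow_natCast, ← Real.rpow_natCast ((N : ℝ) ^ ε), ← Real.rpow_mul hN0.le]
      refine Real.rpow_le_rpow_of_exponent_le hN1 ?_
      rw [div_le_iff₀ hε] at hq
      push_cast
      nlinarith
    calc _ ≤ (N : ℝ) / (N : ℝ) ^ (D + 1) := by gcongr
      _ = _ := by rw [pow_succ]; field_simp
  have hpos : ∀ᶠ N : ℕ in Filter.atTop, 0 < N := Filter.eventually_gt_atTop 0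
  have h1 : HP fun N (u : DomainPoint δ μ γ N) ω => ∀ k,
      ‖u.A.h k k ω‖ ≤ (N : ℝ) ^ ε * √(u.A.S k k) := by
    refine HP.of_forall (fun N => Fin N) 1 (by simp) _ fun D => ?_
    obtain ⟨q, C, hC, hN, h⟩ := key D
    filter_upwards [hN, hpos] with N hN hN0 u k
    simp only [not_le]
    exact (h u.A u.z (u.im_pos hN0 hδ hγ) k _ (by positivity)).1.trans hN
  have h2 : HP fun N (u : DomainPoint δ μ γ N) ω => ∀ p : Fin N × Fin N,
      ‖∑ b, u.A.h p.1 b ω * mres (u.A.H ω) u.z {p.1} b p.2‖ ≤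
        (N : ℝ) ^ ε * √(∑ b, ‖mres (u.A.H ω) u.z {p.1} b p.2‖ ^ 2 * u.A.S p.1 b) := by
    refine HP.of_forall (fun N => Fin N × Fin N) 2 (by simp [sq]) _ fun D => ?_
    obtain ⟨q, C, hC, hN, h⟩ := key D
    filter_upwards [hN, hpos] with N hN hN0 u p
    simp only [not_le]
    exact ((h u.A u.z (u.im_pos hN0 hδ hγ) p.1 _ (by positivity)).2.1 p.2).trans hN
  have h3 : HP fun N (u : DomainPoint δ μ γ N) ω => ∀ k,
      ‖∑ b ∈ Finset.univ \ {k}, ∑ a ∈ Finset.univ \ {k}, mres (u.A.H ω) u.z {k} b a *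
        (u.A.h k b ω * star (u.A.h k a ω) - if b = a then (u.A.S k b : ℂ) else 0)‖ ≤
      (N : ℝ) ^ ε * √(∑ b ∈ Finset.univ \ {k}, ∑ a ∈ Finset.univ \ {k},
        ‖mres (u.A.H ω) u.z {k} b a‖ ^ 2 * (u.A.S k b * u.A.S k a)) := by
    refine HP.of_forall (fun N => Fin N) 1 (by simp) _ fun D => ?_
    obtain ⟨q, C, hC, hN, h⟩ := key D
    filter_upwards [hN, hpos] with N hN hN0 u k
    simp only [not_le]
    exact (h u.A u.z (u.im_pos hN0 hδ hγ) k _ (by positivity)).2.2.trans hN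
  exact ((h1.and h2).and h3).mono (Filter.Eventually.of_forall fun N u ω h k =>
    ⟨h.1.1 k, fun j => h.1.2 (k, j), h.2 k⟩)

end LocalSemicircle
end

/-! ### The self-consistent equation -/

noncomputable section
namespace LocalSemicircle

section SelfConsistent

variable {N : ℕ} {H : Matrix (Fin N) (Fin N) ℂ} {S : Matrix (Fin N) (Fin N) ℝ} {z : ℂ}

/-- The error term of the self-consistent equation. -/
def scError (S : Matrix (Fin N) (Fin N) ℝ) (H : Matrix (Fin N) (Fin N) ℂ) (z : ℂ) (k : Fin N) : ℂ :=
  (res H z k k)⁻¹ + z + ∑ a, (S k a : ℂ) * res H z a a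

/-- The fluctuation omits a = k and uses the minor without k, whose diagonal entries differ from
those of G by rank-one corrections. Both contributions are of second order. -/
theorem scError_sub_fluct (hH : H.IsHermitian) (hz : 0 < z.im) (k : Fin N) :
    scError S H z k - fluct S H z k ∅ = (S k k : ℂ) * res H z k k +
      ∑ a ∈ Finset.univ.erase k, (S k a : ℂ) * (res H z a k * res H z k a / res H z k k) := by
  unfold scError fluct
  have h1 : ∑ a ∈ Finset.univ.erase k, (S k a : ℂ) *
      (if a ∈ (∅ : Finset (Fin N)) then 0 else mres H z (insert k ∅) a a) =
      ∑ a ∈ Finset.univ.erase k, (S k a : ℂ) * res H z a a -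
        ∑ a ∈ Finset.univ.erase k, (S k a : ℂ) * (res H z a k * res H z k a / res H z k k) := by
    rw [← Finset.sum_sub_distrib]
    refine Finset.sum_congr rfl fun a ha => ?_
    rw [if_neg (Finset.notMem_empty a), insert_empty_eq,
      mres_single hH hz (Finset.ne_of_mem_erase ha)]
    ring
  rw [h1, mres_empty, ← Finset.add_sum_erase Finset.univ (fun a => (S k a : ℂ) * res H z a a)
    (Finset.mem_univ k)]
  ring

theorem sum_weight_sub (hS : ∀ i, ∑ j, S i j = 1) (g : Fin N → ℂ) (m : ℂ) (k : Fin N) :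
    ∑ a, (S k a : ℂ) * (g a - m) = ∑ a, (S k a : ℂ) * g a - m := by
  simp only [mul_sub, Finset.sum_sub_distrib, ← Finset.sum_mul]
  rw [← Complex.ofReal_sum, hS k, Complex.ofReal_one, one_mul]

/-- Subtract 1/m = -z - m from the defining relation of the error and multiply by m G_kk. This exact
form is kept beside the linearized one: it bounds G_kk - m without a factor Γ once the weighted sum
is known. -/
theorem res_diag_sub_msc (hH : H.IsHermitian) (hz : 0 < z.im) (hS : ∀ i, ∑ j, S i j = 1)
    (k : Fin N) : res H z k k - msc z = msc z * res H z k k *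
      (∑ a, (S k a : ℂ) * (res H z a a - msc z) - scError S H z k) := by
  have h0 := res_diag_ne_zero hH hz k
  have hm := msc_eq hz
  rw [sum_weight_sub hS (fun a => res H z a a), scError]
  field_simp
  linear_combination (res H z k k) * hm

/-- On the left 1 - m²S acts on the vector G_kk - m, so `norm_le_Gam_mul` applies; replacing m G_kk
by m² costs a quadratic term. -/
theorem res_diag_sub_msc_linear (hH : H.IsHermitian) (hz : 0 < z.im) (hS : ∀ i, ∑ j, S i j = 1)
    (k : Fin N) : res H z k k - msc z -
      msc z ^ 2 * ∑ a, (S k a : ℂ) * (res H z a a - msc z) =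
      -(msc z ^ 2 * scError S H z k) + (res H z k k - msc z) ^ 2 / res H z k k := by
  have h0 := res_diag_ne_zero hH hz k
  have h := res_diag_sub_msc hH hz hS k
  set X := ∑ a, (S k a : ℂ) * (res H z a a - msc z)
  field_simp
  linear_combination (msc z) * h

end SelfConsistent

namespace Ensemble

variable {δ : ℝ} {μ : ℕ → ℝ} {N : ℕ} (A : Ensemble δ μ N) {z : ℂ} {t κ : ℝ} {ω : A.Ω} {k : Fin N}

/-- All entries of the resolvent are within `ψ` of those of `m(z)` times the identity. -/
def Close (z : ℂ) (ψ : ℝ) (ω : A.Ω) : Prop :=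
  ∀ i j, ‖res (A.H ω) z i j - (if i = j then msc z else 0)‖ ≤ ψ

variable {A}

/-- Bound the weights S_kb by 1/M and sum with the column form of the Ward identity. -/
theorem RowBounds.norm_linear_le (h : A.RowBounds z t ω k) (hz : 0 < z.im) (hM : 0 < A.M)
    (ht : 0 ≤ t) (hκ : ∀ b, b ≠ k → (mres (A.H ω) z {k} b b).im ≤ κ) {j : Fin N} (hj : j ≠ k) :
    ‖∑ b, A.H ω k b * mres (A.H ω) z {k} b j‖ ≤ t * √(κ / (A.M * z.im)) := by
  refine (h.linear j).trans (mul_le_mul_of_nonneg_left (Real.sqrt_le_sqrt ?_) ht)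
  have hw := im_res_diag' (isHermitian_minorize (A.isHermitian_H ω) {k}) hz j
  change (mres (A.H ω) z {k} j j).im = z.im * ∑ b, ‖mres (A.H ω) z {k} b j‖ ^ 2 at hw
  calc ∑ b, ‖mres (A.H ω) z {k} b j‖ ^ 2 * A.S k b
      ≤ ∑ b, ‖mres (A.H ω) z {k} b j‖ ^ 2 * (1 / A.M) :=
        Finset.sum_le_sum fun b _ => mul_le_mul_of_nonneg_left (A.S_le k b) (by positivity)
    _ = (mres (A.H ω) z {k} j j).im / (A.M * z.im) := by
        rw [← Finset.sum_mul, hw]; field_simp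
    _ ≤ _ := by gcongr; exact hκ j hj

/-- In the variance one weight is bounded by 1/M and summed by the Ward identity; the other is kept,
since it sums to at most one. -/
theorem RowBounds.norm_fluct_le (h : A.RowBounds z t ω k) (hz : 0 < z.im) (hM : 0 < A.M)
    (ht : 0 ≤ t) (hκ0 : 0 ≤ κ) (hκ : ∀ b, b ≠ k → (mres (A.H ω) z {k} b b).im ≤ κ) :
    ‖fluct A.S (A.H ω) z k ∅‖ ≤ t * (√(1 / A.M) + √(κ / (A.M * z.im))) := by
  rw [fluct_eq A.S (A.isHermitian_H ω) hz (Finset.notMem_empty k), insert_empty_eq, mul_add]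
  refine (norm_sub_le _ _).trans (add_le_add ?_ ?_)
  · exact h.diag.trans (mul_le_mul_of_nonneg_left (Real.sqrt_le_sqrt (A.S_le k k)) ht)
  refine h.quadratic.trans (mul_le_mul_of_nonneg_left (Real.sqrt_le_sqrt ?_) ht)
  calc ∑ b ∈ Finset.univ \ {k}, ∑ a ∈ Finset.univ \ {k},
        ‖mres (A.H ω) z {k} b a‖ ^ 2 * (A.S k b * A.S k a)
      ≤ ∑ b ∈ Finset.univ \ {k}, A.S k b * (κ / (A.M * z.im)) := by
        refine Finset.sum_le_sum fun b hb => ?_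
        have hbk : b ≠ k := by simpa using hb
        have hw := im_res_diag (isHermitian_minorize (A.isHermitian_H ω) {k}) hz b
        change (mres (A.H ω) z {k} b b).im = z.im * ∑ a, ‖mres (A.H ω) z {k} b a‖ ^ 2 at hw
        calc ∑ a ∈ Finset.univ \ {k}, ‖mres (A.H ω) z {k} b a‖ ^ 2 * (A.S k b * A.S k a)
            ≤ ∑ a, ‖mres (A.H ω) z {k} b a‖ ^ 2 * (A.S k b * (1 / A.M)) := by
              refine (Finset.sum_le_sum_of_subset_of_nonneg (Finset.subset_univ _)
                fun a _ _ => mul_nonneg (by positivity)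
                  (mul_nonneg (A.S_nonneg _ _) (A.S_nonneg _ _))).trans ?_
              exact Finset.sum_le_sum fun a _ => mul_le_mul_of_nonneg_left
                (mul_le_mul_of_nonneg_left (A.S_le k a) (A.S_nonneg k b)) (by positivity)
          _ = A.S k b * ((mres (A.H ω) z {k} b b).im / (A.M * z.im)) := by
              rw [← Finset.sum_mul, hw]; field_simp
          _ ≤ _ := by
              refine mul_le_mul_of_nonneg_left ?_ (A.S_nonneg k b)
              gcongr; exact hκ b hbk
    _ ≤ ∑ b, A.S k b * (κ / (A.M * z.im)) :=
        Finset.sum_le_sum_of_subset_of_nonneg (Finset.subset_univ _)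
          fun b _ _ => mul_nonneg (A.S_nonneg k b) (by positivity)
    _ = _ := by rw [← Finset.sum_mul, A.S_row_sum, one_mul]

theorem RowBounds.norm_off_diag_le (h : A.RowBounds z t ω k) (hz : 0 < z.im) (hM : 0 < A.M)
    (ht : 0 ≤ t) (hκ : ∀ b, b ≠ k → (mres (A.H ω) z {k} b b).im ≤ κ)
    (hG : ‖res (A.H ω) z k k‖ ≤ 2) {j : Fin N} (hj : j ≠ k) :
    ‖res (A.H ω) z k j‖ ≤ 2 * (t * √(κ / (A.M * z.im))) := by
  rw [res_row (A.isHermitian_H ω) hz hj, norm_mul, norm_neg]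
  exact mul_le_mul hG (h.norm_linear_le hz hM ht hκ hj) (norm_nonneg _) (by norm_num)

theorem RowBounds.norm_scError_le (h : A.RowBounds z t ω k) (hz : 0 < z.im) (hM : 1 ≤ A.M)
    (ht : 1 ≤ t) (hκ0 : 0 ≤ κ) (hκ : ∀ b, b ≠ k → (mres (A.H ω) z {k} b b).im ≤ κ)
    (hG : ∀ i j, ‖res (A.H ω) z i j‖ ≤ 2) :
    ‖scError A.S (A.H ω) z k‖ ≤ 5 * (t * (√(1 / A.M) + √(κ / (A.M * z.im)))) := by
  have hM0 : 0 < A.M := by linarith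
  have ht0 : 0 ≤ t := by linarith
  set w := t * (√(1 / A.M) + √(κ / (A.M * z.im))) with hw
  have hw1 : t * √(κ / (A.M * z.im)) ≤ w :=
    mul_le_mul_of_nonneg_left (by linarith [Real.sqrt_nonneg (1 / A.M)]) ht0
  have hw0 : 0 ≤ w := by positivity
  have hMw : 1 / A.M ≤ w := by
    have h1 : 1 / A.M ≤ √(1 / A.M) := by
      refine Real.le_sqrt_of_sq_le ?_
      have : 1 / A.M ≤ 1 := by rw [div_le_one hM0]; exact hM
      have h0 : 0 < 1 / A.M := by positivity
      nlinarith
    calc _ ≤ √(1 / A.M) + √(κ / (A.M * z.im)) := by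
          linarith [Real.sqrt_nonneg (κ / (A.M * z.im))]
      _ ≤ _ := le_mul_of_one_le_left (by positivity) ht
  have hX := h.norm_fluct_le hz hM0 ht0 hκ0 hκ
  have e := scError_sub_fluct (S := A.S) (A.isHermitian_H ω) hz k
  have e2 : scError A.S (A.H ω) z k = fluct A.S (A.H ω) z k ∅ + ((A.S k k : ℂ) * res (A.H ω) z k k +
      ∑ a ∈ Finset.univ.erase k, (A.S k a : ℂ) *
        (res (A.H ω) z a k * res (A.H ω) z k a / res (A.H ω) z k k)) := by
    rw [← e]; ring
  rw [e2]
  have h1 : ‖(A.S k k : ℂ) * res (A.H ω) z k k‖ ≤ w * 2 := by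
    rw [norm_mul, Complex.norm_of_nonneg (A.S_nonneg k k)]
    exact mul_le_mul ((A.S_le k k).trans hMw) (hG k k) (norm_nonneg _) hw0
  have h2 : ‖∑ a ∈ Finset.univ.erase k, (A.S k a : ℂ) *
        (res (A.H ω) z a k * res (A.H ω) z k a / res (A.H ω) z k k)‖ ≤ 2 * w := by
    calc _ ≤ ∑ a ∈ Finset.univ.erase k, A.S k a * (2 * w) := by
          refine (norm_sum_le _ _).trans (Finset.sum_le_sum fun a ha => ?_)
          have hak := Finset.ne_of_mem_erase ha
          rw [norm_mul, Complex.norm_of_nonneg (A.S_nonneg k a)]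
          refine mul_le_mul_of_nonneg_left ?_ (A.S_nonneg k a)
          have h0 := res_diag_ne_zero (A.isHermitian_H ω) hz k
          -- Expanding one factor along row k cancels the denominator, so no lower bound on G_kk is
          -- needed. The estimate is thus available at η = 10 without prior closeness.
          have e3 : res (A.H ω) z a k * res (A.H ω) z k a / res (A.H ω) z k k =
              -(res (A.H ω) z a k * ∑ b, A.H ω k b * mres (A.H ω) z {k} b a) := by
            rw [res_row (A.isHermitian_H ω) hz hak]; field_simp
          rw [e3, norm_neg, norm_mul]
          exact mul_le_mul (hG a k) ((h.norm_linear_le hz hM0 ht0 hκ hak).trans hw1)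
            (norm_nonneg _) (by norm_num)
      _ ≤ ∑ a, A.S k a * (2 * w) :=
          Finset.sum_le_sum_of_subset_of_nonneg (Finset.subset_univ _)
            fun a _ _ => mul_nonneg (A.S_nonneg k a) (by positivity)
      _ = _ := by rw [← Finset.sum_mul, A.S_row_sum, one_mul]
  refine (norm_add_le _ _).trans ((add_le_add hX (norm_add_le _ _)).trans ?_)
  linarith

section Close

variable {ψ : ℝ}

theorem Close.norm_le (h : A.Close z ψ ω) (hz : 0 < z.im) (hψ : ψ ≤ 1) (i j : Fin N) :
    ‖res (A.H ω) z i j‖ ≤ 2 := by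
  have h1 := h i j
  have h2 : ‖(if i = j then msc z else 0)‖ ≤ 1 := by
    split_ifs
    · exact (norm_msc_lt_one hz).le
    · simp
  calc _ = ‖(res (A.H ω) z i j - (if i = j then msc z else 0)) + (if i = j then msc z else 0)‖ := by
        rw [sub_add_cancel]
    _ ≤ _ := (norm_add_le _ _).trans (by linarith)

theorem Close.minorsClose (h : A.Close z ψ ω) (hz : 0 < z.im) (hm : ‖(msc z)⁻¹‖ ≤ 16)
    (hψ0 : 0 ≤ ψ) (hψ : 64 * ψ ≤ 1) (k : Fin N) :
    MinorsClose (A.H ω) z (msc z) {k} (2 * ψ) 32 := by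
  have := minorsClose_of_close (A.isHermitian_H ω) hz (by norm_num : (1 : ℝ) ≤ 16)
    (msc_ne_zero hz) hm h hψ0 1 (by linarith) (W := {k}) (by simp)
  norm_num at this
  exact this

theorem Close.im_mres_le (h : A.Close z ψ ω) (hz : 0 < z.im) (hm : ‖(msc z)⁻¹‖ ≤ 16)
    (hψ0 : 0 ≤ ψ) (hψ : 64 * ψ ≤ 1) {k b : Fin N} (hb : b ≠ k) :
    (mres (A.H ω) z {k} b b).im ≤ (msc z).im + 2 * ψ := by
  have h1 := (h.minorsClose hz hm hψ0 hψ k).close {k} (Finset.Subset.refl _) b b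
    (by simpa using hb) (by simpa using hb)
  rw [if_pos rfl] at h1
  have h2 := (Complex.abs_im_le_norm (mres (A.H ω) z {k} b b - msc z)).trans h1
  rw [Complex.sub_im] at h2
  linarith [le_abs_self ((mres (A.H ω) z {k} b b).im - (msc z).im)]

theorem Close.norm_inv_le (h : A.Close z ψ ω) (hz : 0 < z.im) (hm : ‖(msc z)⁻¹‖ ≤ 16)
    (hψ : 64 * ψ ≤ 1) (k : Fin N) : ‖(res (A.H ω) z k k)⁻¹‖ ≤ 32 := by
  have h1 := h k k
  rw [if_pos rfl] at h1
  have hm0 : 0 < ‖msc z‖ := norm_pos_iff.2 (msc_ne_zero hz)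
  rw [norm_inv] at hm ⊢
  have h2 : 1 / 16 ≤ ‖msc z‖ := by
    rw [one_div]; exact inv_le_of_inv_le₀ hm0 hm
  have h3 : ‖msc z‖ ≤ ‖res (A.H ω) z k k‖ + ψ := by
    calc _ = ‖res (A.H ω) z k k - (res (A.H ω) z k k - msc z)‖ := by rw [sub_sub_cancel]
      _ ≤ _ := (norm_sub_le _ _).trans (by linarith)
  have h4 : (1 / 32 : ℝ) ≤ ‖res (A.H ω) z k k‖ := by linarith
  calc _ ≤ (1 / 32 : ℝ)⁻¹ := inv_anti₀ (by norm_num) h4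
    _ = 32 := by norm_num

theorem Close.norm_scError_sub_fluct_le (h : A.Close z ψ ω) (hz : 0 < z.im)
    (hm : ‖(msc z)⁻¹‖ ≤ 16) (hψ0 : 0 ≤ ψ) (hψ : 64 * ψ ≤ 1) (k : Fin N) :
    ‖scError A.S (A.H ω) z k - fluct A.S (A.H ω) z k ∅‖ ≤ 2 * (1 / A.M) + 32 * ψ ^ 2 := by
  rw [scError_sub_fluct (A.isHermitian_H ω) hz k]
  refine (norm_add_le _ _).trans (add_le_add ?_ ?_)
  · rw [norm_mul, Complex.norm_of_nonneg (A.S_nonneg k k), mul_comm]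
    have h0 : (0 : ℝ) ≤ 1 / A.M := (A.S_nonneg k k).trans (A.S_le k k)
    exact mul_le_mul (h.norm_le hz (by linarith) k k) (A.S_le k k) (A.S_nonneg k k) (by norm_num)
  · calc _ ≤ ∑ a ∈ Finset.univ.erase k, A.S k a * (32 * ψ ^ 2) := by
          refine (norm_sum_le _ _).trans (Finset.sum_le_sum fun a ha => ?_)
          have hak := Finset.ne_of_mem_erase ha
          rw [norm_mul, Complex.norm_of_nonneg (A.S_nonneg k a)]
          refine mul_le_mul_of_nonneg_left ?_ (A.S_nonneg k a)
          have h1 := h a k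
          have h2 := h k a
          rw [if_neg hak, sub_zero] at h1
          rw [if_neg hak.symm, sub_zero] at h2
          rw [div_eq_mul_inv, norm_mul, norm_mul]
          have h3 := h.norm_inv_le hz hm hψ k
          calc _ ≤ ψ * ψ * 32 := by gcongr
            _ = _ := by ring
      _ ≤ ∑ a, A.S k a * (32 * ψ ^ 2) :=
          Finset.sum_le_sum_of_subset_of_nonneg (Finset.subset_univ _)
            fun a _ _ => mul_nonneg (A.S_nonneg k a) (by positivity)
      _ = _ := by rw [← Finset.sum_mul, A.S_row_sum, one_mul]

theorem Close.norm_sq_div_le (h : A.Close z ψ ω) (hz : 0 < z.im)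
    (hm : ‖(msc z)⁻¹‖ ≤ 16) (hψ : 64 * ψ ≤ 1) (k : Fin N) :
    ‖(res (A.H ω) z k k - msc z) ^ 2 / res (A.H ω) z k k‖ ≤ 32 * ψ ^ 2 := by
  have h1 := h k k
  rw [if_pos rfl] at h1
  rw [div_eq_mul_inv, norm_mul, norm_pow, mul_comm]
  have h3 := h.norm_inv_le hz hm hψ k
  gcongr

end Close

end Ensemble
end LocalSemicircle
end

/-! ### Self-improvement and the gap in the size of the error -/

noncomputable section
namespace LocalSemicircle

namespace Ensemble

variable {δ : ℝ} {μ : ℕ → ℝ} {N : ℕ} {A : Ensemble δ μ N} {z : ℂ} {t ψ : ℝ} {ω : A.Ω}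

/-- As |m| ≥ 1/16, the identity Im m = |m|²(η + Im m) gives η ≤ 16² Im m. Terms of size M^{-1/2} are
thus absorbed in √(Im m/(Mη)). -/
theorem inv_M_le (hz : 0 < z.im) (hm : ‖(msc z)⁻¹‖ ≤ 16) (hM : 0 < A.M) :
    1 / A.M ≤ 16 ^ 2 * ((msc z).im / (A.M * z.im)) := by
  have hm0 : 0 < ‖msc z‖ := norm_pos_iff.2 (msc_ne_zero hz)
  rw [norm_inv] at hm
  have h2 : 1 / 16 ≤ ‖msc z‖ := by
    rw [one_div]; exact inv_le_of_inv_le₀ hm0 hm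
  have h3 := im_msc_eq hz
  have h4 := im_msc_pos hz
  have h5 : z.im ≤ 16 ^ 2 * (msc z).im := by
    have : (1 / 16) ^ 2 ≤ ‖msc z‖ ^ 2 := pow_le_pow_left₀ (by norm_num) h2 2
    nlinarith
  rw [mul_div_assoc', div_le_div_iff₀ hM (by positivity)]
  nlinarith

/-- The deterministic consequences of the row bounds at a point where the resolvent is close to
`m`. -/
theorem Close.row_estimates (h : A.Close z ψ ω) (hr : ∀ k, A.RowBounds z t ω k) (hz : 0 < z.im)
    (hm : ‖(msc z)⁻¹‖ ≤ 16) (hM : 1 ≤ A.M) (ht : 1 ≤ t) (hψ0 : 0 ≤ ψ) (hψ : 64 * ψ ≤ 1) :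
    (∀ k, ‖scError A.S (A.H ω) z k‖ ≤ 90 * (t * √(((msc z).im + ψ) / (A.M * z.im)))) ∧
    ∀ k j, k ≠ j → ‖res (A.H ω) z k j‖ ≤ 4 * (t * √(((msc z).im + ψ) / (A.M * z.im))) := by
  have hM0 : 0 < A.M := by linarith
  have ht0 : 0 ≤ t := by linarith
  have him := im_msc_pos hz
  set Θ := √(((msc z).im + ψ) / (A.M * z.im)) with hΘ
  have h1 : √(1 / A.M) ≤ 16 * Θ := by
    rw [hΘ, ← Real.sqrt_sq (by norm_num : (0 : ℝ) ≤ 16), ← Real.sqrt_mul (by norm_num)]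
    refine Real.sqrt_le_sqrt ((inv_M_le hz hm hM0).trans ?_)
    gcongr
    linarith
  have h2 : √(((msc z).im + 2 * ψ) / (A.M * z.im)) ≤ 2 * Θ := by
    have e : 2 * Θ = √(2 ^ 2 * (((msc z).im + ψ) / (A.M * z.im))) := by
      rw [Real.sqrt_mul (by norm_num), Real.sqrt_sq (by norm_num)]
    rw [e]
    refine Real.sqrt_le_sqrt ?_
    rw [mul_div_assoc']
    gcongr
    linarith
  have hκ : ∀ k b, b ≠ k → (mres (A.H ω) z {k} b b).im ≤ (msc z).im + 2 * ψ :=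
    fun k b hb => h.im_mres_le hz hm hψ0 hψ hb
  constructor
  · intro k
    refine ((hr k).norm_scError_le hz hM ht (by positivity) (hκ k)
      (h.norm_le hz (by linarith))).trans ?_
    have : t * (√(1 / A.M) + √(((msc z).im + 2 * ψ) / (A.M * z.im))) ≤ t * (18 * Θ) :=
      mul_le_mul_of_nonneg_left (by linarith) ht0
    linarith
  · intro k j hkj
    refine ((hr k).norm_off_diag_le hz hM0 ht0 (hκ k) (h.norm_le hz (by linarith) k k)
      hkj.symm).trans ?_
    have := mul_le_mul_of_nonneg_left h2 ht0
    linarith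

/-- The stability bound applied to the linearized equation controls the diagonal, with residual of
size tΘ + ψ²; the off-diagonal entries come from the row estimates. -/
theorem Close.self_improve (hN : 0 < N) (h : A.Close z ψ ω) (hr : ∀ k, A.RowBounds z t ω k)
    (hz : 0 < z.im)
    (hm : ‖(msc z)⁻¹‖ ≤ 16) (hM : 1 ≤ A.M) (ht : 1 ≤ t) (hψ0 : 0 ≤ ψ) (hψ : 64 * ψ ≤ 1) :
    A.Close z (Gam A.S z * (90 * (t * √(((msc z).im + ψ) / (A.M * z.im))) + 32 * ψ ^ 2) +
      4 * (t * √(((msc z).im + ψ) / (A.M * z.im)))) ω := by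
  obtain ⟨h1, h2⟩ := h.row_estimates hr hz hm hM ht hψ0 hψ
  set Θ := √(((msc z).im + ψ) / (A.M * z.im)) with hΘ
  have hΘ0 : 0 ≤ Θ := Real.sqrt_nonneg _
  have hG := half_le_Gam A.S_nonneg A.S_row_sum hN hz
  have hG0 : 0 ≤ Gam A.S z := by linarith
  have hd : ∀ k, ‖res (A.H ω) z k k - msc z‖ ≤ Gam A.S z * (90 * (t * Θ) + 32 * ψ ^ 2) := by
    refine norm_le_Gam_mul (x := fun k => res (A.H ω) z k k - msc z) A.S_nonneg A.S_row_sum hz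
      fun k => ?_
    rw [res_diag_sub_msc_linear (A.isHermitian_H ω) hz A.S_row_sum]
    refine (norm_add_le _ _).trans (add_le_add ?_ (h.norm_sq_div_le hz hm hψ k))
    rw [norm_neg, norm_mul, norm_pow]
    refine (mul_le_of_le_one_left (norm_nonneg _)
      (pow_le_one₀ (norm_nonneg _) (norm_msc_lt_one hz).le)).trans (h1 k)
  intro i j
  by_cases hij : i = j
  · subst hij
    rw [if_pos rfl]
    refine (hd i).trans ?_
    have : 0 ≤ 4 * (t * Θ) := by positivity
    linarith
  · rw [if_neg hij, sub_zero]
    refine (h2 i j hij).trans ?_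
    have : 0 ≤ Gam A.S z * (90 * (t * Θ) + 32 * ψ ^ 2) := by positivity
    linarith

/-- At η = 10 both m and G_kk have modulus at most 1/10, so the exact equation is a contraction in
the maximum norm and no a priori bound is required. -/
theorem close_of_im_eq_ten (hN : 0 < N) (hr : ∀ k, A.RowBounds z t ω k) (hz : z.im = 10)
    (hM : 1 ≤ A.M) (ht : 1 ≤ t) : A.Close z (4 * (t * √(1 / A.M))) ω := by
  have hz0 : 0 < z.im := by rw [hz]; norm_num
  have hM0 : 0 < A.M := by linarith
  have ht0 : 0 ≤ t := by linarith
  have hκ : ∀ k b, b ≠ k → (mres (A.H ω) z {k} b b).im ≤ 1 / 10 := by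
    intro k b _
    refine (le_abs_self _).trans ((Complex.abs_im_le_norm _).trans ?_)
    rw [← hz]; exact A.norm_mres_H_le hz0 _ _ _ _
  have hG : ∀ i j, ‖res (A.H ω) z i j‖ ≤ 1 / 10 := fun i j => by
    rw [← hz]; exact norm_res_le (A.isHermitian_H ω) hz0 i j
  have hG2 : ∀ i j, ‖res (A.H ω) z i j‖ ≤ 2 := fun i j => (hG i j).trans (by norm_num)
  have hmm : ‖msc z‖ ≤ 1 / 10 := by
    have := norm_msc_le_inv_im hz0
    rw [hz] at this; linarith
  have hsq : √(1 / 10 / (A.M * z.im)) ≤ √(1 / A.M) := by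
    refine Real.sqrt_le_sqrt ?_
    rw [hz, div_div]
    exact one_div_le_one_div_of_le hM0 (by nlinarith)
  set s := √(1 / A.M) with hs
  have hs0 : 0 ≤ s := Real.sqrt_nonneg _
  have hts : t * √(1 / 10 / (A.M * z.im)) ≤ t * s := mul_le_mul_of_nonneg_left hsq ht0
  have hts0 : 0 ≤ t * s := by positivity
  have hΥ : ∀ k, ‖scError A.S (A.H ω) z k‖ ≤ 10 * (t * s) := fun k => by
    refine ((hr k).norm_scError_le hz0 hM ht (by norm_num) (hκ k) hG2).trans ?_
    rw [mul_add]; linarith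
  have : Nonempty (Fin N) := ⟨⟨0, hN⟩⟩
  obtain ⟨k₀, -, hk₀⟩ := Finset.exists_max_image Finset.univ
    (fun k => ‖res (A.H ω) z k k - msc z‖) Finset.univ_nonempty
  set V := ‖res (A.H ω) z k₀ k₀ - msc z‖ with hV
  have hV0 : 0 ≤ V := norm_nonneg _
  have hd : V ≤ t * s := by
    have e := res_diag_sub_msc (A.isHermitian_H ω) hz0 A.S_row_sum k₀
    have e1 : ‖∑ a, (A.S k₀ a : ℂ) * (res (A.H ω) z a a - msc z)‖ ≤ V := by
      calc _ ≤ ∑ a, A.S k₀ a * V := by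
            refine (norm_sum_le _ _).trans (Finset.sum_le_sum fun a _ => ?_)
            rw [norm_mul, Complex.norm_of_nonneg (A.S_nonneg k₀ a)]
            exact mul_le_mul_of_nonneg_left (hk₀ a (Finset.mem_univ a)) (A.S_nonneg k₀ a)
        _ = V := by rw [← Finset.sum_mul, A.S_row_sum, one_mul]
    have e2 : V ≤ 1 / 10 * (1 / 10) * (V + 10 * (t * s)) := by
      calc V = ‖msc z‖ * ‖res (A.H ω) z k₀ k₀‖ *
            ‖∑ a, (A.S k₀ a : ℂ) * (res (A.H ω) z a a - msc z) - scError A.S (A.H ω) z k₀‖ := by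
            rw [hV, ← norm_mul, ← norm_mul]; exact congrArg norm e
        _ ≤ _ := ?_
      refine mul_le_mul (mul_le_mul hmm (hG _ _) (norm_nonneg _) (by norm_num))
        ((norm_sub_le _ _).trans (add_le_add e1 (hΥ k₀))) (norm_nonneg _) (by norm_num)
    linarith
  intro i j
  by_cases hij : i = j
  · subst hij
    rw [if_pos rfl]
    have := hk₀ i (Finset.mem_univ i)
    linarith
  · rw [if_neg hij, sub_zero]
    refine ((hr i).norm_off_diag_le hz0 hM0 ht0 (hκ i) (hG2 i i) (Ne.symm hij)).trans ?_
    linarith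

end Ensemble

section Gap

variable {δ : ℝ} {μ : ℕ → ℝ} {γ : ℝ}

/-- The a priori control parameter `M^{-γ/3} / Γ`. -/
def DomainPoint.apriori {N : ℕ} (u : DomainPoint δ μ γ N) : ℝ :=
  u.A.M ^ (-(γ / 3)) / Gam u.A.S u.z

/-- The domain conditions in terms of a = M^{-γ/3}: M^{-γ} is a³ and M^{-2γ} is a⁶. -/
theorem DomainPoint.apriori_bounds (hδ : 0 < δ) (hγ : γ ∈ Set.Ioo (0 : ℝ) (1 / 2)) {N : ℕ}
    (hN : 0 < N) (u : DomainPoint δ μ γ N) :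
    0 < u.A.M ^ (-(γ / 3)) ∧ u.A.M ^ (-(γ / 3)) ≤ (N : ℝ) ^ (-(δ * γ / 3)) ∧
    1 / (u.A.M * u.z.im) ≤ (u.A.M ^ (-(γ / 3))) ^ 3 / Gam u.A.S u.z ^ 3 ∧
    (msc u.z).im / (u.A.M * u.z.im) ≤ (u.A.M ^ (-(γ / 3))) ^ 6 / Gam u.A.S u.z ^ 4 := by
  have hM := u.A.M_pos hN
  have hN0 : (0 : ℝ) < N := by exact_mod_cast hN
  obtain ⟨h1, h2⟩ := u.eta_bounds hN hδ hγ
  have hz := u.im_pos hN hδ hγ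
  have him := im_msc_pos hz
  have hG := u.half_le_Gam hN hδ hγ
  have hG0 : 0 < Gam u.A.S u.z := by linarith
  have e3 : (u.A.M ^ (-(γ / 3))) ^ 3 = u.A.M ^ (-γ) := by
    rw [← Real.rpow_natCast, ← Real.rpow_mul hM.le]; congr 1; push_cast; ring
  have e6 : (u.A.M ^ (-(γ / 3))) ^ 6 = u.A.M ^ (-(2 * γ)) := by
    rw [← Real.rpow_natCast, ← Real.rpow_mul hM.le]; congr 1; push_cast; ring
  refine ⟨by positivity, ?_, by rw [e3]; exact h1, ?_⟩
  · have hl : (N : ℝ) ^ δ ≤ u.A.M := u.A.lower_M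
    have e : (N : ℝ) ^ (-(δ * γ / 3)) = ((N : ℝ) ^ δ) ^ (-(γ / 3)) := by
      rw [← Real.rpow_mul hN0.le]; congr 1; ring
    rw [e]
    exact Real.rpow_le_rpow_of_nonpos (by positivity) hl (by linarith [hγ.1])
  · rw [e6]
    rw [div_le_div_iff₀ (by positivity) (by positivity)] at h2 ⊢
    linarith

/-- Put ψ = a/Γ with a = M^{-γ/3} into `Close.self_improve`. Then Γψ² = a²/Γ, and the powers Γ³ and
Γ⁴ in the domain are those that give Θ ≤ 2a²/Γ². Everything is O(ta) times a/Γ, and ta is small. -/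
theorem hp_gap (hδ : 0 < δ) (hγ : γ ∈ Set.Ioo (0 : ℝ) (1 / 2)) :
    HP fun N (u : DomainPoint δ μ γ N) ω =>
      u.A.Close u.z u.apriori ω → u.A.Close u.z (u.apriori / 2) ω := by
  have hδγ : 0 < δ * γ / 6 := by have := hγ.1; positivity
  refine (hp_rowBounds hδ hγ hδγ).mono ?_
  -- 456 = 2(196 + 32): at the end (196t + 32)a ≤ 228ta has to be at most 1/2, where ta ≤ 1/t.
  filter_upwards [eventually_le_rpow 456 hδγ, Filter.eventually_gt_atTop 0] with N hlarge hN u ω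
    hr hcl
  have hN1 : (1 : ℝ) ≤ N := by exact_mod_cast hN
  have hN0 : (0 : ℝ) < N := by linarith
  obtain ⟨ha0, haN, hb3, hb6⟩ := u.apriori_bounds hδ hγ hN
  have hz := u.im_pos hN hδ hγ
  have hM := u.A.one_le_M hN hδ.le
  have hM0 := u.A.M_pos hN
  have hG := u.half_le_Gam hN hδ hγ
  set t := (N : ℝ) ^ (δ * γ / 6) with ht
  have hta : t * u.A.M ^ (-(γ / 3)) ≤ t⁻¹ := by
    calc t * u.A.M ^ (-(γ / 3)) ≤ t * (N : ℝ) ^ (-(δ * γ / 3)) := by gcongr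
      _ = t⁻¹ := by
        rw [ht, ← Real.rpow_add hN0, ← Real.rpow_neg hN0.le]; congr 1; ring
  have hti : t⁻¹ ≤ 1 / 456 := by
    rw [one_div]; exact inv_anti₀ (by norm_num) hlarge
  unfold DomainPoint.apriori at hcl ⊢
  set a := u.A.M ^ (-(γ / 3)) with ha
  set g := Gam u.A.S u.z with hg
  have hg0 : 0 < g := by linarith
  have ht0 : 0 < t := by linarith
  have ha1 : 456 * a ≤ 1 := by nlinarith
  have hψ : 64 * (a / g) ≤ 1 := by
    rw [mul_div_assoc', div_le_one hg0]; linarith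
  have himp := hcl.self_improve hN hr hz (u.norm_inv_msc_le hN hδ hγ) hM (by linarith)
    (by positivity) hψ
  have hΘ : √(((msc u.z).im + a / g) / (u.A.M * u.z.im)) ≤ 2 * (a ^ 2 / g ^ 2) := by
    refine Real.sqrt_le_iff.2 ⟨by positivity, ?_⟩
    rw [add_div]
    have h1 : a / g / (u.A.M * u.z.im) ≤ a ^ 4 / g ^ 4 := by
      calc _ = a / g * (1 / (u.A.M * u.z.im)) := by ring
        _ ≤ a / g * (a ^ 3 / g ^ 3) := by gcongr
        _ = _ := by field_simp
    have h2 : a ^ 6 / g ^ 4 ≤ a ^ 4 / g ^ 4 := by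
      gcongr ?_ / _
      exact pow_le_pow_of_le_one ha0.le (by linarith) (by norm_num)
    have e : (2 * (a ^ 2 / g ^ 2)) ^ 2 = 4 * (a ^ 4 / g ^ 4) := by rw [mul_pow, div_pow]; ring
    have h3 : 0 ≤ a ^ 4 / g ^ 4 := by positivity
    rw [e]; linarith
  set Θ := √(((msc u.z).im + a / g) / (u.A.M * u.z.im)) with hΘdef
  intro i j
  refine (himp i j).trans ?_
  have hΘ0 : 0 ≤ Θ := Real.sqrt_nonneg _
  have htΘ : t * Θ ≤ t * (2 * (a ^ 2 / g ^ 2)) := mul_le_mul_of_nonneg_left hΘ ht0.le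
  have hgi : 1 / g ^ 2 ≤ 2 / g := by
    rw [div_le_div_iff₀ (by positivity) hg0]; nlinarith
  calc g * (90 * (t * Θ) + 32 * (a / g) ^ 2) + 4 * (t * Θ)
      ≤ g * (90 * (t * (2 * (a ^ 2 / g ^ 2))) + 32 * (a / g) ^ 2) +
        4 * (t * (2 * (a ^ 2 / g ^ 2))) := by gcongr
    _ = (180 * t + 32) * a ^ 2 / g + 8 * t * a ^ 2 * (1 / g ^ 2) := by
        field_simp; ring
    _ ≤ (180 * t + 32) * a ^ 2 / g + 8 * t * a ^ 2 * (2 / g) := by gcongr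
    _ = (196 * t + 32) * a * (a / g) := by ring
    _ ≤ 1 / 2 * (a / g) := by
        refine mul_le_mul_of_nonneg_right ?_ (by positivity)
        have : t * a ≤ 1 / 456 := hta.trans hti
        nlinarith
    _ = _ := by ring

/-- At height 10 the error is tM^{-1/2}, which γ < 1/2 keeps well below M^{-γ/3}, and Γ ≤ 2. -/
theorem hp_initial (hδ : 0 < δ) (hγ : γ ∈ Set.Ioo (0 : ℝ) (1 / 2)) :
    HP fun N (u : DomainPoint δ μ γ N) ω => u.z.im = 10 → u.A.Close u.z (u.apriori / 2) ω := by
  have hδ6 : 0 < δ / 6 := by positivity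
  refine (hp_rowBounds hδ hγ hδ6).mono ?_
  filter_upwards [eventually_le_rpow 16 hδ6, Filter.eventually_gt_atTop 0] with N hlarge hN u ω
    hr hz10
  have hN0 : (0 : ℝ) < N := by exact_mod_cast hN
  have hM := u.A.one_le_M hN hδ.le
  have hM0 := u.A.M_pos hN
  have hz := u.im_pos hN hδ hγ
  set t := (N : ℝ) ^ (δ / 6) with ht
  have hcl := Ensemble.close_of_im_eq_ten hN hr hz10 hM (by linarith)
  have hG := u.half_le_Gam hN hδ hγ
  have hG2 : Gam u.A.S u.z ≤ 2 := by
    have h1 := Gam_le_of_norm u.A.S_nonneg u.A.S_row_sum hz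
    have h2 := norm_msc_le_inv_im hz
    rw [hz10] at h2
    have h3 : ‖msc u.z‖ ^ 2 ≤ 1 / 2 := by nlinarith [norm_nonneg (msc u.z)]
    nlinarith
  have hG0 : 0 < Gam u.A.S u.z := by linarith
  have hkey : 4 * (t * √(1 / u.A.M)) ≤ u.A.M ^ (-(γ / 3)) / 4 := by
    have hl : (N : ℝ) ^ δ ≤ u.A.M := u.A.lower_M
    have e1 : √(1 / u.A.M) = u.A.M ^ (-(1 / 2) : ℝ) := by
      rw [Real.sqrt_eq_rpow, one_div, Real.inv_rpow hM0.le, Real.rpow_neg hM0.le]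
    have e2 : t * t ≤ u.A.M ^ (1 / 3 : ℝ) := by
      calc t * t = ((N : ℝ) ^ δ) ^ (1 / 3 : ℝ) := by
            rw [ht, ← Real.rpow_add hN0, ← Real.rpow_mul hN0.le]; congr 1; ring
        _ ≤ _ := Real.rpow_le_rpow (by positivity) hl (by norm_num)
    have e3 : u.A.M ^ (1 / 3 : ℝ) * u.A.M ^ (-(1 / 2) : ℝ) ≤ u.A.M ^ (-(γ / 3)) := by
      rw [← Real.rpow_add hM0]
      exact Real.rpow_le_rpow_of_exponent_le hM (by linarith [hγ.2])
    rw [e1]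
    set b := u.A.M ^ (-(1 / 2) : ℝ) with hb
    have hb0 : 0 < b := by positivity
    have e4 : t * t * b ≤ u.A.M ^ (-(γ / 3)) :=
      (mul_le_mul_of_nonneg_right e2 hb0.le).trans e3
    have e5 : 16 * (t * b) ≤ t * (t * b) := mul_le_mul_of_nonneg_right hlarge (by positivity)
    linarith
  intro i j
  refine (hcl i j).trans (hkey.trans ?_)
  unfold DomainPoint.apriori
  rw [div_div, div_le_div_iff₀ (by norm_num) (by positivity)]
  have : 0 < u.A.M ^ (-(γ / 3)) := by positivity
  nlinarith

end Gap
end LocalSemicircle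
end

/-! ### Descent in η from height 10 -/

noncomputable section
namespace LocalSemicircle

/-- With |m| ≥ 1/16 and η ≥ 1/(8n), the bound |m|²η ≤ 1 - |m|² keeps both |m|² below 1 - 1/(2048n),
where 2048 = 16² · 8. -/
theorem norm_msc_sub_le_mul {n : ℝ} (hn : 0 < n) {z w : ℂ} (hz : 0 < z.im) (hw : 0 < w.im)
    (hzn : 1 / z.im ≤ 8 * n) (hwn : 1 / w.im ≤ 8 * n) (hmz : ‖(msc z)⁻¹‖ ≤ 16)
    (hmw : ‖(msc w)⁻¹‖ ≤ 16) : ‖msc z - msc w‖ ≤ 2048 * n * ‖z - w‖ := by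
  have key : ∀ {z : ℂ}, 0 < z.im → 1 / z.im ≤ 8 * n → ‖(msc z)⁻¹‖ ≤ 16 →
      ‖msc z‖ ^ 2 ≤ 1 - 1 / (2048 * n) := by
    intro z hz hzn hm
    have hm0 : 0 < ‖msc z‖ := norm_pos_iff.2 (msc_ne_zero hz)
    rw [norm_inv] at hm
    have h2 : 1 / 16 ≤ ‖msc z‖ := by rw [one_div]; exact inv_le_of_inv_le₀ hm0 hm
    have h3 := one_sub_norm_msc_sq_ge hz
    have h4 : (1 / 16) ^ 2 ≤ ‖msc z‖ ^ 2 := pow_le_pow_left₀ (by norm_num) h2 2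
    have h5 : 1 / (8 * n) ≤ z.im := by
      rw [div_le_iff₀ (by positivity)]
      rwa [div_le_iff₀ hz, mul_comm] at hzn
    have h6 : (1 / 16) ^ 2 * (1 / (8 * n)) ≤ ‖msc z‖ ^ 2 * z.im :=
      mul_le_mul h4 h5 (by positivity) (by positivity)
    have h7 : (1 / 16 : ℝ) ^ 2 * (1 / (8 * n)) = 1 / (2048 * n) := by field_simp; norm_num
    linarith
  have h := norm_msc_sub_le hz hw
  have hp : 1 / (2048 * n) ≤ 1 - ‖msc z‖ * ‖msc w‖ := by
    nlinarith [key hz hzn hmz, key hw hwn hmw, sq_nonneg (‖msc z‖ - ‖msc w‖)]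
  have h1 := (mul_le_mul_of_nonneg_left hp (norm_nonneg (msc z - msc w))).trans h
  rw [mul_one_div, div_le_iff₀ (by positivity)] at h1
  linarith

variable {δ : ℝ} {μ : ℕ → ℝ} {γ : ℝ}

theorem DomainPoint.apriori_ge (hδ : 0 < δ) (hγ : γ ∈ Set.Ioo (0 : ℝ) (1 / 2)) {N : ℕ}
    (hN : 0 < N) (u : DomainPoint δ μ γ N) : 1 / (10 * (N : ℝ)) ≤ u.apriori := by
  obtain ⟨ha0, -, hb3, -⟩ := u.apriori_bounds hδ hγ hN
  have hN1 : (1 : ℝ) ≤ N := by exact_mod_cast hN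
  have hz := u.im_pos hN hδ hγ
  have hM0 := u.A.M_pos hN
  have hMN : u.A.M ≤ N := u.A.M_le
  have hG := u.half_le_Gam hN hδ hγ
  have hp : 0 < u.apriori := div_pos ha0 (by linarith)
  rw [← div_pow] at hb3
  change _ ≤ u.apriori ^ 3 at hb3
  have h1 : 1 / (10 * (N : ℝ)) ≤ u.apriori ^ 3 := by
    refine le_trans (one_div_le_one_div_of_le (by positivity) ?_) hb3
    nlinarith [u.mem.2.2]
  rcases le_total 1 u.apriori with h | h
  · refine le_trans ?_ h
    rw [div_le_one (by positivity)]; linarith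
  · exact h1.trans (pow_le_of_le_one hp.le h (by norm_num))

/-- Across one step of the net all quantities change by O(N^{-3}), while half of the a priori size
is at least 1/(20N). -/
theorem DomainPoint.close_of_close (hδ : 0 < δ) (hγ : γ ∈ Set.Ioo (0 : ℝ) (1 / 2)) {N : ℕ}
    (hN : 2000 ≤ N) (u : DomainPoint δ μ γ N) {w : ℂ} (hw : w ∈ specDomain u.A.S γ)
    (huw : ‖u.z - w‖ ≤ 10 / (N : ℝ) ^ 6) {ω : u.A.Ω}
    (h : u.A.Close w ((DomainPoint.mk u.A w hw).apriori / 2) ω) :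
    u.A.Close u.z u.apriori ω := by
  set v : DomainPoint δ μ γ N := ⟨u.A, w, hw⟩ with hv
  have hN0' : 0 < N := by omega
  have hN0 : (0 : ℝ) < N := by exact_mod_cast hN0'
  have hN2 : (2000 : ℝ) ≤ N := by exact_mod_cast hN
  have hzu := u.im_pos hN0' hδ hγ
  have hzv : 0 < w.im := v.im_pos hN0' hδ hγ
  have hiu := u.inv_im_le hN0' hδ hγ
  have hiv : 1 / w.im ≤ 8 * N := v.inv_im_le hN0' hδ hγ
  have hmu := u.norm_inv_msc_le hN0' hδ hγ
  have hmv : ‖(msc w)⁻¹‖ ≤ 16 := v.norm_inv_msc_le hN0' hδ hγ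
  have hM := u.A.one_le_M hN0' hδ.le
  have hm := norm_msc_sub_le_mul hN0 hzu hzv hiu hiv hmu hmv
  have hlow := v.apriori_ge hδ hγ hN0'
  have hap : v.apriori ≤ u.apriori + 2 * ‖msc u.z - msc w‖ := by
    have h1 := inv_Gam_sub_le u.A.S_nonneg u.A.S_row_sum hN0' hzv hzu
    rw [norm_sub_rev] at h1
    have ha : u.A.M ^ (-(γ / 3)) ≤ 1 :=
      Real.rpow_le_one_of_one_le_of_nonpos hM (by linarith [hγ.1])
    have ha0 : 0 < u.A.M ^ (-(γ / 3)) := Real.rpow_pos_of_pos (by linarith) _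
    unfold DomainPoint.apriori
    change u.A.M ^ (-(γ / 3)) / Gam u.A.S w ≤ _
    rw [div_eq_mul_inv _ (Gam u.A.S w), div_eq_mul_inv _ (Gam u.A.S u.z)]
    calc _ ≤ u.A.M ^ (-(γ / 3)) * ((Gam u.A.S u.z)⁻¹ + 2 * ‖msc u.z - msc w‖) := by gcongr
      _ ≤ _ := by
        rw [mul_add]
        have := mul_le_of_le_one_left (show 0 ≤ 2 * ‖msc u.z - msc w‖ by positivity) ha
        linarith
  set d := ‖u.z - w‖ with hd
  have hd0 : 0 ≤ d := norm_nonneg _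
  have hres : ∀ i j, ‖res (u.A.H ω) u.z i j - res (u.A.H ω) w i j‖ ≤ d * (64 * (N : ℝ) ^ 3) := by
    intro i j
    refine (norm_res_sub_le (u.A.isHermitian_H ω) hzu hzv i j).trans
      (mul_le_mul_of_nonneg_left ?_ hd0)
    rw [Fintype.card_fin]
    calc (N : ℝ) * (1 / u.z.im * (1 / w.im)) ≤ N * (8 * N * (8 * N)) := by gcongr
      _ = _ := by ring
  -- 6208 = 64 + 3 · 2048: the change of G, that of m in the entries, and twice that of m in the a
  -- priori size.
  have hsmall : d * (6208 * (N : ℝ) ^ 3) ≤ 1 / (20 * N) := by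
    calc d * (6208 * (N : ℝ) ^ 3) ≤ 10 / (N : ℝ) ^ 6 * (6208 * (N : ℝ) ^ 3) := by gcongr
      _ = 62080 / (N : ℝ) ^ 3 := by field_simp; norm_num
      _ ≤ _ := by
        rw [div_le_div_iff₀ (by positivity) (by positivity)]
        nlinarith [mul_le_mul hN2 hN2 (by norm_num) hN0.le]
  have hNN : (N : ℝ) ≤ (N : ℝ) ^ 3 := le_self_pow₀ (by linarith) (by norm_num)
  have e20 : 1 / (20 * (N : ℝ)) = 1 / (10 * (N : ℝ)) / 2 := by field_simp; norm_num
  intro i j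
  have h1 := h i j
  have h2 := hres i j
  have h3 : ‖(if i = j then msc u.z else 0) - (if i = j then msc w else 0)‖ ≤
      ‖msc u.z - msc w‖ := by
    split_ifs
    · exact le_rfl
    · simp
  have h4 : ‖res (u.A.H ω) u.z i j - (if i = j then msc u.z else 0)‖ ≤
      d * (64 * (N : ℝ) ^ 3) + v.apriori / 2 + ‖msc u.z - msc w‖ := by
    calc _ = ‖(res (u.A.H ω) u.z i j - res (u.A.H ω) w i j) +
          (res (u.A.H ω) w i j - (if i = j then msc w else 0)) -
          ((if i = j then msc u.z else 0) - (if i = j then msc w else 0))‖ := by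
          congr 1; ring
      _ ≤ _ := (norm_sub_le _ _).trans (add_le_add ((norm_add_le _ _).trans (add_le_add h2 h1)) h3)
  have h5 : d * (N : ℝ) ≤ d * (N : ℝ) ^ 3 := mul_le_mul_of_nonneg_left hNN hd0
  nlinarith

/-- By a union bound the gap holds at all net points at once. Going down from height 10, closeness
at half the a priori size at one point gives closeness at the full size at the next, and the gap
restores the half. -/
theorem hp_close_apriori (hδ : 0 < δ) (hγ : γ ∈ Set.Ioo (0 : ℝ) (1 / 2)) :
    HP fun N (u : DomainPoint δ μ γ N) ω => u.A.Close u.z u.apriori ω := by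
  have hgi := (hp_gap (μ := μ) hδ hγ).and (hp_initial (μ := μ) hδ hγ)
  have hnet := HP.of_forall (fun N => Fin (N ^ 6 + 1)) 7
    (by
      filter_upwards [Filter.eventually_ge_atTop 2] with N hN
      rw [Fintype.card_fin]
      have : 1 ≤ N ^ 6 := Nat.one_le_pow _ _ (by omega)
      calc N ^ 6 + 1 ≤ N ^ 6 * 2 := by omega
        _ ≤ N ^ 6 * N := Nat.mul_le_mul_left _ hN)
    (fun N (u : DomainPoint δ μ γ N) (i : Fin (N ^ 6 + 1)) ω =>
      -- A `DomainPoint` carries its membership proof, so the event is conditional on it;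
      -- `DomainPoint.raise` supplies it below for every net point.
      ∀ hw : (⟨u.z.re, u.z.im + (i : ℕ) / (N : ℝ) ^ 6 * (10 - u.z.im)⟩ : ℂ) ∈ specDomain u.A.S γ,
        (u.A.Close _ (DomainPoint.mk u.A _ hw).apriori ω →
          u.A.Close _ ((DomainPoint.mk u.A _ hw).apriori / 2) ω) ∧
        (u.z.im + (i : ℕ) / (N : ℝ) ^ 6 * (10 - u.z.im) = 10 →
          u.A.Close _ ((DomainPoint.mk u.A _ hw).apriori / 2) ω)) (fun D => by
      filter_upwards [hgi D] with N hN u i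
      by_cases hw : (⟨u.z.re, u.z.im + (i : ℕ) / (N : ℝ) ^ 6 * (10 - u.z.im)⟩ : ℂ) ∈
          specDomain u.A.S γ
      · refine le_trans (measureReal_mono ?_) (hN ⟨u.A, _, hw⟩)
        intro ω hω hc
        exact hω fun _ => hc
      · simp only [hw, IsEmpty.forall_iff, not_true_eq_false, Set.ofPred_false, measureReal_empty]
        positivity)
  refine hnet.mono ?_
  filter_upwards [Filter.eventually_ge_atTop 2000] with N hN u ω hω
  have hN0' : 0 < N := by omega
  have hN0 : (0 : ℝ) < N := by exact_mod_cast hN0'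
  have hz := u.im_pos hN0' hδ hγ
  have hz10 := u.mem.2.2
  set n : ℕ := N ^ 6 with hn
  have hnc : ((N : ℝ) ^ 6) = n := by rw [hn]; push_cast; rfl
  have hn0 : (0 : ℝ) < n := by rw [← hnc]; positivity
  rw [hnc] at hω
  set y : ℕ → ℝ := fun i => u.z.im + i / (n : ℝ) * (10 - u.z.im) with hy
  have hmem : ∀ i, i ≤ n → (⟨u.z.re, y i⟩ : ℂ) ∈ specDomain u.A.S γ := by
    intro i hi
    have h1 : (i : ℝ) / n ≤ 1 := by rw [div_le_one hn0]; exact_mod_cast hi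
    have h0 : (0 : ℝ) ≤ (i : ℝ) / n := by positivity
    refine (u.raise hN0' hδ hγ (y i) ?_ ?_).mem
    · simp only [hy]; nlinarith
    · simp only [hy]; nlinarith
  -- j counts the steps down from height 10; at j = n the point u itself is reached.
  have hind : ∀ j, j ≤ n → ∀ h : (⟨u.z.re, y (n - j)⟩ : ℂ) ∈ specDomain u.A.S γ,
      u.A.Close ⟨u.z.re, y (n - j)⟩ ((DomainPoint.mk u.A _ h).apriori / 2) ω := by
    intro j
    induction j with
    | zero =>
      intro _ h
      have := (hω ⟨n, by omega⟩ h).2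
      refine this ?_
      change u.z.im + (n : ℝ) / n * (10 - u.z.im) = 10
      rw [div_self hn0.ne']; ring
    | succ j ih =>
      intro hj h
      refine (hω ⟨n - (j + 1), by omega⟩ h).1 ?_
      refine (DomainPoint.mk u.A _ h).close_of_close hδ hγ hN (hmem (n - j) (by omega)) ?_
        (ih (by omega) _)
      change ‖(⟨u.z.re, y (n - (j + 1))⟩ : ℂ) - ⟨u.z.re, y (n - j)⟩‖ ≤ _
      have e : (⟨u.z.re, y (n - (j + 1))⟩ : ℂ) - ⟨u.z.re, y (n - j)⟩ =
          ((-((10 - u.z.im) / n) : ℝ) : ℂ) * Complex.I := by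
        have hc : ((n - j : ℕ) : ℝ) = ((n - (j + 1) : ℕ) : ℝ) + 1 := by
          rw [show n - j = n - (j + 1) + 1 by omega]; push_cast; rfl
        apply Complex.ext
        · simp
        · simp only [hy, Complex.sub_im, Complex.mul_im, Complex.ofReal_re, Complex.ofReal_im,
            Complex.I_re, Complex.I_im, hc]
          field_simp; ring
      rw [e, norm_mul, Complex.norm_I, mul_one, Complex.norm_real, norm_neg, Real.norm_eq_abs,
        abs_of_nonneg (div_nonneg (by linarith) hn0.le), hnc]
      gcongr
      linarith
  have hfin := hind n le_rfl (hmem _ (by omega))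
  have hzeq : (⟨u.z.re, y (n - n)⟩ : ℂ) = u.z := by
    apply Complex.ext <;> simp [hy]
  have key : ∀ (w : ℂ) (hw : w ∈ specDomain u.A.S γ), w = u.z →
      u.A.Close w ((DomainPoint.mk u.A w hw).apriori / 2) ω →
      u.A.Close u.z u.apriori ω := by
    rintro w hw rfl hc i j
    refine (hc i j).trans ?_
    have : 0 < u.apriori := lt_of_lt_of_le (by positivity) (u.apriori_ge hδ hγ hN0')
    exact half_le_self this.le
  exact key _ _ hzeq hfin

end LocalSemicircle
end

/-! ### Improving a control parameter -/

noncomputable section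
namespace LocalSemicircle

variable {δ : ℝ} {μ : ℕ → ℝ} {γ : ℝ}

/-- The resolvent is stochastically dominated, entrywise, by the deterministic parameter `Ψ`. -/
def Dom (Ψ : ∀ N, DomainPoint δ μ γ N → ℝ) : Prop :=
  ∀ ε : ℝ, 0 < ε → HP fun N u ω => u.A.Close u.z ((N : ℝ) ^ ε * Ψ N u) ω

/-- A control parameter between `M^{-1/2}` and the a priori bound. -/
def Admissible (Ψ : ∀ N, DomainPoint δ μ γ N → ℝ) : Prop :=
  ∀ᶠ N : ℕ in Filter.atTop, ∀ u : DomainPoint δ μ γ N,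
    0 < Ψ N u ∧ 1 / u.A.M ≤ Ψ N u ^ 2 ∧ Ψ N u ≤ u.apriori

theorem Ensemble.Close.mono {N : ℕ} {A : Ensemble δ μ N} {z : ℂ} {ψ ψ' : ℝ} {ω : A.Ω}
    (h : A.Close z ψ ω) (hψ : ψ ≤ ψ') : A.Close z ψ' ω := fun i j => (h i j).trans hψ

theorem Dom.of_le {Ψ Ψ' : ∀ N, DomainPoint δ μ γ N → ℝ} (h : Dom Ψ) (C : ℝ)
    (hle : ∀ᶠ N : ℕ in Filter.atTop, ∀ u : DomainPoint δ μ γ N,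
      0 ≤ Ψ' N u ∧ Ψ N u ≤ C * Ψ' N u) : Dom Ψ' := by
  intro ε hε
  refine (h (ε / 2) (half_pos hε)).mono ?_
  filter_upwards [hle, eventually_le_rpow C (half_pos hε), Filter.eventually_gt_atTop 0]
    with N h1 h2 hN u ω hc
  have hN0 : (0 : ℝ) < N := by exact_mod_cast hN
  refine hc.mono ?_
  have e : (N : ℝ) ^ ε = (N : ℝ) ^ (ε / 2) * (N : ℝ) ^ (ε / 2) := by
    rw [← Real.rpow_add hN0, add_halves]
  calc (N : ℝ) ^ (ε / 2) * Ψ N u ≤ (N : ℝ) ^ (ε / 2) * (C * Ψ' N u) := by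
        gcongr; exact (h1 u).2
    _ ≤ (N : ℝ) ^ (ε / 2) * ((N : ℝ) ^ (ε / 2) * Ψ' N u) := by
        gcongr; exact (h1 u).1
    _ = _ := by rw [e]; ring

theorem dom_min {Ψ Ψ' : ∀ N, DomainPoint δ μ γ N → ℝ} (h : Dom Ψ) (h' : Dom Ψ') :
    Dom fun N u => min (Ψ N u) (Ψ' N u) := by
  intro ε hε
  refine ((h ε hε).and (h' ε hε)).mono (Filter.Eventually.of_forall fun N u ω hω => ?_)
  rcases min_choice (Ψ N u) (Ψ' N u) with e | e <;> simp only [e]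
  exacts [hω.1, hω.2]

theorem apriori_small (hδ : 0 < δ) (hγ : γ ∈ Set.Ioo (0 : ℝ) (1 / 2)) {ε : ℝ}
    (hε : ε ≤ δ * γ / 12) (C : ℝ) :
    ∀ᶠ N : ℕ in Filter.atTop, ∀ u : DomainPoint δ μ γ N, C * ((N : ℝ) ^ ε * u.apriori) ≤ 1 := by
  have hδγ : 0 < δ * γ / 4 := by have := hγ.1; positivity
  filter_upwards [eventually_le_rpow (2 * |C|) hδγ, Filter.eventually_gt_atTop 0] with N h1 hN u
  have hN1 : (1 : ℝ) ≤ N := by exact_mod_cast hN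
  have hN0 : (0 : ℝ) < N := by linarith
  obtain ⟨ha0, haN, -, -⟩ := u.apriori_bounds hδ hγ hN
  have hG := u.half_le_Gam hN hδ hγ
  have hap : u.apriori ≤ 2 * (N : ℝ) ^ (-(δ * γ / 3)) := by
    unfold DomainPoint.apriori
    rw [div_le_iff₀ (by linarith)]
    nlinarith [Real.rpow_pos_of_pos hN0 (-(δ * γ / 3))]
  have hap0 : 0 ≤ u.apriori := div_nonneg ha0.le (by linarith)
  calc C * ((N : ℝ) ^ ε * u.apriori)
      ≤ |C| * ((N : ℝ) ^ (δ * γ / 12) * (2 * (N : ℝ) ^ (-(δ * γ / 3)))) := by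
        refine mul_le_mul (le_abs_self C) ?_ (by positivity) (abs_nonneg C)
        refine mul_le_mul (Real.rpow_le_rpow_of_exponent_le hN1 hε) hap hap0 (by positivity)
    _ = 2 * |C| * (N : ℝ) ^ (-(δ * γ / 4)) := by
        rw [show -(δ * γ / 4) = δ * γ / 12 + -(δ * γ / 3) by ring, Real.rpow_add hN0]; ring
    _ ≤ (N : ℝ) ^ (δ * γ / 4) * (N : ℝ) ^ (-(δ * γ / 4)) := by gcongr
    _ = 1 := by rw [← Real.rpow_add hN0, add_neg_cancel, Real.rpow_zero]

/-- Large K brings the loss ψ^{-2^{-K}} below N^{ε/2}, because ψ² ≥ 1/N; large q gives the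
probability N^{-D}. -/
theorem hp_fluct_average (hδ : 0 < δ) (hγ : γ ∈ Set.Ioo (0 : ℝ) (1 / 2))
    {Ψ : ∀ N, DomainPoint δ μ γ N → ℝ} (hΨ : Admissible Ψ) (hd : Dom Ψ)
    (T : ∀ N, DomainPoint δ μ γ N → Fin N → Fin N → ℝ)
    (hT : ∀ᶠ N : ℕ in Filter.atTop, ∀ (u : DomainPoint δ μ γ N) k,
      (∀ l, 0 ≤ T N u k l) ∧ (∀ l, T N u k l ≤ 1 / u.A.M) ∧ ∑ l, T N u k l = 1)
    {ε : ℝ} (hε : 0 < ε) :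
    HP fun N u ω => ∀ k, ‖∑ l, (T N u k l : ℂ) * fluct u.A.S (u.A.H ω) u.z l ∅‖ ≤
      (N : ℝ) ^ ε * Ψ N u ^ 2 := by
  refine HP.of_forall (fun N => Fin N) 1 (by simp) _ fun D => ?_
  obtain ⟨K, hK⟩ := exists_pow_lt_of_lt_one hε (by norm_num : (1 / 2 : ℝ) < 1)
  obtain ⟨q, hq⟩ := exists_nat_ge (4 * D / ε)
  obtain ⟨C, hC, L, hFA⟩ := Ensemble.fluctuation_averaging μ q K
  have hδγ : 0 < δ * γ / 12 := by have := hγ.1; positivity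
  -- The bound δγ/12 keeps N^{ε'}Ψ below the smallness threshold. The bound ε/16 makes the total
  -- loss 3ε/8 + ε/2, less than ε.
  set ε' := min (ε / 16) (δ * γ / 12) with hε'
  have hε'0 : 0 < ε' := lt_min (by positivity) hδγ
  filter_upwards [hd ε' hε'0 L, hΨ, hT, eventually_le_rpow C (by positivity : 0 < ε / 8),
    apriori_small hδ hγ (min_le_right (ε / 16) (δ * γ / 12)) (2 ^ (K + 1) * (2 * 16)),
    Filter.eventually_gt_atTop 0] with N h1 h2 h3 h4 h5 hN u k
  have hN1 : (1 : ℝ) ≤ N := by exact_mod_cast hN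
  have hN0 : (0 : ℝ) < N := by linarith
  obtain ⟨hΨ0, hΨM, hΨa⟩ := h2 u
  have hM0 := u.A.M_pos hN
  have hMN : u.A.M ≤ N := u.A.M_le
  set ψ := (N : ℝ) ^ ε' * Ψ N u with hψ
  have hNε : (1 : ℝ) ≤ (N : ℝ) ^ ε' := Real.one_le_rpow hN1 hε'0.le
  have hψ0 : 0 < ψ := by positivity
  have hΨψ : Ψ N u ≤ ψ := le_mul_of_one_le_left hΨ0.le hNε
  have hψM : 1 / u.A.M ≤ ψ ^ 2 := hΨM.trans (pow_le_pow_left₀ hΨ0.le hΨψ 2)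
  have hψs : 2 ^ (K + 1) * ψ * (2 * 16) ≤ 1 := by
    refine le_trans ?_ (h5 u)
    have : ψ ≤ (N : ℝ) ^ ε' * u.apriori := by rw [hψ]; gcongr
    calc _ = 2 ^ (K + 1) * (2 * 16) * ψ := by ring
      _ ≤ _ := by gcongr
  have hbad : u.A.P.real {ω | ∃ i j, ψ <
      ‖res (u.A.H ω) u.z i j - (if i = j then msc u.z else 0)‖} ≤ ((N : ℝ) ^ L)⁻¹ := by
    refine le_trans (measureReal_mono ?_) (h1 u)
    rintro ω ⟨i, j, hij⟩ hc
    exact absurd (hc i j) (not_le.2 hij)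
  have := hFA u.A u.z (T N u k) ψ hN (u.im_pos hN hδ hγ) (u.inv_im_le hN hδ hγ)
    (u.norm_inv_msc_le hN hδ hγ) (h3 u k).1 (h3 u k).2.1 (h3 u k).2.2 hψ0 hψM hψs hbad
    ((N : ℝ) ^ (ε / 8)) (by positivity)
  have hprob : 1 / ((N : ℝ) ^ (ε / 8)) ^ (2 * (q + 1)) ≤ ((N : ℝ) ^ D)⁻¹ := by
    rw [one_div]
    refine inv_anti₀ (by positivity) ?_
    rw [← Real.rpow_natCast, ← Real.rpow_natCast ((N : ℝ) ^ (ε / 8)), ← Real.rpow_mul hN0.le]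
    refine Real.rpow_le_rpow_of_exponent_le hN1 ?_
    rw [div_le_iff₀ hε] at hq
    push_cast
    nlinarith
  refine le_trans (measureReal_mono ?_) (this.trans hprob)
  intro ω hω
  have hω' : (N : ℝ) ^ ε * Ψ N u ^ 2 <
    ‖∑ l, (T N u k l : ℂ) * fluct u.A.S (u.A.H ω) u.z l ∅‖ := not_le.1 hω
  refine lt_of_le_of_lt ?_ hω'
  set p := (1 / 2 : ℝ) ^ K with hp
  have hp0 : 0 < p := by positivity
  have e1 : ψ * ψ ^ (1 - p) ≤ ψ ^ 2 * (N : ℝ) ^ (ε / 2) := by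
    have h6 : ψ * ψ ^ (1 - p) = ψ ^ 2 * (ψ ^ 2) ^ (-(p / 2)) := by
      have : (ψ ^ 2) ^ (-(p / 2)) = ψ ^ (-p) := by
        rw [← Real.rpow_natCast, ← Real.rpow_mul hψ0.le]; congr 1; push_cast; ring
      rw [this, sub_eq_add_neg, Real.rpow_add hψ0, Real.rpow_one]; ring
    rw [h6]
    refine mul_le_mul_of_nonneg_left ?_ (by positivity)
    have h7 : (N : ℝ)⁻¹ ≤ ψ ^ 2 := by
      rw [← one_div]; exact (one_div_le_one_div_of_le hM0 hMN).trans hψM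
    calc (ψ ^ 2) ^ (-(p / 2)) ≤ ((N : ℝ)⁻¹) ^ (-(p / 2)) :=
          Real.rpow_le_rpow_of_nonpos (by positivity) h7 (by linarith)
      _ = (N : ℝ) ^ (p / 2) := by
          rw [Real.inv_rpow hN0.le, Real.rpow_neg hN0.le, inv_inv]
      _ ≤ _ := Real.rpow_le_rpow_of_exponent_le hN1 (by linarith)
  have e2 : ψ ^ 2 ≤ (N : ℝ) ^ (ε / 8) * Ψ N u ^ 2 := by
    rw [hψ, mul_pow]
    refine mul_le_mul_of_nonneg_right ?_ (by positivity)
    rw [← Real.rpow_natCast, ← Real.rpow_mul hN0.le]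
    refine Real.rpow_le_rpow_of_exponent_le hN1 ?_
    have := min_le_left (ε / 16) (δ * γ / 12)
    push_cast; linarith
  calc (N : ℝ) ^ (ε / 8) * (C * (ψ * ψ ^ (1 - p)))
      ≤ (N : ℝ) ^ (ε / 8) * ((N : ℝ) ^ (ε / 8) *
        ((N : ℝ) ^ (ε / 8) * Ψ N u ^ 2 * (N : ℝ) ^ (ε / 2))) := by
        refine mul_le_mul_of_nonneg_left (mul_le_mul h4 ?_ (by positivity) (by positivity))
          (by positivity)
        exact e1.trans (mul_le_mul_of_nonneg_right e2 (by positivity))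
    _ = (N : ℝ) ^ (ε / 8 + ε / 8 + ε / 8 + ε / 2) * Ψ N u ^ 2 := by
        rw [Real.rpow_add hN0, Real.rpow_add hN0, Real.rpow_add hN0]; ring
    _ ≤ _ := by
        gcongr
        linarith

namespace Ensemble

variable {N : ℕ} {A : Ensemble δ μ N} {z : ℂ} {ψ : ℝ} {ω : A.Ω}

/-- Average the linearized equation. All terms except the fluctuation are already quadratic, so
cancellation is needed only there. -/
theorem Close.norm_weighted_le (h : A.Close z ψ ω) (hz : 0 < z.im) (hm : ‖(msc z)⁻¹‖ ≤ 16)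
    (hψ0 : 0 ≤ ψ) (hψ : 64 * ψ ≤ 1) {t : Fin N → ℝ} (ht : ∀ l, 0 ≤ t l) (hts : ∑ l, t l = 1)
    {b : ℝ} (hb : ‖∑ l, (t l : ℂ) * fluct A.S (A.H ω) z l ∅‖ ≤ b) :
    ‖∑ l, (t l : ℂ) * (res (A.H ω) z l l - msc z -
      msc z ^ 2 * ∑ a, (A.S l a : ℂ) * (res (A.H ω) z a a - msc z))‖ ≤
      b + (2 * (1 / A.M) + 64 * ψ ^ 2) := by
  have hw : ∀ (f : Fin N → ℂ) (r : ℝ), (∀ l, ‖f l‖ ≤ r) → ‖∑ l, (t l : ℂ) * f l‖ ≤ r := by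
    intro f r hf
    calc _ ≤ ∑ l, t l * r := by
          refine (norm_sum_le _ _).trans (Finset.sum_le_sum fun l _ => ?_)
          rw [norm_mul, Complex.norm_of_nonneg (ht l)]
          exact mul_le_mul_of_nonneg_left (hf l) (ht l)
      _ = r := by rw [← Finset.sum_mul, hts, one_mul]
  have e : ∑ l, (t l : ℂ) * (res (A.H ω) z l l - msc z -
      msc z ^ 2 * ∑ a, (A.S l a : ℂ) * (res (A.H ω) z a a - msc z)) =
      -(msc z ^ 2 * (∑ l, (t l : ℂ) * fluct A.S (A.H ω) z l ∅ +
        ∑ l, (t l : ℂ) * (scError A.S (A.H ω) z l - fluct A.S (A.H ω) z l ∅))) +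
      ∑ l, (t l : ℂ) * ((res (A.H ω) z l l - msc z) ^ 2 / res (A.H ω) z l l) := by
    rw [← Finset.sum_add_distrib, Finset.mul_sum, ← Finset.sum_neg_distrib,
      ← Finset.sum_add_distrib]
    refine Finset.sum_congr rfl fun l _ => ?_
    rw [res_diag_sub_msc_linear (A.isHermitian_H ω) hz A.S_row_sum]
    ring
  have h1 := hw _ _ (fun l => h.norm_scError_sub_fluct_le hz hm hψ0 hψ l)
  have h2 := hw _ _ (fun l => h.norm_sq_div_le hz hm hψ l)
  rw [e]
  refine (norm_add_le _ _).trans ?_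
  rw [norm_neg, norm_mul, norm_pow]
  have h3 := mul_le_of_le_one_left (norm_nonneg (∑ l, (t l : ℂ) * fluct A.S (A.H ω) z l ∅ +
        ∑ l, (t l : ℂ) * (scError A.S (A.H ω) z l - fluct A.S (A.H ω) z l ∅)))
      (pow_le_one₀ (n := 2) (norm_nonneg _) (norm_msc_lt_one hz).le)
  have h4 := norm_add_le (∑ l, (t l : ℂ) * fluct A.S (A.H ω) z l ∅)
        (∑ l, (t l : ℂ) * (scError A.S (A.H ω) z l - fluct A.S (A.H ω) z l ∅))
  linarith

end Ensemble

/-- S commutes with 1 - m²S, so applying the latter to Sv gives averages of the linearized equation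
with the rows of S as weights. Fluctuation averaging and stability bound Sv by ΓΨ². In G_kk - m = m
G_kk ((Sv)_k - Υ_k) the error Υ, of size √((Im m + Ψ)/(Mη)), is then not multiplied by Γ. -/
theorem Dom.improve (hδ : 0 < δ) (hγ : γ ∈ Set.Ioo (0 : ℝ) (1 / 2))
    {Ψ : ∀ N, DomainPoint δ μ γ N → ℝ} (hd : Dom Ψ) (hΨ : Admissible Ψ) :
    Dom fun _ u => Gam u.A.S u.z * Ψ _ u ^ 2 +
      √(((msc u.z).im + Ψ _ u) / (u.A.M * u.z.im)) := by
  intro ε hε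
  have hδγ : 0 < δ * γ / 12 := by have := hγ.1; positivity
  set ε' := min (ε / 4) (δ * γ / 12) with hε'
  have hε'0 : 0 < ε' := lt_min (by positivity) hδγ
  have hav := hp_fluct_average hδ hγ hΨ hd (fun _ u => u.A.S)
    (Filter.Eventually.of_forall fun N u k =>
      ⟨u.A.S_nonneg k, u.A.S_le k, u.A.S_row_sum k⟩) hε'0
  refine (((hp_rowBounds hδ hγ hε'0).and (hd ε' hε'0)).and hav).mono ?_
  filter_upwards [hΨ, eventually_le_rpow 180 (half_pos hε),
    apriori_small hδ hγ (min_le_right (ε / 4) (δ * γ / 12)) 64,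
    Filter.eventually_gt_atTop 0] with N h2 h4 h5 hN u ω hω
  obtain ⟨⟨hr, hc⟩, ha⟩ := hω
  have hN1 : (1 : ℝ) ≤ N := by exact_mod_cast hN
  have hN0 : (0 : ℝ) < N := by linarith
  obtain ⟨hΨ0, hΨM, hΨa⟩ := h2 u
  have hM0 := u.A.M_pos hN
  have hM1 := u.A.one_le_M hN hδ.le
  have hz := u.im_pos hN hδ hγ
  have him := im_msc_pos hz
  have hm := u.norm_inv_msc_le hN hδ hγ
  have hG := u.half_le_Gam hN hδ hγ
  set g := Gam u.A.S u.z with hg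
  have hg0 : 0 < g := by linarith
  set t := (N : ℝ) ^ ε' with ht
  have ht1 : (1 : ℝ) ≤ t := Real.one_le_rpow hN1 hε'0.le
  have hts : t ≤ t ^ 2 := le_self_pow₀ ht1 (by norm_num)
  set P := Ψ N u with hP
  have hψ : 64 * (t * P) ≤ 1 := by
    refine le_trans ?_ (h5 u)
    gcongr
  set Θ := √(((msc u.z).im + P) / (u.A.M * u.z.im)) with hΘ
  have hΘ0 : 0 ≤ Θ := Real.sqrt_nonneg _
  have hΘ' : √(((msc u.z).im + t * P) / (u.A.M * u.z.im)) ≤ t * Θ := by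
    have e : t * Θ = √(t ^ 2 * (((msc u.z).im + P) / (u.A.M * u.z.im))) := by
      rw [Real.sqrt_mul (by positivity), Real.sqrt_sq (by positivity)]
    rw [e]
    refine Real.sqrt_le_sqrt ?_
    rw [mul_div_assoc']
    gcongr
    have : (msc u.z).im ≤ t ^ 2 * (msc u.z).im := le_mul_of_one_le_left him.le (by linarith)
    have : t * P ≤ t ^ 2 * P := by gcongr
    linarith
  obtain ⟨hΥ, hoff⟩ := hc.row_estimates hr hz hm hM1 ht1 (by positivity) hψ
  have htΘ : t * √(((msc u.z).im + t * P) / (u.A.M * u.z.im)) ≤ t ^ 2 * Θ := by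
    calc _ ≤ t * (t * Θ) := by gcongr
      _ = _ := by ring
  -- 67 = 1 + 2 + 64: the averaged fluctuation, the terms 2/M, and the quadratic errors.
  have hSv : ∀ k, ‖∑ l, (u.A.S k l : ℂ) * (res (u.A.H ω) u.z l l - msc u.z)‖ ≤
      g * (67 * (t ^ 2 * P ^ 2)) := by
    refine norm_le_Gam_mul (x := fun k => ∑ l, (u.A.S k l : ℂ) *
      (res (u.A.H ω) u.z l l - msc u.z)) u.A.S_nonneg u.A.S_row_sum hz fun k => ?_
    have h6 := hc.norm_weighted_le hz hm (by positivity) hψ (u.A.S_nonneg k) (u.A.S_row_sum k) (ha k)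
    have e : ∑ l, (u.A.S k l : ℂ) * (res (u.A.H ω) u.z l l - msc u.z) - msc u.z ^ 2 *
        ∑ j, (u.A.S k j : ℂ) * ∑ l, (u.A.S j l : ℂ) * (res (u.A.H ω) u.z l l - msc u.z) =
        ∑ l, (u.A.S k l : ℂ) * (res (u.A.H ω) u.z l l - msc u.z - msc u.z ^ 2 *
          ∑ a, (u.A.S l a : ℂ) * (res (u.A.H ω) u.z a a - msc u.z)) := by
      rw [Finset.mul_sum, ← Finset.sum_sub_distrib]
      exact Finset.sum_congr rfl fun l _ => by ring
    rw [e]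
    refine h6.trans ?_
    have h7 : t * P ^ 2 ≤ t ^ 2 * P ^ 2 := by gcongr
    have h8 : 1 / u.A.M ≤ t ^ 2 * P ^ 2 :=
      hΨM.trans (le_mul_of_one_le_left (by positivity) (by linarith))
    have h9 : (t * P) ^ 2 = t ^ 2 * P ^ 2 := by ring
    rw [h9]; linarith
  have hfin : ∀ x : ℝ, x ≤ 180 * (t ^ 2 * (g * P ^ 2 + Θ)) →
      x ≤ (N : ℝ) ^ ε * (g * P ^ 2 + Θ) := by
    intro x hx
    refine hx.trans ?_
    rw [← mul_assoc]
    refine mul_le_mul_of_nonneg_right ?_ (by positivity)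
    have e1 : t ^ 2 ≤ (N : ℝ) ^ (ε / 2) := by
      rw [ht, ← Real.rpow_natCast, ← Real.rpow_mul hN0.le]
      refine Real.rpow_le_rpow_of_exponent_le hN1 ?_
      have := min_le_left (ε / 4) (δ * γ / 12)
      push_cast; linarith
    calc 180 * t ^ 2 ≤ (N : ℝ) ^ (ε / 2) * (N : ℝ) ^ (ε / 2) := by gcongr
      _ = _ := by rw [← Real.rpow_add hN0, add_halves]
  intro i j
  apply hfin
  have hgP : 0 ≤ t ^ 2 * (g * P ^ 2) := by positivity
  have htΘ0 : 0 ≤ t ^ 2 * Θ := by positivity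
  by_cases hij : i = j
  · subst hij
    rw [if_pos rfl, res_diag_sub_msc (u.A.isHermitian_H ω) hz u.A.S_row_sum, norm_mul, norm_mul]
    have h6 : ‖msc u.z‖ * ‖res (u.A.H ω) u.z i i‖ ≤ 1 * 2 :=
      mul_le_mul (norm_msc_lt_one hz).le (hc.norm_le hz (by linarith) i i) (norm_nonneg _)
        zero_le_one
    have h7 : ‖∑ a, (u.A.S i a : ℂ) * (res (u.A.H ω) u.z a a - msc u.z) -
        scError u.A.S (u.A.H ω) u.z i‖ ≤ g * (67 * (t ^ 2 * P ^ 2)) + 90 * (t ^ 2 * Θ) :=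
      (norm_sub_le _ _).trans (add_le_add (hSv i) ((hΥ i).trans (by linarith)))
    have h8 := mul_le_mul h6 h7 (norm_nonneg _) (by norm_num)
    refine h8.trans ?_
    linarith
  · rw [if_neg hij, sub_zero]
    refine (hoff i j hij).trans ?_
    linarith

/-- With uniform weights the matrix S drops out, since its columns sum to one. The averaged equation
is scalar, with coefficient 1 - m² in place of the inverse of Γ. -/
theorem Dom.averaged (hδ : 0 < δ) (hγ : γ ∈ Set.Ioo (0 : ℝ) (1 / 2))
    {Ψ : ∀ N, DomainPoint δ μ γ N → ℝ} (hd : Dom Ψ) (hΨ : Admissible Ψ) {ε : ℝ} (hε : 0 < ε) :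
    HP fun N u ω => ‖1 - msc u.z ^ 2‖ * ‖u.A.mN u.z ω - msc u.z‖ ≤ (N : ℝ) ^ ε * Ψ N u ^ 2 := by
  have hδγ : 0 < δ * γ / 12 := by have := hγ.1; positivity
  set ε' := min (ε / 4) (δ * γ / 12) with hε'
  have hε'0 : 0 < ε' := lt_min (by positivity) hδγ
  have hav := hp_fluct_average hδ hγ hΨ hd (fun N _ _ _ => 1 / (N : ℝ))
    (by
      filter_upwards [Filter.eventually_gt_atTop 0] with N hN u k
      have hN0 : (0 : ℝ) < N := by exact_mod_cast hN
      refine ⟨fun _ => by positivity, fun _ => one_div_le_one_div_of_le (u.A.M_pos hN) u.A.M_le, ?_⟩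
      rw [Finset.sum_const, Finset.card_univ, Fintype.card_fin, nsmul_eq_mul]
      field_simp) hε'0
  refine ((hd ε' hε'0).and hav).mono ?_
  filter_upwards [hΨ, eventually_le_rpow 67 (half_pos hε),
    apriori_small hδ hγ (min_le_right (ε / 4) (δ * γ / 12)) 64,
    Filter.eventually_gt_atTop 0] with N h2 h4 h5 hN u ω hω
  obtain ⟨hc, ha⟩ := hω
  have hN1 : (1 : ℝ) ≤ N := by exact_mod_cast hN
  have hN0 : (0 : ℝ) < N := by linarith
  have hNC : (N : ℂ) ≠ 0 := by exact_mod_cast hN0.ne'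
  obtain ⟨hΨ0, hΨM, hΨa⟩ := h2 u
  have hz := u.im_pos hN hδ hγ
  have hm := u.norm_inv_msc_le hN hδ hγ
  set t := (N : ℝ) ^ ε' with ht
  have ht1 : (1 : ℝ) ≤ t := Real.one_le_rpow hN1 hε'0.le
  have hts : t ≤ t ^ 2 := le_self_pow₀ ht1 (by norm_num)
  set P := Ψ N u with hP
  have hψ : 64 * (t * P) ≤ 1 := by
    refine le_trans ?_ (h5 u)
    gcongr
  have h6 := hc.norm_weighted_le hz hm (by positivity) hψ (t := fun _ => 1 / (N : ℝ))
    (fun _ => by positivity)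
    (by rw [Finset.sum_const, Finset.card_univ, Fintype.card_fin, nsmul_eq_mul]; field_simp)
    (ha ⟨0, hN⟩)
  set v : Fin N → ℂ := fun l => res (u.A.H ω) u.z l l - msc u.z with hv
  have hmN : u.A.mN u.z ω - msc u.z = 1 / (N : ℂ) * ∑ l, v l := by
    have e : u.A.mN u.z ω = 1 / (N : ℂ) * ∑ l, res (u.A.H ω) u.z l l := rfl
    rw [e, hv, Finset.sum_sub_distrib, Finset.sum_const, Finset.card_univ, Fintype.card_fin,
      nsmul_eq_mul]
    field_simp
  have hsw : ∑ l, ∑ a, (u.A.S l a : ℂ) * v a = ∑ a, v a := by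
    rw [Finset.sum_comm]
    refine Finset.sum_congr rfl fun a _ => ?_
    rw [← Finset.sum_mul, ← Complex.ofReal_sum, u.A.S_col_sum, Complex.ofReal_one, one_mul]
  have e : ∑ l, ((1 / (N : ℝ) : ℝ) : ℂ) * (v l - msc u.z ^ 2 * ∑ a, (u.A.S l a : ℂ) * v a) =
      (1 - msc u.z ^ 2) * (u.A.mN u.z ω - msc u.z) := by
    rw [← Finset.mul_sum, Finset.sum_sub_distrib, ← Finset.mul_sum, hsw, hmN]
    push_cast; ring
  rw [← norm_mul, ← e]
  refine h6.trans ?_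
  have h7 : t * P ^ 2 ≤ t ^ 2 * P ^ 2 := by gcongr
  have h8 : 1 / u.A.M ≤ t ^ 2 * P ^ 2 :=
    hΨM.trans (le_mul_of_one_le_left (by positivity) (by linarith))
  have h9 : (t * P) ^ 2 = t ^ 2 * P ^ 2 := by ring
  have e1 : t ^ 2 ≤ (N : ℝ) ^ (ε / 2) := by
    rw [ht, ← Real.rpow_natCast, ← Real.rpow_mul hN0.le]
    refine Real.rpow_le_rpow_of_exponent_le hN1 ?_
    have := min_le_left (ε / 4) (δ * γ / 12)
    push_cast; linarith
  calc _ ≤ 67 * t ^ 2 * P ^ 2 := by rw [h9]; linarith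
    _ ≤ (N : ℝ) ^ (ε / 2) * (N : ℝ) ^ (ε / 2) * P ^ 2 := by gcongr
    _ = _ := by rw [← Real.rpow_add hN0, add_halves]

end LocalSemicircle
end

/-! ### Iteration down to Π and the averaged law -/

noncomputable section
namespace LocalSemicircle

variable {δ : ℝ} {μ : ℕ → ℝ} {γ : ℝ}

/-- The control parameter `Π` at a point of the spectral domain. -/
def DomainPoint.ctrl {N : ℕ} (u : DomainPoint δ μ γ N) : ℝ := controlPi u.A.S u.z

theorem DomainPoint.ctrl_eq {N : ℕ} (u : DomainPoint δ μ γ N) :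
    u.ctrl = √((msc u.z).im / (u.A.M * u.z.im)) + 1 / (u.A.M * u.z.im) := rfl

theorem DomainPoint.ctrl_bounds (hδ : 0 < δ) (hγ : γ ∈ Set.Ioo (0 : ℝ) (1 / 2)) {N : ℕ}
    (hN : 0 < N) (u : DomainPoint δ μ γ N) :
    1 / (10 * (N : ℝ)) ≤ u.ctrl ∧ 1 / u.A.M ≤ 16 ^ 2 * u.ctrl ^ 2 ∧
      u.ctrl ^ 2 ≤ 2 * ((msc u.z).im + 1 / (u.A.M * u.z.im)) * (1 / (u.A.M * u.z.im)) := by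
  have hM0 := u.A.M_pos hN
  have hMN : u.A.M ≤ N := u.A.M_le
  have hN0 : (0 : ℝ) < N := by exact_mod_cast hN
  have hz := u.im_pos hN hδ hγ
  have him := im_msc_pos hz
  have h1 := Ensemble.inv_M_le hz (u.norm_inv_msc_le hN hδ hγ) hM0
  rw [u.ctrl_eq]
  have hs := Real.sqrt_nonneg ((msc u.z).im / (u.A.M * u.z.im))
  have hsq := Real.sq_sqrt (show 0 ≤ (msc u.z).im / (u.A.M * u.z.im) by positivity)
  set s := √((msc u.z).im / (u.A.M * u.z.im))
  have hb0 : 0 < 1 / (u.A.M * u.z.im) := by positivity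
  have e : (msc u.z).im / (u.A.M * u.z.im) = (msc u.z).im * (1 / (u.A.M * u.z.im)) := by ring
  rw [e] at hsq h1
  have hb1 : 1 / (10 * (N : ℝ)) ≤ 1 / (u.A.M * u.z.im) :=
    one_div_le_one_div_of_le (by positivity) (by nlinarith [u.mem.2.2])
  set b := 1 / (u.A.M * u.z.im)
  refine ⟨by linarith, ?_, ?_⟩
  · nlinarith [mul_nonneg hs hb0.le, sq_nonneg b]
  · nlinarith [sq_nonneg (s - b)]

/-- The factor N^ε absorbs the constant in 1/M ≤ 16²Π². For the a priori size p, the domain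
condition gives p³ ≥ 1/(10M), hence p⁶ ≥ M^{-3} once M ≥ 100. -/
theorem admissible_min (hδ : 0 < δ) (hγ : γ ∈ Set.Ioo (0 : ℝ) (1 / 2))
    {Ψ : ∀ N, DomainPoint δ μ γ N → ℝ} {ε : ℝ} (hε : 0 < ε)
    (hΨ : ∀ᶠ N : ℕ in Filter.atTop, ∀ u : DomainPoint δ μ γ N, (N : ℝ) ^ ε * u.ctrl ≤ Ψ N u) :
    Admissible fun N u => min (Ψ N u) u.apriori := by
  filter_upwards [hΨ, eventually_le_rpow 16 hε, eventually_le_rpow 100 hδ,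
    Filter.eventually_gt_atTop 0] with N h1 h2 h3 hN u
  have hN0 : (0 : ℝ) < N := by exact_mod_cast hN
  obtain ⟨hc1, hc2, -⟩ := u.ctrl_bounds hδ hγ hN
  obtain ⟨ha0, -, hb3, -⟩ := u.apriori_bounds hδ hγ hN
  have hM0 := u.A.M_pos hN
  have hz := u.im_pos hN hδ hγ
  have hM100 : 100 ≤ u.A.M := h3.trans u.A.lower_M
  have hctrl : 0 < u.ctrl := lt_of_lt_of_le (by positivity) hc1
  have hap : 0 < u.apriori := lt_of_lt_of_le (by positivity) (u.apriori_ge hδ hγ hN)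
  have hΨ16 : 16 * u.ctrl ≤ Ψ N u :=
    (mul_le_mul_of_nonneg_right h2 hctrl.le).trans (h1 u)
  have hΨ0 : 0 < Ψ N u := by linarith
  refine ⟨lt_min hΨ0 hap, ?_, min_le_right _ _⟩
  rcases min_choice (Ψ N u) u.apriori with e | e
  · simp only [e]
    calc 1 / u.A.M ≤ (16 * u.ctrl) ^ 2 := by rw [mul_pow]; exact hc2
      _ ≤ _ := pow_le_pow_left₀ (by positivity) hΨ16 2
  · simp only [e]
    rw [← div_pow] at hb3
    change _ ≤ u.apriori ^ 3 at hb3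
    have h4 : 1 / (10 * u.A.M) ≤ u.apriori ^ 3 := by
      refine le_trans (one_div_le_one_div_of_le (by positivity) ?_) hb3
      nlinarith [u.mem.2.2]
    have h5 : (1 / (10 * u.A.M)) ^ 2 ≤ (u.apriori ^ 2) ^ 3 := by
      rw [← pow_mul]
      calc _ ≤ (u.apriori ^ 3) ^ 2 := pow_le_pow_left₀ (by positivity) h4 2
        _ = _ := by ring
    have h6 : (1 / u.A.M) ^ 3 ≤ (1 / (10 * u.A.M)) ^ 2 := by
      rw [div_pow, div_pow, one_pow, one_pow]
      refine one_div_le_one_div_of_le (by positivity) ?_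
      nlinarith [sq_nonneg u.A.M]
    exact (pow_le_pow_iff_left₀ (by positivity) (by positivity) (by norm_num)).1 (h6.trans h5)

theorem dom_apriori (hδ : 0 < δ) (hγ : γ ∈ Set.Ioo (0 : ℝ) (1 / 2)) :
    Dom fun N (u : DomainPoint δ μ γ N) => u.apriori := by
  intro ε hε
  refine (hp_close_apriori hδ hγ).mono ?_
  filter_upwards [Filter.eventually_gt_atTop 0] with N hN u ω h
  have hN1 : (1 : ℝ) ≤ N := by exact_mod_cast hN
  have hap : 0 < u.apriori := lt_of_lt_of_le (by positivity) (u.apriori_ge hδ hγ hN)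
  exact h.mono (le_mul_of_one_le_left hap.le (Real.one_le_rpow hN1 hε.le))

/-- Below the a priori size ΓΨ is at most N^{-ε}, so ΓΨ² ≤ N^{-ε}Ψ. The geometric mean √(Ψ/(Mη)) is
at most N^{-ε}Ψ + N^ε/(Mη), and the rest is part of N^ε Π. -/
theorem improved_le {N : ℕ} (hδ : 0 < δ) (hγ : γ ∈ Set.Ioo (0 : ℝ) (1 / 2)) (hN : 0 < N)
    (u : DomainPoint δ μ γ N) {ε Ψ : ℝ} (hε : ε ≤ δ * γ / 3) (hΨ0 : 0 ≤ Ψ)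
    (hΨ : Ψ ≤ u.apriori) (hε0 : 0 ≤ ε) :
    Gam u.A.S u.z * Ψ ^ 2 + √(((msc u.z).im + Ψ) / (u.A.M * u.z.im)) ≤
      2 * ((N : ℝ) ^ (-ε) * Ψ) + (N : ℝ) ^ ε * u.ctrl := by
  have hN1 : (1 : ℝ) ≤ N := by exact_mod_cast hN
  have hN0 : (0 : ℝ) < N := by linarith
  have hM0 := u.A.M_pos hN
  have hz := u.im_pos hN hδ hγ
  have him := im_msc_pos hz
  have hG := u.half_le_Gam hN hδ hγ
  have hG0 : 0 < Gam u.A.S u.z := by linarith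
  obtain ⟨ha0, haN, -, -⟩ := u.apriori_bounds hδ hγ hN
  have h1 : Gam u.A.S u.z * Ψ ^ 2 ≤ (N : ℝ) ^ (-ε) * Ψ := by
    have h2 : Gam u.A.S u.z * Ψ ≤ (N : ℝ) ^ (-ε) := by
      calc _ ≤ Gam u.A.S u.z * u.apriori := by gcongr
        _ = u.A.M ^ (-(γ / 3)) := by unfold DomainPoint.apriori; field_simp
        _ ≤ _ := haN.trans (Real.rpow_le_rpow_of_exponent_le hN1 (by linarith))
    calc _ = Gam u.A.S u.z * Ψ * Ψ := by ring
      _ ≤ _ := by gcongr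
  set b := 1 / (u.A.M * u.z.im) with hb
  have hb0 : 0 < b := by positivity
  set e := (N : ℝ) ^ ε with he
  have he1 : 1 ≤ e := Real.one_le_rpow hN1 hε0
  have hee : (N : ℝ) ^ (-ε) = e⁻¹ := Real.rpow_neg hN0.le ε
  have h3 : √(((msc u.z).im + Ψ) / (u.A.M * u.z.im)) ≤
      √((msc u.z).im / (u.A.M * u.z.im)) + (e⁻¹ * Ψ + e * b) := by
    rw [add_div]
    have hadd : ∀ x y : ℝ, 0 ≤ x → 0 ≤ y → √(x + y) ≤ √x + √y := fun x y hx hy =>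
      Real.sqrt_le_iff.2 ⟨by positivity, by
        nlinarith [Real.sq_sqrt hx, Real.sq_sqrt hy,
          mul_nonneg (Real.sqrt_nonneg x) (Real.sqrt_nonneg y)]⟩
    refine (hadd _ _ (by positivity) (by positivity)).trans (add_le_add le_rfl ?_)
    refine Real.sqrt_le_iff.2 ⟨by positivity, ?_⟩
    have e1 : Ψ / (u.A.M * u.z.im) = (e⁻¹ * Ψ) * (e * b) := by rw [hb]; field_simp
    rw [e1]
    have := mul_nonneg (show 0 ≤ e⁻¹ * Ψ by positivity) (show 0 ≤ e * b by positivity)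
    nlinarith [sq_nonneg (e⁻¹ * Ψ), sq_nonneg (e * b)]
  have h4 : √((msc u.z).im / (u.A.M * u.z.im)) + e * b ≤ e * u.ctrl := by
    rw [u.ctrl_eq, mul_add, ← hb]
    have := le_mul_of_one_le_left (Real.sqrt_nonneg ((msc u.z).im / (u.A.M * u.z.im))) he1
    linarith
  rw [hee] at h1 ⊢
  linarith

/-- Each application of `Dom.improve` gains N^{-ε} on the second term. The minimum with the a priori
size keeps the parameter admissible. -/
theorem dom_iterate (hδ : 0 < δ) (hγ : γ ∈ Set.Ioo (0 : ℝ) (1 / 2)) {ε : ℝ} (hε : 0 < ε)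
    (hεδ : ε ≤ δ * γ / 3) (k : ℕ) :
    Dom fun N (u : DomainPoint δ μ γ N) =>
      (N : ℝ) ^ ε * u.ctrl + (N : ℝ) ^ (-(k * ε)) * u.apriori := by
  have hpos : ∀ {N : ℕ}, 0 < N → ∀ u : DomainPoint δ μ γ N, 0 < u.ctrl ∧ 0 < u.apriori := by
    intro N hN u
    have hN0 : (0 : ℝ) < N := by exact_mod_cast hN
    exact ⟨lt_of_lt_of_le (by positivity) (u.ctrl_bounds hδ hγ hN).1,
      lt_of_lt_of_le (by positivity) (u.apriori_ge hδ hγ hN)⟩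
  induction k with
  | zero =>
    refine (dom_apriori hδ hγ).of_le 1 ?_
    filter_upwards [Filter.eventually_gt_atTop 0] with N hN u
    obtain ⟨h1, h2⟩ := hpos hN u
    have h3 : 0 ≤ (N : ℝ) ^ ε * u.ctrl := by positivity
    refine ⟨by positivity, ?_⟩
    simp only [Nat.cast_zero, zero_mul, neg_zero, Real.rpow_zero, one_mul]
    linarith
  | succ k ih =>
    have hadm := admissible_min hδ hγ (Ψ := fun N (u : DomainPoint δ μ γ N) =>
      (N : ℝ) ^ ε * u.ctrl + (N : ℝ) ^ (-(k * ε)) * u.apriori) hε (by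
        filter_upwards [Filter.eventually_gt_atTop 0] with N hN u
        obtain ⟨h1, h2⟩ := hpos hN u
        have : 0 ≤ (N : ℝ) ^ (-(k * ε)) * u.apriori := by positivity
        linarith)
    refine ((dom_min ih (dom_apriori hδ hγ)).improve hδ hγ hadm).of_le 3 ?_
    filter_upwards [Filter.eventually_gt_atTop 0] with N hN u
    obtain ⟨h1, h2⟩ := hpos hN u
    have hN1 : (1 : ℝ) ≤ N := by exact_mod_cast hN
    have hN0 : (0 : ℝ) < N := by linarith
    refine ⟨by positivity, ?_⟩
    refine (improved_le hδ hγ hN u hεδ (by positivity) (min_le_right _ _) hε.le).trans ?_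
    have h3 : (N : ℝ) ^ (-ε) * min ((N : ℝ) ^ ε * u.ctrl + (N : ℝ) ^ (-(k * ε)) * u.apriori)
        u.apriori ≤ u.ctrl + (N : ℝ) ^ (-((k + 1 : ℕ) * ε)) * u.apriori := by
      calc _ ≤ (N : ℝ) ^ (-ε) * ((N : ℝ) ^ ε * u.ctrl + (N : ℝ) ^ (-(k * ε)) * u.apriori) := by
            gcongr; exact min_le_left _ _
        _ = _ := by
            rw [mul_add, ← mul_assoc, ← mul_assoc, ← Real.rpow_add hN0, ← Real.rpow_add hN0,
              neg_add_cancel, Real.rpow_zero, one_mul]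
            congr 3; push_cast; ring
    have h4 : u.ctrl ≤ (N : ℝ) ^ ε * u.ctrl :=
      le_mul_of_one_le_left h1.le (Real.one_le_rpow hN1 hε.le)
    have h5 : 0 ≤ (N : ℝ) ^ (-((k + 1 : ℕ) * ε)) * u.apriori := by positivity
    linarith

theorem dom_rpow_mul_ctrl (hδ : 0 < δ) (hγ : γ ∈ Set.Ioo (0 : ℝ) (1 / 2)) {ε : ℝ} (hε : 0 < ε)
    (hεδ : ε ≤ δ * γ / 3) :
    Dom fun N (u : DomainPoint δ μ γ N) => (N : ℝ) ^ ε * u.ctrl := by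
  -- After 1/ε rounds the second term is at most 1/N, hence at most 10Π.
  obtain ⟨k, hk⟩ := exists_nat_ge (1 / ε)
  rw [div_le_iff₀ hε] at hk
  refine (dom_iterate hδ hγ hε hεδ k).of_le 11 ?_
  have hδγ : 0 ≤ δ * γ / 12 := by have := hγ.1; positivity
  filter_upwards [Filter.eventually_gt_atTop 0, apriori_small (μ := μ) hδ hγ hδγ 1]
    with N hN hsm u
  have hN1 : (1 : ℝ) ≤ N := by exact_mod_cast hN
  have hN0 : (0 : ℝ) < N := by linarith
  have hc := (u.ctrl_bounds hδ hγ hN).1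
  have hc0 : 0 < u.ctrl := lt_of_lt_of_le (by positivity) hc
  have hap0 : 0 < u.apriori := lt_of_lt_of_le (by positivity) (u.apriori_ge hδ hγ hN)
  have hap1 : u.apriori ≤ 1 := by simpa using hsm u
  refine ⟨by positivity, ?_⟩
  have h1 : (N : ℝ) ^ (-(k * ε)) * u.apriori ≤ 10 * u.ctrl := by
    have e : (N : ℝ) ^ (-(k * ε)) ≤ 1 / N := by
      rw [one_div, ← Real.rpow_neg_one]
      exact Real.rpow_le_rpow_of_exponent_le hN1 (by linarith)
    calc _ ≤ 1 / (N : ℝ) * 1 := by gcongr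
      _ = 10 * (1 / (10 * (N : ℝ))) := by field_simp
      _ ≤ _ := by gcongr
  have h4 : u.ctrl ≤ (N : ℝ) ^ ε * u.ctrl :=
    le_mul_of_one_le_left hc0.le (Real.one_le_rpow hN1 hε.le)
  linarith

theorem dom_ctrl (hδ : 0 < δ) (hγ : γ ∈ Set.Ioo (0 : ℝ) (1 / 2)) :
    Dom fun N (u : DomainPoint δ μ γ N) => u.ctrl := by
  intro ε hε
  have hδγ : 0 < δ * γ / 3 := by have := hγ.1; positivity
  have h := dom_rpow_mul_ctrl (μ := μ) hδ hγ (lt_min (half_pos hε) hδγ) (min_le_right _ _)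
  refine (h (ε / 2) (half_pos hε)).mono ?_
  filter_upwards [Filter.eventually_gt_atTop 0] with N hN u ω hc
  have hN1 : (1 : ℝ) ≤ N := by exact_mod_cast hN
  have hN0 : (0 : ℝ) < N := by linarith
  have hc0 : 0 < u.ctrl := lt_of_lt_of_le (by positivity) (u.ctrl_bounds hδ hγ hN).1
  refine hc.mono ?_
  rw [← mul_assoc, ← Real.rpow_add hN0]
  gcongr
  linarith [min_le_left (ε / 2) (δ * γ / 3)]

/-- With b = 1/(Mη), |1 - m²| |m_N - m| is at most about Π² ≤ 2(Im m + b)b. As Im m ≤ |1 - m²| and b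
≤ 4|1 - m²|, the factor |1 - m²| cancels and b remains. -/
theorem hp_averaged (hδ : 0 < δ) (hγ : γ ∈ Set.Ioo (0 : ℝ) (1 / 2)) {ε : ℝ} (hε : 0 < ε) :
    HP fun N (u : DomainPoint δ μ γ N) ω =>
      ‖u.A.mN u.z ω - msc u.z‖ ≤ (N : ℝ) ^ ε * (1 / (u.A.M * u.z.im)) := by
  have hδγ : 0 < δ * γ / 3 := by have := hγ.1; positivity
  set ε' := min (ε / 8) (δ * γ / 3) with hε'
  have hε'0 : 0 < ε' := lt_min (by positivity) hδγ
  have hd := dom_min (dom_rpow_mul_ctrl (μ := μ) hδ hγ hε'0 (min_le_right _ _))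
    (dom_apriori hδ hγ)
  have hadm := admissible_min (μ := μ) hδ hγ (Ψ := fun N u => (N : ℝ) ^ ε' * u.ctrl) hε'0
    (Filter.Eventually.of_forall fun _ _ => le_rfl)
  refine (hd.averaged hδ hγ hadm (show 0 < ε / 4 by positivity)).mono ?_
  filter_upwards [eventually_le_rpow 10 (half_pos hε), Filter.eventually_gt_atTop 0]
    with N h10 hN u ω hω
  have hN1 : (1 : ℝ) ≤ N := by exact_mod_cast hN
  have hN0 : (0 : ℝ) < N := by linarith
  have hz := u.im_pos hN hδ hγ
  have hM0 := u.A.M_pos hN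
  have hM1 := u.A.one_le_M hN hδ.le
  have him := im_msc_pos hz
  have hG := u.half_le_Gam hN hδ hγ
  obtain ⟨hc1, -, hc2⟩ := u.ctrl_bounds hδ hγ hN
  obtain ⟨ha0, -, hb3, -⟩ := u.apriori_bounds hδ hγ hN
  have ha1 : u.A.M ^ (-(γ / 3)) ≤ 1 :=
    Real.rpow_le_one_of_one_le_of_nonpos hM1 (by linarith [hγ.1])
  have hc0 : 0 < u.ctrl := lt_of_lt_of_le (by positivity) hc1
  have hap0 : 0 < u.apriori := lt_of_lt_of_le (by positivity) (u.apriori_ge hδ hγ hN)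
  have hΓ := one_le_Gam_mul u.A.S_nonneg u.A.S_row_sum hN hz
  have hIm := im_msc_le_norm_one_sub_sq u.z
  set b := 1 / (u.A.M * u.z.im) with hb
  have hb0 : 0 < b := by positivity
  set d := ‖1 - msc u.z ^ 2‖ with hd'
  set g := Gam u.A.S u.z with hg
  have hg0 : 0 < g := by linarith
  have hd0 : 0 < d := by
    rcases (norm_nonneg (1 - msc u.z ^ 2)).eq_or_lt with h | h
    · rw [← hd'] at h; rw [← h] at hΓ; linarith
    · exact h
  -- The domain condition gives bΓ ≤ Γ^{-2} ≤ 4, and 1 ≤ Γ|1 - m²|.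
  have hgb : b ≤ 4 * d := by
    have h1 : b * g ≤ 4 := by
      calc b * g ≤ (u.A.M ^ (-(γ / 3))) ^ 3 / g ^ 3 * g := by gcongr
        _ ≤ 1 / g ^ 3 * g := by
            gcongr
            exact pow_le_one₀ ha0.le ha1
        _ = 1 / g ^ 2 := by field_simp
        _ ≤ 4 := by
            rw [div_le_iff₀ (by positivity)]; nlinarith
    calc b ≤ b * (g * d) := le_mul_of_one_le_right hb0.le hΓ
      _ = b * g * d := by ring
      _ ≤ _ := by gcongr
  have hmin : min ((N : ℝ) ^ ε' * u.ctrl) u.apriori ^ 2 ≤ (N : ℝ) ^ (ε / 4) * u.ctrl ^ 2 := by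
    calc _ ≤ ((N : ℝ) ^ ε' * u.ctrl) ^ 2 :=
          pow_le_pow_left₀ (by positivity) (min_le_left _ _) 2
      _ = (N : ℝ) ^ (ε' * (2 : ℕ)) * u.ctrl ^ 2 := by
          rw [mul_pow, ← Real.rpow_natCast ((N : ℝ) ^ ε'), ← Real.rpow_mul hN0.le]
      _ ≤ _ := by
          gcongr
          have := min_le_left (ε / 8) (δ * γ / 3)
          push_cast; linarith
  refine le_of_mul_le_mul_left ?_ hd0
  calc d * ‖u.A.mN u.z ω - msc u.z‖
      ≤ (N : ℝ) ^ (ε / 4) * ((N : ℝ) ^ (ε / 4) * u.ctrl ^ 2) :=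
        hω.trans (mul_le_mul_of_nonneg_left hmin (by positivity))
    _ = (N : ℝ) ^ (ε / 2) * u.ctrl ^ 2 := by
        rw [← mul_assoc, ← Real.rpow_add hN0]; congr 2; ring
    _ ≤ (N : ℝ) ^ (ε / 2) * (2 * (d + 4 * d) * b) := by
        gcongr
        refine hc2.trans ?_
        gcongr
    _ = 10 * (N : ℝ) ^ (ε / 2) * (d * b) := by ring
    _ ≤ (N : ℝ) ^ (ε / 2) * (N : ℝ) ^ (ε / 2) * (d * b) := by gcongr
    _ = d * ((N : ℝ) ^ ε * b) := by rw [← Real.rpow_add hN0, add_halves]; ring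

theorem inv_pow_le_rpow_neg {N D : ℕ} {D' : ℝ} (hN : 0 < N) (hD : D' ≤ D) :
    ((N : ℝ) ^ D)⁻¹ ≤ (N : ℝ) ^ (-D') := by
  have hN1 : (1 : ℝ) ≤ N := by exact_mod_cast hN
  rw [Real.rpow_neg (by linarith)]
  refine inv_anti₀ (Real.rpow_pos_of_pos (by linarith) _) ?_
  rw [← Real.rpow_natCast]
  exact Real.rpow_le_rpow_of_exponent_le hN1 hD

end LocalSemicircle
end

theorem theorem5p1 (γ : ℝ) (hγ : γ ∈ Set.Ioo (0 : ℝ) (1 / 2)) (δ : ℝ) (hδ : 0 < δ) (μ : ℕ → ℝ) :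
    LocalSemicircle.StochDom
      (U := fun N => LocalSemicircle.DomainPoint δ μ γ N × Fin N × Fin N)
      (Ω := fun _ u => u.1.A.Ω)
      (fun _ u => u.1.A.P)
      (fun _ u ω => ‖u.1.A.G u.1.z ω u.2.1 u.2.2 -
        (if u.2.1 = u.2.2 then LocalSemicircle.msc u.1.z else 0)‖)
      (fun _ u _ => LocalSemicircle.controlPi u.1.A.S u.1.z) ∧
    LocalSemicircle.StochDom
      (U := fun N => LocalSemicircle.DomainPoint δ μ γ N)
      (Ω := fun _ u => u.A.Ω)
      (fun _ u => u.A.P)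
      (fun _ u ω => ‖u.A.mN u.z ω - LocalSemicircle.msc u.z‖)
      (fun _ u _ => 1 / (u.A.M * u.z.im)) := by
  constructor
  · intro ε hε D hD
    obtain ⟨D', hD'⟩ := exists_nat_ge D
    obtain ⟨N₀, hN₀⟩ := Filter.eventually_atTop.1
      ((LocalSemicircle.dom_ctrl (μ := μ) hδ hγ ε hε) D')
    -- The shift by one guarantees N > 0. The threshold was chosen before u, hence it does not
    -- depend on the matrix, on z or on the indices.
    refine ⟨N₀ + 1, fun N hN u => ?_⟩
    refine le_trans (measureReal_mono ?_) ((hN₀ N (by omega) u.1).trans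
      (LocalSemicircle.inv_pow_le_rpow_neg (by omega) hD'))
    intro ω hω hc
    exact absurd (hc u.2.1 u.2.2) (not_le.2 hω)
  · intro ε hε D hD
    obtain ⟨D', hD'⟩ := exists_nat_ge D
    obtain ⟨N₀, hN₀⟩ := Filter.eventually_atTop.1
      ((LocalSemicircle.hp_averaged (μ := μ) hδ hγ hε) D')
    refine ⟨N₀ + 1, fun N hN u => ?_⟩
    refine le_trans (measureReal_mono ?_) ((hN₀ N (by omega) u).trans
      (LocalSemicircle.inv_pow_le_rpow_neg (by omega) hD'))
    intro ω hω hc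
    exact absurd hc (not_le.2 hω)
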